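/- For $\tau_1,\tau_2,u,v\in\mathbb R$ let $$\mathbb K^{\rm P}_{\tau_1,\tau_2}(u,v)=\frac1{(2\pi i)^2}\int_{i\mathbb R}d\zeta\int_{\Gamma^{\rm P}}d\omega\,\frac{\exp\left(-\frac{\zeta^4}4-\frac{\tau_2\zeta^2}2-v\zeta+\frac{\omega^4}4+\frac{\tau_1\omega^2}2+u\omega\right)}{\zeta-\omega}-1(\tau_1>\tau_2)\frac{\exp\left(-\frac{(u-v)^2}{2(\tau_1-\tau_2)}\right)}{\sqrt{2\pi(\tau_1-\tau_2)}}$$ be the extended Pearcey kernel, where $i\mathbb R$ is oriented upwards and $\Gamma^{\rm P}$ consists of two rays from the origin to $\pm\infty e^{-i\pi/4}$ and two rays from $\pm\infty e^{i\pi/4}$ to the origin, and let $$\mathbb K^{\rm S_2}_{\tau_1,\tau_2}(u,v)=\frac1{2\pi i}\int_{e^{-i\pi/3}}^{e^{i\pi/3}}e^{(\tau_1-\tau_2)\omega^2+(u-v)\omega}\,d\omega-1(\tau_1>\tau_2)\frac{\exp\left(-\frac{(u-v)^2}{4(\tau_1-\tau_2)}\right)}{\sqrt{4\pi(\tau_1-\tau_2)}}$$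 be the $S_2$-variant of the extended sine kernel. (1) As $a\to+\infty$, $$\frac1{a^{1/3}}\mathbb K^{\rm P}_{2\tau_1/a^{2/3},\,2\tau_2/a^{2/3}}\left(\frac u{a^{1/3}}+a,\frac v{a^{1/3}}+a\right)=\mathbb K^{\rm S_2}_{\tau_1,\tau_2}(u,v)+\mathrm{fluc}(u,v;\tau_1,\tau_2;a)+\mathcal O\left(a^{-8/3}\right),$$ uniformly for $u,v,\tau_1,\tau_2$ in compact subsets of $\mathbb R$, where $$\mathrm{fluc}(u,v;\tau_1,\tau_2;a)=-\frac23\frac{\pi}{(2\pi i)^2}\frac{e^{\frac{u-v}2-\frac{\tau_1-\tau_2}2}}{a^{4/3}}\left\{F_{\tau_1,\tau_2}(u,v)-\frac2{\sqrt3}\cos\left(\frac{3\sqrt3}4a^{4/3}+\frac{\sqrt3}2(u+v+\tau_1+\tau_2)\right)\right\},$$ $$F_{\tau_1,\tau_2}(u,v)=\left(\tfrac{u+v}2-(\tau_1+\tau_2)\right)\sin\left(\tfrac{\sqrt3}2(u-v+\tau_1-\tau_2)\right)+\sqrt3\left(\tfrac{u+v}2+(\tau_1+\tau_2)\right)\cos\left(\tfrac{\sqrt3}2(u-v+\tau_1-\tau_2)\right).$$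 (2) There is a complete asymptotic expansion: for every integer $N\ge0$, as $a\to+\infty$, $$\frac1{a^{1/3}}\mathbb K^{\rm P}_{2\tau_1/a^{2/3},\,2\tau_2/a^{2/3}}\left(\frac u{a^{1/3}}+a,\frac v{a^{1/3}}+a\right)=\mathbb K^{\rm S_2}_{\tau_1,\tau_2}(u,v)+\sum_{\nu=1}^N\frac2{(2\pi i)^2a^{\frac43\nu}}\sum_{k+l=2\nu-1}\Re\{b_{k,l}B_{k,l}\}$$ $$+\sum_{\nu=1}^N\frac2{(2\pi i)^2a^{\frac43\nu}}\sum_{k+l=\nu-1}\Re\left\{c_{2k,2l}e^{-i\frac{3\sqrt3}4a^{4/3}}\right\}\Gamma\left(k+\tfrac12\right)\Gamma\left(l+\tfrac12\right)+\mathcal O\left(a^{-\frac43(N+1)}\right),$$ uniformly for $u,v,\tau_1,\tau_2$ in compact subsets of $\mathbb R$, where $k,l\ge0$. Here $$B_{k,l}=\int_{-\infty}^\infty dx\int_{-\infty}^\infty dy\,e^{-(x^2+y^2)}\frac{x^ky^l}{x-iy}.$$ Let $f(\zeta)=\zeta^4/4+\zeta$, let $g$ be the analytic function near $0$ with $f(g(x))-\frac34e^{i\pi/3}=x^2$,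 $g(0)=e^{i\pi/3}$, $g'(0)=\sqrt{2/3}\,e^{2\pi i/3}$, and let $\overline g(x)=\overline{g(\overline x)}$. Then $b_{k,l}$ and $c_{k,l}$ are the coefficients of the power series $\varphi(x,y)=\sum_{k,l\ge0}b_{k,l}x^ky^l$ and $\varPhi(x,y)=\sum_{k,l\ge0}c_{k,l}x^ky^l$, convergent for complex $x,y$ in a neighbourhood of the origin that can be chosen independently of $u,v,\tau_1,\tau_2$, of the analytic functions $$\varphi(x,y)=\frac{x-iy}{g(x)-g(iy)}\exp\left\{-vg(x)-\tau_2g(x)^2+ug(iy)+\tau_1g(iy)^2\right\}\frac{d}{dx}g(x)\,\frac{d}{dy}g(iy),$$ $$\varPhi(x,y)=\frac{\exp\left\{-vg(x)-\tau_2g(x)^2+u\overline g(iy)+\tau_1\overline g(iy)^2\right\}}{g(x)-\overline g(iy)}\frac{d}{dx}g(x)\,\frac{d}{dy}\overline g(iy)$$ (the first one with its removable singularity at $x=iy$ removed). -/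

import Mathlib

open Filter Topology

noncomputable section

/-! ### Kernels -/

/-- `∫ h(ω) dω` along the ray `r ↦ r e^{iθ}`, `r` from `0` to `∞`. -/
def rayIntegral (θ : ℝ) (h : ℂ → ℂ) : ℂ :=
  ∫ r in Set.Ioi (0 : ℝ), h ((r : ℂ) * Complex.exp (θ * Complex.I)) * Complex.exp (θ * Complex.I)

/-- `∫ h(ω) dω` along the Pearcey contour: two rays from the origin to `±∞ e^{-iπ/4}` and two
rays from `±∞ e^{iπ/4}` to the origin. -/
def pearceyContourIntegral (h : ℂ → ℂ) : ℂ :=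
  rayIntegral (-(Real.pi / 4)) h + rayIntegral (3 * Real.pi / 4) h
    - rayIntegral (Real.pi / 4) h - rayIntegral (-(3 * Real.pi / 4)) h

/-- `∫ h(ζ) dζ` along the imaginary axis, oriented upwards. -/
def imaginaryAxisIntegral (h : ℂ → ℂ) : ℂ :=
  ∫ s : ℝ, h ((s : ℂ) * Complex.I) * Complex.I

/-- `∫ h(ω) dω` along the straight segment from `p` to `q`. -/
def segmentIntegral (p q : ℂ) (h : ℂ → ℂ) : ℂ :=
  ∫ t in (0 : ℝ)..1, h (p + (t : ℂ) * (q - p)) * (q - p)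

/-- The extended Pearcey kernel. -/
def pearceyKernel (τ₁ τ₂ u v : ℝ) : ℂ :=
  1 / (2 * Real.pi * Complex.I) ^ 2 *
      imaginaryAxisIntegral (fun ζ => pearceyContourIntegral (fun ω =>
        Complex.exp (-ζ ^ 4 / 4 - τ₂ * ζ ^ 2 / 2 - v * ζ + ω ^ 4 / 4 + τ₁ * ω ^ 2 / 2 + u * ω)
          / (ζ - ω)))
    - (if τ₂ < τ₁ then
        ((1 / Real.sqrt (2 * Real.pi * (τ₁ - τ₂)) *
          Real.exp (-(u - v) ^ 2 / (2 * (τ₁ - τ₂))) : ℝ) : ℂ) else 0)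

/-- The saddle point `e^{iπ/3}`. -/
def saddlePt : ℂ := Complex.exp (Real.pi / 3 * Complex.I)

/-- The `S₂`-variant of the extended sine kernel. -/
def sineKernelS2 (τ₁ τ₂ u v : ℝ) : ℂ :=
  1 / (2 * Real.pi * Complex.I) *
      segmentIntegral (Complex.exp (-(Real.pi / 3) * Complex.I))
        (Complex.exp (Real.pi / 3 * Complex.I))
        (fun ω => Complex.exp ((τ₁ - τ₂) * ω ^ 2 + (u - v) * ω))
    - (if τ₂ < τ₁ then
        ((1 / Real.sqrt (4 * Real.pi * (τ₁ - τ₂)) *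
          Real.exp (-(u - v) ^ 2 / (4 * (τ₁ - τ₂))) : ℝ) : ℂ) else 0)

/-- `a^{-1/3} K^P_{2τ₁/a^{2/3}, 2τ₂/a^{2/3}} (u/a^{1/3} + a, v/a^{1/3} + a)`. -/
def rescaledPearceyKernel (a τ₁ τ₂ u v : ℝ) : ℂ :=
  ((1 / a ^ (1 / 3 : ℝ) : ℝ) : ℂ) *
    pearceyKernel (2 * τ₁ / a ^ (2 / 3 : ℝ)) (2 * τ₂ / a ^ (2 / 3 : ℝ))
      (u / a ^ (1 / 3 : ℝ) + a) (v / a ^ (1 / 3 : ℝ) + a)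

/-! ### The explicit first-order fluctuations -/

def flucCoeffS2 (τ₁ τ₂ u v : ℝ) : ℝ :=
  ((u + v) / 2 - (τ₁ + τ₂)) * Real.sin (Real.sqrt 3 / 2 * (u - v + τ₁ - τ₂))
    + Real.sqrt 3 * ((u + v) / 2 + (τ₁ + τ₂)) * Real.cos (Real.sqrt 3 / 2 * (u - v + τ₁ - τ₂))

def flucS2 (u v τ₁ τ₂ a : ℝ) : ℂ :=
  -(2 / 3) * (Real.pi / (2 * Real.pi * Complex.I) ^ 2)
    * ((Real.exp ((u - v) / 2 - (τ₁ - τ₂) / 2) / a ^ (4 / 3 : ℝ) : ℝ) : ℂ)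
    * ((flucCoeffS2 τ₁ τ₂ u v - 2 / Real.sqrt 3 *
        Real.cos (3 * Real.sqrt 3 / 4 * a ^ (4 / 3 : ℝ)
          + Real.sqrt 3 / 2 * (u + v + τ₁ + τ₂)) : ℝ) : ℂ)

/-! ### The local parametrization of the steepest paths -/

/-- The phase function. -/
def phase (ζ : ℂ) : ℂ := ζ ^ 4 / 4 + ζ

/-- `g` is the analytic branch at `0` of `f(g(x)) - (3/4) e^{iπ/3} = x²` with
`g(0) = e^{iπ/3}` and `g'(0) = √(2/3) e^{2πi/3}`. These conditions determine the germ of `g`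
at `0`. -/
structure IsSaddleBranch (g : ℂ → ℂ) : Prop where
  analyticAt : AnalyticAt ℂ g 0
  map_zero : g 0 = saddlePt
  deriv_zero : deriv g 0 = Real.sqrt (2 / 3) * Complex.exp (2 * Real.pi / 3 * Complex.I)
  phase_eq : ∀ᶠ z in 𝓝 (0 : ℂ), phase (g z) - 3 / 4 * saddlePt = z ^ 2

theorem saddlePt_cube : saddlePt ^ 3 = -1 := by
  rw [saddlePt, ← Complex.exp_nat_mul, ← Complex.exp_pi_mul_I]
  congr 1
  push_cast
  ring

theorem exists_isSaddleBranch : ∃ g, IsSaddleBranch g := by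
  have h3 := saddlePt_cube
  have h0 : saddlePt ≠ 0 := Complex.exp_ne_zero _
  set p := saddlePt with hp
  -- `q` is the quotient `(f(ζ) - f(p)) / (ζ - p)²`, normalized to be `1` at `p`
  let q : ℂ → ℂ := fun ζ => 1 + 2 / (3 * p) * (ζ - p) + 1 / (6 * p ^ 2) * (ζ - p) ^ 2
  let l : ℂ := Real.sqrt (2 / 3) * Complex.exp (2 * Real.pi / 3 * Complex.I)
  have hl : l ^ 2 * p ^ 2 = 2 / 3 := by
    have e1 : (Complex.exp (2 * Real.pi / 3 * Complex.I)) = p ^ 2 := by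
      rw [hp, saddlePt, ← Complex.exp_nat_mul]
      congr 1
      push_cast
      ring
    have e2 : ((Real.sqrt (2 / 3) : ℝ) : ℂ) ^ 2 = 2 / 3 := by
      rw [← Complex.ofReal_pow, Real.sq_sqrt (by norm_num)]
      push_cast
      rfl
    simp only [l, e1, mul_pow, e2]
    have : (p ^ 2) ^ 2 * p ^ 2 = (p ^ 3) ^ 2 := by ring
    rw [mul_assoc, this, h3]
    norm_num
  have hl0 : l ≠ 0 := by
    intro h
    rw [h] at hl
    norm_num at hl
  let s : ℂ → ℂ := fun ζ => Complex.exp (Complex.log (q ζ) / 2)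
  let ψ : ℂ → ℂ := fun ζ => l⁻¹ * (ζ - p) * s ζ
  have hqp : q p = 1 := by simp [q]
  have hqa : AnalyticAt ℂ q p := by
    simp only [q]
    fun_prop
  have hsa : AnalyticAt ℂ s p := by
    refine AnalyticAt.cexp ?_
    refine AnalyticAt.div (hqa.clog ?_) analyticAt_const (by norm_num)
    rw [hqp]
    exact Complex.one_mem_slitPlane
  have hsp : s p = 1 := by simp [s, hqp]
  have hψa : AnalyticAt ℂ ψ p := by
    refine AnalyticAt.mul ?_ hsa
    fun_prop
  have hψp : ψ p = 0 := by simp [ψ]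
  have hψd : deriv ψ p = l⁻¹ := by
    have h1 : HasDerivAt (fun ζ : ℂ => l⁻¹ * (ζ - p)) (l⁻¹ * 1) p :=
      ((hasDerivAt_id p).sub_const p).const_mul _
    have h2 := h1.mul hsa.differentiableAt.hasDerivAt
    have h4 := h2.deriv
    rw [hsp, sub_self] at h4
    rw [mul_one, mul_one, mul_zero, zero_mul, add_zero] at h4
    exact h4
  have hd0 : deriv ψ p ≠ 0 := by
    rw [hψd]
    exact inv_ne_zero hl0
  let g := hψa.hasStrictDerivAt.localInverse _ _ _ hd0
  have hga : AnalyticAt ℂ g (ψ p) := hψa.analyticAt_localInverse hd0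
  have hg0 : g (ψ p) = p := HasStrictFDerivAt.localInverse_apply_image ..
  have hgd : HasStrictDerivAt g (deriv ψ p)⁻¹ (ψ p) :=
    hψa.hasStrictDerivAt.to_localInverse hd0
  have hgr : ∀ᶠ z in 𝓝 (ψ p), ψ (g z) = z := HasStrictDerivAt.eventually_right_inverse ..
  rw [hψp] at hga hg0 hgd hgr
  refine ⟨g, hga, hg0, ?_, ?_⟩
  · rw [hgd.hasDerivAt.deriv, hψd, inv_inv]
  · have hqc : ∀ᶠ ζ in 𝓝 p, q ζ ≠ 0 :=
      hqa.continuousAt.eventually_ne (by rw [hqp]; exact one_ne_zero)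
    have hgc : Tendsto g (𝓝 0) (𝓝 p) := by
      have := hga.continuousAt.tendsto
      rwa [hg0] at this
    filter_upwards [hgr, hgc.eventually hqc] with z hz hq
    have hs : s (g z) ^ 2 = q (g z) := by
      simp only [s]
      rw [← Complex.exp_nat_mul]
      push_cast
      rw [mul_div_cancel₀ _ (by norm_num : (2 : ℂ) ≠ 0), Complex.exp_log hq]
    have hli : (l⁻¹) ^ 2 = 3 / 2 * p ^ 2 := by
      rw [inv_pow]
      refine inv_eq_of_mul_eq_one_right ?_
      linear_combination (3 / 2) * hl
    have hz2 : z ^ 2 = (3 / 2 * p ^ 2) * (g z - p) ^ 2 * q (g z) := by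
      rw [← hli, ← hs]
      nth_rewrite 1 [← hz]
      simp only [ψ]
      ring
    rw [hz2]
    generalize g z = w
    have hq' : (3 / 2 * p ^ 2) * q w
        = 3 / 2 * p ^ 2 + p * (w - p) + (w - p) ^ 2 / 4 := by
      simp only [q]
      field_simp
      ring
    have : (3 / 2 * p ^ 2) * (w - p) ^ 2 * q w
        = (w - p) ^ 2 * (3 / 2 * p ^ 2 + p * (w - p) + (w - p) ^ 2 / 4) := by
      rw [← hq']
      ring
    rw [this, phase]
    linear_combination (w - p + p / 4) * h3

/-- The function `g` parametrizing the steepest paths through `e^{iπ/3}`. -/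
def saddleBranch : ℂ → ℂ := Classical.choose exists_isSaddleBranch

theorem saddleBranch_spec : IsSaddleBranch saddleBranch :=
  Classical.choose_spec exists_isSaddleBranch

/-- The function whose power series at `0` has the complex conjugate coefficients of `g`. -/
def saddleBranchConj (z : ℂ) : ℂ :=
  (starRingEnd ℂ) (saddleBranch ((starRingEnd ℂ) z))

/-! ### The coefficients of the complete expansion -/

/-- The function `φ(x,y)`, where `(x - iy) / (g(x) - g(iy))` is extended analytically to
`x = iy`: `dslope g b a` is `(g a - g b) / (a - b)` for `a ≠ b`, and `g' b` for `a = b`. -/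
def phiFun (τ₁ τ₂ u v : ℝ) (x y : ℂ) : ℂ :=
  (dslope saddleBranch (Complex.I * y) x)⁻¹ *
    Complex.exp (-v * saddleBranch x - τ₂ * saddleBranch x ^ 2
      + u * saddleBranch (Complex.I * y) + τ₁ * saddleBranch (Complex.I * y) ^ 2) *
    deriv saddleBranch x * deriv (fun t : ℂ => saddleBranch (Complex.I * t)) y

/-- The function `Φ(x,y)`. -/
def capPhiFun (τ₁ τ₂ u v : ℝ) (x y : ℂ) : ℂ :=
  Complex.exp (-v * saddleBranch x - τ₂ * saddleBranch x ^ 2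
      + u * saddleBranchConj (Complex.I * y) + τ₁ * saddleBranchConj (Complex.I * y) ^ 2) /
    (saddleBranch x - saddleBranchConj (Complex.I * y)) *
    deriv saddleBranch x * deriv (fun t : ℂ => saddleBranchConj (Complex.I * t)) y

/-- The coefficient of `x^k y^l` in the power series of `F` at `(0,0)`:
`∂_x^k ∂_y^l F (0,0) / (k! l!)`. -/
def taylorCoeff₂ (F : ℂ → ℂ → ℂ) (k l : ℕ) : ℂ :=
  iteratedDeriv k (fun x => iteratedDeriv l (fun y => F x y) 0) 0
    / ((Nat.factorial k : ℂ) * (Nat.factorial l : ℂ))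

/-- The coefficients `b_{k,l}` of `φ`. -/
def bCoeff (τ₁ τ₂ u v : ℝ) (k l : ℕ) : ℂ := taylorCoeff₂ (phiFun τ₁ τ₂ u v) k l

/-- The coefficients `c_{k,l}` of `Φ`. -/
def cCoeff (τ₁ τ₂ u v : ℝ) (k l : ℕ) : ℂ := taylorCoeff₂ (capPhiFun τ₁ τ₂ u v) k l

/-- `B_{k,l} = ∫ dx ∫ dy e^{-(x²+y²)} x^k y^l / (x - iy)`. -/
def BCoeff (k l : ℕ) : ℂ :=
  ∫ x : ℝ, ∫ y : ℝ,
    Complex.exp (-((x : ℂ) ^ 2 + (y : ℂ) ^ 2)) * ((x : ℂ) ^ k * (y : ℂ) ^ l)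
      / ((x : ℂ) - Complex.I * (y : ℂ))

/-- The term of index `ν` in the first series, from the saddle points `(e^{±iπ/3}, e^{±iπ/3})`
with equal signs. -/
def diagTerm (τ₁ τ₂ u v a : ℝ) (ν : ℕ) : ℂ :=
  2 / ((2 * Real.pi * Complex.I) ^ 2 * ((a ^ (4 / 3 * ν : ℝ) : ℝ) : ℂ)) *
    ((∑ p ∈ Finset.HasAntidiagonal.antidiagonal (2 * ν - 1),
      (bCoeff τ₁ τ₂ u v p.1 p.2 * BCoeff p.1 p.2).re : ℝ) : ℂ)

/-- The term of index `ν` in the second series, from the saddle points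
`(e^{±iπ/3}, e^{∓iπ/3})` with opposite signs. -/
def oscTerm (τ₁ τ₂ u v a : ℝ) (ν : ℕ) : ℂ :=
  2 / ((2 * Real.pi * Complex.I) ^ 2 * ((a ^ (4 / 3 * ν : ℝ) : ℝ) : ℂ)) *
    ((∑ p ∈ Finset.HasAntidiagonal.antidiagonal (ν - 1),
      (cCoeff τ₁ τ₂ u v (2 * p.1) (2 * p.2) *
        Complex.exp (-Complex.I * ((3 * Real.sqrt 3 / 4 * a ^ (4 / 3 : ℝ) : ℝ) : ℂ))).re
      * Real.Gamma (p.1 + 1 / 2) * Real.Gamma (p.2 + 1 / 2) : ℝ) : ℂ)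

/-- `R(u,v;τ₁,τ₂;a) = O(a^{-r})` as `a → +∞`, uniformly in `u, v, τ₁, τ₂` from compact subsets
of `ℝ`. Arguments of `R` are in the order `a, τ₁, τ₂, u, v`. -/
def UniformBigOOnCompacts (R : ℝ → ℝ → ℝ → ℝ → ℝ → ℂ) (r : ℝ) : Prop :=
  ∀ T₁ T₂ U V : Set ℝ, IsCompact T₁ → IsCompact T₂ → IsCompact U → IsCompact V →
    ∃ C : ℝ, ∀ᶠ a : ℝ in atTop, ∀ τ₁ ∈ T₁, ∀ τ₂ ∈ T₂, ∀ u ∈ U, ∀ v ∈ V,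
      ‖R a τ₁ τ₂ u v‖ ≤ C * a ^ (-r)

end

open MeasureTheory

/-! ### Joint analyticity of the divided difference -/

/-! The substitution ζ = a^{1/3} z, ω = a^{1/3} w turns the rescaled kernel into a double integral
of e^{-λ(f(z)-f(w))} h(z) k(w) / (z-w) with λ = a^{4/3} and f(z) = z⁴/4 + z
(`rescaledPearceyKernel_eq`). Contours and amplitudes are symmetric under conjugation, so it equals
twice the real part of the contribution of the upper half of the ω-contour (`kernelInt_eq`), where
the relevant saddle point is p = e^{iπ/3}. The ω-ray from ∞e^{iπ/4} is bent so that it runs through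
p and then straight to 0 (`integral_wInt_rayNE`), and the ζ-line is moved to Re z = 1/2, the line
through p and its conjugate. The moving line crosses only the segment between p and 0. The residues
there do not contain λ, because the exponentials cancel at z = w; together with their conjugates
they form the integral from p̄ to p, which is the sine kernel (`poleInt_seg_sub`,
`rescaledPearceyKernel_sub_sineKernelS2`).

What remains has its pole z = w exactly at the saddle point p. The pole is removed by
differentiating in λ: this brings down f(z) - f(w), which is z - w times a polynomial, that is,
times a sum of four products of a function of z and a function of w (`phase_sub_phase`). Hence the
double integral is an integral over m from λ to ∞ of a finite sum of products of single integrals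
(`integral_pairing`, `integral_saddleInt`). Each single integral has a classical Laplace expansion
(`SaddlePath.exists_expansion`), uniform over all entire amplitudes of a fixed Gaussian growth; this
is the source of the uniformity in the parameters. Pairing p with p gives the non-oscillating terms,
pairing p with p̄ the terms with the factor e^{-iωλ}, where iω = f(p) - f(p̄). The same pairing,
applied to the linear phase, represents 1/(z-w) as a Laplace integral and justifies the contour
deformations (`poleInt_eq`, `cauchyInt_half_sub`).

The coefficients are identified without being computed. Since f(g(x)) - f(g(iy)) = x² + y² =
(x-iy)(x+iy), the function (x+iy) φ(x,y) is a sum of products of the one-variable amplitudes in the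
local coordinate (`add_I_mul_phiFun`), and so is (iω+x²+y²) Φ(x,y) (`mul_capPhiFun`). The numbers
B_{k,l} are evaluated by the same pairing. Comparing coefficients gives `diagDerivCoeff_succ` and
`oscDerivCoeff_succ`: the asserted series has, term by term, the negative derivative found above,
and integration in m finishes the proof (`abs_re_sub_oscSum_le`). The explicit fluctuation is the
term ν = 1 of both series (`flucS2_eq`). -/

theorem exists_hasSum_of_analyticAt {g : ℂ → ℂ} (hg : AnalyticAt ℂ g 0) :
    ∃ (c : ℕ → ℂ) (ρ C : ℝ), 0 < ρ ∧ (∀ n, ‖c n‖ * ρ ^ n ≤ C) ∧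
      DifferentiableOn ℂ g (Metric.ball 0 ρ) ∧
      ∀ z, ‖z‖ < ρ → HasSum (fun n => c n * z ^ n) (g z) := by
  obtain ⟨r, hr, hd⟩ := Metric.eventually_nhds_iff_ball.1 hg.eventually_analyticAt
  have hdo : DifferentiableOn ℂ g (Metric.ball 0 r) := fun z hz =>
    (hd z hz).differentiableAt.differentiableWithinAt
  have hs : ∀ z, ‖z‖ < r → HasSum (fun n => ((n.factorial : ℂ)⁻¹ * iteratedDeriv n g 0) * z ^ n)
      (g z) := by
    intro z hz
    have := Complex.hasSum_taylorSeries_on_ball hdo (mem_ball_zero_iff.2 hz)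
    simpa [mul_assoc, mul_comm, mul_left_comm] using this
  -- The terms of the convergent series at the point r/2 are bounded, which is the required
  -- coefficient bound with ρ = r/2.
  have h2 := (hs ((r / 2 : ℝ) : ℂ) (by
    rw [Complex.norm_real, Real.norm_of_nonneg (by positivity)]; linarith)).summable.norm
  obtain ⟨C, hC⟩ := h2.tendsto_atTop_zero.bddAbove_range
  refine ⟨fun n => (n.factorial : ℂ)⁻¹ * iteratedDeriv n g 0, r / 2, C, by positivity, ?_,
    hdo.mono (Metric.ball_subset_ball (by linarith)), fun z hz => hs z (by linarith)⟩
  intro n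
  have := hC (Set.mem_range_self n)
  simpa [abs_of_pos hr] using this

/-- The bilinear-type series of the divided difference of `∑ c n z ^ n`. -/
noncomputable def dividedDifferenceSeries (c : ℕ → ℂ) : FormalMultilinearSeries ℂ (ℂ × ℂ) ℂ := fun n =>
  c (n + 1) • ∑ i ∈ Finset.range (n + 1),
    (ContinuousMultilinearMap.mkPiAlgebra ℂ (Fin n) ℂ).compContinuousLinearMap
      (fun m => if (m : ℕ) < i then ContinuousLinearMap.fst ℂ ℂ ℂ
        else ContinuousLinearMap.snd ℂ ℂ ℂ)

/-- On the diagonal the summand with index i becomes a^i b^(n-i), and these add up to (a^(n+1) -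
b^(n+1))/(a - b). Hence the coefficient c (n+1) belongs to degree n. -/
theorem dividedDifferenceSeries_apply (c : ℕ → ℂ) (n : ℕ) (q : ℂ × ℂ) :
    dividedDifferenceSeries c n (fun _ => q) =
      c (n + 1) * ∑ i ∈ Finset.range (n + 1), q.1 ^ i * q.2 ^ (n - i) := by
  simp only [dividedDifferenceSeries, _root_.smul_apply,
    _root_.sum_apply, smul_eq_mul,
    ContinuousMultilinearMap.compContinuousLinearMap_apply,
    ContinuousMultilinearMap.mkPiAlgebra_apply]
  congr 1
  refine Finset.sum_congr rfl fun i hi => ?_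
  have hi' : i ≤ n := Nat.lt_succ_iff.1 (Finset.mem_range.1 hi)
  have : ∀ m : Fin n, (if (m : ℕ) < i then ContinuousLinearMap.fst ℂ ℂ ℂ
      else ContinuousLinearMap.snd ℂ ℂ ℂ) q = if (m : ℕ) < i then q.1 else q.2 := by
    intro m
    split_ifs <;> rfl
  simp only [this]
  rw [Fin.prod_univ_eq_prod_range (fun m => if m < i then q.1 else q.2) n,
    ← Nat.add_sub_of_le hi', Finset.prod_range_add]
  congr 1
  · rw [Finset.prod_congr rfl (g := fun _ => q.1), Finset.prod_const, Finset.card_range]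
    intro x hx
    simp [Finset.mem_range.1 hx]
  · simp

theorem norm_dividedDifferenceSeries_le (c : ℕ → ℂ) (n : ℕ) :
    ‖dividedDifferenceSeries c n‖ ≤ ‖c (n + 1)‖ * (n + 1) := by
  rw [dividedDifferenceSeries, norm_smul]
  refine mul_le_mul_of_nonneg_left ?_ (norm_nonneg _)
  refine (norm_sum_le _ _).trans ?_
  refine (Finset.sum_le_card_nsmul _ _ 1 fun i _ => ?_).trans (by simp)
  refine (ContinuousMultilinearMap.norm_compContinuousLinearMap_le _ _).trans ?_
  rw [ContinuousMultilinearMap.norm_mkPiAlgebra, one_mul]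
  refine Finset.prod_le_one (fun _ _ => norm_nonneg _) fun m _ => ?_
  split_ifs
  · exact ContinuousLinearMap.norm_fst_le ..
  · exact ContinuousLinearMap.norm_snd_le ..

/-- The function φ contains the divided difference of g with its removable singularity on the
diagonal. Its double power series requires analyticity in both variables jointly, which the explicit
series `dividedDifferenceSeries` provides. -/
theorem AnalyticAt.dslope_prod {g : ℂ → ℂ} (hg : AnalyticAt ℂ g 0) :
    AnalyticAt ℂ (fun q : ℂ × ℂ => dslope g q.2 q.1) 0 := by
  obtain ⟨c, ρ, C, hρ, hC, hd, hs⟩ := exists_hasSum_of_analyticAt hg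
  set p := dividedDifferenceSeries c with hp
  -- Halving ρ absorbs the factor n + 1 ≤ 2^n coming from the number of summands in degree n.
  have hrad : ENNReal.ofReal (ρ / 2) ≤ p.radius := by
    refine p.le_radius_of_bound (C / ρ) fun n => ?_
    rw [Real.coe_toNNReal _ (by positivity)]
    have h1 := norm_dividedDifferenceSeries_le c n
    have h2 := hC (n + 1)
    have h3 : ((n : ℝ) + 1) ≤ 2 ^ n := by exact_mod_cast Nat.lt_two_pow_self (n := n)
    calc ‖p n‖ * (ρ / 2) ^ n ≤ ‖c (n + 1)‖ * (n + 1) * (ρ / 2) ^ n := by gcongr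
      _ ≤ ‖c (n + 1)‖ * 2 ^ n * (ρ / 2) ^ n := by gcongr
      _ = ‖c (n + 1)‖ * ρ ^ (n + 1) / ρ := by rw [div_pow, pow_succ]; field_simp
      _ ≤ C / ρ := by gcongr
  have hpos : 0 < p.radius := lt_of_lt_of_le (by simpa using hρ) hrad
  have hF := p.hasFPowerSeriesOnBall hpos
  have hball : ∀ q : ℂ × ℂ, ‖q‖ < ρ / 2 → q ∈ Metric.eball (0 : ℂ × ℂ) p.radius := by
    intro q hq
    refine Metric.eball_subset_eball hrad ?_
    rw [Metric.eball_ofReal]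
    simpa using hq
  have hne : ∀ q : ℂ × ℂ, ‖q‖ < ρ / 2 → q.1 ≠ q.2 → p.sum q = dslope g q.2 q.1 := by
    intro q hq hne
    have h1 : HasSum (fun n : ℕ => p n fun _ : Fin n => q) (p.sum q) := by
      simpa using hF.hasSum (hball q hq)
    have ha : ‖q.1‖ < ρ := lt_of_le_of_lt (norm_fst_le q) (by linarith)
    have hb : ‖q.2‖ < ρ := lt_of_le_of_lt (norm_snd_le q) (by linarith)
    have h2 := ((hs _ ha).sub (hs _ hb)).mul_left (q.1 - q.2)⁻¹
    have h3 := (hasSum_nat_add_iff' 1).2 h2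
    have h4 : HasSum (fun n : ℕ => p n fun _ : Fin n => q) ((q.1 - q.2)⁻¹ * (g q.1 - g q.2)) := by
      convert! h3 using 1
      · funext n
        rw [hp, dividedDifferenceSeries_apply, ← mul_sub,
          ← geom_sum₂_mul q.1 q.2 (n + 1)]
        have : q.1 - q.2 ≠ 0 := sub_ne_zero.2 hne
        simp only [Nat.add_sub_cancel]
        field_simp
      · simp
    rw [h1.unique h4, dslope_of_ne _ hne, slope_def_field, div_eq_inv_mul]
  refine (hF.analyticAt).congr ?_
  refine Metric.eventually_nhds_iff.2 ⟨ρ / 2, by positivity, fun q hq => ?_⟩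
  rw [dist_zero_right] at hq
  by_cases h : q.1 = q.2
  · obtain ⟨a, b⟩ := q
    simp only at h
    subst h
    have ha : ‖a‖ < ρ / 2 := lt_of_le_of_lt (norm_fst_le (a, a)) hq
    have hdiff : DifferentiableAt ℂ g a :=
      hd.differentiableAt (Metric.isOpen_ball.mem_nhds (by
        rw [mem_ball_zero_iff]; linarith))
    -- On the diagonal the two sides agree because both are continuous in the first variable and
    -- coincide at all nearby off-diagonal points.
    have c1 : ContinuousAt (fun t => dslope g a t) a := continuousAt_dslope_same.2 hdiff
    have c2 : ContinuousAt (fun t => p.sum (t, a)) a := by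
      have : ContinuousAt p.sum (a, a) :=
        (hF.continuousOn).continuousAt (Metric.isOpen_eball.mem_nhds (hball _ hq))
      exact ContinuousAt.comp (f := fun t : ℂ => (t, a)) this (by fun_prop)
    have hnear : ∀ᶠ t in 𝓝[≠] a, p.sum (t, a) = dslope g a t := by
      have : ∀ᶠ t in 𝓝 a, ‖((t, a) : ℂ × ℂ)‖ < ρ / 2 := by
        refine ContinuousAt.eventually_lt (by fun_prop) continuousAt_const hq
      filter_upwards [this.filter_mono nhdsWithin_le_nhds, self_mem_nhdsWithin] with t ht hta
      exact hne (t, a) ht hta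
    exact tendsto_nhds_unique (c2.tendsto.mono_left nhdsWithin_le_nhds)
      ((c1.tendsto.mono_left nhdsWithin_le_nhds).congr' (hnear.mono fun _ h => h.symm))
  · exact hne q hq h

/-! ### Power series in two variables -/

theorem iteratedDeriv_eq_of_hasSum {f : ℂ → ℂ} {c : ℕ → ℂ} {ε : ℝ} (hε : 0 < ε)
    (h : ∀ z, ‖z‖ < ε → HasSum (fun n => c n * z ^ n) (f z)) (n : ℕ) :
    iteratedDeriv n f 0 = n.factorial * c n := by
  have h1 : HasFPowerSeriesAt f (FormalMultilinearSeries.ofScalars ℂ c) 0 := by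
    rw [hasFPowerSeriesAt_iff]
    refine Metric.eventually_nhds_iff.2 ⟨ε, hε, fun z hz => ?_⟩
    rw [dist_zero_right] at hz
    simpa [FormalMultilinearSeries.coeff_ofScalars, mul_comm] using h z hz
  have h2 := h1.analyticAt.hasFPowerSeriesAt
  have h3 := h1.eq_formalMultilinearSeries h2
  have h4 := congrArg (fun p => FormalMultilinearSeries.coeff p n) h3
  simp only [FormalMultilinearSeries.coeff_ofScalars] at h4
  rw [h4]
  field_simp [Nat.factorial_ne_zero]

/-- Uniqueness of double power series: it turns identities between analytic functions into
identities between their coefficients. -/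
theorem taylorCoeff₂_eq_of_hasSum {F : ℂ → ℂ → ℂ} {c : ℕ → ℕ → ℂ} {ε : ℝ} (hε : 0 < ε)
    (h : ∀ x y, ‖x‖ < ε → ‖y‖ < ε →
      HasSum (fun p : ℕ × ℕ => c p.1 p.2 * x ^ p.1 * y ^ p.2) (F x y)) (k l : ℕ) :
    taylorCoeff₂ F k l = c k l := by
  -- For fixed l the series in k is a fibre of the double series at y = ε/2, divided by (ε/2)^l.
  have hs : ∀ x, ‖x‖ < ε → ∀ l, Summable fun k => c k l * x ^ k := by
    intro x hx l
    have hy : ‖((ε / 2 : ℝ) : ℂ)‖ < ε := by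
      rw [Complex.norm_real, Real.norm_of_nonneg (by positivity)]; linarith
    have h1 := ((Equiv.prodComm ℕ ℕ).summable_iff.2 (h x _ hx hy).summable).prod_factor l
    have h2 := h1.mul_right ((((ε / 2 : ℝ) : ℂ) ^ l)⁻¹)
    refine h2.congr fun k => ?_
    have : (((ε / 2 : ℝ) : ℂ) ^ l) ≠ 0 := pow_ne_zero _ (by
      exact_mod_cast (by positivity : ε / 2 ≠ 0))
    simp only [Function.comp_apply, Equiv.prodComm_apply, Prod.fst_swap, Prod.snd_swap]
    rw [mul_inv_cancel_right₀ this]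
  have h1 : ∀ x, ‖x‖ < ε → ∀ l, iteratedDeriv l (fun y => F x y) 0
      = l.factorial * ∑' k, c k l * x ^ k := by
    intro x hx l
    refine iteratedDeriv_eq_of_hasSum hε (c := fun l => ∑' k, c k l * x ^ k) (fun y hy => ?_) l
    have h2 : HasSum (fun p : ℕ × ℕ => c p.2 p.1 * x ^ p.2 * y ^ p.1) (F x y) :=
      (Equiv.prodComm ℕ ℕ).hasSum_iff.2 (h x y hx hy)
    have h3 : ∀ l, HasSum (fun k => c k l * x ^ k * y ^ l) ((∑' k, c k l * x ^ k) * y ^ l) :=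
      fun l => (hs x hx l).hasSum.mul_right _
    exact h2.prod_fiberwise h3
  have h2 : (fun x => iteratedDeriv l (fun y => F x y) 0)
      =ᶠ[𝓝 0] fun x => l.factorial * ∑' k, c k l * x ^ k := by
    refine Metric.eventually_nhds_iff.2 ⟨ε, hε, fun z hz => ?_⟩
    rw [dist_zero_right] at hz
    exact h1 z hz l
  rw [taylorCoeff₂, h2.iteratedDeriv_eq, iteratedDeriv_eq_of_hasSum hε
    (c := fun k => l.factorial * c k l) (fun x hx => ?_) k]
  · field_simp [Nat.factorial_ne_zero]
  · simpa only [mul_assoc] using (hs x hx l).hasSum.mul_left (l.factorial : ℂ)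

/-- A derivative in the second variable is the Fréchet derivative applied to (0, 1), which is again
jointly analytic; the claim follows by induction. -/
theorem AnalyticAt.iteratedDeriv_snd {F : ℂ → ℂ → ℂ} {R : ℝ}
    (h : ∀ x y, ‖x‖ < R → ‖y‖ < R → AnalyticAt ℂ (fun q : ℂ × ℂ => F q.1 q.2) (x, y))
    (l : ℕ) : ∀ x y, ‖x‖ < R → ‖y‖ < R →
      AnalyticAt ℂ (fun q : ℂ × ℂ => iteratedDeriv l (fun t => F q.1 t) q.2) (x, y) := by
  induction l with
  | zero => simpa using h
  | succ l ih =>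
    intro x y hx hy
    have h1 := ((ContinuousLinearMap.apply ℂ ℂ ((0 : ℂ), (1 : ℂ))).analyticAt _).comp
      (AnalyticAt.fderiv (ih x y hx hy))
    refine h1.congr ?_
    filter_upwards [(ih x y hx hy).eventually_analyticAt] with q hq
    have h2 : HasDerivAt (fun t : ℂ => ((q.1, t) : ℂ × ℂ)) (0, 1) q.2 :=
      (hasDerivAt_const _ _).prodMk (hasDerivAt_id _)
    have h3 := (hq.differentiableAt.hasFDerivAt).comp_hasDerivAt q.2 h2
    rw [iteratedDeriv_succ]
    exact h3.deriv.symm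

/-- Cauchy's estimates, applied in y and then in x on a slightly smaller bidisc of radius r, give
the bound M / r^(k+l) for the coefficients. The double series therefore converges absolutely, and it
may be summed as a Taylor series in x inside a Taylor series in y. -/
theorem hasSum_taylorCoeff₂ {F : ℂ → ℂ → ℂ} {R : ℝ}
    (h : ∀ x y, ‖x‖ < R → ‖y‖ < R → AnalyticAt ℂ (fun q : ℂ × ℂ => F q.1 q.2) (x, y))
    {x y : ℂ} (hx : ‖x‖ < R) (hy : ‖y‖ < R) :
    HasSum (fun p : ℕ × ℕ => taylorCoeff₂ F p.1 p.2 * x ^ p.1 * y ^ p.2) (F x y) := by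
  obtain ⟨r, hr1, hr2⟩ := exists_between (max_lt hx hy)
  have hxr : ‖x‖ < r := (le_max_left _ _).trans_lt hr1
  have hyr : ‖y‖ < r := (le_max_right _ _).trans_lt hr1
  have hr : 0 < r := (norm_nonneg x).trans_lt hxr
  obtain ⟨M, hM⟩ : ∃ M, ∀ q ∈ Metric.closedBall (0 : ℂ) r ×ˢ Metric.closedBall (0 : ℂ) r,
      ‖(fun q : ℂ × ℂ => F q.1 q.2) q‖ ≤ M := by
    refine IsCompact.exists_bound_of_continuousOn
      ((isCompact_closedBall 0 r).prod (isCompact_closedBall 0 r)) fun q hq => ?_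
    have h1 := mem_closedBall_zero_iff.1 hq.1
    have h2 := mem_closedBall_zero_iff.1 hq.2
    exact (h q.1 q.2 (by linarith) (by linarith)).continuousAt.continuousWithinAt
  have hFy : ∀ x', ‖x'‖ < R → DifferentiableOn ℂ (F x') (Metric.ball 0 R) := by
    intro x' hx' y' hy'
    have := (h x' y' hx' (mem_ball_zero_iff.1 hy')).differentiableAt
    exact (this.comp y' (f := fun t => ((x', t) : ℂ × ℂ))
      (by fun_prop)).differentiableWithinAt
  have ha : ∀ l, DifferentiableOn ℂ (fun x => iteratedDeriv l (F x) 0) (Metric.ball 0 R) := by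
    intro l x' hx'
    have h0 : ‖(0 : ℂ)‖ < R := by rw [norm_zero]; linarith
    have := (AnalyticAt.iteratedDeriv_snd h l x' 0 (mem_ball_zero_iff.1 hx') h0).differentiableAt
    exact (this.comp x' (f := fun t => ((t, 0) : ℂ × ℂ))
      (by fun_prop)).differentiableWithinAt
  have hsub : closure (Metric.ball (0 : ℂ) r) ⊆ Metric.ball 0 R :=
    Metric.closure_ball_subset_closedBall.trans (Metric.closedBall_subset_ball hr2)
  have hb1 : ∀ l x', ‖x'‖ ≤ r → ‖iteratedDeriv l (F x') 0‖ ≤ l.factorial * M / r ^ l := by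
    intro l x' hx'
    refine Complex.norm_iteratedDeriv_le_of_forall_mem_sphere_norm_le l hr
      ((hFy x' (by linarith)).mono hsub).diffContOnCl fun z hz => ?_
    exact hM (x', z) ⟨mem_closedBall_zero_iff.2 hx', Metric.sphere_subset_closedBall hz⟩
  have hb2 : ∀ k l, ‖taylorCoeff₂ F k l‖ ≤ M / (r ^ k * r ^ l) := by
    intro k l
    have := Complex.norm_iteratedDeriv_le_of_forall_mem_sphere_norm_le k hr
      ((ha l).mono hsub).diffContOnCl fun z hz =>
        hb1 l z (mem_sphere_zero_iff_norm.1 hz).le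
    rw [taylorCoeff₂, norm_div, norm_mul, Complex.norm_natCast, Complex.norm_natCast,
      div_le_iff₀ (by positivity)]
    refine this.trans (le_of_eq ?_)
    field_simp
  have hM0 : 0 ≤ M := (norm_nonneg _).trans (hM (0, 0) (by simp [hr.le]))
  have hsum : Summable (fun p : ℕ × ℕ => taylorCoeff₂ F p.1 p.2 * x ^ p.1 * y ^ p.2) := by
    have g1 := summable_geometric_of_lt_one (r := ‖x‖ / r) (by positivity)
      ((div_lt_one hr).2 hxr)
    have g2 := summable_geometric_of_lt_one (r := ‖y‖ / r) (by positivity)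
      ((div_lt_one hr).2 hyr)
    refine Summable.of_norm_bounded ((g1.mul_of_nonneg g2 (fun _ => by positivity)
      (fun _ => by positivity)).mul_left M) fun p => ?_
    rw [norm_mul, norm_mul, norm_pow, norm_pow, div_pow, div_pow]
    calc _ ≤ M / (r ^ p.1 * r ^ p.2) * ‖x‖ ^ p.1 * ‖y‖ ^ p.2 := by
          gcongr; exact hb2 _ _
      _ = _ := by field_simp
  have h1 := ((Equiv.prodComm ℕ ℕ).hasSum_iff.2 hsum.hasSum).prod_fiberwise
    (g := fun l => (l.factorial : ℂ)⁻¹ • y ^ l • iteratedDeriv l (F x) 0) fun l => by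
      have := (Complex.hasSum_taylorSeries_on_ball (ha l)
        (mem_ball_zero_iff.2 hx)).mul_left ((l.factorial : ℂ)⁻¹ * y ^ l)
      simp only [smul_eq_mul, sub_zero] at this ⊢
      rw [← mul_assoc]
      refine this.congr_fun ?_
      intro k
      simp only [Function.comp_apply, Equiv.prodComm_apply, Prod.fst_swap, Prod.snd_swap,
        taylorCoeff₂]
      field_simp
  have h2 := Complex.hasSum_taylorSeries_on_ball (hFy x hx) (mem_ball_zero_iff.2 hy)
  simp only [sub_zero] at h2
  rw [h2.unique h1]
  exact hsum.hasSum

theorem taylorCoeff₂_mul (A B : ℂ → ℂ) (k l : ℕ) :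
    taylorCoeff₂ (fun x y => A x * B y) k l
      = (iteratedDeriv k A 0 / k.factorial) * (iteratedDeriv l B 0 / l.factorial) := by
  have h1 : ∀ x, iteratedDeriv l (fun y => A x * B y) 0 = A x * iteratedDeriv l B 0 := fun x => by
    exact iteratedDeriv_const_mul_field (n := l) (x := (0 : ℂ)) (A x) B
  have h2 : iteratedDeriv k (fun x => A x * iteratedDeriv l B 0) 0
      = iteratedDeriv k A 0 * iteratedDeriv l B 0 := by
    have := iteratedDeriv_const_mul_field (n := k) (x := (0 : ℂ)) (iteratedDeriv l B 0) A
    simp only [mul_comm (iteratedDeriv l B 0)] at this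
    exact this
  simp only [taylorCoeff₂, h1, h2]
  field_simp

/-! ### The local parametrization near the origin -/

theorem saddleBranchConj_eq : saddleBranchConj
    = (starRingEnd ℂ) ∘ saddleBranch ∘ (starRingEnd ℂ) := rfl

theorem tendsto_conj_zero : Tendsto (starRingEnd ℂ) (𝓝 0) (𝓝 0) := by
  have := Complex.continuous_conj.tendsto 0
  rwa [map_zero] at this

theorem analyticAt_saddleBranchConj : AnalyticAt ℂ saddleBranchConj 0 := by
  rw [Complex.analyticAt_iff_eventually_differentiableAt]
  filter_upwards [tendsto_conj_zero.eventually
    saddleBranch_spec.analyticAt.eventually_analyticAt] with z hz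
  have := hz.differentiableAt.conj_conj
  rwa [Complex.conj_conj] at this

theorem saddlePt_ne_zero : saddlePt ≠ 0 := Complex.exp_ne_zero _

theorem saddlePt_eq : saddlePt = 1 / 2 + (Real.sqrt 3 / 2 : ℝ) * Complex.I := by
  rw [saddlePt, show (Real.pi / 3 * Complex.I : ℂ) = ((Real.pi / 3 : ℝ) : ℂ) * Complex.I by
    push_cast; rfl, Complex.exp_mul_I, ← Complex.ofReal_cos, ← Complex.ofReal_sin,
    Real.cos_pi_div_three, Real.sin_pi_div_three]
  push_cast
  ring

theorem saddlePt_re : saddlePt.re = 1 / 2 := by simp [saddlePt_eq]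

theorem saddlePt_im : saddlePt.im = Real.sqrt 3 / 2 := by simp [saddlePt_eq]

/-- The derivative `g'(0)`. -/
noncomputable def saddleDir : ℂ := Real.sqrt (2 / 3) * saddlePt ^ 2

theorem deriv_saddleBranch_zero : deriv saddleBranch 0 = saddleDir := by
  rw [saddleBranch_spec.deriv_zero, saddleDir, saddlePt, ← Complex.exp_nat_mul]
  congr 2
  push_cast
  ring

theorem saddleDir_ne_zero : saddleDir ≠ 0 := by
  refine mul_ne_zero ?_ (pow_ne_zero _ saddlePt_ne_zero)
  exact_mod_cast (Real.sqrt_pos.2 (by norm_num : (0 : ℝ) < 2 / 3)).ne'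

/-- This is g'(0)² = 2/f''(p) = 2/(3p²), rewritten with p³ = -1. -/
theorem saddleDir_sq : saddleDir ^ 2 = -(2 / 3) * saddlePt := by
  have e2 : ((Real.sqrt (2 / 3) : ℝ) : ℂ) ^ 2 = 2 / 3 := by
    rw [← Complex.ofReal_pow, Real.sq_sqrt (by norm_num)]
    push_cast
    rfl
  rw [saddleDir, mul_pow, e2]
  linear_combination (2 / 3 * saddlePt) * saddlePt_cube

theorem deriv_comp_I_mul (g : ℂ → ℂ) (y : ℂ) :
    deriv (fun t : ℂ => g (Complex.I * t)) y = Complex.I * deriv g (Complex.I * y) := by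
  simpa using deriv_comp_mul_left Complex.I g y

theorem phase_saddlePt : phase saddlePt = 3 / 4 * saddlePt := by
  rw [phase]
  linear_combination (saddlePt / 4) * saddlePt_cube

theorem saddleBranchConj_zero : saddleBranchConj 0 = (starRingEnd ℂ) saddlePt := by
  rw [saddleBranchConj, map_zero, saddleBranch_spec.map_zero]

theorem phase_conj (z : ℂ) : phase ((starRingEnd ℂ) z) = (starRingEnd ℂ) (phase z) := by
  simp only [phase, map_add, map_div₀, map_pow, map_ofNat]

/-- The common domain on which the local identities for `g` and its conjugate hold. -/
theorem exists_saddleBranch_radius : ∃ R : ℝ, 0 < R ∧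
    (∀ x, ‖x‖ < R → AnalyticAt ℂ saddleBranch x) ∧
    (∀ x, ‖x‖ < R → AnalyticAt ℂ saddleBranchConj x) ∧
    (∀ x, ‖x‖ < R → phase (saddleBranch x) = 3 / 4 * saddlePt + x ^ 2) ∧
    (∀ x, ‖x‖ < R → deriv saddleBranch x ≠ 0) ∧
    (∀ x y, ‖x‖ < R → ‖y‖ < R →
      AnalyticAt ℂ (fun q : ℂ × ℂ => dslope saddleBranch q.2 q.1) (x, y) ∧
      dslope saddleBranch y x ≠ 0 ∧ saddleBranch x - saddleBranchConj y ≠ 0) := by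
  have hg := saddleBranch_spec.analyticAt
  have h1 := hg.eventually_analyticAt
  have h2 := analyticAt_saddleBranchConj.eventually_analyticAt
  have h3 := saddleBranch_spec.phase_eq
  have h4 : ∀ᶠ x in 𝓝 (0 : ℂ), deriv saddleBranch x ≠ 0 :=
    hg.deriv.continuousAt.eventually_ne (by
      rw [deriv_saddleBranch_zero]; exact saddleDir_ne_zero)
  have h5 := hg.dslope_prod.eventually_analyticAt
  have h6 : ∀ᶠ q in 𝓝 (0 : ℂ × ℂ), dslope saddleBranch q.2 q.1 ≠ 0 :=
    hg.dslope_prod.continuousAt.eventually_ne (by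
      rw [Prod.fst_zero, Prod.snd_zero, dslope_same, deriv_saddleBranch_zero]
      exact saddleDir_ne_zero)
  have h7 : ∀ᶠ q in 𝓝 (0 : ℂ × ℂ), saddleBranch q.1 - saddleBranchConj q.2 ≠ 0 := by
    have c1 : ContinuousAt (fun q : ℂ × ℂ => saddleBranch q.1) 0 :=
      ContinuousAt.comp (f := Prod.fst) hg.continuousAt continuousAt_fst
    have c2 : ContinuousAt (fun q : ℂ × ℂ => saddleBranchConj q.2) 0 :=
      ContinuousAt.comp (f := Prod.snd) (g := saddleBranchConj)
        analyticAt_saddleBranchConj.continuousAt continuousAt_snd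
    refine (c1.sub c2).eventually_ne ?_
    rw [Pi.sub_apply, Prod.fst_zero, Prod.snd_zero, saddleBranchConj_zero,
      saddleBranch_spec.map_zero]
    intro h
    have := congrArg Complex.im h
    simp [saddlePt_im] at this
  obtain ⟨R, hR, h⟩ := Metric.eventually_nhds_iff.1 (h1.and (h2.and (h3.and h4)))
  obtain ⟨R', hR', h'⟩ := Metric.eventually_nhds_iff.1 (h5.and (h6.and h7))
  refine ⟨min R R', lt_min hR hR', ?_, ?_, ?_, ?_, ?_⟩
  · exact fun x hx => (h (by rw [dist_zero_right]; exact hx.trans_le (min_le_left _ _))).1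
  · exact fun x hx => (h (by rw [dist_zero_right]; exact hx.trans_le (min_le_left _ _))).2.1
  · intro x hx
    have := (h (y := x) (by rw [dist_zero_right]; exact hx.trans_le (min_le_left _ _))).2.2.1
    linear_combination this
  · exact fun x hx => (h (by rw [dist_zero_right]; exact hx.trans_le (min_le_left _ _))).2.2.2
  · intro x y hx hy
    exact h' (y := (x, y)) (by
      rw [dist_zero_right]
      exact (max_lt hx hy).trans_le (min_le_right _ _))

/-- The left factors in `(f z - f w) / (z - w) = ∑ j, phaseCoeff j z * w ^ j`. -/
noncomputable def phaseCoeff (j : Fin 4) (z : ℂ) : ℂ :=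
  ![1 + z ^ 3 / 4, z ^ 2 / 4, z / 4, 1 / 4] j

/-- The separation of variables on which the proof rests: the divided difference of f is a
polynomial, hence a finite sum of products, so multiplying 1/(z-w) by f(z) - f(w) decouples the
double integral. -/
theorem phase_sub_phase (z w : ℂ) :
    phase z - phase w = (z - w) * ∑ j, phaseCoeff j z * w ^ (j : ℕ) := by
  simp [phaseCoeff, Fin.sum_univ_four, phase]
  ring

theorem sum_phaseCoeff_self (z : ℂ) : ∑ j, phaseCoeff j z * z ^ (j : ℕ) = 1 + z ^ 3 := by
  simp [phaseCoeff, Fin.sum_univ_four]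
  ring

/-- The amplitude of the `ζ`-integrals. -/
noncomputable def ampZ (τ v : ℝ) (j : Fin 4) (z : ℂ) : ℂ :=
  phaseCoeff j z * Complex.exp (-v * z - τ * z ^ 2)

/-- The amplitude of the `ω`-integrals. -/
noncomputable def ampW (τ u : ℝ) (j : Fin 4) (w : ℂ) : ℂ :=
  w ^ (j : ℕ) * Complex.exp (u * w + τ * w ^ 2)

/-- The amplitude `h` transported to the local coordinate `G`. -/
noncomputable def localAmp (h G : ℂ → ℂ) (x : ℂ) : ℂ := h (G x) * deriv G x

/-- `x` times a power series in two variables, on coefficients. -/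
def shiftFst (c : ℕ → ℕ → ℂ) (k l : ℕ) : ℂ := if k = 0 then 0 else c (k - 1) l

/-- `y` times a power series in two variables, on coefficients. -/
def shiftSnd (c : ℕ → ℕ → ℂ) (k l : ℕ) : ℂ := if l = 0 then 0 else c k (l - 1)

theorem hasSum_shiftFst {c : ℕ → ℕ → ℂ} {x y S : ℂ}
    (h : HasSum (fun p : ℕ × ℕ => c p.1 p.2 * x ^ p.1 * y ^ p.2) S) :
    HasSum (fun p : ℕ × ℕ => shiftFst c p.1 p.2 * x ^ p.1 * y ^ p.2) (x * S) := by
  have hi : Function.Injective (fun p : ℕ × ℕ => (p.1 + 1, p.2)) := fun p q hpq => by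
    simpa [Prod.ext_iff] using hpq
  rw [← hi.hasSum_iff]
  · refine (h.mul_left x).congr_fun fun p => ?_
    simp only [Function.comp_apply, shiftFst, Nat.add_sub_cancel, if_neg (Nat.succ_ne_zero _)]
    ring
  · rintro ⟨k, l⟩ hkl
    rcases k with _ | k
    · simp [shiftFst]
    · exact absurd ⟨(k, l), rfl⟩ hkl

theorem hasSum_shiftSnd {c : ℕ → ℕ → ℂ} {x y S : ℂ}
    (h : HasSum (fun p : ℕ × ℕ => c p.1 p.2 * x ^ p.1 * y ^ p.2) S) :
    HasSum (fun p : ℕ × ℕ => shiftSnd c p.1 p.2 * x ^ p.1 * y ^ p.2) (y * S) := by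
  have hi : Function.Injective (fun p : ℕ × ℕ => (p.1, p.2 + 1)) := fun p q hpq => by
    simpa [Prod.ext_iff] using hpq
  rw [← hi.hasSum_iff]
  · refine (h.mul_left y).congr_fun fun p => ?_
    simp only [Function.comp_apply, shiftSnd, Nat.add_sub_cancel, if_neg (Nat.succ_ne_zero _)]
    ring
  · rintro ⟨k, l⟩ hkl
    rcases l with _ | l
    · simp [shiftSnd]
    · exact absurd ⟨(k, l), rfl⟩ hkl

/-- `g(iy)` as a function of `y`. -/
noncomputable def branchW (y : ℂ) : ℂ := saddleBranch (Complex.I * y)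

/-- `ḡ(iy)` as a function of `y`. -/
noncomputable def branchWConj (y : ℂ) : ℂ := saddleBranchConj (Complex.I * y)

/-- Because f(g(x)) - f(g(iy)) = x² + y² = (x-iy)(x+iy), `phase_sub_phase` shows that the divided
difference of g times that of f equals x + iy. The factor x + iy thus cancels the inverse divided
difference in φ and leaves products of one-variable functions. -/
theorem add_I_mul_phiFun {R : ℝ}
    (hA : ∀ x, ‖x‖ < R → AnalyticAt ℂ saddleBranch x)
    (hp : ∀ x, ‖x‖ < R → phase (saddleBranch x) = 3 / 4 * saddlePt + x ^ 2)
    (hd : ∀ x y, ‖x‖ < R → ‖y‖ < R → dslope saddleBranch y x ≠ 0)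
    (τ₁ τ₂ u v : ℝ) {x y : ℂ} (hx : ‖x‖ < R) (hy : ‖y‖ < R) :
    (x + Complex.I * y) * phiFun τ₁ τ₂ u v x y =
      ∑ j, localAmp (ampZ τ₂ v j) saddleBranch x * localAmp (ampW τ₁ u j) branchW y := by
  have hy' : ‖Complex.I * y‖ < R := by simpa using hy
  have hD := hd x _ hx hy'
  have key : x + Complex.I * y = dslope saddleBranch (Complex.I * y) x *
      ∑ j, phaseCoeff j (saddleBranch x) * saddleBranch (Complex.I * y) ^ (j : ℕ) := by
    by_cases h : x = Complex.I * y
    -- On the diagonal x = iy the identity is the chain rule for f ∘ g, whose derivative is 2x.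
    · rw [← h, dslope_same, sum_phaseCoeff_self]
      have h1 : HasDerivAt (fun t => phase (saddleBranch t))
          ((1 + saddleBranch x ^ 3) * deriv saddleBranch x) x := by
        have e := (hA x hx).differentiableAt.hasDerivAt
        have := ((e.pow 4).div_const 4).add e
        refine this.congr_deriv ?_
        push_cast
        ring
      have h2 : HasDerivAt (fun t => phase (saddleBranch t)) (2 * x) x := by
        have : HasDerivAt (fun t : ℂ => 3 / 4 * saddlePt + t ^ 2) (2 * x) x := by
          simpa using (hasDerivAt_pow 2 x).const_add (3 / 4 * saddlePt)
        refine this.congr_of_eventuallyEq ?_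
        filter_upwards [continuous_norm.continuousAt.eventually_lt continuousAt_const hx] with t ht
        exact hp t ht
      have := h1.unique h2
      linear_combination -this
    · have h1 := phase_sub_phase (saddleBranch x) (saddleBranch (Complex.I * y))
      rw [hp x hx, hp _ hy'] at h1
      have h2 : saddleBranch x - saddleBranch (Complex.I * y)
          = (x - Complex.I * y) * dslope saddleBranch (Complex.I * y) x := by
        have := sub_smul_dslope saddleBranch (Complex.I * y) x
        rw [smul_eq_mul] at this
        exact this.symm
      rw [h2] at h1
      have h3 : x - Complex.I * y ≠ 0 := sub_ne_zero.2 h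
      refine mul_left_cancel₀ h3 ?_
      linear_combination h1
  rw [key, phiFun]
  have e1 : ∀ j : Fin 4, localAmp (ampZ τ₂ v j) saddleBranch x * localAmp (ampW τ₁ u j) branchW y
      = phaseCoeff j (saddleBranch x) * saddleBranch (Complex.I * y) ^ (j : ℕ) *
        (Complex.exp (-v * saddleBranch x - τ₂ * saddleBranch x ^ 2
      + u * saddleBranch (Complex.I * y) + τ₁ * saddleBranch (Complex.I * y) ^ 2) *
        deriv saddleBranch x * deriv (fun t : ℂ => saddleBranch (Complex.I * t)) y) := by
    intro j
    rw [add_assoc (_ - _) _ _, Complex.exp_add]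
    simp only [localAmp, ampZ, ampW, branchW]
    ring!
  rw [Finset.sum_congr rfl fun j _ => e1 j, ← Finset.sum_mul]
  field_simp

theorem phase_saddleBranchConj {R : ℝ}
    (hp : ∀ x, ‖x‖ < R → phase (saddleBranch x) = 3 / 4 * saddlePt + x ^ 2)
    {x : ℂ} (hx : ‖x‖ < R) :
    phase (saddleBranchConj x) = 3 / 4 * (starRingEnd ℂ) saddlePt + x ^ 2 := by
  rw [saddleBranchConj, phase_conj, hp _ (by simpa using hx)]
  simp only [map_add, map_mul, map_div₀, map_pow, map_ofNat, Complex.conj_conj]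

/-- Here `phase_sub_phase` is applied at g(x) and ḡ(iy), which lie near different saddle points. The
factor f(g(x)) - f(ḡ(iy)) keeps the constant term f(p) - f(p̄), which is the origin of the
oscillation. -/
theorem mul_capPhiFun {R : ℝ}
    (hp : ∀ x, ‖x‖ < R → phase (saddleBranch x) = 3 / 4 * saddlePt + x ^ 2)
    (hd : ∀ x y, ‖x‖ < R → ‖y‖ < R → saddleBranch x - saddleBranchConj y ≠ 0)
    (τ₁ τ₂ u v : ℝ) {x y : ℂ} (hx : ‖x‖ < R) (hy : ‖y‖ < R) :
    (3 / 4 * saddlePt - 3 / 4 * (starRingEnd ℂ) saddlePt + x ^ 2 + y ^ 2)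
        * capPhiFun τ₁ τ₂ u v x y =
      ∑ j, localAmp (ampZ τ₂ v j) saddleBranch x * localAmp (ampW τ₁ u j) branchWConj y := by
  have hy' : ‖Complex.I * y‖ < R := by simpa using hy
  have hD := hd x _ hx hy'
  have h1 := phase_sub_phase (saddleBranch x) (saddleBranchConj (Complex.I * y))
  rw [hp x hx, phase_saddleBranchConj hp hy', mul_pow, Complex.I_sq] at h1
  have key : 3 / 4 * saddlePt - 3 / 4 * (starRingEnd ℂ) saddlePt + x ^ 2 + y ^ 2 =
      (saddleBranch x - saddleBranchConj (Complex.I * y)) *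
      ∑ j, phaseCoeff j (saddleBranch x) * saddleBranchConj (Complex.I * y) ^ (j : ℕ) := by
    rw [← h1]
    ring
  rw [key, capPhiFun]
  have e1 : ∀ j : Fin 4, localAmp (ampZ τ₂ v j) saddleBranch x *
        localAmp (ampW τ₁ u j) branchWConj y
      = phaseCoeff j (saddleBranch x) * saddleBranchConj (Complex.I * y) ^ (j : ℕ) *
        (Complex.exp (-v * saddleBranch x - τ₂ * saddleBranch x ^ 2
      + u * saddleBranchConj (Complex.I * y) + τ₁ * saddleBranchConj (Complex.I * y) ^ 2) *
        deriv saddleBranch x * deriv (fun t : ℂ => saddleBranchConj (Complex.I * t)) y) := by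
    intro j
    rw [add_assoc (_ - _) _ _, Complex.exp_add]
    simp only [localAmp, ampZ, ampW, branchWConj]
    ring!
  rw [Finset.sum_congr rfl fun j _ => e1 j, ← Finset.sum_mul]
  field_simp

/-! ### Convergence of the coefficient series and the coefficient identities -/

/-- Taylor coefficients at the origin. -/
noncomputable def taylorCoeff (f : ℂ → ℂ) (n : ℕ) : ℂ := iteratedDeriv n f 0 / n.factorial

theorem deriv_branchW (y : ℂ) : deriv branchW y = Complex.I * deriv saddleBranch (Complex.I * y) :=
  deriv_comp_I_mul saddleBranch y

theorem deriv_branchWConj (y : ℂ) :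
    deriv branchWConj y = Complex.I * deriv saddleBranchConj (Complex.I * y) :=
  deriv_comp_I_mul saddleBranchConj y

theorem analyticAt_ampZ (τ v : ℝ) (j : Fin 4) (z : ℂ) : AnalyticAt ℂ (ampZ τ v j) z := by
  refine AnalyticAt.mul ?_ (by fun_prop)
  unfold phaseCoeff
  fin_cases j <;> simp <;> fun_prop

theorem analyticAt_ampW (τ u : ℝ) (j : Fin 4) (z : ℂ) : AnalyticAt ℂ (ampW τ u j) z := by
  unfold ampW
  fun_prop

theorem AnalyticAt.localAmp {h G : ℂ → ℂ} {x : ℂ} (hh : AnalyticAt ℂ h (G x))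
    (hG : AnalyticAt ℂ G x) : AnalyticAt ℂ (localAmp h G) x :=
  (hh.comp hG).mul hG.deriv

theorem analyticAt_branchW {R : ℝ} (hA : ∀ x, ‖x‖ < R → AnalyticAt ℂ saddleBranch x)
    {y : ℂ} (hy : ‖y‖ < R) : AnalyticAt ℂ branchW y :=
  (hA (Complex.I * y) (by simpa using hy)).comp (f := fun t => Complex.I * t) (by fun_prop)

theorem analyticAt_branchWConj {R : ℝ} (hA : ∀ x, ‖x‖ < R → AnalyticAt ℂ saddleBranchConj x)
    {y : ℂ} (hy : ‖y‖ < R) : AnalyticAt ℂ branchWConj y :=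
  (hA (Complex.I * y) (by simpa using hy)).comp (f := fun t => Complex.I * t) (by fun_prop)

theorem analyticAt_phiFun {R : ℝ} (hA : ∀ x, ‖x‖ < R → AnalyticAt ℂ saddleBranch x)
    (hd : ∀ x y, ‖x‖ < R → ‖y‖ < R →
      AnalyticAt ℂ (fun q : ℂ × ℂ => dslope saddleBranch q.2 q.1) (x, y) ∧
      dslope saddleBranch y x ≠ 0)
    (τ₁ τ₂ u v : ℝ) (x y : ℂ) (hx : ‖x‖ < R) (hy : ‖y‖ < R) :
    AnalyticAt ℂ (fun q : ℂ × ℂ => phiFun τ₁ τ₂ u v q.1 q.2) (x, y) := by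
  have hy' : ‖Complex.I * y‖ < R := by simpa using hy
  have a1 : AnalyticAt ℂ (fun q : ℂ × ℂ => dslope saddleBranch (Complex.I * q.2) q.1) (x, y) :=
    AnalyticAt.comp (g := fun q : ℂ × ℂ => dslope saddleBranch q.2 q.1)
      (f := fun q : ℂ × ℂ => (q.1, Complex.I * q.2)) (x := (x, y)) (hd x _ hx hy').1
      (analyticAt_fst.prod (analyticAt_const.mul analyticAt_snd))
  have a2 : AnalyticAt ℂ (fun q : ℂ × ℂ => saddleBranch q.1) (x, y) :=
    (hA x hx).comp (f := Prod.fst) analyticAt_fst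
  have a3 : AnalyticAt ℂ (fun q : ℂ × ℂ => saddleBranch (Complex.I * q.2)) (x, y) :=
    AnalyticAt.comp (f := fun q : ℂ × ℂ => Complex.I * q.2) (x := (x, y)) (hA _ hy')
      (analyticAt_const.mul analyticAt_snd)
  have a4 : AnalyticAt ℂ (fun q : ℂ × ℂ => deriv saddleBranch q.1) (x, y) :=
    AnalyticAt.comp (f := Prod.fst) (g := deriv saddleBranch) (x := (x, y))
      (hA x hx).deriv analyticAt_fst
  have a5 : AnalyticAt ℂ (fun q : ℂ × ℂ => deriv branchW q.2) (x, y) :=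
    AnalyticAt.comp (f := Prod.snd) (g := deriv branchW) (x := (x, y))
      (analyticAt_branchW hA hy).deriv analyticAt_snd
  have a6 := (((((a1.inv (hd x _ hx hy').2).mul (AnalyticAt.cexp
    ((((analyticAt_const (v := -(v : ℂ))).mul a2).sub ((analyticAt_const (v := (τ₂ : ℂ))).mul
      (a2.pow 2))).add ((analyticAt_const (v := (u : ℂ))).mul a3) |>.add
      ((analyticAt_const (v := (τ₁ : ℂ))).mul (a3.pow 2))))).mul a4)).mul a5)
  exact a6

theorem analyticAt_capPhiFun {R : ℝ} (hA : ∀ x, ‖x‖ < R → AnalyticAt ℂ saddleBranch x)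
    (hB : ∀ x, ‖x‖ < R → AnalyticAt ℂ saddleBranchConj x)
    (hd : ∀ x y, ‖x‖ < R → ‖y‖ < R → saddleBranch x - saddleBranchConj y ≠ 0)
    (τ₁ τ₂ u v : ℝ) (x y : ℂ) (hx : ‖x‖ < R) (hy : ‖y‖ < R) :
    AnalyticAt ℂ (fun q : ℂ × ℂ => capPhiFun τ₁ τ₂ u v q.1 q.2) (x, y) := by
  have hy' : ‖Complex.I * y‖ < R := by simpa using hy
  have a2 : AnalyticAt ℂ (fun q : ℂ × ℂ => saddleBranch q.1) (x, y) :=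
    (hA x hx).comp (f := Prod.fst) analyticAt_fst
  have a3 : AnalyticAt ℂ (fun q : ℂ × ℂ => saddleBranchConj (Complex.I * q.2)) (x, y) :=
    AnalyticAt.comp (f := fun q : ℂ × ℂ => Complex.I * q.2) (x := (x, y)) (hB _ hy')
      (analyticAt_const.mul analyticAt_snd)
  have a4 : AnalyticAt ℂ (fun q : ℂ × ℂ => deriv saddleBranch q.1) (x, y) :=
    AnalyticAt.comp (f := Prod.fst) (g := deriv saddleBranch) (x := (x, y))
      (hA x hx).deriv analyticAt_fst
  have a5 : AnalyticAt ℂ (fun q : ℂ × ℂ => deriv branchWConj q.2) (x, y) :=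
    AnalyticAt.comp (f := Prod.snd) (g := deriv branchWConj) (x := (x, y))
      (analyticAt_branchWConj hB hy).deriv analyticAt_snd
  have a6 := ((((AnalyticAt.cexp
    ((((analyticAt_const (v := -(v : ℂ))).mul a2).sub ((analyticAt_const (v := (τ₂ : ℂ))).mul
      (a2.pow 2))).add ((analyticAt_const (v := (u : ℂ))).mul a3) |>.add
      ((analyticAt_const (v := (τ₁ : ℂ))).mul (a3.pow 2)))).div (a2.sub a3)
        (hd x _ hx hy')).mul a4)).mul a5
  exact a6

theorem exists_hasSum_phiFun_capPhiFun : ∃ ε : ℝ, 0 < ε ∧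
    ∀ (τ₁ τ₂ u v : ℝ) (x y : ℂ), ‖x‖ < ε → ‖y‖ < ε →
      HasSum (fun p : ℕ × ℕ => bCoeff τ₁ τ₂ u v p.1 p.2 * x ^ p.1 * y ^ p.2)
        (phiFun τ₁ τ₂ u v x y) ∧
      HasSum (fun p : ℕ × ℕ => cCoeff τ₁ τ₂ u v p.1 p.2 * x ^ p.1 * y ^ p.2)
        (capPhiFun τ₁ τ₂ u v x y) := by
  obtain ⟨R, hR, hA, hB, -, -, hD⟩ := exists_saddleBranch_radius
  refine ⟨R, hR, fun τ₁ τ₂ u v x y hx hy => ⟨?_, ?_⟩⟩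
  · exact hasSum_taylorCoeff₂ (analyticAt_phiFun hA (fun x y hx hy =>
      ⟨(hD x y hx hy).1, (hD x y hx hy).2.1⟩) τ₁ τ₂ u v) hx hy
  · exact hasSum_taylorCoeff₂ (analyticAt_capPhiFun hA hB (fun x y hx hy =>
      (hD x y hx hy).2.2) τ₁ τ₂ u v) hx hy

theorem hasSum_sum_mul {R : ℝ} {A B : Fin 4 → ℂ → ℂ}
    (hA : ∀ j x, ‖x‖ < R → AnalyticAt ℂ (A j) x) (hB : ∀ j x, ‖x‖ < R → AnalyticAt ℂ (B j) x)
    {x y : ℂ} (hx : ‖x‖ < R) (hy : ‖y‖ < R) :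
    HasSum (fun p : ℕ × ℕ =>
      (∑ j, taylorCoeff (A j) p.1 * taylorCoeff (B j) p.2) * x ^ p.1 * y ^ p.2)
      (∑ j, A j x * B j y) := by
  have h : ∀ j : Fin 4, HasSum (fun p : ℕ × ℕ =>
      taylorCoeff (A j) p.1 * taylorCoeff (B j) p.2 * x ^ p.1 * y ^ p.2) (A j x * B j y) := by
    intro j
    have := hasSum_taylorCoeff₂ (F := fun x y => A j x * B j y) (R := R) (fun x y hx hy =>
      ((hA j x hx).comp (f := Prod.fst) analyticAt_fst).mul
        ((hB j y hy).comp (f := Prod.snd) analyticAt_snd)) hx hy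
    simpa only [taylorCoeff₂_mul, taylorCoeff] using this
  refine (hasSum_sum fun j _ => h j).congr_fun fun p => ?_
  simp only [Finset.sum_mul]

/-- Comparison of coefficients in `add_I_mul_phiFun`. The right-hand side consists of the
coefficients that occur in the expansions of the single integrals. -/
theorem shift_bCoeff (τ₁ τ₂ u v : ℝ) (k l : ℕ) :
    shiftFst (bCoeff τ₁ τ₂ u v) k l + Complex.I * shiftSnd (bCoeff τ₁ τ₂ u v) k l =
      ∑ j, taylorCoeff (localAmp (ampZ τ₂ v j) saddleBranch) k *
        taylorCoeff (localAmp (ampW τ₁ u j) branchW) l := by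
  obtain ⟨R, hR, hA, hB, hp, -, hD⟩ := exists_saddleBranch_radius
  have e1 := taylorCoeff₂_eq_of_hasSum hR (c := fun k l => ∑ j,
      taylorCoeff (localAmp (ampZ τ₂ v j) saddleBranch) k *
        taylorCoeff (localAmp (ampW τ₁ u j) branchW) l) (fun x y hx hy =>
    hasSum_sum_mul (fun j x hx => (analyticAt_ampZ τ₂ v j _).localAmp (hA x hx))
      (fun j y hy => (analyticAt_ampW τ₁ u j _).localAmp (analyticAt_branchW hA hy)) hx hy) k l
  rw [← e1]
  symm
  refine taylorCoeff₂_eq_of_hasSum hR (c := fun k l =>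
    shiftFst (bCoeff τ₁ τ₂ u v) k l + Complex.I * shiftSnd (bCoeff τ₁ τ₂ u v) k l)
    (fun x y hx hy => ?_) k l
  have h : HasSum (fun p : ℕ × ℕ => bCoeff τ₁ τ₂ u v p.1 p.2 * x ^ p.1 * y ^ p.2) _ :=
    hasSum_taylorCoeff₂ (analyticAt_phiFun hA (fun x y hx hy =>
      ⟨(hD x y hx hy).1, (hD x y hx hy).2.1⟩) τ₁ τ₂ u v) hx hy
  rw [← add_I_mul_phiFun hA hp (fun x y hx hy => (hD x y hx hy).2.1) τ₁ τ₂ u v hx hy,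
    add_mul, mul_assoc]
  refine ((hasSum_shiftFst h).add ((hasSum_shiftSnd h).mul_left Complex.I)).congr_fun fun p => ?_
  ring

/-- Comparison of coefficients in `mul_capPhiFun`; the two double shifts come from x² and y². -/
theorem shift_cCoeff (τ₁ τ₂ u v : ℝ) (k l : ℕ) :
    (3 / 4 * saddlePt - 3 / 4 * (starRingEnd ℂ) saddlePt) * cCoeff τ₁ τ₂ u v k l +
      shiftFst (shiftFst (cCoeff τ₁ τ₂ u v)) k l + shiftSnd (shiftSnd (cCoeff τ₁ τ₂ u v)) k l =
      ∑ j, taylorCoeff (localAmp (ampZ τ₂ v j) saddleBranch) k *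
        taylorCoeff (localAmp (ampW τ₁ u j) branchWConj) l := by
  obtain ⟨R, hR, hA, hB, hp, -, hD⟩ := exists_saddleBranch_radius
  have e1 := taylorCoeff₂_eq_of_hasSum hR (c := fun k l => ∑ j,
      taylorCoeff (localAmp (ampZ τ₂ v j) saddleBranch) k *
        taylorCoeff (localAmp (ampW τ₁ u j) branchWConj) l) (fun x y hx hy =>
    hasSum_sum_mul (fun j x hx => (analyticAt_ampZ τ₂ v j _).localAmp (hA x hx))
      (fun j y hy => (analyticAt_ampW τ₁ u j _).localAmp (analyticAt_branchWConj hB hy)) hx hy) k l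
  rw [← e1]
  symm
  refine taylorCoeff₂_eq_of_hasSum hR (c := fun k l =>
    (3 / 4 * saddlePt - 3 / 4 * (starRingEnd ℂ) saddlePt) * cCoeff τ₁ τ₂ u v k l +
      shiftFst (shiftFst (cCoeff τ₁ τ₂ u v)) k l + shiftSnd (shiftSnd (cCoeff τ₁ τ₂ u v)) k l)
    (fun x y hx hy => ?_) k l
  have h : HasSum (fun p : ℕ × ℕ => cCoeff τ₁ τ₂ u v p.1 p.2 * x ^ p.1 * y ^ p.2) _ :=
    hasSum_taylorCoeff₂ (analyticAt_capPhiFun hA hB (fun x y hx hy =>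
      (hD x y hx hy).2.2) τ₁ τ₂ u v) hx hy
  rw [← mul_capPhiFun hp (fun x y hx hy => (hD x y hx hy).2.2) τ₁ τ₂ u v hx hy,
    add_mul, add_mul, pow_two x, pow_two y, mul_assoc x, mul_assoc y]
  refine (((h.mul_left (3 / 4 * saddlePt - 3 / 4 * (starRingEnd ℂ) saddlePt)).add
    (hasSum_shiftFst (hasSum_shiftFst h))).add
    (hasSum_shiftSnd (hasSum_shiftSnd h))).congr_fun fun p => ?_
  ring

/-- The amplitude has real coefficients and the conjugate of iy is i·(-ȳ), so everything is the
reflected conjugate, except that the factor i from the derivative of y ↦ iy changes sign under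
conjugation. -/
theorem localAmp_branchWConj (τ u : ℝ) (j : Fin 4) (y : ℂ) :
    localAmp (ampW τ u j) branchWConj y
      = -(starRingEnd ℂ) (localAmp (ampW τ u j) branchW (-(starRingEnd ℂ) y)) := by
  have e : Complex.I * -(starRingEnd ℂ) y = (starRingEnd ℂ) (Complex.I * y) := by simp
  have h1 : deriv saddleBranchConj (Complex.I * y)
      = (starRingEnd ℂ) (deriv saddleBranch ((starRingEnd ℂ) (Complex.I * y))) := by
    rw [saddleBranchConj_eq]
    exact congrFun (deriv_conj_conj (f := saddleBranch)) (Complex.I * y)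
  simp only [localAmp, deriv_branchW, deriv_branchWConj, branchW, branchWConj, e, h1,
    saddleBranchConj, ampW]
  simp [← Complex.exp_conj]

/-- The reflection y ↦ -ȳ contributes (-1)^k, which is 1 in even degree. Only even degrees survive
against a Gaussian. -/
theorem taylorCoeff_branchWConj (τ u : ℝ) (j : Fin 4) (n : ℕ) :
    taylorCoeff (localAmp (ampW τ u j) branchWConj) (2 * n)
      = -(starRingEnd ℂ) (taylorCoeff (localAmp (ampW τ u j) branchW) (2 * n)) := by
  obtain ⟨R, hR, hA, hB, hp, -, hD⟩ := exists_saddleBranch_radius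
  have hdiff : DifferentiableOn ℂ (localAmp (ampW τ u j) branchW) (Metric.ball 0 R) :=
    fun y hy => ((analyticAt_ampW τ u j _).localAmp
      (analyticAt_branchW hA (mem_ball_zero_iff.1 hy))).differentiableAt.differentiableWithinAt
  have := iteratedDeriv_eq_of_hasSum hR (f := localAmp (ampW τ u j) branchWConj)
    (c := fun k => -(-1) ^ k *
      (starRingEnd ℂ) (taylorCoeff (localAmp (ampW τ u j) branchW) k)) (fun z hz => by
      have hz' : ‖-(starRingEnd ℂ) z‖ < R := by simpa using hz
      rw [localAmp_branchWConj τ u j z]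
      have h2 := Complex.hasSum_taylorSeries_on_ball hdiff (mem_ball_zero_iff.2 hz')
      have h3 := (Complex.hasSum_conj'.2 h2).neg
      refine h3.congr_fun fun k => ?_
      rw [sub_zero, neg_pow ((starRingEnd ℂ) z) k]
      simp [taylorCoeff]
      ring) (2 * n)
  rw [taylorCoeff, this]
  have : ((2 * n).factorial : ℂ) ≠ 0 := by exact_mod_cast Nat.factorial_ne_zero _
  field_simp
  simp

/-! ### Gaussian moments and Watson's lemma -/

theorem integrable_exp_neg_mul_sq_mul_pow {μ : ℝ} (hμ : 0 < μ) (k : ℕ) :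
    Integrable fun x : ℝ => Real.exp (-μ * x ^ 2) * x ^ k := by
  have := integrable_rpow_mul_exp_neg_mul_sq hμ (s := k) (by
    have : (0 : ℝ) ≤ k := Nat.cast_nonneg k
    linarith)
  simpa only [Real.rpow_natCast, mul_comm] using this

theorem integral_exp_neg_mul_sq_mul_pow_even {μ : ℝ} (hμ : 0 < μ) (n : ℕ) :
    ∫ x : ℝ, Real.exp (-μ * x ^ 2) * x ^ (2 * n)
      = Real.Gamma (n + 1 / 2) * μ ^ (-((n : ℝ) + 1 / 2)) := by
  have h1 : ∀ x : ℝ, Real.exp (-μ * x ^ 2) * x ^ (2 * n)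
      = (fun y : ℝ => Real.exp (-μ * y ^ 2) * y ^ (2 * n)) |x| := fun x => by
    simp only [sq_abs, pow_mul]
  rw [integral_congr_ae (Eventually.of_forall h1),
    integral_comp_abs (f := fun y : ℝ => Real.exp (-μ * y ^ 2) * y ^ (2 * n))]
  have h2 := integral_rpow_mul_exp_neg_mul_rpow (p := 2) (q := (2 * n : ℕ)) (b := μ)
    (by norm_num) (by have : (0 : ℝ) ≤ (2 * n : ℕ) := Nat.cast_nonneg _; linarith) hμ
  rw [setIntegral_congr_fun measurableSet_Ioi
    (g := fun x : ℝ => x ^ ((2 * n : ℕ) : ℝ) * Real.exp (-μ * x ^ (2 : ℝ)))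
    (fun x _ => by
      simp only [Real.rpow_natCast, Real.rpow_two]
      ring), h2]
  have e1 : (((2 * n : ℕ) : ℝ) + 1) / 2 = n + 1 / 2 := by push_cast; ring
  have e2 : -(((2 * n : ℕ) : ℝ) + 1) / 2 = -((n : ℝ) + 1 / 2) := by push_cast; ring
  rw [e1, e2]
  ring

theorem integral_exp_neg_mul_sq_mul_pow_odd (μ : ℝ) (n : ℕ) :
    ∫ x : ℝ, Real.exp (-μ * x ^ 2) * x ^ (2 * n + 1) = 0 := by
  have h := integral_neg_eq_self (fun x : ℝ => Real.exp (-μ * x ^ 2) * x ^ (2 * n + 1)) volume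
  have h2 : ∀ x : ℝ, Real.exp (-μ * (-x) ^ 2) * (-x) ^ (2 * n + 1)
      = -(Real.exp (-μ * x ^ 2) * x ^ (2 * n + 1)) := fun x => by
    rw [neg_sq, Odd.neg_pow ⟨n, rfl⟩]
    ring
  rw [integral_congr_ae (Eventually.of_forall h2), integral_neg] at h
  linarith

theorem norm_taylorCoeff_le {H : ℂ → ℂ} {R r B : ℝ} (hr : 0 < r) (hrR : r < R)
    (hH : DifferentiableOn ℂ H (Metric.ball 0 R)) (hB : ∀ z, ‖z‖ ≤ r → ‖H z‖ ≤ B) (k : ℕ) :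
    ‖taylorCoeff H k‖ ≤ B / r ^ k := by
  have hsub : closure (Metric.ball (0 : ℂ) r) ⊆ Metric.ball 0 R :=
    Metric.closure_ball_subset_closedBall.trans (Metric.closedBall_subset_ball hrR)
  have := Complex.norm_iteratedDeriv_le_of_forall_mem_sphere_norm_le k hr
    (hH.mono hsub).diffContOnCl fun z hz => hB z (mem_sphere_zero_iff_norm.1 hz).le
  rw [taylorCoeff, norm_div, Complex.norm_natCast, div_le_iff₀ (by positivity)]
  exact this.trans (le_of_eq (by ring))

/-- By Cauchy's estimates the tail is dominated by a geometric series of ratio ‖z‖/r ≤ 1/2, whence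
the factor 2. -/
theorem norm_sub_sum_taylorCoeff_le {H : ℂ → ℂ} {R r B : ℝ} (hr : 0 < r) (hrR : r < R)
    (hH : DifferentiableOn ℂ H (Metric.ball 0 R)) (hB : ∀ z, ‖z‖ ≤ r → ‖H z‖ ≤ B) (M : ℕ)
    {z : ℂ} (hz : ‖z‖ ≤ r / 2) :
    ‖H z - ∑ k ∈ Finset.range M, taylorCoeff H k * z ^ k‖ ≤ 2 * B / r ^ M * ‖z‖ ^ M := by
  have hB0 : 0 ≤ B := (norm_nonneg _).trans (hB 0 (by simpa using hr.le))
  have h1 : HasSum (fun k => taylorCoeff H k * z ^ k) (H z) := by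
    have := Complex.hasSum_taylorSeries_on_ball hH (z := z) (mem_ball_zero_iff.2 (by linarith))
    refine this.congr_fun fun k => ?_
    simp only [taylorCoeff, sub_zero, smul_eq_mul]
    ring
  have h2 := (hasSum_nat_add_iff' M).2 h1
  have hg : HasSum (fun k : ℕ => B / r ^ M * ‖z‖ ^ M * (1 / 2) ^ k) (B / r ^ M * ‖z‖ ^ M * 2) := by
    simpa using hasSum_geometric_two.mul_left (B / r ^ M * ‖z‖ ^ M)
  rw [← h2.tsum_eq]
  refine (tsum_of_norm_bounded hg fun k => ?_).trans (le_of_eq (by ring))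
  rw [norm_mul, norm_pow]
  calc _ ≤ B / r ^ (k + M) * ‖z‖ ^ (k + M) := by
        gcongr
        exact norm_taylorCoeff_le hr hrR hH hB _
    _ = B / r ^ M * ‖z‖ ^ M * (‖z‖ / r) ^ k := by
        rw [pow_add, pow_add, div_pow]
        field_simp
    _ ≤ _ := by
        refine mul_le_mul_of_nonneg_left (pow_le_pow_left₀ (by positivity) ?_ k) (by positivity)
        rw [div_le_iff₀ hr]
        linarith

theorem sum_range_two_mul {E : Type*} [AddCommMonoid E] (f : ℕ → E) (N : ℕ) :
    ∑ k ∈ Finset.range (2 * N), f k = ∑ n ∈ Finset.range N, (f (2 * n) + f (2 * n + 1)) := by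
  induction N with
  | zero => simp
  | succ N ih => rw [mul_add, mul_one, Finset.sum_range_succ, Finset.sum_range_succ, ih,
      Finset.sum_range_succ, add_assoc]

/-- Watson's lemma on `[-δ, δ]` with the Gaussian weight, with an explicit error bound. -/
theorem norm_integral_gaussian_sub_le {H : ℂ → ℂ} {R r B δ μ : ℝ} (hr : 0 < r) (hrR : r < R)
    (hH : DifferentiableOn ℂ H (Metric.ball 0 R)) (hB : ∀ z, ‖z‖ ≤ r → ‖H z‖ ≤ B)
    (hδ : 0 < δ) (hδr : δ ≤ r / 2) (hμ : 0 < μ) (N : ℕ) :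
    ‖(∫ x in (-δ)..δ, Complex.exp (-μ * (x : ℂ) ^ 2) * H x) -
      ∑ n ∈ Finset.range N, taylorCoeff H (2 * n) *
        ((Real.Gamma (n + 1 / 2) * μ ^ (-((n : ℝ) + 1 / 2)) : ℝ) : ℂ)‖ ≤
      2 * B / δ ^ (2 * N) * (Real.Gamma (N + 1 / 2) * μ ^ (-((N : ℝ) + 1 / 2))) := by
  have hB0 : 0 ≤ B := (norm_nonneg _).trans (hB 0 (by simpa using hr.le))
  set P : ℝ → ℂ := fun x => ∑ k ∈ Finset.range (2 * N), taylorCoeff H k * (x : ℂ) ^ k with hP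
  have hexp : ∀ x : ℝ, Complex.exp (-μ * (x : ℂ) ^ 2) = ((Real.exp (-μ * x ^ 2) : ℝ) : ℂ) := by
    intro x
    push_cast
    rfl
  have hcont : ContinuousOn (fun x : ℝ => Complex.exp (-μ * (x : ℂ) ^ 2) * H x)
      (Set.Icc (-δ) δ) := by
    refine ContinuousOn.mul (by fun_prop) ?_
    refine hH.continuousOn.comp (by fun_prop) fun x hx => ?_
    rw [mem_ball_zero_iff, Complex.norm_real, Real.norm_eq_abs]
    have := abs_le.2 hx
    linarith
  have hint1 : Integrable (Set.indicator (Set.Ioc (-δ) δ)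
      fun x : ℝ => Complex.exp (-μ * (x : ℂ) ^ 2) * H x) := by
    rw [integrable_indicator_iff measurableSet_Ioc]
    exact (hcont.integrableOn_Icc).mono_set Set.Ioc_subset_Icc_self
  have hmom : ∀ k : ℕ, Integrable fun x : ℝ => Complex.exp (-μ * (x : ℂ) ^ 2) * (x : ℂ) ^ k := by
    intro k
    have := (integrable_exp_neg_mul_sq_mul_pow hμ k).ofReal (𝕜 := ℂ)
    refine this.congr (Eventually.of_forall fun x => ?_)
    simp
  have hmomv : ∀ k : ℕ, ∫ x : ℝ, Complex.exp (-μ * (x : ℂ) ^ 2) * (x : ℂ) ^ k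
      = ((∫ x : ℝ, Real.exp (-μ * x ^ 2) * x ^ k : ℝ) : ℂ) := by
    intro k
    rw [← integral_complex_ofReal]
    refine integral_congr_ae (Eventually.of_forall fun x => ?_)
    simp
  have hPexp : ∀ x : ℝ, Complex.exp (-μ * (x : ℂ) ^ 2) * P x = ∑ k ∈ Finset.range (2 * N),
      taylorCoeff H k * (Complex.exp (-μ * (x : ℂ) ^ 2) * (x : ℂ) ^ k) := by
    intro x
    rw [hP, Finset.mul_sum]
    exact Finset.sum_congr rfl fun k _ => by ring
  have hint2 : Integrable fun x : ℝ => Complex.exp (-μ * (x : ℂ) ^ 2) * P x := by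
    simp only [hPexp]
    exact integrable_finsetSum _ fun k _ => (hmom k).const_mul _
  have hval : ∫ x : ℝ, Complex.exp (-μ * (x : ℂ) ^ 2) * P x =
      ∑ n ∈ Finset.range N, taylorCoeff H (2 * n) *
        ((Real.Gamma (n + 1 / 2) * μ ^ (-((n : ℝ) + 1 / 2)) : ℝ) : ℂ) := by
    simp only [hPexp]
    rw [integral_finsetSum _ fun k _ => (hmom k).const_mul _, sum_range_two_mul]
    refine Finset.sum_congr rfl fun n _ => ?_
    rw [integral_const_mul, integral_const_mul, hmomv, hmomv,
      integral_exp_neg_mul_sq_mul_pow_even hμ, integral_exp_neg_mul_sq_mul_pow_odd]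
    simp
  rw [← hval, intervalIntegral.integral_of_le (by linarith), ← integral_indicator measurableSet_Ioc,
    ← integral_sub hint1 hint2, ← integral_exp_neg_mul_sq_mul_pow_even hμ N, ← integral_const_mul]
  refine norm_integral_le_of_norm_le ((integrable_exp_neg_mul_sq_mul_pow hμ (2 * N)).const_mul _)
    (Eventually.of_forall fun x => ?_)
  -- One bound serves the whole line. For |x| ≤ δ it is the Taylor remainder; for |x| > δ it is the
  -- Taylor polynomial itself, whose powers of |x|/δ below 2N are at most (|x|/δ)^(2N). Integration
  -- then yields the moment of order 2N, with no separate estimate of the Gaussian tails.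
  have key : ‖Set.indicator (Set.Ioc (-δ) δ) (fun x : ℝ => H x) x - P x‖
      ≤ 2 * B / δ ^ (2 * N) * |x| ^ (2 * N) := by
    have hnx : ‖(x : ℂ)‖ = |x| := by rw [Complex.norm_real, Real.norm_eq_abs]
    by_cases hx : x ∈ Set.Ioc (-δ) δ
    · rw [Set.indicator_of_mem hx]
      have hx' : |x| ≤ δ := abs_le.2 ⟨hx.1.le, hx.2⟩
      refine (norm_sub_sum_taylorCoeff_le hr hrR hH hB (2 * N) (z := x) (by
        rw [hnx]; linarith)).trans ?_
      rw [hnx]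
      gcongr
      linarith
    · rw [Set.indicator_of_notMem hx, zero_sub, norm_neg, hP]
      have hx' : δ ≤ |x| := by
        by_contra h
        push Not at h
        exact hx ⟨(abs_lt.1 h).1, (abs_lt.1 h).2.le⟩
      refine (norm_sum_le _ _).trans ?_
      -- The condition 2δ ≤ r turns Cauchy's bound into one with the summable factor (1/2)^k.
      have hterm : ∀ k ∈ Finset.range (2 * N), ‖taylorCoeff H k * (x : ℂ) ^ k‖
          ≤ B / δ ^ (2 * N) * |x| ^ (2 * N) * (1 / 2) ^ k := by
        intro k hk
        have hk' := (Finset.mem_range.1 hk).le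
        rw [norm_mul, norm_pow, hnx]
        calc _ ≤ B / r ^ k * |x| ^ k := by
              gcongr
              exact norm_taylorCoeff_le hr hrR hH hB _
          _ ≤ B / (2 * δ) ^ k * |x| ^ k := by
              gcongr
              linarith
          _ = B * (1 / 2) ^ k * (|x| / δ) ^ k := by
              rw [mul_pow, div_pow, div_pow, one_pow]
              field_simp
          _ ≤ B * (1 / 2) ^ k * (|x| / δ) ^ (2 * N) := by
              gcongr
              rwa [one_le_div hδ]
          _ = _ := by
              rw [div_pow |x|]
              field_simp
      refine (Finset.sum_le_sum hterm).trans ?_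
      rw [← Finset.mul_sum]
      have := sum_le_hasSum (Finset.range (2 * N)) (fun k _ => by positivity) hasSum_geometric_two
      calc _ ≤ B / δ ^ (2 * N) * |x| ^ (2 * N) * 2 := by gcongr
        _ = _ := by ring
  have e1 : (Set.indicator (Set.Ioc (-δ) δ)
      (fun x : ℝ => Complex.exp (-μ * (x : ℂ) ^ 2) * H x) x -
      Complex.exp (-μ * (x : ℂ) ^ 2) * P x) = Complex.exp (-μ * (x : ℂ) ^ 2) *
      (Set.indicator (Set.Ioc (-δ) δ) (fun x : ℝ => H x) x - P x) := by
    by_cases hx : x ∈ Set.Ioc (-δ) δ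
    · simp only [Set.indicator_of_mem hx]
      ring
    · simp only [Set.indicator_of_notMem hx]
      ring
  rw [e1, norm_mul, hexp, Complex.norm_real, Real.norm_of_nonneg (Real.exp_pos _).le]
  have e2 : |x| ^ (2 * N) = x ^ (2 * N) := by rw [pow_mul, sq_abs, pow_mul]
  rw [e2] at key
  calc _ ≤ Real.exp (-μ * x ^ 2) * (2 * B / δ ^ (2 * N) * x ^ (2 * N)) := by gcongr
    _ = _ := by ring

/-! ### The contribution of a simple saddle point -/

/-- Local data at a simple saddle point `p` of `F`: a coordinate `G` with
`F (G x) = F p + x ^ 2`, and the quadratic approximation of `F` at `p`. -/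
structure SaddleCoord (F G : ℂ → ℂ) (p : ℂ) : Prop where
  differentiable : Differentiable ℂ F
  analyticAt : AnalyticAt ℂ G 0
  map_zero : G 0 = p
  deriv_ne_zero : deriv G 0 ≠ 0
  eventually_eq : ∀ᶠ x in 𝓝 (0 : ℂ), F (G x) = F p + x ^ 2
  quadratic : ∃ M : ℝ, ∀ w : ℂ, ‖w‖ ≤ 1 →
    ‖F (p + w) - F p - w ^ 2 / deriv G 0 ^ 2‖ ≤ M * ‖w‖ ^ 3

/-- Reversing the coordinate reduces the incoming half of a contour to the outgoing one. -/
theorem SaddleCoord.neg_coord {F G : ℂ → ℂ} {p : ℂ} (h : SaddleCoord F G p) :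
    SaddleCoord F (fun x => G (-x)) p := by
  have hd : deriv (fun x => G (-x)) 0 = -deriv G 0 := by
    simpa using deriv_comp_neg (f := G) (0 : ℂ)
  have hneg : Tendsto (fun x : ℂ => -x) (𝓝 0) (𝓝 0) := by
    simpa using (continuous_neg (G := ℂ)).tendsto 0
  refine ⟨h.differentiable, ?_, by simpa using h.map_zero, ?_, ?_, ?_⟩
  · have := h.analyticAt
    exact AnalyticAt.comp (f := fun x : ℂ => -x) (g := G) (by simpa using this) (by fun_prop)
  · rw [hd]
    exact neg_ne_zero.2 h.deriv_ne_zero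
  · filter_upwards [hneg.eventually h.eventually_eq] with x hx
    rw [hx, neg_sq]
  · simpa only [hd, neg_sq] using h.quadratic

/-- On the segment from `G δ` to `p + δ G'(0) (1 + iσ)`, `|σ| < 1`, the real part of `F` exceeds
`Re F p` if `δ > 0` is small. -/
theorem SaddleCoord.eventually_segment {F G : ℂ → ℂ} {p : ℂ} (h : SaddleCoord F G p) {σ : ℝ}
    (hσ : |σ| < 1) : ∀ᶠ δ : ℝ in 𝓝[>] 0, ∃ κ > 0, ∀ z ∈ segment ℝ (G δ)
      (p + δ * deriv G 0 * (1 + σ * Complex.I)), (F p).re + κ ≤ (F z).re := by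
  set l := deriv G 0 with hl
  have hl0 : l ≠ 0 := h.deriv_ne_zero
  have hln : 0 < ‖l‖ := norm_pos_iff.2 hl0
  obtain ⟨M, hM⟩ := h.quadratic
  have hM0 : 0 ≤ M := by
    have := hM 1 (by simp)
    exact (norm_nonneg _).trans (by simpa using this)
  -- With |σ| = 1 - 4η, perturbing both parts of 1 + iσ by η leaves (1-η)² - (1-3η)² = 4η - 8η²,
  -- which is at least 2η since η ≤ 1/4. So a margin remains for the cubic error.
  set η := (1 - |σ|) / 4 with hη
  have hη0 : 0 < η := by rw [hη]; linarith
  have hη1 : η ≤ 1 / 4 := by rw [hη]; linarith [abs_nonneg σ]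
  -- the linear approximation of `G`
  have h1 : ∀ᶠ δ : ℝ in 𝓝[>] 0, ‖G δ - p - δ * l‖ ≤ η * ‖l‖ * δ := by
    have e := (h.analyticAt.differentiableAt.hasDerivAt).isLittleO
    have e2 := (Asymptotics.isLittleO_iff.1 e) (mul_pos hη0 hln)
    have e3 : Tendsto (fun δ : ℝ => (δ : ℂ)) (𝓝[>] 0) (𝓝 0) := by
      have : Tendsto (fun δ : ℝ => (δ : ℂ)) (𝓝 0) (𝓝 0) := by
        simpa using Complex.continuous_ofReal.tendsto 0
      exact this.mono_left nhdsWithin_le_nhds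
    filter_upwards [e3.eventually e2, self_mem_nhdsWithin] with δ hδ hpos
    have hpos' : (0 : ℝ) < δ := hpos
    simpa [h.map_zero, abs_of_pos hpos'] using hδ
  have h2 : ∀ᶠ δ : ℝ in 𝓝[>] 0, 3 * ‖l‖ * δ < 1 := by
    have : Tendsto (fun δ : ℝ => 3 * ‖l‖ * δ) (𝓝[>] 0) (𝓝 0) := by
      have : Tendsto (fun δ : ℝ => 3 * ‖l‖ * δ) (𝓝 0) (𝓝 (3 * ‖l‖ * 0)) :=
        (continuous_const.mul continuous_id).tendsto 0
      rw [mul_zero] at this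
      exact this.mono_left nhdsWithin_le_nhds
    exact this.eventually_lt_const one_pos
  have h3 : ∀ᶠ δ : ℝ in 𝓝[>] 0, M * (3 * ‖l‖) ^ 3 * δ < η / 2 := by
    have : Tendsto (fun δ : ℝ => M * (3 * ‖l‖) ^ 3 * δ) (𝓝[>] 0) (𝓝 0) := by
      have : Tendsto (fun δ : ℝ => M * (3 * ‖l‖) ^ 3 * δ) (𝓝 0) (𝓝 (M * (3 * ‖l‖) ^ 3 * 0)) :=
        (continuous_const.mul continuous_id).tendsto 0
      rw [mul_zero] at this
      exact this.mono_left nhdsWithin_le_nhds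
    exact this.eventually_lt_const (by positivity)
  filter_upwards [h1, h2, h3, self_mem_nhdsWithin] with δ hd1 hd2 hd3 hpos
  have hδ : (0 : ℝ) < δ := hpos
  refine ⟨η / 2 * δ ^ 2, by positivity, ?_⟩
  rintro z ⟨a, b, ha, hb, hab, rfl⟩
  -- The relative deviation of the curve from its tangent: a point of the segment is p + δl(1 + ibσ
  -- + ρ).
  set ρ : ℂ := a * (G δ - p - δ * l) / (δ * l) with hρ
  have hδl : (δ : ℂ) * l ≠ 0 := mul_ne_zero (by exact_mod_cast hδ.ne') hl0
  have hρn : ‖ρ‖ ≤ η := by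
    rw [hρ, norm_div, norm_mul, norm_mul, Complex.norm_real, Complex.norm_real,
      Real.norm_of_nonneg ha, Real.norm_of_nonneg hδ.le, div_le_iff₀ (by positivity)]
    calc a * ‖G δ - p - δ * l‖ ≤ 1 * (η * ‖l‖ * δ) := by gcongr; linarith
      _ = _ := by ring
  set w : ℂ := δ * l * (1 + (b * σ : ℝ) * Complex.I + ρ) with hw
  have hz : a • G δ + b • (p + δ * l * (1 + σ * Complex.I)) = p + w := by
    have hb' : (b : ℂ) = 1 - a := by rw [← Complex.ofReal_one, ← hab]; push_cast; ring
    rw [Complex.real_smul, Complex.real_smul, hw, mul_add (δ * l : ℂ) _ ρ, hρ,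
      mul_div_cancel₀ _ hδl]
    push_cast
    rw [hb']
    ring
  rw [hz]
  have hσ' : |b * σ| ≤ |σ| := by
    rw [abs_mul, abs_of_nonneg hb]
    exact mul_le_of_le_one_left (abs_nonneg _) (by linarith)
  have hwn : ‖w‖ ≤ 3 * ‖l‖ * δ := by
    rw [hw, norm_mul, norm_mul, Complex.norm_real, Real.norm_of_nonneg hδ.le]
    have : ‖1 + ((b * σ : ℝ) : ℂ) * Complex.I + ρ‖ ≤ 3 := by
      refine (norm_add₃_le).trans ?_
      rw [norm_one, norm_mul, Complex.norm_I, mul_one, Complex.norm_real, Real.norm_eq_abs]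
      linarith
    calc δ * ‖l‖ * _ ≤ δ * ‖l‖ * 3 := by gcongr
      _ = _ := by ring
  have hq := hM w (by linarith)
  have hre : η * δ ^ 2 ≤ (w ^ 2 / l ^ 2).re := by
    have e : w ^ 2 / l ^ 2 = ((δ ^ 2 : ℝ) : ℂ) * (1 + (b * σ : ℝ) * Complex.I + ρ) ^ 2 := by
      rw [hw]
      push_cast
      field_simp
    rw [e, Complex.re_ofReal_mul, mul_comm]
    gcongr
    have r1 := (abs_le.1 ((Complex.abs_re_le_norm ρ).trans hρn)).1
    have r2 := (Complex.abs_im_le_norm ρ).trans hρn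
    have e2 : ((1 + ((b * σ : ℝ) : ℂ) * Complex.I + ρ) ^ 2).re
        = (1 + ρ.re) ^ 2 - (b * σ + ρ.im) ^ 2 := by
      rw [sq, Complex.mul_re]
      simp
      ring
    rw [e2]
    have r3 : |b * σ + ρ.im| ≤ |σ| + η := (abs_add_le _ _).trans (by linarith)
    have r4 : (b * σ + ρ.im) ^ 2 ≤ (|σ| + η) ^ 2 := by
      rw [← sq_abs]
      gcongr
    have r5 : |σ| = 1 - 4 * η := by rw [hη]; ring
    rw [r5] at r4
    nlinarith
  have h4 : ‖F (p + w) - F p - w ^ 2 / l ^ 2‖ ≤ η / 2 * δ ^ 2 := by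
    refine hq.trans ?_
    calc M * ‖w‖ ^ 3 ≤ M * (3 * ‖l‖ * δ) ^ 3 := by gcongr
      _ = M * (3 * ‖l‖) ^ 3 * δ * δ ^ 2 := by ring
      _ ≤ _ := by gcongr
  have h5 := (abs_le.1 ((Complex.abs_re_le_norm _).trans h4)).1
  simp only [Complex.sub_re] at h5
  linarith

/-- The part of the integral over the curve `G`, in terms of a primitive `E` of the integrand. -/
theorem primitive_sub_eq_integral {F G h E : ℂ → ℂ} {F₀ : ℂ} {R δ : ℝ} {μ : ℂ}
    (hG : ∀ x, ‖x‖ < R → AnalyticAt ℂ G x) (hF : ∀ x, ‖x‖ < R → F (G x) = F₀ + x ^ 2)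
    (hE : ∀ z, HasDerivAt E (Complex.exp (-μ * F z) * h z) z) (hh : Differentiable ℂ h)
    (hδ : 0 < δ) (hδR : δ < R) :
    E (G δ) - E (G (-δ)) = Complex.exp (-μ * F₀) *
      ∫ x in (-δ)..δ, Complex.exp (-μ * (x : ℂ) ^ 2) * localAmp h G x := by
  have hx : ∀ x ∈ Set.uIcc (-δ) δ, ‖(x : ℂ)‖ < R := by
    intro x hx
    rw [Set.uIcc_of_le (by linarith)] at hx
    rw [Complex.norm_real, Real.norm_eq_abs]
    exact (abs_le.2 hx).trans_lt hδR
  have hd : ∀ x ∈ Set.uIcc (-δ) δ, HasDerivAt (fun x : ℝ => E (G x))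
      (Complex.exp (-μ * F₀) * (Complex.exp (-μ * (x : ℂ) ^ 2) * localAmp h G x)) x := by
    intro x hx'
    have h1 := ((hE (G x)).comp (x : ℂ)
      (hG x (hx x hx')).differentiableAt.hasDerivAt).comp_ofReal
    refine h1.congr_deriv ?_
    rw [hF _ (hx x hx'), mul_add, Complex.exp_add, localAmp]
    ring
  have hc : ContinuousOn (fun x : ℝ => Complex.exp (-μ * F₀) *
      (Complex.exp (-μ * (x : ℂ) ^ 2) * localAmp h G x)) (Set.uIcc (-δ) δ) := by
    intro x hx'
    refine ContinuousAt.continuousWithinAt ?_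
    have a1 : ContinuousAt (localAmp h G) x :=
      ((hh.analyticAt _).localAmp (hG x (hx x hx'))).continuousAt
    have a2 : ContinuousAt (fun x : ℝ => localAmp h G x) x :=
      ContinuousAt.comp (f := fun x : ℝ => (x : ℂ)) a1 (by fun_prop)
    exact continuousAt_const.mul (ContinuousAt.mul (by fun_prop) a2)
  have := intervalIntegral.integral_eq_sub_of_hasDerivAt hd hc.intervalIntegrable
  rw [intervalIntegral.integral_const_mul] at this
  rw [this]
  push_cast
  rfl

theorem exists_exp_neg_le_rpow {κ : ℝ} (hκ : 0 < κ) (s : ℝ) :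
    ∃ C : ℝ, 0 ≤ C ∧ ∀ μ : ℝ, 1 ≤ μ → Real.exp (-(μ * κ)) ≤ C * μ ^ (-s) := by
  obtain ⟨n, hn⟩ := exists_nat_ge s
  refine ⟨n.factorial / κ ^ n, by positivity, fun μ hμ => ?_⟩
  have hμ0 : 0 < μ := by linarith
  have h1 := Real.pow_div_factorial_le_exp (μ * κ) (by positivity) n
  have h2 : μ ^ s ≤ μ ^ n := by
    rw [← Real.rpow_natCast]
    exact Real.rpow_le_rpow_of_exponent_le hμ hn
  rw [Real.exp_neg, Real.rpow_neg hμ0.le, ← div_eq_mul_inv, inv_eq_one_div,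
    div_le_div_iff₀ (Real.exp_pos _) (Real.rpow_pos_of_pos hμ0 s), one_mul, div_mul_eq_mul_div,
    le_div_iff₀ (by positivity)]
  rw [mul_pow, div_le_iff₀ (by positivity)] at h1
  calc μ ^ s * κ ^ n ≤ μ ^ n * κ ^ n := by gcongr
    _ ≤ _ := by rw [mul_comm (n.factorial : ℝ)]; exact h1

/-- A contour `γ` with velocity `c` through the saddle point `p = γ 0`, along which `Re F` is
minimal at `p` only. Near `p` the contour consists of two straight pieces, whose directions are
within `π / 4` of the steepest direction `l`. -/
structure SaddlePath (F : ℂ → ℂ) (p l : ℂ) (γ c : ℝ → ℂ) : Prop where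
  measurable_path : Measurable γ
  measurable_weight : Measurable c
  right : ∃ t₀ : ℝ, 0 < t₀ ∧ ∃ α : ℝ, 0 < α ∧ ∃ σ : ℝ, |σ| < 1 ∧ ∀ t ∈ Set.Ioc (0 : ℝ) t₀,
    γ t = p + t * (α * l * (1 + σ * Complex.I)) ∧ c t = α * l * (1 + σ * Complex.I)
  left : ∃ t₀ : ℝ, 0 < t₀ ∧ ∃ α : ℝ, 0 < α ∧ ∃ σ : ℝ, |σ| < 1 ∧ ∀ t ∈ Set.Ioc (-t₀ : ℝ) 0,
    γ t = p + t * (α * l * (1 + σ * Complex.I)) ∧ c t = α * l * (1 + σ * Complex.I)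
  le_re : ∀ t, c t ≠ 0 → (F p).re ≤ (F (γ t)).re
  gap : ∀ η > 0, ∃ κ > 0, ∀ t, η ≤ |t| → c t ≠ 0 → (F p).re + κ ≤ (F (γ t)).re
  integrable : ∀ K : ℝ, Integrable fun t =>
    ‖c t‖ * Real.exp (-(F (γ t)).re) * Real.exp (K * (1 + ‖γ t‖ ^ 2))

/-- The factor e^{-μ Re F} is split as e^{-(μ-1) Re F} e^{-Re F}. The first factor is estimated by
the lower bound of Re F along the path; the second belongs to an integrable majorant independent of
μ and h. -/
theorem norm_saddle_integrand_le {F : ℂ → ℂ} {p : ℂ} {γ c : ℝ → ℂ} {K : ℝ} {h : ℂ → ℂ} (hK : ∀ z, ‖h z‖ ≤ Real.exp (K * (1 + ‖z‖ ^ 2))) {μ : ℝ} (hμ : 1 ≤ μ)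
    {κ t : ℝ} (hκ : c t ≠ 0 → (F p).re + κ ≤ (F (γ t)).re) :
    ‖Complex.exp (-μ * F (γ t)) * h (γ t) * c t‖ ≤ Real.exp (-((μ - 1) * ((F p).re + κ))) *
      (‖c t‖ * Real.exp (-(F (γ t)).re) * Real.exp (K * (1 + ‖γ t‖ ^ 2))) := by
  by_cases hc : c t = 0
  · simp [hc]
  have h1 := hκ hc
  rw [norm_mul, norm_mul, Complex.norm_exp]
  have e : (-(μ : ℂ) * F (γ t)).re = -((μ - 1) * (F (γ t)).re) + -(F (γ t)).re := by
    rw [← Complex.ofReal_neg, Complex.re_ofReal_mul]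
    ring
  rw [e, Real.exp_add]
  have h2 : Real.exp (-((μ - 1) * (F (γ t)).re)) ≤ Real.exp (-((μ - 1) * ((F p).re + κ))) := by
    apply Real.exp_le_exp.2
    have : 0 ≤ μ - 1 := by linarith
    nlinarith
  calc _ ≤ Real.exp (-((μ - 1) * ((F p).re + κ))) * Real.exp (-(F (γ t)).re) *
        Real.exp (K * (1 + ‖γ t‖ ^ 2)) * ‖c t‖ := by
          gcongr
          exact hK _
    _ = _ := by ring

theorem SaddlePath.integrable_integrand {F : ℂ → ℂ} {p l : ℂ} {γ c : ℝ → ℂ}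
    (hP : SaddlePath F p l γ c) (hF : Differentiable ℂ F) {K : ℝ} {h : ℂ → ℂ}
    (hh : Differentiable ℂ h) (hK : ∀ z, ‖h z‖ ≤ Real.exp (K * (1 + ‖z‖ ^ 2))) {μ : ℝ}
    (hμ : 1 ≤ μ) : Integrable fun t => Complex.exp (-μ * F (γ t)) * h (γ t) * c t := by
  refine ((hP.integrable K).const_mul (Real.exp (-((μ - 1) * ((F p).re + 0))))).mono' ?_
    (Eventually.of_forall fun t => norm_saddle_integrand_le hK hμ fun hc => by simpa using hP.le_re t hc)
  have m1 := hF.continuous.measurable.comp hP.measurable_path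
  have m2 := hh.continuous.measurable.comp hP.measurable_path
  exact (((Complex.measurable_exp.comp (m1.const_mul (-(μ : ℂ)))).mul m2).mul
    hP.measurable_weight).aestronglyMeasurable

theorem integral_segment_eq_sub {P E : ℂ → ℂ} (hE : ∀ z, HasDerivAt E (P z) z)
    (hP : Continuous P) (p d : ℂ) (a b : ℝ) :
    ∫ t in a..b, P (p + t * d) * d = E (p + b * d) - E (p + a * d) := by
  have hd : ∀ t ∈ Set.uIcc a b, HasDerivAt (fun t : ℝ => E (p + t * d)) (P (p + t * d) * d) t := by
    intro t _
    have h1 : HasDerivAt (fun t : ℂ => p + t * d) d t := by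
      simpa using ((hasDerivAt_id (t : ℂ)).mul_const d).const_add p
    exact ((hE _).comp (t : ℂ) h1).comp_ofReal
  exact intervalIntegral.integral_eq_sub_of_hasDerivAt hd
    (Continuous.intervalIntegrable (by fun_prop) _ _)

/-- Bounds for the amplitude in the local coordinate, uniform in `h`. -/
theorem SaddleCoord.exists_radius {F G : ℂ → ℂ} {p : ℂ} (hS : SaddleCoord F G p) (K : ℝ) :
    ∃ R B : ℝ, 0 < R ∧ (∀ x, ‖x‖ < R → AnalyticAt ℂ G x) ∧
      (∀ x, ‖x‖ < R → F (G x) = F p + x ^ 2) ∧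
      ∀ h : ℂ → ℂ, (∀ z, ‖h z‖ ≤ Real.exp (K * (1 + ‖z‖ ^ 2))) →
        ∀ x, ‖x‖ ≤ R / 2 → ‖localAmp h G x‖ ≤ B := by
  obtain ⟨R, hR, hA⟩ := Metric.eventually_nhds_iff.1
    (hS.analyticAt.eventually_analyticAt.and hS.eventually_eq)
  simp only [dist_zero_right] at hA
  obtain ⟨B, hB⟩ : ∃ B, ∀ x ∈ Metric.closedBall (0 : ℂ) (R / 2),
      ‖Real.exp (K * (1 + ‖G x‖ ^ 2)) * ‖deriv G x‖‖ ≤ B := by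
    refine (isCompact_closedBall (0 : ℂ) (R / 2)).exists_bound_of_continuousOn fun x hx => ?_
    have hx' : ‖x‖ < R := by
      have := mem_closedBall_zero_iff.1 hx
      linarith
    have a1 := (hA hx').1.continuousAt
    have a2 := (hA hx').1.deriv.continuousAt
    exact ContinuousAt.continuousWithinAt (by fun_prop)
  refine ⟨R, B, hR, fun x hx => (hA hx).1, fun x hx => (hA hx).2, fun h hh x hx => ?_⟩
  refine le_trans ?_ ((le_abs_self _).trans (hB x (mem_closedBall_zero_iff.2 hx)))
  rw [localAmp, norm_mul]
  gcongr
  exact hh _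

theorem SaddleCoord.exists_taylorCoeff_le {F G : ℂ → ℂ} {p : ℂ} (hS : SaddleCoord F G p)
    (K : ℝ) (k : ℕ) : ∃ C : ℝ, ∀ h : ℂ → ℂ, Differentiable ℂ h →
      (∀ z, ‖h z‖ ≤ Real.exp (K * (1 + ‖z‖ ^ 2))) → ‖taylorCoeff (localAmp h G) k‖ ≤ C := by
  obtain ⟨R, B, hR, hG, -, hB⟩ := hS.exists_radius K
  refine ⟨B / (R / 2) ^ k, fun h hh hK => ?_⟩
  exact norm_taylorCoeff_le (half_pos hR) (half_lt_self hR)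
    (fun x hx => ((hh.analyticAt _).localAmp
      (hG x (mem_ball_zero_iff.1 hx))).differentiableAt.differentiableWithinAt) (hB h hK) k

theorem norm_primitive_sub_le {F h E : ℂ → ℂ} {K m μ : ℝ} (hμ : 0 ≤ μ)
    (hE : ∀ z, HasDerivAt E (Complex.exp (-μ * F z) * h z) z)
    (hK : ∀ z, ‖h z‖ ≤ Real.exp (K * (1 + ‖z‖ ^ 2))) {a b : ℂ}
    (hF : ∀ z ∈ segment ℝ a b, m ≤ (F z).re) :
    ‖E b - E a‖ ≤ Real.exp (-(μ * m)) *
      Real.exp (|K| * (1 + (‖a‖ + ‖b‖) ^ 2)) * ‖b - a‖ := by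
  refine (convex_segment a b).norm_image_sub_le_of_norm_hasDerivWithin_le
    (fun z _ => (hE z).hasDerivWithinAt) (fun z hz => ?_) (left_mem_segment ℝ a b)
    (right_mem_segment ℝ a b)
  rw [norm_mul, Complex.norm_exp]
  have hz' : ‖z‖ ≤ ‖a‖ + ‖b‖ := by
    obtain ⟨s, t, hs, ht, hst, rfl⟩ := hz
    refine (norm_add_le _ _).trans ?_
    rw [norm_smul, norm_smul, Real.norm_of_nonneg hs, Real.norm_of_nonneg ht]
    gcongr
    · exact mul_le_of_le_one_left (norm_nonneg _) (by linarith)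
    · exact mul_le_of_le_one_left (norm_nonneg _) (by linarith)
  gcongr
  · rw [← Complex.ofReal_neg, Complex.re_ofReal_mul]
    have := mul_le_mul_of_nonneg_left (hF z hz) hμ
    linarith
  · refine (hK z).trans (Real.exp_le_exp.2 ?_)
    calc K * (1 + ‖z‖ ^ 2) ≤ |K| * (1 + ‖z‖ ^ 2) := by
          gcongr
          exact le_abs_self K
      _ ≤ _ := by gcongr

/-- The complete asymptotic expansion of the contribution of a simple saddle point, uniformly for
all entire amplitudes of a given Gaussian growth. -/
theorem SaddlePath.exists_expansion {F G : ℂ → ℂ} {p : ℂ} {γ c : ℝ → ℂ} (hS : SaddleCoord F G p)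
    (hP : SaddlePath F p (deriv G 0) γ c) (K : ℝ) (N : ℕ) :
    ∃ C : ℝ, ∀ h : ℂ → ℂ, Differentiable ℂ h →
      (∀ z, ‖h z‖ ≤ Real.exp (K * (1 + ‖z‖ ^ 2))) → ∀ μ : ℝ, 1 ≤ μ →
      ‖Complex.exp (μ * F p) * (∫ t, Complex.exp (-μ * F (γ t)) * h (γ t) * c t) -
        ∑ n ∈ Finset.range N, taylorCoeff (localAmp h G) (2 * n) *
          ((Real.Gamma (n + 1 / 2) * μ ^ (-((n : ℝ) + 1 / 2)) : ℝ) : ℂ)‖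
        ≤ C * μ ^ (-((N : ℝ) + 1 / 2)) := by
  obtain ⟨R, B, hR, hG, hFG, hB⟩ := hS.exists_radius K
  obtain ⟨tp, htp, αp, hαp, σp, hσp, hright⟩ := hP.right
  obtain ⟨tm, htm, αm, hαm, σm, hσm, hleft⟩ := hP.left
  set l := deriv G 0 with hl
  have hlneg : deriv (fun x => G (-x)) 0 = -l := by
    simpa using deriv_comp_neg (f := G) (0 : ℂ)
  have hsmall : ∀ x : ℝ, 0 < x → ∀ᶠ δ : ℝ in 𝓝[>] 0, δ < x := fun x hx =>
    (tendsto_id.mono_left nhdsWithin_le_nhds).eventually_lt_const hx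
  -- Here δ is so small that the ends G(±δ) of the steepest arc can be joined to the contour points
  -- at parameters δ/αp and -δ/αm through a region where Re F exceeds Re F(p) by a fixed amount.
  obtain ⟨δ, ⟨κ₁, hκ₁, hseg₁⟩, ⟨κ₂, hκ₂, hseg₂⟩, hδ₁, hδ₂, hδ₃, hδ⟩ :=
    ((hS.eventually_segment hσp).and ((hS.neg_coord.eventually_segment hσm).and
      ((hsmall (R / 4) (by positivity)).and ((hsmall (tp * αp) (by positivity)).and
        ((hsmall (tm * αm) (by positivity)).and self_mem_nhdsWithin))))).exists
  have hδ : (0 : ℝ) < δ := hδ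
  rw [hlneg] at hseg₂
  have hbp : 0 < δ / αp := by positivity
  have hbm : 0 < δ / αm := by positivity
  obtain ⟨κ₃, hκ₃, hgap⟩ := hP.gap (min (δ / αp) (δ / αm)) (lt_min hbp hbm)
  set zp : ℂ := p + δ * l * (1 + σp * Complex.I) with hzp
  set zm : ℂ := p + δ * -l * (1 + σm * Complex.I) with hzm
  obtain ⟨C₁, hC₁, hexp₁⟩ := exists_exp_neg_le_rpow hκ₁ (N + 1 / 2)
  obtain ⟨C₂, hC₂, hexp₂⟩ := exists_exp_neg_le_rpow hκ₂ (N + 1 / 2)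
  obtain ⟨C₃, hC₃, hexp₃⟩ := exists_exp_neg_le_rpow hκ₃ (N + 1 / 2)
  set D₁ := Real.exp (|K| * (1 + (‖G δ‖ + ‖zp‖) ^ 2)) * ‖zp - G δ‖ with hD₁
  set D₂ := Real.exp (|K| * (1 + (‖G (-δ)‖ + ‖zm‖) ^ 2)) * ‖zm - G (-δ)‖ with hD₂
  set W := ∫ t, ‖c t‖ * Real.exp (-(F (γ t)).re) * Real.exp (K * (1 + ‖γ t‖ ^ 2)) with hW
  have hW0 : 0 ≤ W := integral_nonneg fun t => by positivity
  set D₃ := Real.exp ((F p).re + κ₃) * W with hD₃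
  refine ⟨2 * B / δ ^ (2 * N) * Real.Gamma (N + 1 / 2) + D₁ * C₁ + D₂ * C₂ + D₃ * C₃,
    fun h hh hK μ hμ => ?_⟩
  have hμ0 : 0 < μ := by linarith
  have hPd : Differentiable ℂ fun z => Complex.exp (-μ * F z) * h z := by
    have := hS.differentiable
    fun_prop
  -- Cauchy's theorem enters as the existence of a primitive: integrals over all pieces of path
  -- become differences of values of E.
  obtain ⟨E, hE'⟩ := hPd.isExactOn_univ
  have hE : ∀ z, HasDerivAt E (Complex.exp (-μ * F z) * h z) z := fun z => hE' z trivial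
  have hint := hP.integrable_integrand hS.differentiable hh hK hμ
  set φ := fun t => Complex.exp (-μ * F (γ t)) * h (γ t) * c t with hφ
  -- the inner part of the contour
  have hinner : ∫ t in Set.Ioc (-(δ / αm)) (δ / αp), φ t = E zp - E zm := by
    rw [← intervalIntegral.integral_of_le (by linarith),
      ← intervalIntegral.integral_add_adjacent_intervals (b := 0) hint.intervalIntegrable
        hint.intervalIntegrable]
    have e1 : ∫ t in (0 : ℝ)..(δ / αp), φ t = E zp - E p := by
      rw [intervalIntegral.integral_of_le hbp.le, setIntegral_congr_fun measurableSet_Ioc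
        (g := fun t : ℝ => (fun z => Complex.exp (-μ * F z) * h z)
          (p + t * (αp * l * (1 + σp * Complex.I))) * (αp * l * (1 + σp * Complex.I))),
        ← intervalIntegral.integral_of_le hbp.le,
        integral_segment_eq_sub hE hPd.continuous]
      · congr 2
        · rw [hzp]
          have : (αp : ℂ) ≠ 0 := by exact_mod_cast hαp.ne'
          push_cast
          field_simp
        · simp
      · intro t ht
        have := hright t ⟨ht.1, ht.2.trans (by rw [div_le_iff₀ hαp]; exact hδ₂.le)⟩
        simp only [hφ, this]
    have e2 : ∫ t in (-(δ / αm))..(0 : ℝ), φ t = E p - E zm := by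
      rw [intervalIntegral.integral_of_le (by linarith), setIntegral_congr_fun measurableSet_Ioc
        (g := fun t : ℝ => (fun z => Complex.exp (-μ * F z) * h z)
          (p + t * (αm * l * (1 + σm * Complex.I))) * (αm * l * (1 + σm * Complex.I))),
        ← intervalIntegral.integral_of_le (by linarith),
        integral_segment_eq_sub hE hPd.continuous]
      · congr 2
        · simp
        · rw [hzm]
          have : (αm : ℂ) ≠ 0 := by exact_mod_cast hαm.ne'
          push_cast
          field_simp
      · intro t ht
        have h2 : δ / αm ≤ tm := by rw [div_le_iff₀ hαm]; exact hδ₃.le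
        have := hleft t ⟨lt_of_le_of_lt (by linarith) ht.1, ht.2⟩
        simp only [hφ, this]
    rw [e1, e2]
    ring
  -- the outer part
  have houter : ‖∫ t in (Set.Ioc (-(δ / αm)) (δ / αp))ᶜ, φ t‖ ≤
      Real.exp (-((μ - 1) * ((F p).re + κ₃))) * W := by
    rw [hW, ← integral_const_mul]
    have hi := (hP.integrable K).const_mul (Real.exp (-((μ - 1) * ((F p).re + κ₃))))
    refine (norm_integral_le_of_norm_le hi.integrableOn ?_).trans
      (setIntegral_le_integral hi (Eventually.of_forall fun t => by positivity))
    refine (ae_restrict_iff' measurableSet_Ioc.compl).2 (Eventually.of_forall fun t ht => ?_)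
    refine norm_saddle_integrand_le hK hμ fun hc => hgap t ?_ hc
    by_contra hlt
    push Not at hlt
    have h1 := abs_lt.1 (hlt.trans_le (min_le_left _ _))
    have h2 := abs_lt.1 (hlt.trans_le (min_le_right _ _))
    exact ht ⟨h2.1, h1.2.le⟩
  -- The inner straight piece is replaced by the steepest arc and two connecting segments. The
  -- segments and the outer part are exponentially small relative to e^{-μ F(p)}; the arc is a
  -- Gaussian integral to which Watson's lemma applies.
  have hsplit : ∫ t, φ t = (E (G δ) - E (G (-δ))) + (E zp - E (G δ)) - (E zm - E (G (-δ))) +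
      ∫ t in (Set.Ioc (-(δ / αm)) (δ / αp))ᶜ, φ t := by
    rw [← integral_add_compl measurableSet_Ioc hint, hinner]
    ring
  have hcurve := primitive_sub_eq_integral hG hFG hE hh hδ (by linarith)
  have hcancel : Complex.exp (μ * F p) * Complex.exp (-μ * F p) = 1 := by
    rw [← Complex.exp_add]
    simp
  have hwat := norm_integral_gaussian_sub_le (half_pos hR) (half_lt_self hR)
    (fun x hx => ((hh.analyticAt _).localAmp
      (hG x (mem_ball_zero_iff.1 hx))).differentiableAt.differentiableWithinAt) (hB h hK)
    hδ (by linarith) hμ0 N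
  have hs₁ := norm_primitive_sub_le hμ0.le hE hK hseg₁
  have hs₂ := norm_primitive_sub_le hμ0.le hE hK (a := G (-δ)) (b := zm) (by simpa using hseg₂)
  have hnorm : ‖Complex.exp (μ * F p)‖ = Real.exp (μ * (F p).re) := by
    rw [Complex.norm_exp, Complex.re_ofReal_mul]
  have hb₁ : ‖Complex.exp (μ * F p) * (E zp - E (G δ))‖ ≤ D₁ * (C₁ * μ ^ (-((N : ℝ) + 1 / 2))) := by
    rw [norm_mul, hnorm]
    calc _ ≤ Real.exp (μ * (F p).re) * (Real.exp (-(μ * ((F p).re + κ₁))) *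
          Real.exp (|K| * (1 + (‖G δ‖ + ‖zp‖) ^ 2)) * ‖zp - G δ‖) := by gcongr
      _ = D₁ * (Real.exp (μ * (F p).re) * Real.exp (-(μ * ((F p).re + κ₁)))) := by
          rw [hD₁]; ring
      _ = D₁ * Real.exp (-(μ * κ₁)) := by rw [← Real.exp_add]; ring_nf
      _ ≤ _ := by gcongr; exact hexp₁ μ hμ
  have hb₂ : ‖Complex.exp (μ * F p) * (E zm - E (G (-δ)))‖
      ≤ D₂ * (C₂ * μ ^ (-((N : ℝ) + 1 / 2))) := by
    rw [norm_mul, hnorm]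
    calc _ ≤ Real.exp (μ * (F p).re) * (Real.exp (-(μ * ((F p).re + κ₂))) *
          Real.exp (|K| * (1 + (‖G (-δ)‖ + ‖zm‖) ^ 2)) * ‖zm - G (-δ)‖) := by gcongr
      _ = D₂ * (Real.exp (μ * (F p).re) * Real.exp (-(μ * ((F p).re + κ₂)))) := by
          rw [hD₂]; ring
      _ = D₂ * Real.exp (-(μ * κ₂)) := by rw [← Real.exp_add]; ring_nf
      _ ≤ _ := by gcongr; exact hexp₂ μ hμ
  have hb₃ : ‖Complex.exp (μ * F p) * ∫ t in (Set.Ioc (-(δ / αm)) (δ / αp))ᶜ, φ t‖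
      ≤ D₃ * (C₃ * μ ^ (-((N : ℝ) + 1 / 2))) := by
    rw [norm_mul, hnorm]
    calc _ ≤ Real.exp (μ * (F p).re) * (Real.exp (-((μ - 1) * ((F p).re + κ₃))) * W) := by gcongr
      _ = (Real.exp (μ * (F p).re) * Real.exp (-((μ - 1) * ((F p).re + κ₃)))) * W := by ring
      _ = (Real.exp ((F p).re + κ₃) * Real.exp (-(μ * κ₃))) * W := by
          rw [← Real.exp_add, ← Real.exp_add]; ring_nf
      _ = D₃ * Real.exp (-(μ * κ₃)) := by rw [hD₃]; ring
      _ ≤ _ := by gcongr; exact hexp₃ μ hμ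
  have hfinal : Complex.exp (μ * F p) * ∫ t, φ t =
      (∫ x in (-δ)..δ, Complex.exp (-μ * (x : ℂ) ^ 2) * localAmp h G x) +
      Complex.exp (μ * F p) * (E zp - E (G δ)) - Complex.exp (μ * F p) * (E zm - E (G (-δ))) +
      Complex.exp (μ * F p) * ∫ t in (Set.Ioc (-(δ / αm)) (δ / αp))ᶜ, φ t := by
    rw [hsplit, hcurve]
    linear_combination (∫ x in (-δ)..δ, Complex.exp (-μ * (x : ℂ) ^ 2) * localAmp h G x) * hcancel
  rw [hfinal]
  set S := ∑ n ∈ Finset.range N, taylorCoeff (localAmp h G) (2 * n) *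
          ((Real.Gamma (n + 1 / 2) * μ ^ (-((n : ℝ) + 1 / 2)) : ℝ) : ℂ)
  have habc : ∀ a b c d s : ℂ, ‖a + b - c + d - s‖ ≤ ‖a - s‖ + ‖b‖ + ‖c‖ + ‖d‖ := by
    intro a b c d s
    have : a + b - c + d - s = (a - s) + b - c + d := by ring
    rw [this]
    refine (norm_add_le _ _).trans ?_
    gcongr
    refine (norm_sub_le _ _).trans ?_
    gcongr
    exact norm_add_le _ _
  refine (habc _ _ _ _ _).trans ?_
  refine (add_le_add (add_le_add (add_le_add hwat hb₁) hb₂) hb₃).trans (le_of_eq ?_)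
  ring

/-! ### Growth of the phase along straight lines -/

theorem norm_phase_sub_le {b d : ℂ} (hb : ‖b‖ ≤ 1) (hd : ‖d‖ = 1) (t : ℝ) :
    ‖phase (b + t * d) - t ^ 4 * d ^ 4 / 4‖ ≤ 6 * (1 + |t| ^ 3) := by
  have e : phase (b + t * d) - t ^ 4 * d ^ 4 / 4 = b * (t * d) ^ 3 + 3 / 2 * b ^ 2 * (t * d) ^ 2
      + b ^ 3 * (t * d) + b ^ 4 / 4 + b + t * d := by
    rw [phase]
    ring
  have ht : ‖(t : ℂ) * d‖ = |t| := by
    rw [norm_mul, hd, mul_one, Complex.norm_real, Real.norm_eq_abs]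
  have ha := abs_nonneg t
  have hp : ∀ k : ℕ, ‖b‖ ^ k ≤ 1 := fun k => pow_le_one₀ (norm_nonneg _) hb
  have h1 : |t| ≤ 1 + |t| ^ 3 := by
    nlinarith [sq_nonneg (|t| - 1), mul_nonneg ha (sq_nonneg (|t| - 1))]
  have h2 : |t| ^ 2 ≤ 1 + |t| ^ 3 := by
    nlinarith [sq_nonneg (|t| - 1), mul_nonneg ha (sq_nonneg (|t| - 1))]
  have n1 : ‖b * (t * d) ^ 3‖ ≤ |t| ^ 3 := by
    rw [norm_mul, norm_pow, ht]
    exact mul_le_of_le_one_left (by positivity) hb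
  have n2 : ‖3 / 2 * b ^ 2 * (t * d) ^ 2‖ ≤ 3 / 2 * |t| ^ 2 := by
    rw [norm_mul, norm_mul, norm_pow, norm_pow, ht]
    norm_num
    nlinarith [hp 2, sq_nonneg |t|, sq_nonneg t, sq_abs t]
  have n3 : ‖b ^ 3 * (t * d)‖ ≤ |t| := by
    rw [norm_mul, norm_pow, ht]
    exact mul_le_of_le_one_left (by positivity) (hp 3)
  have n4 : ‖b ^ 4 / 4‖ ≤ 1 / 4 := by
    rw [norm_div, norm_pow]
    norm_num
    linarith [hp 4]
  rw [e]
  refine (norm_add_le _ _).trans ((add_le_add ((norm_add_le _ _).trans (add_le_add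
    ((norm_add_le _ _).trans (add_le_add ((norm_add_le _ _).trans (add_le_add
    ((norm_add_le _ _).trans (add_le_add n1 n2)) n3)) n4)) hb)) ht.le).trans ?_)
  have : 0 ≤ |t| ^ 3 := by positivity
  nlinarith [h1, h2]

theorem exists_quartic_bound {lam : ℝ} (hl : 0 < lam) (K : ℝ) :
    ∃ C : ℝ, ∀ t : ℝ, K * (1 + |t| ^ 3) - lam * t ^ 4 ≤ C - t ^ 2 := by
  have hcont : Continuous fun t : ℝ => K * (1 + |t| ^ 3) - lam * t ^ 4 + t ^ 2 := by fun_prop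
  -- Beyond T one has λ|t| ≥ 2|K| + 1, so λt⁴ dominates both K(1+|t|³) ≤ 2|K||t|³ and t² ≤ |t|³.
  set T := max 1 ((2 * |K| + 1) / lam) with hT
  obtain ⟨C, hC⟩ := (isCompact_Icc (a := -T) (b := T)).exists_bound_of_continuousOn
    hcont.continuousOn
  refine ⟨max C 0, fun t => ?_⟩
  by_cases h : |t| ≤ T
  · have := (le_abs_self _).trans (hC t (abs_le.1 h))
    have h2 := le_max_left C 0
    linarith
  · push Not at h
    have h1 : 1 ≤ |t| := (le_max_left _ _).trans h.le
    have h2 : (2 * |K| + 1) / lam ≤ |t| := (le_max_right _ _).trans h.le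
    rw [div_le_iff₀ hl] at h2
    have h3 : 0 ≤ |t| ^ 3 := by positivity
    have h4 : t ^ 4 = |t| ^ 3 * |t| := by
      rw [← pow_succ]
      exact (Even.pow_abs (by decide) t).symm
    have h5 : t ^ 2 ≤ |t| ^ 3 := by
      rw [← sq_abs, pow_succ |t| 2]
      exact le_mul_of_one_le_right (by positivity) h1
    have h6 : 1 ≤ |t| ^ 3 := one_le_pow₀ h1
    have h7 : K * (1 + |t| ^ 3) ≤ |K| * (2 * |t| ^ 3) := by
      calc K * (1 + |t| ^ 3) ≤ |K| * (1 + |t| ^ 3) := by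
            gcongr
            exact le_abs_self K
        _ ≤ _ := by
            gcongr
            linarith
    have h8 := mul_le_mul_of_nonneg_left h2 h3
    have := le_max_right C 0
    rw [h4]
    nlinarith

/-- Gaussian decay of `exp (-λ F) h` along the line `b + t d`, where `F` has leading term
`t ^ 4 / 4`. -/
theorem exists_gaussian_bound {lam : ℝ} (hl : 0 < lam) (K : ℝ) : ∃ C : ℝ, 0 ≤ C ∧
    ∀ (s : ℝ) (b d : ℂ), |s| = 1 → ‖b‖ ≤ 1 → ‖d‖ = 1 → s * d ^ 4 = 1 → ∀ t : ℝ,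
      Real.exp (-lam * (s * phase (b + t * d)).re) * Real.exp (K * (1 + ‖b + t * d‖ ^ 2))
        ≤ C * Real.exp (-t ^ 2) := by
  -- The term 6λ comes from `norm_phase_sub_le` and 5|K| from 1 + (1+|t|)² ≤ 5(1+|t|³); λ/4 belongs
  -- to the leading term t⁴/4.
  obtain ⟨C, hC⟩ := exists_quartic_bound (lam := lam / 4) (by positivity) (6 * lam + 5 * |K|)
  refine ⟨Real.exp C, (Real.exp_pos _).le, fun s b d hs hb hd hsd t => ?_⟩
  rw [← Real.exp_add, ← Real.exp_add]
  apply Real.exp_le_exp.2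
  have h1 := norm_phase_sub_le hb hd t
  have h2 : t ^ 4 / 4 - 6 * (1 + |t| ^ 3) ≤ (s * phase (b + t * d)).re := by
    have e : (s : ℂ) * phase (b + t * d) = (t ^ 4 / 4 : ℝ) + s * (phase (b + t * d)
        - t ^ 4 * d ^ 4 / 4) := by
      push_cast
      linear_combination (t ^ 4 / 4 : ℂ) * hsd
    have h3 : ‖(s : ℂ) * (phase (b + t * d) - t ^ 4 * d ^ 4 / 4)‖ ≤ 6 * (1 + |t| ^ 3) := by
      rw [norm_mul, Complex.norm_real, Real.norm_eq_abs, hs, one_mul]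
      exact h1
    have h4 := (abs_le.1 ((Complex.abs_re_le_norm _).trans h3)).1
    rw [e, Complex.add_re, Complex.ofReal_re]
    linarith
  have h5 : K * (1 + ‖b + t * d‖ ^ 2) ≤ 5 * |K| * (1 + |t| ^ 3) := by
    have ha := abs_nonneg t
    have n1 : ‖b + t * d‖ ≤ 1 + |t| := by
      refine (norm_add_le _ _).trans (add_le_add hb (le_of_eq ?_))
      rw [norm_mul, hd, mul_one, Complex.norm_real, Real.norm_eq_abs]
    have n2 : ‖b + t * d‖ ^ 2 ≤ (1 + |t|) ^ 2 := by gcongr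
    have n3 : 1 + (1 + |t|) ^ 2 ≤ 5 * (1 + |t| ^ 3) := by
      nlinarith [sq_nonneg (|t| - 1), mul_nonneg ha (sq_nonneg (|t| - 1))]
    calc K * (1 + ‖b + t * d‖ ^ 2) ≤ |K| * (1 + ‖b + t * d‖ ^ 2) := by
          gcongr
          exact le_abs_self K
      _ ≤ |K| * (5 * (1 + |t| ^ 3)) := by
          gcongr
          linarith
      _ = _ := by ring
  have h6 := hC t
  have h7 := mul_le_mul_of_nonneg_left h2 hl.le
  nlinarith

/-! ### The saddle point contours -/

/-- `e^{iπ/4}` -/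
noncomputable def dirNE : ℂ := Real.sqrt 2 / 2 * (1 + Complex.I)

/-- `e^{3iπ/4}` -/
noncomputable def dirNW : ℂ := Real.sqrt 2 / 2 * (-1 + Complex.I)

theorem exp_pi_div_four : Complex.exp ((Real.pi / 4 : ℝ) * Complex.I) = dirNE := by
  rw [Complex.exp_mul_I, ← Complex.ofReal_cos, ← Complex.ofReal_sin,
    Real.cos_pi_div_four, Real.sin_pi_div_four, dirNE]
  push_cast
  ring

theorem exp_three_pi_div_four : Complex.exp ((3 * Real.pi / 4 : ℝ) * Complex.I) = dirNW := by
  have e : (3 * Real.pi / 4 : ℝ) = Real.pi - Real.pi / 4 := by ring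
  rw [Complex.exp_mul_I, ← Complex.ofReal_cos, ← Complex.ofReal_sin, e, Real.cos_pi_sub,
    Real.sin_pi_sub, Real.cos_pi_div_four, Real.sin_pi_div_four, dirNW]
  push_cast
  ring

theorem ofReal_sqrt_sq {x : ℝ} (hx : 0 ≤ x) : (Real.sqrt x : ℂ) ^ 2 = x := by
  rw [← Complex.ofReal_pow, Real.sq_sqrt hx]

theorem dirNE_sq : dirNE ^ 2 = Complex.I := by
  have := ofReal_sqrt_sq (x := 2) (by norm_num)
  rw [dirNE]
  push_cast at this
  linear_combination (1 + Complex.I) ^ 2 / 4 * this + (1 / 2 : ℂ) * Complex.I_sq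

theorem dirNW_sq : dirNW ^ 2 = -Complex.I := by
  have := ofReal_sqrt_sq (x := 2) (by norm_num)
  rw [dirNW]
  push_cast at this
  linear_combination (-1 + Complex.I) ^ 2 / 4 * this + (1 / 2 : ℂ) * Complex.I_sq

theorem dirNE_pow_four : dirNE ^ 4 = -1 := by
  have : dirNE ^ 4 = (dirNE ^ 2) ^ 2 := by ring
  rw [this, dirNE_sq, Complex.I_sq]

theorem dirNW_pow_four : dirNW ^ 4 = -1 := by
  have : dirNW ^ 4 = (dirNW ^ 2) ^ 2 := by ring
  rw [this, dirNW_sq, neg_sq, Complex.I_sq]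

theorem norm_dirNE : ‖dirNE‖ = 1 := by
  rw [← exp_pi_div_four, Complex.norm_exp_ofReal_mul_I]

theorem norm_dirNW : ‖dirNW‖ = 1 := by
  rw [← exp_three_pi_div_four, Complex.norm_exp_ofReal_mul_I]

theorem norm_saddlePt : ‖saddlePt‖ = 1 := by
  rw [saddlePt, show (Real.pi / 3 * Complex.I : ℂ) = ((Real.pi / 3 : ℝ) : ℂ) * Complex.I by
    push_cast; rfl, Complex.norm_exp_ofReal_mul_I]

theorem dirNE_re : dirNE.re = Real.sqrt 2 / 2 := by simp [dirNE]
theorem dirNE_im : dirNE.im = Real.sqrt 2 / 2 := by simp [dirNE]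
theorem dirNW_re : dirNW.re = -(Real.sqrt 2 / 2) := by simp [dirNW]
theorem dirNW_im : dirNW.im = Real.sqrt 2 / 2 := by simp [dirNW]

theorem saddlePt_sq : saddlePt ^ 2 = -1 / 2 + (Real.sqrt 3 / 2 : ℝ) * Complex.I := by
  have := ofReal_sqrt_sq (x := 3) (by norm_num)
  rw [saddlePt_eq]
  push_cast at this ⊢
  linear_combination (1 / 4 : ℂ) * Complex.I ^ 2 * this + (3 / 4 : ℂ) * Complex.I_sq

/-- The upper half of the line `Re z = 1 / 2`, as a contour through the saddle point. -/
noncomputable def zPath (t : ℝ) : ℂ := saddlePt + t * Complex.I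

/-- The velocity of `zPath`, cut off at the real axis. -/
noncomputable def zWeight (t : ℝ) : ℂ := if -(Real.sqrt 3 / 2) < t then Complex.I else 0

/-- The upper `ω`-contour: from `∞ e^{iπ/4}` to the saddle point, to the origin, and to
`∞ e^{3iπ/4}`. -/
noncomputable def wPath (t : ℝ) : ℂ :=
  if t ≤ 0 then saddlePt - t * dirNE else if t ≤ 1 then (1 - t) * saddlePt else (t - 1) * dirNW

/-- The velocity of `wPath`. -/
noncomputable def wWeight (t : ℝ) : ℂ :=
  if t ≤ 0 then -dirNE else if t ≤ 1 then -saddlePt else dirNW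

theorem measurable_zPath : Measurable zPath := by unfold zPath; fun_prop

theorem measurable_zWeight : Measurable zWeight :=
  Measurable.ite measurableSet_Ioi measurable_const measurable_const

theorem measurable_wPath : Measurable wPath :=
  Measurable.ite measurableSet_Iic (by fun_prop)
    (Measurable.ite measurableSet_Iic (by fun_prop) (by fun_prop))

theorem measurable_wWeight : Measurable wWeight :=
  Measurable.ite measurableSet_Iic measurable_const
    (Measurable.ite measurableSet_Iic measurable_const measurable_const)

/-- Since f'(p) = 0, the expansion at p is f(p+w) - f(p) = (3/2)p²w² + pw³ + w⁴/4, and (3/2)p² =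
1/g'(0)². -/
theorem saddleCoord_phase : SaddleCoord phase saddleBranch saddlePt := by
  refine ⟨by unfold phase; fun_prop, saddleBranch_spec.analyticAt, saddleBranch_spec.map_zero,
    by rw [deriv_saddleBranch_zero]; exact saddleDir_ne_zero, ?_, ⟨2, fun w hw => ?_⟩⟩
  · filter_upwards [saddleBranch_spec.phase_eq] with x hx
    rw [phase_saddlePt]
    linear_combination hx
  · rw [deriv_saddleBranch_zero, saddleDir_sq]
    have h0 := saddlePt_ne_zero
    have e : phase (saddlePt + w) - phase saddlePt - w ^ 2 / (-(2 / 3) * saddlePt)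
        = saddlePt * w ^ 3 + w ^ 4 / 4 := by
      have h1 : w ^ 2 / (-(2 / 3) * saddlePt) = 3 / 2 * saddlePt ^ 2 * w ^ 2 := by
        rw [div_eq_iff (mul_ne_zero (by norm_num) h0)]
        linear_combination w ^ 2 * saddlePt_cube
      rw [h1, phase, phase]
      linear_combination w * saddlePt_cube
    rw [e]
    refine (norm_add_le _ _).trans ?_
    rw [norm_mul, norm_saddlePt, norm_div, norm_pow, norm_pow]
    have : ‖w‖ ^ 4 ≤ ‖w‖ ^ 3 := pow_le_pow_of_le_one (norm_nonneg _) hw (by norm_num)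
    have h3 : 0 ≤ ‖w‖ ^ 3 := by positivity
    norm_num
    linarith

/-- Multiplying the coordinate by i turns x² into -x², so the steepest directions of -f are those of
f rotated by a right angle. -/
theorem saddleCoord_neg_phase : SaddleCoord (fun z => -phase z) branchW saddlePt := by
  have h := saddleCoord_phase
  have hI : Tendsto (fun x : ℂ => Complex.I * x) (𝓝 0) (𝓝 0) := by
    have : Tendsto (fun x : ℂ => Complex.I * x) (𝓝 0) (𝓝 (Complex.I * 0)) :=
      (continuous_const.mul continuous_id).tendsto 0
    rwa [mul_zero] at this
  refine ⟨h.differentiable.neg, ?_, by simp [branchW, h.map_zero], ?_, ?_, ?_⟩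
  · exact AnalyticAt.comp (f := fun x : ℂ => Complex.I * x) (g := saddleBranch)
      (by simpa using h.analyticAt) (by fun_prop)
  · rw [deriv_branchW, mul_zero]
    exact mul_ne_zero Complex.I_ne_zero h.deriv_ne_zero
  · filter_upwards [hI.eventually h.eventually_eq] with x hx
    rw [branchW, hx, mul_pow, Complex.I_sq]
    ring
  · obtain ⟨M, hM⟩ := h.quadratic
    refine ⟨M, fun w hw => (hM w hw).trans' (le_of_eq ?_)⟩
    rw [deriv_branchW, mul_zero, mul_pow, Complex.I_sq, ← norm_neg]
    congr 1
    rw [neg_one_mul, div_neg]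
    ring

/-! ### The real part of the phase along the contours, and Gaussian decay. -/

theorem integrable_exp_neg_sq : Integrable fun t : ℝ => Real.exp (-t ^ 2) := by
  simpa using integrable_exp_neg_mul_sq one_pos

/-- On the line Re z = 1/2 the real part of f is 3/8 plus a square that vanishes at t = 0 and t =
-√3, that is, exactly at p and p̄. Hence both saddle points are minima on this line. -/
theorem phase_zPath_re (t : ℝ) :
    (phase (zPath t)).re = 3 / 8 + (t * (t + Real.sqrt 3)) ^ 2 / 4 := by
  have h3 : Real.sqrt 3 ^ 2 = 3 := Real.sq_sqrt (by norm_num)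
  have e : phase (zPath t) = 3 / 4 * saddlePt - 3 / 2 * saddlePt ^ 2 * t ^ 2
      - saddlePt * Complex.I * t ^ 3 + t ^ 4 / 4 := by
    rw [zPath, phase]
    linear_combination (3 / 2 * saddlePt ^ 2 * t ^ 2 + saddlePt * t ^ 3 * Complex.I +
      t ^ 4 * (Complex.I ^ 2 - 1) / 4) * Complex.I_sq
      + (saddlePt / 4 + t * Complex.I) * saddlePt_cube
  have e2 : (3 / 4 * saddlePt - 3 / 2 * saddlePt ^ 2 * t ^ 2
      - saddlePt * Complex.I * t ^ 3 + t ^ 4 / 4 : ℂ) =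
      ((3 / 8 + 3 / 4 * t ^ 2 + Real.sqrt 3 / 2 * t ^ 3 + t ^ 4 / 4 : ℝ) : ℂ) +
      ((3 / 4 * (Real.sqrt 3 / 2) - 3 / 2 * (Real.sqrt 3 / 2) * t ^ 2 - t ^ 3 / 2 : ℝ) : ℂ)
        * Complex.I := by
    rw [saddlePt_sq, saddlePt_eq]
    push_cast
    linear_combination (-(Real.sqrt 3 : ℂ) / 2 * t ^ 3) * Complex.I_sq
  rw [e, e2, Complex.add_re, Complex.ofReal_re, Complex.re_ofReal_mul, Complex.I_re]
  nlinarith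

theorem phase_saddlePt_re : (phase saddlePt).re = 3 / 8 := by
  rw [phase_saddlePt, show (3 / 4 * saddlePt : ℂ) = ((3 / 4 : ℝ) : ℂ) * saddlePt by push_cast; rfl,
    Complex.re_ofReal_mul, saddlePt_re]
  norm_num

/-- On the upper half-line t + √3 ≥ √3/2, so the square is at least (3/4)t², and a quarter of it
gives 3/16. -/
theorem phase_zPath_gap {t : ℝ} (ht : -(Real.sqrt 3 / 2) < t) :
    (phase saddlePt).re + 3 / 16 * t ^ 2 ≤ (phase (zPath t)).re := by
  have h3 : Real.sqrt 3 ^ 2 = 3 := Real.sq_sqrt (by norm_num)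
  rw [phase_zPath_re, phase_saddlePt_re]
  have h1 : Real.sqrt 3 / 2 ≤ t + Real.sqrt 3 := by linarith
  have h2 : 3 / 4 ≤ (t + Real.sqrt 3) ^ 2 := by nlinarith [Real.sqrt_nonneg 3]
  nlinarith [sq_nonneg t]

/-- For t ≤ 0 the terms in t², t³ and t⁴ are all nonpositive. The constant 3/16 is far from sharp
and matches the one used on the other pieces. -/
theorem phase_add_dirNE_re {t : ℝ} (ht : t ≤ 0) :
    (phase (saddlePt - t * dirNE)).re ≤ 3 / 8 - 3 / 16 * t ^ 2 := by
  have h3 : Real.sqrt 3 ^ 2 = 3 := Real.sq_sqrt (by norm_num)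
  have hs3 : 1 ≤ Real.sqrt 3 := Real.one_le_sqrt.2 (by norm_num)
  have e : phase (saddlePt - t * dirNE) = 3 / 4 * saddlePt + 3 / 2 * saddlePt ^ 2 * Complex.I *
      t ^ 2 - saddlePt * (Complex.I * dirNE) * t ^ 3 - t ^ 4 / 4 := by
    rw [phase]
    linear_combination (saddlePt / 4 - t * dirNE) * saddlePt_cube + t ^ 4 / 4 * dirNE_pow_four
      + (3 / 2 * saddlePt ^ 2 * t ^ 2 - saddlePt * t ^ 3 * dirNE) * dirNE_sq
  have e2 : (3 / 4 * saddlePt + 3 / 2 * saddlePt ^ 2 * Complex.I *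
      t ^ 2 - saddlePt * (Complex.I * dirNE) * t ^ 3 - t ^ 4 / 4 : ℂ) =
      ((3 / 8 - 3 / 4 * Real.sqrt 3 * t ^ 2 + Real.sqrt 2 / 4 * (1 + Real.sqrt 3) * t ^ 3
        - t ^ 4 / 4 : ℝ) : ℂ) +
      ((3 / 8 * Real.sqrt 3 - 3 / 4 * t ^ 2 + Real.sqrt 2 / 4 * (Real.sqrt 3 - 1) * t ^ 3 : ℝ) : ℂ)
        * Complex.I := by
    rw [saddlePt_sq, saddlePt_eq, dirNE]
    push_cast
    linear_combination (3 / 4 * (Real.sqrt 3 : ℂ) * t ^ 2 - (Real.sqrt 2 : ℂ) / 4 * t ^ 3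
      - (Real.sqrt 2 : ℂ) * (Real.sqrt 3 : ℂ) / 4 * t ^ 3 * (1 + Complex.I)) * Complex.I_sq
  rw [e, e2, Complex.add_re, Complex.ofReal_re, Complex.re_ofReal_mul, Complex.I_re]
  have h4 : Real.sqrt 2 / 4 * (1 + Real.sqrt 3) * t ^ 3 ≤ 0 := by
    refine mul_nonpos_of_nonneg_of_nonpos (by positivity) ?_
    have : t ^ 3 = t * t ^ 2 := by ring
    rw [this]
    exact mul_nonpos_of_nonpos_of_nonneg ht (sq_nonneg t)
  nlinarith [sq_nonneg t, sq_nonneg (t ^ 2)]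

theorem phase_mul_saddlePt_re (t : ℝ) :
    (phase ((1 - t) * saddlePt)).re = ((1 - t) - (1 - t) ^ 4 / 4) / 2 := by
  have e : phase ((1 - t) * saddlePt) = (((1 - t) - (1 - t) ^ 4 / 4 : ℝ) : ℂ) * saddlePt := by
    rw [phase]
    push_cast
    linear_combination (1 - t : ℂ) ^ 4 / 4 * saddlePt * saddlePt_cube
  rw [e, Complex.re_ofReal_mul, saddlePt_re]
  ring

theorem phase_mul_dirNW_re (r : ℝ) :
    (phase (r * dirNW)).re = -r ^ 4 / 4 - Real.sqrt 2 / 2 * r := by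
  have e : phase (r * dirNW) = ((-r ^ 4 / 4 : ℝ) : ℂ) + (r : ℂ) * dirNW := by
    rw [phase]
    push_cast
    linear_combination (r : ℂ) ^ 4 / 4 * dirNW_pow_four
  rw [e, Complex.add_re, Complex.ofReal_re, Complex.re_ofReal_mul, dirNW_re]
  ring

/-- Along the ω-contour Re f is largest at p only. On the ray to ∞e^{3iπ/4} it is nonpositive, so
there the whole value 3/8 at p is gained; on the other two pieces the gain is quadratic. -/
theorem phase_wPath_gap (t : ℝ) :
    (phase (wPath t)).re ≤ (phase saddlePt).re - min (3 / 16 * t ^ 2) (3 / 8) := by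
  rw [phase_saddlePt_re, wPath]
  split_ifs with h1 h2
  · exact (phase_add_dirNE_re h1).trans (sub_le_sub_left (min_le_left _ _) _)
  · push Not at h1
    refine le_trans ?_ (sub_le_sub_left (min_le_left _ _) _)
    rw [phase_mul_saddlePt_re]
    nlinarith [sq_nonneg t, sq_nonneg (t * (1 - t)), mul_nonneg (sq_nonneg t) (sub_nonneg.2 h2)]
  · push Not at h2
    refine le_trans ?_ (sub_le_sub_left (min_le_right _ _) _)
    have : ((t : ℂ) - 1) = ((t - 1 : ℝ) : ℂ) := by push_cast; rfl
    rw [this, phase_mul_dirNW_re]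
    have : 0 ≤ Real.sqrt 2 / 2 * (t - 1) := by
      have : 0 ≤ t - 1 := by linarith
      positivity
    have : 0 ≤ (t - 1) ^ 4 := by positivity
    linarith

/-- Gaussian decay of the `ζ`-integrands on vertical lines. -/
theorem exists_gaussian_bound_vertical {lam : ℝ} (hl : 0 < lam) (K : ℝ) : ∃ C : ℝ, 0 ≤ C ∧
    ∀ b : ℂ, ‖b‖ ≤ 1 → ∀ t : ℝ, Real.exp (-lam * (phase (b + t * Complex.I)).re) *
      Real.exp (K * (1 + ‖b + t * Complex.I‖ ^ 2)) ≤ C * Real.exp (-t ^ 2) := by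
  obtain ⟨C, hC0, hC⟩ := exists_gaussian_bound hl K
  refine ⟨C, hC0, fun b hb t => ?_⟩
  simpa using hC 1 b Complex.I (by simp) hb (by simp) (by simp) t

/-- Gaussian decay of the `ω`-integrands on lines in the directions `e^{iπ/4}`, `e^{3iπ/4}`. -/
theorem exists_gaussian_bound_diagonal {lam : ℝ} (hl : 0 < lam) (K : ℝ) : ∃ C : ℝ, 0 ≤ C ∧
    ∀ b d : ℂ, ‖b‖ ≤ 1 → d = dirNE ∨ d = dirNW → ∀ t : ℝ,
      Real.exp (lam * (phase (b + t * d)).re) *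
      Real.exp (K * (1 + ‖b + t * d‖ ^ 2)) ≤ C * Real.exp (-t ^ 2) := by
  obtain ⟨C, hC0, hC⟩ := exists_gaussian_bound hl K
  refine ⟨C, hC0, fun b d hb hd t => ?_⟩
  have hd1 : ‖d‖ = 1 := by
    rcases hd with rfl | rfl
    exacts [norm_dirNE, norm_dirNW]
  have hd4 : d ^ 4 = -1 := by
    rcases hd with rfl | rfl
    exacts [dirNE_pow_four, dirNW_pow_four]
  simpa using hC (-1) b d (by simp) hb hd1 (by simp [hd4]) t

/-- Gaussian decay along the whole `ω`-contour. -/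
theorem exists_gaussian_bound_wPath {lam : ℝ} (hl : 0 < lam) (K : ℝ) : ∃ C : ℝ, 0 ≤ C ∧
    ∀ t : ℝ, Real.exp (lam * (phase (wPath t)).re) *
      Real.exp (K * (1 + ‖wPath t‖ ^ 2)) ≤ C * (Real.exp (-t ^ 2) + Real.exp (-(t - 1) ^ 2)) := by
  obtain ⟨C, hC0, hC⟩ := exists_gaussian_bound_diagonal hl K
  -- The extra factor e serves the bounded segment 0 < t ≤ 1, where 1 ≤ e · e^{-t²}.
  refine ⟨C + C * Real.exp 1, by positivity, fun t => ?_⟩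
  have e1 := Real.exp_pos (-t ^ 2)
  have e2 := Real.exp_pos (-(t - 1) ^ 2)
  have h3 : 0 ≤ C * Real.exp 1 := by positivity
  rw [wPath]
  split_ifs with h1 h2
  · have := hC saddlePt dirNE norm_saddlePt.le (Or.inl rfl) (-t)
    rw [neg_sq] at this
    push_cast at this
    rw [neg_mul, ← sub_eq_add_neg] at this
    refine this.trans ?_
    nlinarith
  · push Not at h1
    have hb : ‖((1 : ℂ) - t) * saddlePt‖ ≤ 1 := by
      rw [norm_mul, norm_saddlePt, mul_one, show (1 : ℂ) - t = ((1 - t : ℝ) : ℂ) by push_cast; rfl,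
        Complex.norm_real, Real.norm_eq_abs, abs_le]
      constructor <;> linarith
    have := hC _ dirNE hb (Or.inl rfl) 0
    simp only [Complex.ofReal_zero, zero_mul, add_zero] at this
    refine this.trans ?_
    have h4 : 1 ≤ Real.exp 1 * Real.exp (-t ^ 2) := by
      rw [← Real.exp_add]
      exact Real.one_le_exp (by nlinarith)
    have h5 := mul_le_mul_of_nonneg_left h4 hC0
    simp only [ne_eq, OfNat.ofNat_ne_zero, not_false_eq_true, zero_pow, neg_zero, Real.exp_zero]
    nlinarith
  · have := hC 0 dirNW (by simp) (Or.inr rfl) (t - 1)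
    rw [zero_add] at this
    push_cast at this
    refine this.trans ?_
    nlinarith

theorem integrable_wBound : Integrable fun t : ℝ => Real.exp (-t ^ 2) + Real.exp (-(t - 1) ^ 2) :=
  integrable_exp_neg_sq.add (integrable_exp_neg_sq.comp_sub_right 1)

theorem norm_zWeight_le (t : ℝ) : ‖zWeight t‖ ≤ 1 := by
  rw [zWeight]
  split_ifs <;> simp

theorem norm_wWeight (t : ℝ) : ‖wWeight t‖ = 1 := by
  rw [wWeight]
  split_ifs <;> simp [norm_dirNE, norm_dirNW, norm_saddlePt]

theorem measurable_phase : Measurable phase := by unfold phase; fun_prop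

theorem sqrt_two_thirds_ne_zero : (Real.sqrt (2 / 3) : ℂ) ≠ 0 := by
  exact_mod_cast (Real.sqrt_pos.2 (by norm_num : (0 : ℝ) < 2 / 3)).ne'

/-- The contour has direction i and the steepest direction g'(0) has argument 2π/3. The deviation is
-π/6, so σ = tan(-π/6) = -√3/3, and α is cos(π/6)/|g'(0)|. -/
theorem saddlePath_z : SaddlePath phase saddlePt (deriv saddleBranch 0) zPath zWeight := by
  have hs3 : 0 < Real.sqrt 3 := Real.sqrt_pos.2 (by norm_num)
  have h3 := ofReal_sqrt_sq (x := 3) (by norm_num)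
  push_cast at h3
  have hs3' : (Real.sqrt 3 : ℂ) ≠ 0 := by exact_mod_cast hs3.ne'
  have h23 : 0 < Real.sqrt (2 / 3) := Real.sqrt_pos.2 (by norm_num)
  have h23' := sqrt_two_thirds_ne_zero
  have hdir : (((Real.sqrt 3 / 2) / Real.sqrt (2 / 3) : ℝ) : ℂ) * deriv saddleBranch 0 *
      (1 + ((-(Real.sqrt 3 / 3) : ℝ) : ℂ) * Complex.I) = Complex.I := by
    rw [deriv_saddleBranch_zero, saddleDir, saddlePt_sq]
    push_cast
    field_simp
    linear_combination (-(Real.sqrt 3 : ℂ) * Complex.I ^ 2 + 3 * Complex.I + Complex.I) * h3 -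
      3 * (Real.sqrt 3 : ℂ) * Complex.I_sq
  have hσ : |(-(Real.sqrt 3 / 3) : ℝ)| < 1 := by
    rw [abs_neg, abs_of_pos (by positivity)]
    have : Real.sqrt 3 < 3 := by
      rw [Real.sqrt_lt' (by norm_num)]
      norm_num
    linarith
  have hle : ∀ t, zWeight t ≠ 0 → -(Real.sqrt 3 / 2) < t := by
    intro t ht
    by_contra h
    exact ht (by rw [zWeight, if_neg h])
  refine ⟨measurable_zPath, measurable_zWeight, ⟨1, one_pos,
    Real.sqrt 3 / 2 / Real.sqrt (2 / 3), by positivity, _, hσ, ?_⟩,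
    ⟨Real.sqrt 3 / 2, by positivity, Real.sqrt 3 / 2 / Real.sqrt (2 / 3), by positivity, _, hσ, ?_⟩, ?_, ?_, ?_⟩
  · intro t ht
    rw [hdir]
    exact ⟨rfl, by rw [zWeight, if_pos (by linarith [ht.1])]⟩
  · intro t ht
    rw [hdir]
    exact ⟨rfl, by rw [zWeight, if_pos ht.1]⟩
  · intro t ht
    have := phase_zPath_gap (hle t ht)
    nlinarith [sq_nonneg t]
  · intro η hη
    refine ⟨3 / 16 * η ^ 2, by positivity, fun t ht hc => ?_⟩
    have h1 := phase_zPath_gap (hle t hc)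
    have : η ^ 2 ≤ t ^ 2 := by
      rw [← sq_abs t]
      gcongr
    linarith
  · intro K
    obtain ⟨C, hC0, hC⟩ := exists_gaussian_bound_vertical one_pos K
    refine (integrable_exp_neg_sq.const_mul C).mono' ?_ (Eventually.of_forall fun t => ?_)
    · have m1 := measurable_phase.comp measurable_zPath
      have m2 := measurable_zPath
      have m3 := measurable_zWeight
      exact ((m3.norm.mul (Complex.measurable_re.comp m1).neg.exp).mul
        (((m2.norm.pow_const 2).const_add 1).const_mul K).exp).aestronglyMeasurable
    · have h1 := hC saddlePt norm_saddlePt.le t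
      rw [neg_one_mul] at h1
      rw [Real.norm_of_nonneg (by positivity), mul_assoc]
      refine le_trans ?_ h1
      exact mul_le_of_le_one_left (by positivity) (norm_zWeight_le t)

/-- The steepest direction i g'(0) has argument 7π/6. The outgoing direction -p deviates by π/6,
giving σ = √3/3; the incoming direction -e^{iπ/4} deviates by π/12, giving σ = tan(π/12) =
(√3-1)/(√3+1) and α = cos(π/12)/|g'(0)|. Both are below π/4. -/
theorem saddlePath_w : SaddlePath (fun z => -phase z) saddlePt (deriv branchW 0) wPath wWeight := by
  have hs3 : 0 < Real.sqrt 3 := Real.sqrt_pos.2 (by norm_num)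
  have hs3a : 1 < Real.sqrt 3 := by
    rw [Real.lt_sqrt (by norm_num)]
    norm_num
  have hs3b : Real.sqrt 3 < 3 := by
    rw [Real.sqrt_lt' (by norm_num)]
    norm_num
  have h3 := ofReal_sqrt_sq (x := 3) (by norm_num)
  push_cast at h3
  have hs3' : (Real.sqrt 3 : ℂ) ≠ 0 := by exact_mod_cast hs3.ne'
  have hs3'' : (Real.sqrt 3 : ℂ) + 1 ≠ 0 := by exact_mod_cast (by positivity : Real.sqrt 3 + 1 ≠ 0)
  have h23 : 0 < Real.sqrt (2 / 3) := Real.sqrt_pos.2 (by norm_num)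
  have h23' := sqrt_two_thirds_ne_zero
  have hd : deriv branchW 0 = Complex.I * saddleDir := by
    rw [deriv_branchW, mul_zero, deriv_saddleBranch_zero]
  have hright : (((Real.sqrt 3 / 2) / Real.sqrt (2 / 3) : ℝ) : ℂ) * deriv branchW 0 *
      (1 + ((Real.sqrt 3 / 3 : ℝ) : ℂ) * Complex.I) = -saddlePt := by
    rw [hd, saddleDir, saddlePt_sq, saddlePt_eq]
    push_cast
    field_simp
    linear_combination ((Real.sqrt 3 : ℂ) * Complex.I ^ 3 + 3 * Complex.I ^ 2 - Complex.I ^ 2) * h3 +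
      (3 * (Real.sqrt 3 : ℂ) * Complex.I + 6) * Complex.I_sq
  have hleft : (((Real.sqrt 3 + 1) * Real.sqrt 2 / 4 / Real.sqrt (2 / 3) : ℝ) : ℂ) *
      deriv branchW 0 * (1 + (((Real.sqrt 3 - 1) / (Real.sqrt 3 + 1) : ℝ) : ℂ) * Complex.I)
        = -dirNE := by
    have key : Complex.I * (-1 + (Real.sqrt 3 : ℂ) * Complex.I) *
        (((Real.sqrt 3 : ℂ) + 1) + ((Real.sqrt 3 : ℂ) - 1) * Complex.I) = -4 * (1 + Complex.I) := by
      linear_combination -(1 + Complex.I) * h3 + (((Real.sqrt 3 : ℂ) ^ 2 + 1) +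
        ((Real.sqrt 3 : ℂ) ^ 2 - (Real.sqrt 3 : ℂ)) * Complex.I) * Complex.I_sq
    rw [hd, saddleDir, saddlePt_sq, dirNE]
    push_cast
    field_simp
    linear_combination key
  have hσ1 : |(Real.sqrt 3 / 3 : ℝ)| < 1 := by
    rw [abs_of_pos (by positivity)]
    linarith
  have hσ2 : |((Real.sqrt 3 - 1) / (Real.sqrt 3 + 1) : ℝ)| < 1 := by
    rw [abs_of_pos (div_pos (by linarith) (by linarith)), div_lt_one (by linarith)]
    linarith
  refine ⟨measurable_wPath, measurable_wWeight, ⟨1, one_pos,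
    Real.sqrt 3 / 2 / Real.sqrt (2 / 3), by positivity, _, hσ1, ?_⟩,
    ⟨1, one_pos, (Real.sqrt 3 + 1) * Real.sqrt 2 / 4 / Real.sqrt (2 / 3), by positivity, _, hσ2, ?_⟩, ?_, ?_, ?_⟩
  · intro t ht
    rw [hright, wPath, wWeight, if_neg (not_le.2 ht.1), if_pos ht.2, if_neg (not_le.2 ht.1),
      if_pos ht.2]
    exact ⟨by ring, rfl⟩
  · intro t ht
    rw [hleft, wPath, wWeight, if_pos ht.2, if_pos ht.2]
    exact ⟨by ring, rfl⟩
  · intro t ht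
    have := phase_wPath_gap t
    have h4 : 0 ≤ min (3 / 16 * t ^ 2) (3 / 8) := by positivity
    simp only [Complex.neg_re]
    linarith
  · intro η hη
    refine ⟨min (3 / 16 * η ^ 2) (3 / 8), by positivity, fun t ht hc => ?_⟩
    have h1 := phase_wPath_gap t
    have : min (3 / 16 * η ^ 2) (3 / 8) ≤ min (3 / 16 * t ^ 2) (3 / 8) := by
      refine min_le_min_right _ ?_
      rw [← sq_abs t]
      gcongr
    simp only [Complex.neg_re]
    linarith
  · intro K
    obtain ⟨C, hC0, hC⟩ := exists_gaussian_bound_wPath one_pos K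
    refine (integrable_wBound.const_mul C).mono' ?_ (Eventually.of_forall fun t => ?_)
    · have m1 := measurable_phase.comp measurable_wPath
      have m2 := measurable_wPath
      have m3 := measurable_wWeight
      exact ((m3.norm.mul (Complex.measurable_re.comp m1.neg).neg.exp).mul
        (((m2.norm.pow_const 2).const_add 1).const_mul K).exp).aestronglyMeasurable
    · have h1 := hC t
      rw [one_mul] at h1
      rw [Real.norm_of_nonneg (by positivity), norm_wWeight, one_mul, Complex.neg_re, neg_neg]
      exact h1

/-! ### Deforming the contours of entire integrands -/

theorem tendsto_exp_neg_sq_atTop : Tendsto (fun T : ℝ => Real.exp (-T ^ 2)) atTop (𝓝 0) :=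
  Real.tendsto_exp_atBot.comp
    (tendsto_neg_atTop_atBot.comp (tendsto_pow_atTop (by norm_num : (2 : ℕ) ≠ 0)))

/-- The cross-cut between two parallel lines has fixed length, while the integrand on it is
O(e^{-T²}). -/
theorem tendsto_primitive_sub {k E : ℂ → ℂ} (hE : ∀ z, HasDerivAt E (k z) z) {b b' d : ℂ} {C : ℝ}
    (hb : ‖b‖ ≤ 1) (hb' : ‖b'‖ ≤ 1)
    (hk : ∀ c : ℂ, ‖c‖ ≤ 1 → ∀ t : ℝ, ‖k (c + t * d)‖ ≤ C * Real.exp (-t ^ 2)) {l : Filter ℝ}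
    (hl : Tendsto (fun T : ℝ => Real.exp (-T ^ 2)) l (𝓝 0)) :
    Tendsto (fun T : ℝ => E (b' + T * d) - E (b + T * d)) l (𝓝 0) := by
  have h1 : ∀ T : ℝ, ‖E (b' + T * d) - E (b + T * d)‖ ≤ C * Real.exp (-T ^ 2) * ‖b' - b‖ := by
    intro T
    have h2 := (convex_segment b b').norm_image_sub_le_of_norm_hasDerivWithin_le
      (f := fun z => E (z + T * d)) (f' := fun z => k (z + T * d)) (C := C * Real.exp (-T ^ 2))
      (fun z _ => ((hE (z + T * d)).comp_add_const z (T * d)).hasDerivWithinAt) (fun z hz => ?_)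
      (left_mem_segment ℝ b b') (right_mem_segment ℝ b b')
    · exact h2
    · refine hk z ?_ T
      have := (convex_closedBall (0 : ℂ) 1).segment_subset (mem_closedBall_zero_iff.2 hb)
        (mem_closedBall_zero_iff.2 hb') hz
      exact mem_closedBall_zero_iff.1 this
  refine squeeze_zero_norm h1 ?_
  simpa using (hl.const_mul C).mul_const ‖b' - b‖

theorem integrable_of_norm_le_exp_neg_sq {φ : ℝ → ℂ} (hφ : Continuous φ) {C : ℝ}
    (h : ∀ t, ‖φ t‖ ≤ C * Real.exp (-t ^ 2)) : Integrable φ :=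
  (integrable_exp_neg_sq.const_mul C).mono' hφ.aestronglyMeasurable (Eventually.of_forall h)

/-- Integrals over parallel lines agree. -/
theorem integral_line_eq {k : ℂ → ℂ} (hk : Differentiable ℂ k) {b b' d : ℂ} {C : ℝ}
    (hb : ‖b‖ ≤ 1) (hb' : ‖b'‖ ≤ 1)
    (hC : ∀ c : ℂ, ‖c‖ ≤ 1 → ∀ t : ℝ, ‖k (c + t * d)‖ ≤ C * Real.exp (-t ^ 2)) :
    ∫ t : ℝ, k (b' + t * d) * d = ∫ t : ℝ, k (b + t * d) * d := by
  obtain ⟨E, hE'⟩ := hk.isExactOn_univ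
  have hE : ∀ z, HasDerivAt E (k z) z := fun z => hE' z trivial
  have hkc := hk.continuous
  have hi : ∀ c : ℂ, ‖c‖ ≤ 1 → Tendsto (fun T : ℝ => E (c + T * d) - E (c + (-T : ℝ) * d)) atTop
      (𝓝 (∫ t : ℝ, k (c + t * d) * d)) := by
    intro c hc
    have h1 : Integrable fun t : ℝ => k (c + t * d) * d :=
      (integrable_of_norm_le_exp_neg_sq (by fun_prop) (hC c hc)).mul_const d
    have h2 := intervalIntegral_tendsto_integral h1 tendsto_neg_atTop_atBot tendsto_id
    refine h2.congr fun T => ?_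
    exact integral_segment_eq_sub hE hkc c d (-T) T
  have h3 := tendsto_primitive_sub hE hb hb' hC tendsto_exp_neg_sq_atTop
  have h4 := tendsto_primitive_sub hE hb hb' hC (l := atBot) (by
    have := tendsto_exp_neg_sq_atTop.comp tendsto_neg_atBot_atTop
    simpa [Function.comp_def] using this)
  have h5 := (hi b' hb').sub (hi b hb)
  have h6 := h3.sub (h4.comp tendsto_neg_atTop_atBot)
  have h7 := tendsto_nhds_unique h5 (h6.congr fun T => by
    simp only [Function.comp_apply]
    ring)
  rw [sub_zero] at h7
  exact sub_eq_zero.1 h7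

/-- Moving the base point of a ray. -/
theorem integral_ray_sub {k E : ℂ → ℂ} (hk : Continuous k) (hE : ∀ z, HasDerivAt E (k z) z)
    {b b' d : ℂ} {C : ℝ} (hb : ‖b‖ ≤ 1) (hb' : ‖b'‖ ≤ 1)
    (hC : ∀ c : ℂ, ‖c‖ ≤ 1 → ∀ t : ℝ, ‖k (c + t * d)‖ ≤ C * Real.exp (-t ^ 2)) :
    (∫ t in Set.Ioi (0 : ℝ), k (b' + t * d) * d) - ∫ t in Set.Ioi (0 : ℝ), k (b + t * d) * d
      = E b - E b' := by
  have hi : ∀ c : ℂ, ‖c‖ ≤ 1 → Tendsto (fun T : ℝ => E (c + T * d) - E c) atTop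
      (𝓝 (∫ t in Set.Ioi (0 : ℝ), k (c + t * d) * d)) := by
    intro c hc
    have h1 : Integrable fun t : ℝ => k (c + t * d) * d :=
      (integrable_of_norm_le_exp_neg_sq (by fun_prop) (hC c hc)).mul_const d
    have h2 := intervalIntegral_tendsto_integral_Ioi 0 h1.integrableOn tendsto_id
    refine h2.congr fun T => ?_
    simpa using integral_segment_eq_sub hE hk c d 0 T
  have h3 := tendsto_primitive_sub hE hb hb' hC tendsto_exp_neg_sq_atTop
  have h4 : Tendsto (fun T : ℝ => (E (b' + T * d) - E (b + T * d)) + (E b - E b')) atTop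
      (𝓝 (0 + (E b - E b'))) := h3.add_const _
  rw [zero_add] at h4
  refine tendsto_nhds_unique (((hi b' hb').sub (hi b hb)).congr fun T => ?_) h4
  ring

/-! ### The integrands -/

/-- Entire amplitudes of Gaussian growth. -/
structure GaussianGrowth (K : ℝ) (h : ℂ → ℂ) : Prop where
  differentiable : Differentiable ℂ h
  norm_le : ∀ z, ‖h z‖ ≤ Real.exp (K * (1 + ‖z‖ ^ 2))

/-- The `ζ`-integrand. -/
noncomputable def zInt (lam : ℝ) (h : ℂ → ℂ) (z : ℂ) : ℂ := Complex.exp (-lam * phase z) * h z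

/-- The `ω`-integrand. -/
noncomputable def wInt (lam : ℝ) (h : ℂ → ℂ) (w : ℂ) : ℂ := Complex.exp (lam * phase w) * h w

theorem differentiable_phase : Differentiable ℂ phase := by unfold phase; fun_prop

theorem differentiable_zInt {K lam : ℝ} {h : ℂ → ℂ} (hh : GaussianGrowth K h) :
    Differentiable ℂ (zInt lam h) := by
  have := hh.differentiable
  have := differentiable_phase
  unfold zInt
  fun_prop

theorem differentiable_wInt {K lam : ℝ} {h : ℂ → ℂ} (hh : GaussianGrowth K h) :
    Differentiable ℂ (wInt lam h) := by
  have := hh.differentiable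
  have := differentiable_phase
  unfold wInt
  fun_prop

theorem norm_zInt_le {K : ℝ} {h : ℂ → ℂ} (hh : GaussianGrowth K h) (lam : ℝ) (z : ℂ) :
    ‖zInt lam h z‖ ≤ Real.exp (-lam * (phase z).re) * Real.exp (K * (1 + ‖z‖ ^ 2)) := by
  rw [zInt, norm_mul, Complex.norm_exp, ← Complex.ofReal_neg, Complex.re_ofReal_mul]
  gcongr
  exact hh.norm_le z

theorem norm_wInt_le {K : ℝ} {h : ℂ → ℂ} (hh : GaussianGrowth K h) (lam : ℝ) (w : ℂ) :
    ‖wInt lam h w‖ ≤ Real.exp (lam * (phase w).re) * Real.exp (K * (1 + ‖w‖ ^ 2)) := by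
  rw [wInt, norm_mul, Complex.norm_exp, Complex.re_ofReal_mul]
  gcongr
  exact hh.norm_le w

theorem exists_zInt_bound {K lam : ℝ} (hl : 0 < lam) : ∃ C : ℝ, 0 ≤ C ∧ ∀ h : ℂ → ℂ,
    GaussianGrowth K h → ∀ b : ℂ, ‖b‖ ≤ 1 → ∀ t : ℝ,
      ‖zInt lam h (b + t * Complex.I)‖ ≤ C * Real.exp (-t ^ 2) := by
  obtain ⟨C, hC0, hC⟩ := exists_gaussian_bound_vertical hl K
  exact ⟨C, hC0, fun h hh b hb t => (norm_zInt_le hh lam _).trans (hC b hb t)⟩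

theorem exists_wInt_bound {K lam : ℝ} (hl : 0 < lam) : ∃ C : ℝ, 0 ≤ C ∧ ∀ h : ℂ → ℂ,
    GaussianGrowth K h → ∀ b d : ℂ, ‖b‖ ≤ 1 → d = dirNE ∨ d = dirNW → ∀ t : ℝ,
      ‖wInt lam h (b + t * d)‖ ≤ C * Real.exp (-t ^ 2) := by
  obtain ⟨C, hC0, hC⟩ := exists_gaussian_bound_diagonal hl K
  exact ⟨C, hC0, fun h hh b d hb hd t => (norm_wInt_le hh lam _).trans (hC b d hb hd t)⟩

theorem exists_wInt_bound_wPath {K lam : ℝ} (hl : 0 < lam) : ∃ C : ℝ, 0 ≤ C ∧ ∀ h : ℂ → ℂ,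
    GaussianGrowth K h → ∀ t : ℝ,
      ‖wInt lam h (wPath t)‖ ≤ C * (Real.exp (-t ^ 2) + Real.exp (-(t - 1) ^ 2)) := by
  obtain ⟨C, hC0, hC⟩ := exists_gaussian_bound_wPath hl K
  exact ⟨C, hC0, fun h hh t => (norm_wInt_le hh lam _).trans (hC t)⟩

/-- The weight of `wPath` restricted to the ray in direction `e^{iπ/4}`. -/
noncomputable def weightNE (t : ℝ) : ℂ := if t ≤ 0 then -dirNE else 0

/-- The weight of `wPath` restricted to the segment from the saddle point to the origin. -/
noncomputable def weightSeg (t : ℝ) : ℂ := if 0 < t ∧ t < 1 then -saddlePt else 0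

/-- The weight of `wPath` restricted to the ray in direction `e^{3iπ/4}`. -/
noncomputable def weightNW (t : ℝ) : ℂ := if 1 < t then dirNW else 0

/-- The ray from `∞ e^{iπ/4}` to the origin. -/
noncomputable def rayNE (t : ℝ) : ℂ := -t * dirNE

theorem setIntegral_ray_eq (k : ℂ → ℂ) (b : ℂ) :
    ∫ t : ℝ, k (b - (t : ℂ) * dirNE) * weightNE t
      = -∫ t in Set.Ioi (0 : ℝ), k (b + t * dirNE) * dirNE := by
  have h1 : ∀ t : ℝ, k (b - (t : ℂ) * dirNE) * weightNE t
      = -(Set.indicator (Set.Iic 0) (fun t : ℝ => k (b - t * dirNE) * dirNE) t) := by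
    intro t
    by_cases ht : t ≤ 0
    · rw [weightNE, if_pos ht, Set.indicator_of_mem (Set.mem_Iic.2 ht)]
      ring
    · rw [weightNE, if_neg ht, Set.indicator_of_notMem (by simpa using ht)]
      ring
  rw [integral_congr_ae (Eventually.of_forall h1), integral_neg,
    integral_indicator measurableSet_Iic]
  have := integral_comp_neg_Ioi (0 : ℝ) (fun t : ℝ => k (b - t * dirNE) * dirNE)
  rw [neg_zero] at this
  rw [← this]
  push_cast
  simp only [neg_mul, sub_neg_eq_add]

theorem integral_segment_weight (k : ℂ → ℂ) :
    ∫ t, k (wPath t) * weightSeg t = -∫ t in (0 : ℝ)..1, k (0 + t * saddlePt) * saddlePt := by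
  have h1 : ∀ t : ℝ, k (wPath t) * weightSeg t
      = -(Set.indicator (Set.Ioo 0 1)
        (fun t : ℝ => k (0 + (1 - t : ℝ) * saddlePt) * saddlePt) t) := by
    intro t
    by_cases ht : 0 < t ∧ t < 1
    · rw [weightSeg, if_pos ht, Set.indicator_of_mem (Set.mem_Ioo.2 ht), wPath,
        if_neg (not_le.2 ht.1), if_pos ht.2.le]
      push_cast
      rw [zero_add]
      ring
    · rw [weightSeg, if_neg ht, Set.indicator_of_notMem (by simpa using ht)]
      ring
  rw [integral_congr_ae (Eventually.of_forall h1), integral_neg,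
    integral_indicator measurableSet_Ioo, ← integral_Ioc_eq_integral_Ioo,
    ← intervalIntegral.integral_of_le zero_le_one,
    intervalIntegral.integral_comp_sub_left
      (fun t : ℝ => k (0 + (t : ℂ) * saddlePt) * saddlePt) 1]
  simp

/-- Replacing the ray from `∞ e^{iπ/4}` to the origin by the path through the saddle point. -/
theorem integral_wInt_rayNE {K lam : ℝ} (hl : 0 < lam) {h : ℂ → ℂ} (hh : GaussianGrowth K h) :
    ∫ t, wInt lam h (rayNE t) * weightNE t =
      (∫ t, wInt lam h (wPath t) * weightNE t) + ∫ t, wInt lam h (wPath t) * weightSeg t := by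
  obtain ⟨C, -, hC⟩ := exists_wInt_bound (K := K) hl
  have hd := differentiable_wInt (lam := lam) hh
  obtain ⟨E, hE'⟩ := hd.isExactOn_univ
  have hE : ∀ z, HasDerivAt E (wInt lam h z) z := fun z => hE' z trivial
  have h1 := integral_ray_sub hd.continuous hE (b := 0) (b' := saddlePt) (d := dirNE) (by simp)
    norm_saddlePt.le (fun c hc t => hC h hh c dirNE hc (Or.inl rfl) t)
  have h2 := integral_segment_eq_sub hE hd.continuous 0 saddlePt 0 1
  have h3 : ∫ t, wInt lam h (wPath t) * weightNE t
      = ∫ t : ℝ, wInt lam h (saddlePt - (t : ℂ) * dirNE) * weightNE t := by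
    refine integral_congr_ae (Eventually.of_forall fun t => ?_)
    by_cases ht : t ≤ 0
    · simp only [wPath, if_pos ht]
    · simp only [weightNE, if_neg ht, mul_zero]
  have h4 : ∫ t, wInt lam h (rayNE t) * weightNE t
      = ∫ t : ℝ, wInt lam h (0 - (t : ℂ) * dirNE) * weightNE t := by
    simp only [rayNE, zero_sub, neg_mul]
  rw [h3, h4, setIntegral_ray_eq, setIntegral_ray_eq, integral_segment_weight, h2]
  simp only [Complex.ofReal_one, one_mul, Complex.ofReal_zero, zero_mul, zero_add] at h1 ⊢
  linear_combination h1

/-- The integral over the full line in terms of the integral over its upper half, for an amplitude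
with `h (conj z) = conj (h z)`. -/
theorem integral_zInt_eq_sub_conj {K lam : ℝ} (hl : 0 < lam) {h : ℂ → ℂ}
    (hh : GaussianGrowth K h) (hconj : ∀ z, h ((starRingEnd ℂ) z) = (starRingEnd ℂ) (h z)) :
    ∫ t : ℝ, zInt lam h ((1 / 2 : ℝ) + t * Complex.I) * Complex.I =
      (∫ t, zInt lam h (zPath t) * zWeight t)
        - (starRingEnd ℂ) (∫ t, zInt lam h (zPath t) * zWeight t) := by
  obtain ⟨C, -, hC⟩ := exists_zInt_bound (K := K) hl
  have hc := (differentiable_zInt (lam := lam) hh).continuous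
  set φ : ℝ → ℂ := fun t => zInt lam h ((1 / 2 : ℝ) + t * Complex.I) * Complex.I with hφ
  have hint : Integrable φ :=
    (integrable_of_norm_le_exp_neg_sq (by fun_prop) (hC h hh _ (by norm_num))).mul_const _
  have hA : ∫ t, zInt lam h (zPath t) * zWeight t = ∫ t in Set.Ioi (0 : ℝ), φ t := by
    have h1 : ∀ t : ℝ, zInt lam h (zPath t) * zWeight t
        = (Set.indicator (Set.Ioi 0) φ) (t + Real.sqrt 3 / 2) := by
      intro t
      by_cases ht : -(Real.sqrt 3 / 2) < t
      · rw [zWeight, if_pos ht, Set.indicator_of_mem (by rw [Set.mem_Ioi]; linarith), hφ, zPath,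
          saddlePt_eq]
        push_cast
        simp only [add_mul]
        congr 2
        ring
      · rw [zWeight, if_neg ht, Set.indicator_of_notMem (by rw [Set.mem_Ioi]; linarith), mul_zero]
    rw [integral_congr_ae (Eventually.of_forall h1),
      integral_add_right_eq_self (Set.indicator (Set.Ioi 0) φ),
      integral_indicator measurableSet_Ioi]
  -- The minus sign is due to the factor i in dz = i dt.
  have hconjφ : ∀ t : ℝ, φ (-t) = -(starRingEnd ℂ) (φ t) := by
    intro t
    have e : ((1 / 2 : ℝ) : ℂ) + ((-t : ℝ) : ℂ) * Complex.I
        = (starRingEnd ℂ) (((1 / 2 : ℝ) : ℂ) + (t : ℂ) * Complex.I) := by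
      simp only [map_add, map_mul, Complex.conj_ofReal, Complex.conj_I]
      push_cast
      ring
    simp only [hφ, e, zInt, phase_conj, hconj, map_mul, Complex.conj_I, ← Complex.exp_conj,
      map_neg, Complex.conj_ofReal]
    ring
  have hB : ∫ t in Set.Iic (0 : ℝ), φ t = -(starRingEnd ℂ) (∫ t in Set.Ioi (0 : ℝ), φ t) := by
    have := integral_comp_neg_Ioi (0 : ℝ) φ
    rw [neg_zero] at this
    rw [← this, ← integral_conj, ← integral_neg]
    simp only [hconjφ]
  rw [hA, ← integral_add_compl measurableSet_Ioi hint, Set.compl_Ioi, hB]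
  ring

/-! ### Double integrals with a simple pole -/

section Pairing

variable {α β ι : Type*} [MeasurableSpace α] [MeasurableSpace β] {μ : Measure α} {ν : Measure β}
  [SFinite μ] [SFinite ν]

/-- For fixed z the norm is monotone in m, so on an interval it is bounded by its values at the two
ends. This provides a majorant independent of m for Fubini's theorem. -/
theorem norm_exp_neg_mul_le {lam Lam m : ℝ} (h1 : lam ≤ m) (h2 : m ≤ Lam) (z : ℂ) :
    ‖Complex.exp (-m * z)‖ ≤ ‖Complex.exp (-lam * z)‖ + ‖Complex.exp (-Lam * z)‖ := by
  have e : ∀ r : ℝ, ‖Complex.exp (-r * z)‖ = Real.exp (-(r * z.re)) := by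
    intro r
    rw [Complex.norm_exp, ← Complex.ofReal_neg, Complex.re_ofReal_mul, neg_mul]
  rw [e, e, e]
  rcases le_total 0 z.re with h | h
  · have : Real.exp (-(m * z.re)) ≤ Real.exp (-(lam * z.re)) :=
      Real.exp_le_exp.2 (neg_le_neg (mul_le_mul_of_nonneg_right h1 h))
    linarith [Real.exp_pos (-(Lam * z.re))]
  · have : Real.exp (-(m * z.re)) ≤ Real.exp (-(Lam * z.re)) :=
      Real.exp_le_exp.2 (neg_le_neg (mul_le_mul_of_nonpos_right h2 h))
    linarith [Real.exp_pos (-(lam * z.re))]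

/-- If `(p - q) κ` is a finite sum of products, then the double integral of
`A B κ exp (-λ (p - q))` is an improper integral over `[λ, ∞)` of sums of products of single
integrals. -/
theorem integral_pairing (s : Finset ι) {A p : α → ℂ} {B q : β → ℂ} {κ : α × β → ℂ}
    {a : ι → α → ℂ} {b : ι → β → ℂ} {lam : ℝ}
    (hAm : Measurable A) (hpm : Measurable p) (hBm : Measurable B) (hqm : Measurable q)
    (hκm : Measurable κ)
    (ham : ∀ j, Measurable (a j)) (hbm : ∀ j, Measurable (b j))
    (hint : Integrable (fun x : α × β =>
      A x.1 * B x.2 * κ x * Complex.exp (-lam * (p x.1 - q x.2))) (μ.prod ν))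
    (hre : ∀ᵐ x ∂μ.prod ν, A x.1 * B x.2 ≠ 0 → 0 < (p x.1 - q x.2).re ∧
      (p x.1 - q x.2) * κ x = ∑ j ∈ s, a j x.1 * b j x.2)
    (hA : ∀ m : ℝ, lam ≤ m → ∀ j ∈ s,
      Integrable (fun x => A x * a j x * Complex.exp (-m * p x)) μ)
    (hB : ∀ m : ℝ, lam ≤ m → ∀ j ∈ s,
      Integrable (fun y => B y * b j y * Complex.exp (m * q y)) ν) :
    (∀ Lam : ℝ, lam ≤ Lam → IntervalIntegrable (fun m : ℝ => ∑ j ∈ s,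
      (∫ x, A x * a j x * Complex.exp (-m * p x) ∂μ) *
        ∫ y, B y * b j y * Complex.exp (m * q y) ∂ν) volume lam Lam) ∧
    Tendsto (fun Lam : ℝ => ∫ m in lam..Lam, ∑ j ∈ s,
      (∫ x, A x * a j x * Complex.exp (-m * p x) ∂μ) *
        ∫ y, B y * b j y * Complex.exp (m * q y) ∂ν) atTop
      (𝓝 (∫ x, A x.1 * B x.2 * κ x * Complex.exp (-lam * (p x.1 - q x.2)) ∂μ.prod ν)) := by
  set F : ℝ → α × β → ℂ := fun m x =>
    A x.1 * B x.2 * κ x * Complex.exp (-m * (p x.1 - q x.2)) with hF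
  set S : ι → ℝ → α × β → ℂ := fun j m x =>
    (A x.1 * a j x.1 * Complex.exp (-m * p x.1)) * (B x.2 * b j x.2 * Complex.exp (m * q x.2))
    with hS
  have hFm : ∀ m, Measurable (F m) := by
    intro m
    simp only [hF]
    fun_prop
  have hFle : ∀ Lam, lam ≤ Lam → ∀ᵐ x ∂μ.prod ν, ‖F Lam x‖ ≤ ‖F lam x‖ := by
    intro Lam hL
    filter_upwards [hre] with x hx
    by_cases h0 : A x.1 * B x.2 = 0
    · simp [hF, h0]
    · simp only [hF, norm_mul _ (Complex.exp _)]
      refine mul_le_mul_of_nonneg_left ?_ (norm_nonneg _)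
      rw [Complex.norm_exp, Complex.norm_exp, Real.exp_le_exp, ← Complex.ofReal_neg,
        ← Complex.ofReal_neg, Complex.re_ofReal_mul, Complex.re_ofReal_mul]
      exact mul_le_mul_of_nonneg_right (by linarith) (hx h0).1.le
  have hFint : ∀ Lam, lam ≤ Lam → Integrable (F Lam) (μ.prod ν) := fun Lam hL =>
    hint.mono (hFm Lam).aestronglyMeasurable (hFle Lam hL)
  -- The contribution of the upper end Λ vanishes by dominated convergence, since Re(p - q) > 0
  -- wherever the integrand does not vanish.
  have hzero : Tendsto (fun Lam : ℝ => ∫ x, F Lam x ∂μ.prod ν) atTop (𝓝 0) := by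
    rw [← integral_zero (α × β) ℂ (μ := μ.prod ν)]
    refine tendsto_integral_filter_of_dominated_convergence (fun x => ‖F lam x‖)
      (Eventually.of_forall fun m => (hFm m).aestronglyMeasurable)
      (eventually_atTop.2 ⟨lam, hFle⟩) hint.norm ?_
    filter_upwards [hre] with x hx
    by_cases h0 : A x.1 * B x.2 = 0
    · simp [hF, h0]
    · have h1 : Tendsto (fun m : ℝ => Complex.exp (-m * (p x.1 - q x.2))) atTop (𝓝 0) := by
        rw [tendsto_zero_iff_norm_tendsto_zero]
        simp only [Complex.norm_exp, ← Complex.ofReal_neg, Complex.re_ofReal_mul]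
        refine Real.tendsto_exp_atBot.comp ?_
        simp only [neg_mul]
        exact tendsto_neg_atTop_atBot.comp (tendsto_id.atTop_mul_const (hx h0).1)
      simpa [hF] using h1.const_mul (A x.1 * B x.2 * κ x)
  have hSint : ∀ m, lam ≤ m → ∀ j ∈ s, Integrable (S j m) (μ.prod ν) := fun m hm j hj =>
    (hA m hm j hj).mul_prod (hB m hm j hj)
  -- Differentiating e^{-m(p-q)} in m brings down p - q, which removes the pole in κ and leaves a
  -- sum of products.
  have hpt : ∀ Lam, lam ≤ Lam → ∀ᵐ x ∂μ.prod ν,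
      F lam x - F Lam x = ∫ m in lam..Lam, ∑ j ∈ s, S j m x := by
    intro Lam hL
    filter_upwards [hre] with x hx
    have hder : ∀ m : ℝ, HasDerivAt (fun m : ℝ => -F m x) (∑ j ∈ s, S j m x) m := by
      intro m
      have h1 : HasDerivAt (fun m : ℝ => -F m x)
          (A x.1 * B x.2 * ((p x.1 - q x.2) * κ x) * Complex.exp (-m * (p x.1 - q x.2))) m := by
        have h2 : HasDerivAt (fun m : ℝ => -(m : ℂ) * (p x.1 - q x.2))
            (-1 * (p x.1 - q x.2)) m := (hasDerivAt_id m).ofReal_comp.neg.mul_const _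
        refine (h2.cexp.const_mul (A x.1 * B x.2 * κ x)).neg.congr_deriv ?_
        ring
      convert h1 using 1
      by_cases h0 : A x.1 * B x.2 = 0
      · rw [h0, zero_mul, zero_mul]
        refine Finset.sum_eq_zero fun j _ => ?_
        simp only [hS]
        linear_combination (a j x.1 * Complex.exp (-m * p x.1)) *
          (b j x.2 * Complex.exp (m * q x.2)) * h0
      · rw [(hx h0).2, Finset.mul_sum, Finset.sum_mul]
        refine Finset.sum_congr rfl fun j _ => ?_
        have : Complex.exp (-m * (p x.1 - q x.2))
            = Complex.exp (-m * p x.1) * Complex.exp (m * q x.2) := by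
          rw [← Complex.exp_add]
          ring_nf
        simp only [hS, this]
        ring
    have hcont : Continuous fun m : ℝ => ∑ j ∈ s, S j m x := by
      simp only [hS]
      fun_prop
    rw [intervalIntegral.integral_eq_sub_of_hasDerivAt (fun m _ => hder m)
      (hcont.intervalIntegrable _ _)]
    ring
  -- Absolute integrability in all three variables, needed to exchange the m-integral with the
  -- double integral; the majorant is a product of sums of end-point values.
  have hS2 : ∀ Lam, lam ≤ Lam → ∀ j ∈ s,
      Integrable (Function.uncurry fun (m : ℝ) x => S j m x)
        ((volume.restrict (Set.uIoc lam Lam)).prod (μ.prod ν)) := by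
    intro Lam hL j hj
    have hb : Integrable (fun z : ℝ × (α × β) => (1 : ℝ) *
        ((‖A z.2.1 * a j z.2.1 * Complex.exp (-lam * p z.2.1)‖
          + ‖A z.2.1 * a j z.2.1 * Complex.exp (-Lam * p z.2.1)‖) *
        (‖B z.2.2 * b j z.2.2 * Complex.exp (lam * q z.2.2)‖
          + ‖B z.2.2 * b j z.2.2 * Complex.exp (Lam * q z.2.2)‖)))
        ((volume.restrict (Set.uIoc lam Lam)).prod (μ.prod ν)) := by
      have hg := Integrable.mul_prod ((hA lam le_rfl j hj).norm.add (hA Lam hL j hj).norm)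
        ((hB lam le_rfl j hj).norm.add (hB Lam hL j hj).norm)
      have h1 : Integrable (fun _ : ℝ => (1 : ℝ)) (volume.restrict (Set.uIoc lam Lam)) := by
        rw [Set.uIoc_of_le hL]
        exact integrable_const _
      exact h1.mul_prod hg
    refine hb.mono' ?_ ?_
    · have ha := ham j
      have hb := hbm j
      refine Measurable.aestronglyMeasurable ?_
      simp only [hS, Function.uncurry_def]
      fun_prop
    · have h1 : ∀ᵐ z ∂(volume.restrict (Set.uIoc lam Lam)).prod (μ.prod ν),
          z.1 ∈ Set.uIoc lam Lam := by
        have : (volume.restrict (Set.uIoc lam Lam)).prod (μ.prod ν)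
            = (volume.prod (μ.prod ν)).restrict (Set.uIoc lam Lam ×ˢ Set.univ) := by
          rw [← Measure.prod_restrict, Measure.restrict_univ]
        rw [this]
        filter_upwards [ae_restrict_mem (measurableSet_uIoc.prod MeasurableSet.univ)] with z hz
        exact hz.1
      filter_upwards [h1] with z hz
      rw [Set.uIoc_of_le hL] at hz
      have e1 := norm_exp_neg_mul_le hz.1.le hz.2 (p z.2.1)
      have e2 := norm_exp_neg_mul_le hz.1.le hz.2 (-q z.2.2)
      simp only [neg_mul_neg] at e2
      simp only [Function.uncurry_def, hS, one_mul, norm_mul _ (Complex.exp _),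
        norm_mul _ (_ * Complex.exp _), ← mul_add]
      gcongr
  have hmain : ∀ Lam, lam ≤ Lam → (∫ m in lam..Lam, ∑ j ∈ s,
      (∫ x, A x * a j x * Complex.exp (-m * p x) ∂μ) *
        ∫ y, B y * b j y * Complex.exp (m * q y) ∂ν)
      = (∫ x, F lam x ∂μ.prod ν) - ∫ x, F Lam x ∂μ.prod ν := by
    intro Lam hL
    rw [← integral_sub hint (hFint Lam hL), integral_congr_ae (hpt Lam hL),
      ← intervalIntegral_integral_swap]
    · refine intervalIntegral.integral_congr fun m hm => ?_
      rw [Set.uIcc_of_le hL] at hm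
      rw [integral_finsetSum _ fun j hj => hSint m hm.1 j hj]
      refine Finset.sum_congr rfl fun j _ => ?_
      rw [← integral_prod_mul]
    · have := integrable_finsetSum s fun j hj => hS2 Lam hL j hj
      simpa only [Function.uncurry_def] using this
  have h := (tendsto_const_nhds (x := ∫ x, F lam x ∂μ.prod ν)).sub hzero
  rw [sub_zero] at h
  refine ⟨fun Lam hL => ?_,
    h.congr' (eventually_atTop.2 ⟨lam, fun Lam hL => (hmain Lam hL).symm⟩)⟩
  rw [intervalIntegrable_iff, IntegrableOn]
  refine integrable_finsetSum s fun j hj => ?_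
  refine (hS2 Lam hL j hj).integral_prod_left.congr (Eventually.of_forall fun m => ?_)
  exact integral_prod_mul (fun x => A x * a j x * Complex.exp (-m * p x))
    fun y => B y * b j y * Complex.exp (m * q y)

end Pairing

/-! ### Integrability across a pole at a corner. -/

theorem integrable_norm_mul_abs_sub_rpow {A : ℝ → ℂ} (hA : Integrable A) {M : ℝ} (hM : ∀ y, ‖A y‖ ≤ M)
    (y₀ : ℝ) : Integrable fun y => ‖A y‖ * |y - y₀| ^ (-(1 / 2) : ℝ) := by
  have hm : AEStronglyMeasurable (fun y : ℝ => |y| ^ (-(1 / 2) : ℝ)) volume :=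
    Measurable.aestronglyMeasurable (by fun_prop)
  -- The inverse square root is integrable near its singularity, where A is bounded by M; at
  -- distance at least 1 it is at most 1, and integrability of A suffices.
  have h1 : IntegrableOn (fun y : ℝ => |y| ^ (-(1 / 2) : ℝ)) (Metric.ball 0 1) := by
    refine integrableOn_ball_of_norm_le_rpow (C := 1) (α := 1 / 2) (by simp) ?_ ?_ hm
    · simp only [Module.finrank_self, Nat.cast_one]
      norm_num
    · refine Eventually.of_forall fun x => ?_
      rw [one_mul, Real.norm_eq_abs, abs_of_nonneg (by positivity), Real.norm_eq_abs]
  have h2 := ((integrable_indicator_iff Metric.isOpen_ball.measurableSet).2 h1).comp_sub_right y₀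
  refine (hA.norm.add (h2.const_mul M)).mono'
    (hA.norm.aestronglyMeasurable.mul (Measurable.aestronglyMeasurable (by fun_prop)))
    (Eventually.of_forall fun y => ?_)
  have hM0 : 0 ≤ M := (norm_nonneg _).trans (hM y)
  rw [Real.norm_eq_abs, abs_of_nonneg (by positivity)]
  simp only [Pi.add_apply]
  by_cases hy : y - y₀ ∈ Metric.ball (0 : ℝ) 1
  · rw [Set.indicator_of_mem hy]
    have := mul_le_mul_of_nonneg_right (hM y) (by positivity : 0 ≤ |y - y₀| ^ (-(1 / 2) : ℝ))
    linarith [norm_nonneg (A y)]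
  · rw [Set.indicator_of_notMem hy, mul_zero, add_zero]
    have h3 : 1 ≤ |y - y₀| := by simpa using hy
    exact mul_le_of_le_one_right (norm_nonneg _)
      (Real.rpow_le_one_of_one_le_of_nonpos h3 (by norm_num))

/-- Integrability of a double integral with a pole at the corner `(y₀, t₀)`. -/
theorem integrable_mul_kernel {A B : ℝ → ℂ} (hA : Integrable A) {M M' : ℝ} (hM : ∀ y, ‖A y‖ ≤ M)
    (hB : Integrable B) (hM' : ∀ t, ‖B t‖ ≤ M') {κ : ℝ × ℝ → ℂ} (hκm : Measurable κ) {C y₀ t₀ : ℝ}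
    (hκ : ∀ y t, A y ≠ 0 → B t ≠ 0 → |y - y₀| * |t - t₀| * ‖κ (y, t)‖ ^ 2 ≤ C) :
    Integrable (fun x : ℝ × ℝ => A x.1 * B x.2 * κ x) (volume.prod volume) := by
  have h1 := ((integrable_norm_mul_abs_sub_rpow hA hM y₀).mul_prod
    (integrable_norm_mul_abs_sub_rpow hB hM' t₀)).const_mul
    (Real.sqrt C)
  refine h1.mono' ?_ ?_
  · exact (hA.aestronglyMeasurable.comp_fst.mul hB.aestronglyMeasurable.comp_snd).mul
      hκm.aestronglyMeasurable
  · have hn1 : ∀ᵐ x : ℝ × ℝ ∂volume.prod volume, x.1 ≠ y₀ :=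
      Measure.quasiMeasurePreserving_fst.ae (Measure.ae_ne volume y₀)
    have hn2 : ∀ᵐ x : ℝ × ℝ ∂volume.prod volume, x.2 ≠ t₀ :=
      Measure.quasiMeasurePreserving_snd.ae (Measure.ae_ne volume t₀)
    filter_upwards [hn1, hn2] with x hx1 hx2
    by_cases hA0 : A x.1 = 0
    · simp [hA0]
    by_cases hB0 : B x.2 = 0
    · simp [hB0]
    have ha : 0 < |x.1 - y₀| := abs_pos.2 (sub_ne_zero.2 hx1)
    have hb : 0 < |x.2 - t₀| := abs_pos.2 (sub_ne_zero.2 hx2)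
    have h2 := hκ x.1 x.2 hA0 hB0
    -- The pole of order one is shared evenly between the two variables, as a product of two inverse
    -- square roots each of which is locally integrable.
    have h3 : ‖κ x‖ ≤ Real.sqrt C * (|x.1 - y₀| ^ (-(1 / 2) : ℝ) * |x.2 - t₀| ^ (-(1 / 2) : ℝ)) := by
      rw [Real.rpow_neg ha.le, Real.rpow_neg hb.le, ← Real.sqrt_eq_rpow, ← Real.sqrt_eq_rpow,
        ← mul_inv, ← Real.sqrt_mul ha.le, ← div_eq_mul_inv,
        le_div_iff₀ (Real.sqrt_pos.2 (mul_pos ha hb))]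
      refine Real.le_sqrt_of_sq_le ?_
      rw [mul_pow, Real.sq_sqrt (by positivity)]
      linarith
    rw [norm_mul, norm_mul]
    have := mul_le_mul_of_nonneg_left h3 (by positivity : 0 ≤ ‖A x.1‖ * ‖B x.2‖)
    refine this.trans (le_of_eq ?_)
    ring

/-! ### The admissible contours -/

/-- The Laplace representation of 1/(z-w) multiplies the amplitudes by e^{sz}; the class of
amplitudes has to be stable under this. -/
theorem GaussianGrowth.exp_mul {K : ℝ} {h : ℂ → ℂ} (hh : GaussianGrowth K h) (s : ℝ) :
    GaussianGrowth (K + |s|) (fun z => Complex.exp (s * z) * h z) where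
  differentiable := by
    have := hh.differentiable
    fun_prop
  norm_le z := by
    rw [norm_mul, add_comm K, add_mul, Real.exp_add, Complex.norm_exp, Complex.re_ofReal_mul]
    refine mul_le_mul (Real.exp_le_exp.2 ?_) (hh.norm_le z) (norm_nonneg _) (Real.exp_pos _).le
    have h1 : s * z.re ≤ |s| * ‖z‖ := by
      refine (le_abs_self _).trans ?_
      rw [abs_mul]
      exact mul_le_mul_of_nonneg_left (Complex.abs_re_le_norm z) (abs_nonneg _)
    nlinarith [abs_nonneg s, sq_nonneg (‖z‖ - 1)]

/-- Weighted paths along which the `ω`-integrands decay. -/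
structure DecayPath (γ c : ℝ → ℂ) : Prop where
  measurable_path : Measurable γ
  measurable_weight : Measurable c
  bound : ∀ lam : ℝ, 0 < lam → ∀ K : ℝ, ∃ C : ℝ, ∀ h : ℂ → ℂ, GaussianGrowth K h → ∀ t : ℝ,
    ‖wInt lam h (γ t) * c t‖ ≤ C * (Real.exp (-t ^ 2) + Real.exp (-(t - 1) ^ 2))

theorem decayPath_wPath {c : ℝ → ℂ} (hc : Measurable c) (h1 : ∀ t, ‖c t‖ ≤ 1) :
    DecayPath wPath c where
  measurable_path := measurable_wPath
  measurable_weight := hc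
  bound lam hl K := by
    obtain ⟨C, -, hC⟩ := exists_wInt_bound_wPath (K := K) hl
    refine ⟨C, fun f hf t => ?_⟩
    rw [norm_mul]
    exact (mul_le_of_le_one_right (norm_nonneg _) (h1 t)).trans (hC f hf t)

theorem measurable_weightNE : Measurable weightNE :=
  Measurable.ite measurableSet_Iic measurable_const measurable_const

theorem measurable_weightSeg : Measurable weightSeg :=
  Measurable.ite measurableSet_Ioo measurable_const measurable_const

theorem measurable_weightNW : Measurable weightNW :=
  Measurable.ite measurableSet_Ioi measurable_const measurable_const

theorem norm_weightNE_le (t : ℝ) : ‖weightNE t‖ ≤ 1 := by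
  rw [weightNE]
  split_ifs <;> simp [norm_dirNE]

theorem norm_weightSeg_le (t : ℝ) : ‖weightSeg t‖ ≤ 1 := by
  rw [weightSeg]
  split_ifs <;> simp [norm_saddlePt]

theorem norm_weightNW_le (t : ℝ) : ‖weightNW t‖ ≤ 1 := by
  rw [weightNW]
  split_ifs <;> simp [norm_dirNW]

theorem decayPath_rayNE : DecayPath rayNE weightNE where
  measurable_path := by unfold rayNE; fun_prop
  measurable_weight := measurable_weightNE
  bound lam hl K := by
    obtain ⟨C, hC0, hC⟩ := exists_wInt_bound (K := K) hl
    refine ⟨C, fun f hf t => ?_⟩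
    rw [norm_mul]
    refine (mul_le_of_le_one_right (norm_nonneg _) (norm_weightNE_le t)).trans ?_
    have := hC f hf 0 dirNE (by simp) (Or.inl rfl) (-t)
    rw [zero_add, neg_sq] at this
    push_cast at this
    refine this.trans (mul_le_mul_of_nonneg_left ?_ hC0)
    linarith [Real.exp_pos (-(t - 1) ^ 2)]

theorem DecayPath.integrable {γ c : ℝ → ℂ} (hγ : DecayPath γ c) {lam : ℝ} (hl : 0 < lam) {K : ℝ}
    {h : ℂ → ℂ} (hh : GaussianGrowth K h) : Integrable fun t => wInt lam h (γ t) * c t := by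
  obtain ⟨C, hC⟩ := hγ.bound lam hl K
  refine (integrable_wBound.const_mul C).mono' ?_ (Eventually.of_forall (hC h hh))
  exact (((differentiable_wInt hh).continuous.measurable.comp hγ.measurable_path).mul
    hγ.measurable_weight).aestronglyMeasurable

theorem DecayPath.norm_le {γ c : ℝ → ℂ} (hγ : DecayPath γ c) {lam : ℝ} (hl : 0 < lam) {K : ℝ}
    {h : ℂ → ℂ} (hh : GaussianGrowth K h) : ∃ M, ∀ t, ‖wInt lam h (γ t) * c t‖ ≤ M := by
  obtain ⟨C, hC⟩ := hγ.bound lam hl K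
  refine ⟨|C| * (1 + 1), fun t => (hC h hh t).trans ?_⟩
  refine mul_le_mul (le_abs_self C) (add_le_add ?_ ?_) (by positivity) (abs_nonneg C)
  · exact Real.exp_le_one_iff.2 (neg_nonpos.2 (sq_nonneg _))
  · exact Real.exp_le_one_iff.2 (neg_nonpos.2 (sq_nonneg _))

/-- The vertical line through `b`. -/
noncomputable def vLine (b y : ℝ) : ℂ := b + y * Complex.I

theorem vLine_re (b y : ℝ) : (vLine b y).re = b := by simp [vLine]

theorem vLine_im (b y : ℝ) : (vLine b y).im = y := by simp [vLine]

theorem continuous_vLine (b : ℝ) : Continuous (vLine b) := by unfold vLine; fun_prop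

theorem exists_norm_zInt_vLine_le {lam K b : ℝ} (hl : 0 < lam) (hb : |b| ≤ 1) {h : ℂ → ℂ}
    (hh : GaussianGrowth K h) :
    ∃ C, 0 ≤ C ∧ ∀ y : ℝ, ‖zInt lam h (vLine b y) * Complex.I‖ ≤ C * Real.exp (-y ^ 2) := by
  obtain ⟨C, hC0, hC⟩ := exists_zInt_bound (K := K) hl
  refine ⟨C, hC0, fun y => ?_⟩
  rw [norm_mul, Complex.norm_I, mul_one]
  exact hC h hh b (by simpa using hb) y

theorem integrable_zInt_vLine {lam K b : ℝ} (hl : 0 < lam) (hb : |b| ≤ 1) {h : ℂ → ℂ}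
    (hh : GaussianGrowth K h) : Integrable fun y : ℝ => zInt lam h (vLine b y) * Complex.I := by
  obtain ⟨C, -, hC⟩ := exists_norm_zInt_vLine_le hl hb hh
  refine integrable_of_norm_le_exp_neg_sq ?_ hC
  exact ((differentiable_zInt hh).continuous.comp (continuous_vLine b)).mul continuous_const

theorem integral_zInt_vLine_eq {lam K b b' : ℝ} (hl : 0 < lam) (hb : |b| ≤ 1) (hb' : |b'| ≤ 1)
    {h : ℂ → ℂ} (hh : GaussianGrowth K h) :
    ∫ y : ℝ, zInt lam h (vLine b y) * Complex.I = ∫ y : ℝ, zInt lam h (vLine b' y) * Complex.I := by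
  obtain ⟨C, -, hC⟩ := exists_zInt_bound (K := K) hl
  exact integral_line_eq (differentiable_zInt hh) (by simpa using hb') (by simpa using hb)
    (hC h hh)

/-- The double integral over a vertical line and a weighted path. -/
noncomputable def poleInt (lam : ℝ) (hz hw : ℂ → ℂ) (b : ℝ) (γ c : ℝ → ℂ) : ℂ :=
  ∫ x : ℝ × ℝ, (zInt lam hz (vLine b x.1) * Complex.I) * (wInt lam hw (γ x.2) * c x.2) *
    (1 / (vLine b x.1 - γ x.2)) ∂volume.prod volume

/-- A vertical line and a weighted path which are separated except for a corner. -/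
structure CornerSeparated (b : ℝ) (γ c : ℝ → ℂ) : Prop where
  abs_le : |b| ≤ 1
  decay : DecayPath γ c
  dist : ∃ C y₀ t₀ : ℝ, 0 ≤ C ∧ ∀ y t, c t ≠ 0 →
    |y - y₀| * |t - t₀| ≤ C * ‖vLine b y - γ t‖ ^ 2

theorem CornerSeparated.integrable {b : ℝ} {γ c : ℝ → ℂ} (hs : CornerSeparated b γ c) {lam : ℝ}
    (hl : 0 < lam) {K : ℝ} {hz hw : ℂ → ℂ} (hhz : GaussianGrowth K hz) (hhw : GaussianGrowth K hw) :
    Integrable (fun x : ℝ × ℝ => (zInt lam hz (vLine b x.1) * Complex.I) *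
      (wInt lam hw (γ x.2) * c x.2) * (1 / (vLine b x.1 - γ x.2))) (volume.prod volume) := by
  obtain ⟨C, y₀, t₀, hC0, hC⟩ := hs.dist
  obtain ⟨M, hM0, hM⟩ := exists_norm_zInt_vLine_le hl hs.abs_le hhz
  obtain ⟨M', hM'⟩ := hs.decay.norm_le hl hhw
  have hm := (continuous_vLine b).measurable
  have hm' := hs.decay.measurable_path
  refine integrable_mul_kernel (integrable_zInt_vLine hl hs.abs_le hhz) (M := M)
    (fun y => (hM y).trans (mul_le_of_le_one_right hM0
      (Real.exp_le_one_iff.2 (neg_nonpos.2 (sq_nonneg _)))))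
    (hs.decay.integrable hl hhw) hM' (κ := fun x => 1 / (vLine b x.1 - γ x.2)) (by fun_prop)
    (C := C) (y₀ := y₀) (t₀ := t₀) (fun y t _ ht => ?_)
  have h1 := hC y t (right_ne_zero_of_mul ht)
  rw [norm_div, norm_one, div_pow, one_pow, mul_one_div]
  exact div_le_of_le_mul₀ (sq_nonneg _) hC0 h1

/-- Double integrals over separated contours in terms of the Laplace transforms of the single
integrals. -/
theorem CornerSeparated.tendsto_poleInt {b : ℝ} {γ c : ℝ → ℂ} (hs : CornerSeparated b γ c)
    {lam : ℝ} (hl : 0 < lam) {K : ℝ} {hz hw : ℂ → ℂ} (hhz : GaussianGrowth K hz)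
    (hhw : GaussianGrowth K hw) {σ : ℝ} (hσ : ∀ᵐ t, c t ≠ 0 → 0 < σ * ((γ t).re - b)) :
    Tendsto (fun S : ℝ => ∫ m in (0 : ℝ)..S, (-σ) *
      (∫ y, zInt lam (fun z => Complex.exp ((m * σ : ℝ) * z) * hz z) (vLine b y) * Complex.I) *
      ∫ t, wInt lam (fun z => Complex.exp ((-(m * σ) : ℝ) * z) * hw z) (γ t) * c t) atTop
      (𝓝 (poleInt lam hz hw b γ c)) := by
  have hm := (continuous_vLine b).measurable
  have hm' := hs.decay.measurable_path
  have hm2 := hs.decay.measurable_weight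
  have hz' := (differentiable_zInt (lam := lam) hhz).continuous.measurable
  have hw' := (differentiable_wInt (lam := lam) hhw).continuous.measurable
  -- Pairing for the linear phase -σz, started at 0. It encodes 1/(z-w) = -σ ∫₀^∞ e^{mσ(z-w)} dm,
  -- valid when σ Re(w - z) > 0.
  have key := (integral_pairing (μ := volume) (ν := volume) {()} (lam := 0)
    (A := fun y => zInt lam hz (vLine b y) * Complex.I) (p := fun y => -σ * vLine b y)
    (B := fun t => wInt lam hw (γ t) * c t) (q := fun t => -σ * γ t)
    (κ := fun x => 1 / (vLine b x.1 - γ x.2)) (a := fun _ _ => -σ) (b := fun _ _ => 1)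
    (by fun_prop) (by fun_prop) (by fun_prop) (by fun_prop) (by fun_prop)
    (by fun_prop) (by fun_prop) (by simpa using hs.integrable hl hhz hhw) ?_ ?_ ?_).2
  · simp only [Complex.ofReal_zero, neg_zero, zero_mul, Complex.exp_zero, mul_one] at key
    refine key.congr fun S => intervalIntegral.integral_congr fun m _ => ?_
    rw [Finset.sum_singleton, ← integral_const_mul (-σ : ℂ)]
    refine congrArg₂ (fun a b : ℂ => a * b) (integral_congr_ae (Eventually.of_forall fun y => ?_))
      (integral_congr_ae (Eventually.of_forall fun t => ?_))
    · simp only [zInt]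
      push_cast
      ring_nf
    · simp only [wInt]
      push_cast
      ring_nf
  · filter_upwards [Measure.quasiMeasurePreserving_snd.ae hσ] with x hx h0
    have h1 := hx (right_ne_zero_of_mul (right_ne_zero_of_mul h0))
    have e : ((-σ * vLine b x.1 - -σ * γ x.2 : ℂ)).re = σ * ((γ x.2).re - b) := by
      simp only [neg_mul, Complex.sub_re, Complex.neg_re, Complex.re_ofReal_mul, vLine_re]
      ring
    refine ⟨by rw [e]; exact h1, ?_⟩
    have h2 : vLine b x.1 - γ x.2 ≠ 0 := by
      intro h3
      have h4 := congrArg Complex.re h3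
      rw [Complex.sub_re, vLine_re, Complex.zero_re] at h4
      rw [← neg_sub, h4] at h1
      simp at h1
    rw [Finset.sum_singleton]
    field_simp
    ring
  · intro m _ j _
    have h1 := (integrable_zInt_vLine hl hs.abs_le (hhz.exp_mul (m * σ))).const_mul (-σ : ℂ)
    refine h1.congr (Eventually.of_forall fun y => ?_)
    simp only [zInt]
    push_cast
    ring_nf
  · intro m _ j _
    refine (hs.decay.integrable hl (hhw.exp_mul (-(m * σ)))).congr
      (Eventually.of_forall fun y => ?_)
    simp only [wInt]
    push_cast
    ring_nf

/-- Deformation of the contours of a double integral. -/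
theorem poleInt_eq {b b' : ℝ} {γ c γ' c' : ℝ → ℂ} (hs : CornerSeparated b γ c)
    (hs' : CornerSeparated b' γ' c') {lam : ℝ} (hl : 0 < lam) {K : ℝ} {hz hw : ℂ → ℂ}
    (hhz : GaussianGrowth K hz) (hhw : GaussianGrowth K hw) (σ : ℝ)
    (hσ : ∀ᵐ t, c t ≠ 0 → 0 < σ * ((γ t).re - b))
    (hσ' : ∀ᵐ t, c' t ≠ 0 → 0 < σ * ((γ' t).re - b'))
    (heq : ∀ K' h, GaussianGrowth K' h →
      ∫ t, wInt lam h (γ t) * c t = ∫ t, wInt lam h (γ' t) * c' t) :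
    poleInt lam hz hw b γ c = poleInt lam hz hw b' γ' c' := by
  -- Both double integrals are limits of parameter integrals of products of single entire integrals,
  -- and those are unchanged by the deformation. The pole itself never has to be deformed around.
  refine tendsto_nhds_unique (hs.tendsto_poleInt hl hhz hhw hσ)
    ((hs'.tendsto_poleInt hl hhz hhw hσ').congr fun S => ?_)
  refine intervalIntegral.integral_congr fun m _ => ?_
  rw [heq _ _ (hhw.exp_mul (-(m * σ))),
    integral_zInt_vLine_eq hl hs.abs_le hs'.abs_le (hhz.exp_mul (m * σ))]

/-! ### Separation of the contours -/

/-- The squared distance between iy and r(α+iβ) is y² + r² - 2yrβ ≥ 2(1-|β|)|y||r|, and 1 - |β| ≥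
1/10. This covers straight pieces of path that start at the corner in a direction bounded away from
the vertical. -/
theorem abs_mul_abs_le_of_direction {α β : ℝ} (h1 : α ^ 2 + β ^ 2 = 1) (h2 : |β| ≤ 9 / 10)
    (y r : ℝ) : |y| * |r| ≤ 5 * ((r * α) ^ 2 + (y - r * β) ^ 2) := by
  have h3 : y * r * β ≤ |y| * |r| * (9 / 10) := by
    refine (le_abs_self _).trans ?_
    rw [abs_mul, abs_mul]
    exact mul_le_mul_of_nonneg_left h2 (by positivity)
  have h4 : 2 * (|y| * |r|) ≤ y ^ 2 + r ^ 2 := by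
    have := sq_nonneg (|y| - |r|)
    rw [sub_sq, sq_abs, sq_abs] at this
    linarith
  have h5 : (r * α) ^ 2 + (y - r * β) ^ 2 = r ^ 2 + y ^ 2 - 2 * (y * r * β) := by
    linear_combination r ^ 2 * h1
  rw [h5]
  linarith

/-- For the pieces of path away from the corner: the horizontal distance ρ already controls both
factors, by 3‖z-w‖ and 2‖z-w‖. -/
theorem abs_sub_mul_abs_sub_le {z w : ℂ} {ρ y₀ t t₀ : ℝ} (h1 : ρ ≤ |z.re - w.re|)
    (h2 : |w.im - y₀| ≤ 2 * ρ) (h3 : |t - t₀| ≤ 2 * ρ) :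
    |z.im - y₀| * |t - t₀| ≤ 6 * ‖z - w‖ ^ 2 := by
  have hr : |z.re - w.re| ≤ ‖z - w‖ := by
    rw [← Complex.sub_re]
    exact Complex.abs_re_le_norm _
  have hi : |z.im - w.im| ≤ ‖z - w‖ := by
    rw [← Complex.sub_im]
    exact Complex.abs_im_le_norm _
  have h4 : |z.im - y₀| ≤ 3 * ‖z - w‖ := by
    have := abs_sub_le z.im w.im y₀
    linarith
  have h5 : |t - t₀| ≤ 2 * ‖z - w‖ := by linarith
  nlinarith [mul_le_mul h4 h5 (abs_nonneg _) (by positivity)]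

theorem sqrt_three_div_two_bounds : 17 / 20 ≤ Real.sqrt 3 / 2 ∧ Real.sqrt 3 / 2 ≤ 9 / 10 := by
  have h1 : Real.sqrt 3 ≤ 18 / 10 := Real.sqrt_le_iff.2 ⟨by norm_num, by norm_num⟩
  have h2 : 17 / 10 ≤ Real.sqrt 3 := Real.le_sqrt_of_sq_le (by norm_num)
  constructor <;> linarith

theorem sqrt_two_div_two_bounds : 7 / 10 ≤ Real.sqrt 2 / 2 ∧ Real.sqrt 2 / 2 ≤ 8 / 10 := by
  have h1 : Real.sqrt 2 ≤ 16 / 10 := Real.sqrt_le_iff.2 ⟨by norm_num, by norm_num⟩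
  have h2 : 14 / 10 ≤ Real.sqrt 2 := Real.le_sqrt_of_sq_le (by norm_num)
  constructor <;> linarith

theorem wPath_of_nonpos {t : ℝ} (ht : t ≤ 0) : (wPath t).re = 1 / 2 - t * (Real.sqrt 2 / 2) ∧
    (wPath t).im = Real.sqrt 3 / 2 - t * (Real.sqrt 2 / 2) := by
  rw [wPath, if_pos ht, Complex.sub_re, Complex.sub_im, Complex.re_ofReal_mul,
    Complex.im_ofReal_mul, dirNE_re, dirNE_im, saddlePt_re, saddlePt_im]
  exact ⟨rfl, rfl⟩

theorem wPath_of_mem {t : ℝ} (h0 : 0 < t) (h1 : t ≤ 1) : (wPath t).re = (1 - t) * (1 / 2) ∧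
    (wPath t).im = (1 - t) * (Real.sqrt 3 / 2) := by
  have e : wPath t = ((1 - t : ℝ) : ℂ) * saddlePt := by
    rw [wPath, if_neg (not_le.2 h0), if_pos h1]
    push_cast
    rfl
  rw [e, Complex.re_ofReal_mul, Complex.im_ofReal_mul, saddlePt_re, saddlePt_im]
  exact ⟨rfl, rfl⟩

theorem wPath_of_one_lt {t : ℝ} (ht : 1 < t) : (wPath t).re = (t - 1) * -(Real.sqrt 2 / 2) ∧
    (wPath t).im = (t - 1) * (Real.sqrt 2 / 2) := by
  have e : wPath t = ((t - 1 : ℝ) : ℂ) * dirNW := by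
    rw [wPath, if_neg (not_le.2 (by linarith)), if_neg (not_le.2 ht)]
    push_cast
    rfl
  rw [e, Complex.re_ofReal_mul, Complex.im_ofReal_mul, dirNW_re, dirNW_im]
  exact ⟨rfl, rfl⟩

theorem sqrt_three_div_two_sq : (1 / 2 : ℝ) ^ 2 + (Real.sqrt 3 / 2) ^ 2 = 1 := by
  rw [div_pow, div_pow, Real.sq_sqrt (by norm_num)]
  norm_num

theorem sqrt_two_div_two_sq : (Real.sqrt 2 / 2) ^ 2 + (Real.sqrt 2 / 2) ^ 2 = 1 := by
  rw [div_pow, Real.sq_sqrt (by norm_num)]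
  norm_num

theorem norm_vLine_sub_sq (b y : ℝ) (w : ℂ) :
    ‖vLine b y - w‖ ^ 2 = (w.re - b) ^ 2 + (y - w.im) ^ 2 := by
  rw [Complex.sq_norm, Complex.normSq_apply, Complex.sub_re, Complex.sub_im, vLine_re, vLine_im]
  ring

/-- The imaginary axis meets the path only at the origin, reached at t = 1. The segment and the last
ray leave that corner obliquely; the first ray stays to the right of the axis. -/
theorem cornerSeparated_wPath_zero {c : ℝ → ℂ} (hc : Measurable c) (h1 : ∀ t, ‖c t‖ ≤ 1) :
    CornerSeparated 0 wPath c where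
  abs_le := by simp
  decay := decayPath_wPath hc h1
  dist := by
    obtain ⟨h3l, h3u⟩ := sqrt_three_div_two_bounds
    obtain ⟨h2l, h2u⟩ := sqrt_two_div_two_bounds
    refine ⟨6, 0, 1, by norm_num, fun y t _ => ?_⟩
    rcases le_or_gt t 0 with ht | ht
    · obtain ⟨hr, hi⟩ := wPath_of_nonpos ht
      have := abs_sub_mul_abs_sub_le (z := vLine 0 y) (w := wPath t) (y₀ := 0) (t := t) (t₀ := 1)
        (ρ := 1 / 2 - t * (Real.sqrt 2 / 2)) ?_ ?_ ?_
      · rwa [vLine_im] at this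
      · rw [vLine_re, hr, zero_sub, abs_neg]
        exact le_abs_self _
      · rw [hi, sub_zero, abs_of_nonneg (by nlinarith)]
        nlinarith
      · rw [abs_of_nonpos (by linarith)]
        nlinarith
    have key : |y - 0| * |t - 1| ≤ 5 * ‖vLine 0 y - wPath t‖ ^ 2 := by
      rw [norm_vLine_sub_sq, sub_zero, sub_zero]
      rcases le_or_gt t 1 with ht1 | ht1
      · obtain ⟨hr, hi⟩ := wPath_of_mem ht ht1
        rw [hr, hi, abs_sub_comm t 1]
        exact abs_mul_abs_le_of_direction sqrt_three_div_two_sq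
          (by rw [abs_of_nonneg] <;> linarith) y (1 - t)
      · obtain ⟨hr, hi⟩ := wPath_of_one_lt ht1
        rw [hr, hi]
        exact abs_mul_abs_le_of_direction (by rw [neg_sq]; exact sqrt_two_div_two_sq)
          (by rw [abs_of_nonneg] <;> linarith) y (t - 1)
    have := sq_nonneg ‖vLine 0 y - wPath t‖
    linarith

theorem cornerSeparated_wPath_half {c : ℝ → ℂ} (hc : Measurable c) (h1 : ∀ t, ‖c t‖ ≤ 1) :
    CornerSeparated (1 / 2) wPath c where
  abs_le := by norm_num [abs_of_pos]
  decay := decayPath_wPath hc h1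
  dist := by
    obtain ⟨h3l, h3u⟩ := sqrt_three_div_two_bounds
    obtain ⟨h2l, h2u⟩ := sqrt_two_div_two_bounds
    -- The line Re z = 1/2 meets the path only at p, that is, at height √3/2 and t = 0; now the last
    -- ray is the piece away from the corner.
    refine ⟨6, Real.sqrt 3 / 2, 0, by norm_num, fun y t _ => ?_⟩
    rcases lt_or_ge 1 t with ht | ht
    · obtain ⟨hr, hi⟩ := wPath_of_one_lt ht
      have := abs_sub_mul_abs_sub_le (z := vLine (1 / 2) y) (w := wPath t)
        (y₀ := Real.sqrt 3 / 2) (t := t) (t₀ := 0)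
        (ρ := 1 / 2 + (t - 1) * (Real.sqrt 2 / 2)) ?_ ?_ ?_
      · rwa [vLine_im] at this
      · rw [vLine_re, hr]
        refine le_trans (le_of_eq ?_) (le_abs_self _)
        ring
      · rw [hi, abs_le]
        constructor <;> nlinarith
      · rw [sub_zero, abs_of_nonneg (by linarith)]
        nlinarith
    have key : |y - Real.sqrt 3 / 2| * |t - 0| ≤ 5 * ‖vLine (1 / 2) y - wPath t‖ ^ 2 := by
      rw [norm_vLine_sub_sq, sub_zero, ← abs_neg t]
      rcases le_or_gt t 0 with ht1 | ht1
      · obtain ⟨hr, hi⟩ := wPath_of_nonpos ht1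
        rw [hr, hi]
        convert abs_mul_abs_le_of_direction sqrt_two_div_two_sq
          (by rw [abs_of_nonneg] <;> linarith) (y - Real.sqrt 3 / 2) (-t) using 2
        ring
      · obtain ⟨hr, hi⟩ := wPath_of_mem ht1 ht
        rw [hr, hi]
        convert abs_mul_abs_le_of_direction sqrt_three_div_two_sq
          (by rw [abs_of_nonneg] <;> linarith) (y - Real.sqrt 3 / 2) (-t) using 2
        ring
    have := sq_nonneg ‖vLine (1 / 2) y - wPath t‖
    linarith

theorem rayNE_re (t : ℝ) : (rayNE t).re = -t * (Real.sqrt 2 / 2) := by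
  rw [rayNE, ← Complex.ofReal_neg, Complex.re_ofReal_mul, dirNE_re]

theorem rayNE_im (t : ℝ) : (rayNE t).im = -t * (Real.sqrt 2 / 2) := by
  rw [rayNE, ← Complex.ofReal_neg, Complex.im_ofReal_mul, dirNE_im]

theorem cornerSeparated_rayNE : CornerSeparated 0 rayNE weightNE where
  abs_le := by simp
  decay := decayPath_rayNE
  dist := by
    obtain ⟨h2l, h2u⟩ := sqrt_two_div_two_bounds
    refine ⟨5, 0, 0, by norm_num, fun y t _ => ?_⟩
    rw [norm_vLine_sub_sq, rayNE_re, rayNE_im, sub_zero, sub_zero, sub_zero, ← abs_neg t]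
    exact abs_mul_abs_le_of_direction sqrt_two_div_two_sq
      (by rw [abs_of_nonneg] <;> linarith) y (-t)

theorem poleInt_add {b : ℝ} {γ c c' : ℝ → ℂ} (hs : CornerSeparated b γ c)
    (hs' : CornerSeparated b γ c') {lam : ℝ} (hl : 0 < lam) {K : ℝ} {hz hw : ℂ → ℂ}
    (hhz : GaussianGrowth K hz) (hhw : GaussianGrowth K hw) :
    poleInt lam hz hw b γ (fun t => c t + c' t)
      = poleInt lam hz hw b γ c + poleInt lam hz hw b γ c' := by
  rw [poleInt, poleInt, poleInt,
    ← integral_add (hs.integrable hl hhz hhw) (hs'.integrable hl hhz hhw)]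
  refine integral_congr_ae (Eventually.of_forall fun x => ?_)
  ring

theorem norm_weightNE_add_weightSeg_le (t : ℝ) : ‖weightNE t + weightSeg t‖ ≤ 1 := by
  rw [weightNE, weightSeg]
  split_ifs with h1 h2 h2
  · linarith [h2.1]
  · simp [norm_dirNE]
  · simp [norm_saddlePt]
  · simp

theorem wWeight_ae_eq : ∀ᵐ t, wWeight t = weightNE t + weightSeg t + weightNW t := by
  filter_upwards [Measure.ae_ne volume (1 : ℝ)] with t h1
  rw [wWeight, weightNE, weightSeg, weightNW]
  rcases le_or_gt t 0 with h | h
  · rw [if_pos h, if_pos h, if_neg (fun h' => by linarith [h'.1]), if_neg (by linarith)]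
    ring
  rcases lt_or_gt_of_ne h1 with h' | h'
  · rw [if_neg (by linarith), if_pos h'.le, if_neg (by linarith), if_pos ⟨h, h'⟩,
      if_neg (by linarith)]
    ring
  · rw [if_neg (by linarith), if_neg (by linarith), if_neg (by linarith),
      if_neg (fun h'' => by linarith [h''.2]), if_pos h']
    ring

/-- The double integral over the original contours, up to the residues along the segment. -/
theorem poleInt_rayNE_add {lam : ℝ} (hl : 0 < lam) {K : ℝ} {hz hw : ℂ → ℂ}
    (hhz : GaussianGrowth K hz) (hhw : GaussianGrowth K hw) :
    poleInt lam hz hw 0 rayNE weightNE + poleInt lam hz hw 0 wPath weightNW =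
      poleInt lam hz hw (1 / 2) wPath wWeight + (poleInt lam hz hw 0 wPath weightSeg
        - poleInt lam hz hw (1 / 2) wPath weightSeg) := by
  obtain ⟨h2l, h2u⟩ := sqrt_two_div_two_bounds
  have sNE0 := cornerSeparated_wPath_zero measurable_weightNE norm_weightNE_le
  have sSeg0 := cornerSeparated_wPath_zero measurable_weightSeg norm_weightSeg_le
  have sNW0 := cornerSeparated_wPath_zero measurable_weightNW norm_weightNW_le
  have sNE1 := cornerSeparated_wPath_half measurable_weightNE norm_weightNE_le
  have sSeg1 := cornerSeparated_wPath_half measurable_weightSeg norm_weightSeg_le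
  have sNW1 := cornerSeparated_wPath_half measurable_weightNW norm_weightNW_le
  have sNS0 : CornerSeparated 0 wPath (fun t => weightNE t + weightSeg t) :=
    cornerSeparated_wPath_zero (measurable_weightNE.add measurable_weightSeg)
    norm_weightNE_add_weightSeg_le
  have sNS1 : CornerSeparated (1 / 2) wPath (fun t => weightNE t + weightSeg t) :=
    cornerSeparated_wPath_half (measurable_weightNE.add measurable_weightSeg)
    norm_weightNE_add_weightSeg_le
  -- With the ζ-line still at Re z = 0, both the ray and its deformation lie to its right almost
  -- everywhere, so σ = 1.
  have e1 : poleInt lam hz hw 0 rayNE weightNE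
      = poleInt lam hz hw 0 wPath (fun t => weightNE t + weightSeg t) := by
    refine poleInt_eq cornerSeparated_rayNE sNS0 hl hhz hhw 1 ?_ ?_ ?_
    · filter_upwards [Measure.ae_ne volume (0 : ℝ)] with t h0 h1
      have h3 : t ≤ 0 := by
        by_contra h
        exact h1 (by rw [weightNE, if_neg h])
      have h4 : t < 0 := lt_of_le_of_ne h3 h0
      rw [rayNE_re]
      nlinarith
    · filter_upwards [] with t h1
      rcases le_or_gt t 0 with h | h
      · rw [(wPath_of_nonpos h).1]
        nlinarith
      · have h3 : t < 1 := by
          by_contra h'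
          refine h1 ?_
          rw [weightNE, weightSeg, if_neg (not_le.2 h), if_neg (fun h'' => h' h''.2), add_zero]
        rw [(wPath_of_mem h h3.le).1]
        linarith
    · intro K' h hh
      simp only [mul_add]
      rw [integral_wInt_rayNE hl hh, integral_add (sNE0.decay.integrable hl hh)
        (sSeg0.decay.integrable hl hh)]
  -- The first ray lies to the right of both vertical lines and the last ray to the left of both, so
  -- their integrals survive the shift of the line. Only the segment lies between the lines.
  have e2 : poleInt lam hz hw 0 wPath weightNE = poleInt lam hz hw (1 / 2) wPath weightNE := by
    refine poleInt_eq sNE0 sNE1 hl hhz hhw 1 ?_ ?_ fun _ _ _ => rfl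
    all_goals
      filter_upwards [Measure.ae_ne volume (0 : ℝ)] with t h0 h1
      have h3 : t ≤ 0 := by
        by_contra h
        exact h1 (by rw [weightNE, if_neg h])
      have h4 : t < 0 := lt_of_le_of_ne h3 h0
      rw [(wPath_of_nonpos h3).1]
      nlinarith
  have e3 : poleInt lam hz hw 0 wPath weightNW = poleInt lam hz hw (1 / 2) wPath weightNW := by
    refine poleInt_eq sNW0 sNW1 hl hhz hhw (-1) ?_ ?_ fun _ _ _ => rfl
    all_goals
      filter_upwards [] with t h1
      have h3 : 1 < t := by
        by_contra h
        exact h1 (by rw [weightNW, if_neg h])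
      rw [(wPath_of_one_lt h3).1]
      nlinarith
  have e4 : poleInt lam hz hw (1 / 2) wPath wWeight
      = poleInt lam hz hw (1 / 2) wPath (fun t => weightNE t + weightSeg t + weightNW t) := by
    refine integral_congr_ae ?_
    filter_upwards [Measure.quasiMeasurePreserving_snd.ae wWeight_ae_eq] with x hx
    rw [hx]
  rw [e1, e4, poleInt_add sNS1 sNW1 hl hhz hhw, poleInt_add sNE1 sSeg1 hl hhz hhw,
    poleInt_add sNE0 sSeg0 hl hhz hhw, e2, e3]
  ring

open scoped FourierTransform

/-! ### The residue between the two vertical lines -/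

/-- Fourier inversion at the origin; the factor 2π comes from the normalization of the frequency. -/
theorem integral_integral_exp_eq {φ : ℝ → ℂ} (hc : Continuous φ) (hi : Integrable φ)
    (hψ : Integrable fun s : ℝ => ∫ η : ℝ, Complex.exp (s * (η * Complex.I)) * φ η) :
    ∫ s : ℝ, ∫ η : ℝ, Complex.exp (s * (η * Complex.I)) * φ η = 2 * Real.pi * φ 0 := by
  set ψ : ℝ → ℂ := fun s => ∫ η : ℝ, Complex.exp (s * (η * Complex.I)) * φ η with hψd
  have h1 : 𝓕 φ = fun x => ψ (-(2 * Real.pi) * x) := by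
    ext x
    rw [Real.fourier_real_eq_integral_exp_smul]
    refine integral_congr_ae (Eventually.of_forall fun η => ?_)
    simp only [smul_eq_mul]
    congr 2
    push_cast
    ring
  have h0 : -(2 * Real.pi) ≠ 0 := by simp [Real.pi_ne_zero]
  have h2 : Integrable (𝓕 φ) := by
    rw [h1]
    exact hψ.comp_mul_left' h0
  have h3 := congrFun (hc.fourierInv_fourier_eq hi h2) 0
  rw [Real.fourierInv_eq', h1] at h3
  simp only [inner_zero_right, mul_zero, Complex.ofReal_zero, zero_mul, Complex.exp_zero,
    one_smul] at h3
  rw [Measure.integral_comp_mul_left, abs_inv, abs_neg, abs_of_pos (by positivity),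
    Complex.real_smul] at h3
  rw [← h3, ← mul_assoc]
  push_cast
  rw [mul_inv_cancel₀ (by simp [Real.pi_ne_zero]), one_mul]

theorem integrable_of_norm_le_exp {ψ : ℝ → ℂ} (hm : AEStronglyMeasurable ψ) {C C' r r' : ℝ}
    (hr : 0 < r) (hr' : 0 < r') (h1 : ∀ s, ‖ψ s‖ ≤ C * Real.exp (-r * s))
    (h2 : ∀ s, ‖ψ s‖ ≤ C' * Real.exp (r' * s)) : Integrable ψ := by
  rw [← integrableOn_univ, ← Set.Iic_union_Ioi (a := (0 : ℝ)), integrableOn_union]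
  constructor
  · exact ((integrableOn_exp_mul_Iic hr' 0).const_mul C').mono' hm.restrict
      (Eventually.of_forall h2)
  · exact ((integrableOn_exp_mul_Ioi (neg_lt_zero.2 hr) 0).const_mul C).mono' hm.restrict
      (Eventually.of_forall h1)

/-- With a one-point second factor, `integral_pairing` also applies to single integrals. -/
theorem integral_prod_dirac_unit {α : Type*} [MeasurableSpace α] {μ : Measure α} [SFinite μ]
    {f : α × Unit → ℂ} (hf : Measurable f) :
    ∫ x, f x ∂μ.prod (Measure.dirac ()) = ∫ x, f (x, ()) ∂μ := by
  rw [Measure.prod_dirac, integral_map (by fun_prop) hf.aestronglyMeasurable]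

/-- The Cauchy transform of the `ζ`-integrand along a vertical line. -/
noncomputable def cauchyInt (lam : ℝ) (h : ℂ → ℂ) (b : ℝ) (w : ℂ) : ℂ :=
  ∫ y, (zInt lam h (vLine b y) * Complex.I) * (1 / (vLine b y - w))

/-- The Laplace representation of `CornerSeparated.tendsto_poleInt` with w held fixed. -/
theorem tendsto_cauchyInt {lam K : ℝ} (hl : 0 < lam) {h : ℂ → ℂ} (hh : GaussianGrowth K h)
    {b : ℝ} (hb : |b| ≤ 1) {w : ℂ} {σ : ℝ} (hσ : 0 < σ * (w.re - b)) :
    Tendsto (fun S : ℝ => ∫ m in (0 : ℝ)..S, (-σ) *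
      (∫ y, zInt lam (fun z => Complex.exp ((m * σ : ℝ) * z) * h z) (vLine b y) * Complex.I) *
        Complex.exp (-(m * σ : ℝ) * w)) atTop (𝓝 (cauchyInt lam h b w)) := by
  have hm := (continuous_vLine b).measurable
  have hz' := (differentiable_zInt (lam := lam) hh).continuous.measurable
  have hne : ∀ y, vLine b y - w ≠ 0 := by
    intro y h3
    have h4 := congrArg Complex.re h3
    rw [Complex.sub_re, vLine_re, Complex.zero_re] at h4
    rw [← neg_sub, h4] at hσ
    simp at hσ
  have hb0 : w.re - b ≠ 0 := right_ne_zero_of_mul hσ.ne'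
  have hi : Integrable fun y => (zInt lam h (vLine b y) * Complex.I) * (1 / (vLine b y - w)) := by
    refine (integrable_zInt_vLine hl hb hh).mul_bdd (c := |w.re - b|⁻¹)
      (Measurable.aestronglyMeasurable (by fun_prop))
      (Eventually.of_forall fun y => ?_)
    rw [one_div, norm_inv]
    refine inv_anti₀ (abs_pos.2 hb0) ?_
    have := Complex.abs_re_le_norm (vLine b y - w)
    rwa [Complex.sub_re, vLine_re, abs_sub_comm] at this
  have key := (integral_pairing (μ := volume) (ν := Measure.dirac ()) {()} (lam := 0)
    (A := fun y => zInt lam h (vLine b y) * Complex.I) (p := fun y => -σ * vLine b y)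
    (B := fun _ => 1) (q := fun _ => -σ * w)
    (κ := fun x => 1 / (vLine b x.1 - w)) (a := fun _ _ => -σ) (b := fun _ _ => 1)
    (by fun_prop) (by fun_prop) (by fun_prop) (by fun_prop) (by fun_prop)
    (by fun_prop) (by fun_prop) ?_ ?_ ?_ ?_).2
  · simp only [Complex.ofReal_zero, neg_zero, zero_mul, Complex.exp_zero, mul_one] at key
    rw [integral_prod_dirac_unit (by fun_prop)] at key
    refine key.congr fun S => intervalIntegral.integral_congr fun m _ => ?_
    rw [Finset.sum_singleton, ← integral_const_mul (-σ : ℂ), integral_dirac]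
    refine congrArg₂ (fun a b : ℂ => a * b) (integral_congr_ae (Eventually.of_forall fun y => ?_))
      ?_
    · simp only [zInt]
      push_cast
      ring_nf
    · push_cast
      ring_nf
  · rw [Measure.prod_dirac, integrable_map_measure (by fun_prop) (by fun_prop)]
    simpa [Function.comp_def] using hi
  · refine Eventually.of_forall fun x _ => ⟨?_, ?_⟩
    · have e : ((-σ * vLine b x.1 - -σ * w : ℂ)).re = σ * (w.re - b) := by
        simp only [neg_mul, Complex.sub_re, Complex.neg_re, Complex.re_ofReal_mul, vLine_re]
        ring
      rw [e]
      exact hσ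
    · have h2 := hne x.1
      rw [Finset.sum_singleton]
      field_simp
      ring
  · intro m _ j _
    have h1 := (integrable_zInt_vLine hl hb (hh.exp_mul (m * σ))).const_mul (-σ : ℂ)
    refine h1.congr (Eventually.of_forall fun y => ?_)
    simp only [zInt]
    push_cast
    ring_nf
  · intro m _ j _
    exact integrable_dirac (by simp)

/-- The residue picked up between the lines `Re z = 0` and `Re z = 1 / 2`. -/
theorem cauchyInt_half_sub {lam K : ℝ} (hl : 0 < lam) {h : ℂ → ℂ} (hh : GaussianGrowth K h)
    {w : ℂ} (h0 : 0 < w.re) (h1 : w.re < 1 / 2) :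
    cauchyInt lam h (1 / 2) w - cauchyInt lam h 0 w = 2 * Real.pi * Complex.I * zInt lam h w := by
  have hb0 : |(0 : ℝ)| ≤ 1 := by simp
  have hb1 : |(1 / 2 : ℝ)| ≤ 1 := by norm_num [abs_of_pos]
  have hbw : |w.re| ≤ 1 := by rw [abs_of_pos h0]; linarith
  have hzc := (differentiable_zInt (lam := lam) hh).continuous
  set φ : ℝ → ℂ := fun η => zInt lam h (w + η * Complex.I) with hφ
  -- Up to the factor i e^{sw}, ψ(s) is the integral of e^{sz} times the integrand over any
  -- admissible vertical line. The Cauchy integrals to the left and to the right of w become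
  -- half-line integrals of ψ, so their difference is governed by the full integral of ψ, which
  -- Fourier inversion evaluates.
  set ψ : ℝ → ℂ := fun s => ∫ η : ℝ, Complex.exp (s * (η * Complex.I)) * φ η with hψ
  set M : ℝ → ℝ → ℂ := fun b s =>
    ∫ y, zInt lam (fun z => Complex.exp ((s : ℝ) * z) * h z) (vLine b y) * Complex.I with hM
  have hvw : ∀ y : ℝ, vLine w.re (y + w.im) = w + y * Complex.I := by
    intro y
    rw [vLine]
    push_cast
    conv_rhs => rw [← Complex.re_add_im w]
    ring
  have hφc : Continuous φ := by simp only [hφ]; fun_prop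
  have hφi : Integrable φ := by
    have := ((integrable_zInt_vLine hl hbw hh).comp_add_right w.im).mul_const (-Complex.I)
    refine this.congr (Eventually.of_forall fun y => ?_)
    simp only [hφ, hvw, mul_assoc, mul_neg, Complex.I_mul_I, neg_neg, mul_one]
  have hMψ : ∀ b, |b| ≤ 1 → ∀ s : ℝ, M b s = Complex.I * Complex.exp (s * w) * ψ s := by
    intro b hb s
    simp only [hM, hψ]
    rw [integral_zInt_vLine_eq hl hb hbw (hh.exp_mul s), ← integral_const_mul,
      ← integral_add_right_eq_self _ w.im]
    refine integral_congr_ae (Eventually.of_forall fun y => ?_)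
    simp only [hφ, hvw, zInt, mul_add, Complex.exp_add]
    ring
  have hψn : ∀ s, ‖ψ s‖ = Real.exp (-(s * w.re)) * ‖ψ s * Complex.exp (s * w)‖ := by
    intro s
    rw [norm_mul, Complex.norm_exp, Complex.re_ofReal_mul, mul_comm, mul_assoc, ← Real.exp_add,
      add_neg_cancel, Real.exp_zero, mul_one]
  -- Computing ψ on the line b = 0 gives decay as s → +∞ and on b = 1/2 decay as s → -∞, because 0 <
  -- Re w < 1/2.
  have hbd : ∀ b, |b| ≤ 1 → ∀ s, ‖ψ s‖ ≤
      (∫ y, ‖zInt lam h (vLine b y) * Complex.I‖) * Real.exp (s * (b - w.re)) := by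
    intro b hb s
    have e1 : ‖ψ s * Complex.exp (s * w)‖ = ‖M b s‖ := by
      rw [hMψ b hb, norm_mul, norm_mul, norm_mul, Complex.norm_I, one_mul, mul_comm]
    have e2 : ‖M b s‖ ≤ ∫ y, Real.exp (s * b) * ‖zInt lam h (vLine b y) * Complex.I‖ := by
      refine (norm_integral_le_integral_norm _).trans (le_of_eq ?_)
      refine integral_congr_ae (Eventually.of_forall fun y => ?_)
      simp only [zInt, norm_mul, Complex.norm_exp (s * _), Complex.re_ofReal_mul, vLine_re]
      ring
    rw [integral_const_mul] at e2
    rw [hψn, e1]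
    refine (mul_le_mul_of_nonneg_left e2 (Real.exp_pos _).le).trans (le_of_eq ?_)
    rw [mul_sub, sub_eq_add_neg, Real.exp_add]
    ring
  have hψm : AEStronglyMeasurable ψ := by
    have : Measurable fun x : ℝ × ℝ => Complex.exp (x.1 * (x.2 * Complex.I)) * φ x.2 := by
      have := hφc.measurable
      fun_prop
    exact (this.stronglyMeasurable.integral_prod_right (ν := volume)).aestronglyMeasurable
  have hψi : Integrable ψ := by
    refine integrable_of_norm_le_exp hψm h0 (sub_pos.2 h1)
      (C := ∫ y, ‖zInt lam h (vLine 0 y) * Complex.I‖)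
      (C' := ∫ y, ‖zInt lam h (vLine (1 / 2) y) * Complex.I‖)
      (fun s => (hbd 0 hb0 s).trans (le_of_eq ?_)) (fun s => (hbd (1 / 2) hb1 s).trans (le_of_eq ?_))
    · rw [zero_sub, mul_comm s]
    · rw [mul_comm s]
  have l0 := tendsto_cauchyInt hl hh hb0 (w := w) (σ := 1) (by simpa using h0)
  have l1 := tendsto_cauchyInt hl hh hb1 (w := w) (σ := -1) (by linarith)
  have hneg : Integrable fun s => ψ (-s) := hψi.comp_neg
  have t0 := (intervalIntegral_tendsto_integral_Ioi 0 hψi.integrableOn tendsto_id).const_mul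
    (-Complex.I)
  have t1 := (intervalIntegral_tendsto_integral_Ioi 0 hneg.integrableOn tendsto_id).const_mul
    Complex.I
  have c0 : cauchyInt lam h 0 w = -Complex.I * ∫ s in Set.Ioi (0 : ℝ), ψ s := by
    refine tendsto_nhds_unique l0 (t0.congr fun S => ?_)
    rw [← intervalIntegral.integral_const_mul]
    refine intervalIntegral.integral_congr fun m _ => ?_
    have := hMψ 0 hb0 m
    simp only [hM] at this
    simp only [mul_one, Complex.ofReal_one, this]
    have e : Complex.exp (m * w) * Complex.exp (-m * w) = 1 := by
      rw [← Complex.exp_add, neg_mul, add_neg_cancel, Complex.exp_zero]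
    linear_combination (Complex.I * ψ m) * e
  have c1 : cauchyInt lam h (1 / 2) w = Complex.I * ∫ s in Set.Ioi (0 : ℝ), ψ (-s) := by
    refine tendsto_nhds_unique l1 (t1.congr fun S => ?_)
    rw [← intervalIntegral.integral_const_mul]
    refine intervalIntegral.integral_congr fun m _ => ?_
    have := hMψ (1 / 2) hb1 (-m)
    simp only [hM] at this
    simp only [mul_neg, mul_one, Complex.ofReal_one, Complex.ofReal_neg, neg_neg, one_mul] at this ⊢
    rw [this]
    have e : Complex.exp (-m * w) * Complex.exp (m * w) = 1 := by
      rw [← Complex.exp_add, neg_mul, neg_add_cancel, Complex.exp_zero]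
    linear_combination (-Complex.I * ψ (-m)) * e
  have hsum : (∫ s in Set.Ioi (0 : ℝ), ψ s) + ∫ s in Set.Ioi (0 : ℝ), ψ (-s)
      = 2 * Real.pi * zInt lam h w := by
    have e := integral_integral_exp_eq hφc hφi hψi
    have e' := integral_comp_neg_Ioi (0 : ℝ) ψ
    rw [neg_zero] at e'
    rw [e', ← Set.compl_Ioi, integral_add_compl measurableSet_Ioi hψi, e]
    simp [hφ]
  rw [c0, c1]
  linear_combination Complex.I * hsum

/-- After Fubini the inner integrals are Cauchy transforms, whose difference is a residue. At z = w
the factors e^{∓λf} cancel, so the result does not depend on λ. The minus sign reflects that the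
path runs from p to 0. -/
theorem poleInt_seg_sub {lam : ℝ} (hl : 0 < lam) {K : ℝ} {hz hw : ℂ → ℂ}
    (hhz : GaussianGrowth K hz) (hhw : GaussianGrowth K hw) :
    poleInt lam hz hw (1 / 2) wPath weightSeg - poleInt lam hz hw 0 wPath weightSeg
      = 2 * Real.pi * Complex.I *
        -(∫ t in (0 : ℝ)..1, hz (t * saddlePt) * hw (t * saddlePt) * saddlePt) := by
  have s0 := (cornerSeparated_wPath_zero measurable_weightSeg norm_weightSeg_le).integrable
    hl hhz hhw
  have s1 := (cornerSeparated_wPath_half measurable_weightSeg norm_weightSeg_le).integrable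
    hl hhz hhw
  have e : ∀ b, (∀ t, (∫ y, zInt lam hz (vLine b y) * Complex.I * (wInt lam hw (wPath t) *
      weightSeg t) * (1 / (vLine b y - wPath t)))
        = wInt lam hw (wPath t) * weightSeg t * cauchyInt lam hz b (wPath t)) := by
    intro b t
    rw [cauchyInt, ← integral_const_mul]
    refine integral_congr_ae (Eventually.of_forall fun y => ?_)
    ring
  rw [poleInt, poleInt, integral_prod_symm _ s0, integral_prod_symm _ s1]
  have i0 := s0.integral_prod_right
  have i1 := s1.integral_prod_right
  simp only [e] at i0 i1 ⊢
  rw [← integral_sub i1 i0]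
  have := integral_segment_weight (fun w => hz w * hw w)
  simp only [zero_add] at this
  rw [← this, ← integral_const_mul]
  refine integral_congr_ae (Eventually.of_forall fun t => ?_)
  by_cases ht : 0 < t ∧ t < 1
  · have hr := (wPath_of_mem ht.1 ht.2.le).1
    have := cauchyInt_half_sub hl hhz (w := wPath t) (by rw [hr]; linarith) (by rw [hr]; linarith)
    simp only
    rw [← mul_sub, this, zInt, wInt]
    have e : Complex.exp (-lam * phase (wPath t)) * Complex.exp (lam * phase (wPath t)) = 1 := by
      rw [← Complex.exp_add, neg_mul, neg_add_cancel, Complex.exp_zero]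
    linear_combination (2 * Real.pi * Complex.I * hz (wPath t) * hw (wPath t) * weightSeg t) * e
  · simp [weightSeg, if_neg ht]

/-! ### The rescaled kernel -/

theorem imaginaryAxisIntegral_scale {s : ℝ} (hs : 0 < s) (h : ℂ → ℂ) :
    imaginaryAxisIntegral h = s * imaginaryAxisIntegral fun z => h (s * z) := by
  have := Measure.integral_comp_mul_left (fun t : ℝ => h (t * Complex.I) * Complex.I) s
  rw [abs_of_pos (inv_pos.2 hs), Complex.real_smul] at this
  have hs' : (s : ℂ) ≠ 0 := by exact_mod_cast hs.ne'
  simp only [imaginaryAxisIntegral]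
  rw [← mul_right_inj' (inv_ne_zero hs'), inv_mul_cancel_left₀ hs', ← Complex.ofReal_inv, ← this]
  push_cast
  simp only [mul_assoc]

theorem rayIntegral_scale {s : ℝ} (hs : 0 < s) (θ : ℝ) (h : ℂ → ℂ) :
    rayIntegral θ h = s * rayIntegral θ fun z => h (s * z) := by
  have := integral_comp_mul_left_Ioi (fun r : ℝ => h (r * Complex.exp (θ * Complex.I)) *
    Complex.exp (θ * Complex.I)) 0 hs
  rw [mul_zero, Complex.real_smul] at this
  have hs' : (s : ℂ) ≠ 0 := by exact_mod_cast hs.ne'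
  simp only [rayIntegral]
  rw [← mul_right_inj' (inv_ne_zero hs'), inv_mul_cancel_left₀ hs', ← Complex.ofReal_inv, ← this]
  push_cast
  simp only [mul_assoc]

theorem pearceyContourIntegral_scale {s : ℝ} (hs : 0 < s) (h : ℂ → ℂ) :
    pearceyContourIntegral h = s * pearceyContourIntegral fun z => h (s * z) := by
  simp only [pearceyContourIntegral]
  rw [rayIntegral_scale hs, rayIntegral_scale hs (3 * Real.pi / 4), rayIntegral_scale hs (Real.pi / 4),
    rayIntegral_scale hs (-(3 * Real.pi / 4))]
  ring

theorem pearceyContourIntegral_const_mul (c : ℂ) (h : ℂ → ℂ) :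
    pearceyContourIntegral (fun w => c * h w) = c * pearceyContourIntegral h := by
  simp only [pearceyContourIntegral, rayIntegral, mul_assoc, integral_const_mul]
  ring

/-- The amplitude of the `ζ`-integrand. -/
noncomputable def baseZ (τ v : ℝ) (z : ℂ) : ℂ := Complex.exp (-v * z - τ * z ^ 2)

/-- The amplitude of the `ω`-integrand. -/
noncomputable def baseW (τ u : ℝ) (w : ℂ) : ℂ := Complex.exp (u * w + τ * w ^ 2)

/-- The double integral in the rescaled Pearcey kernel. -/
noncomputable def kernelInt (lam τ₁ τ₂ u v : ℝ) : ℂ :=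
  imaginaryAxisIntegral fun z => pearceyContourIntegral fun w =>
    zInt lam (baseZ τ₂ v) z * wInt lam (baseW τ₁ u) w * (1 / (z - w))

theorem rescaled_gaussian {s τ₁ τ₂ u v : ℝ} (hs : 0 < s) (hτ : τ₂ < τ₁) :
    1 / s * (1 / Real.sqrt (2 * Real.pi * (2 * τ₁ / s ^ 2 - 2 * τ₂ / s ^ 2)) *
      Real.exp (-((u / s + s ^ 3) - (v / s + s ^ 3)) ^ 2 / (2 * (2 * τ₁ / s ^ 2 - 2 * τ₂ / s ^ 2))))
    = 1 / Real.sqrt (4 * Real.pi * (τ₁ - τ₂)) * Real.exp (-(u - v) ^ 2 / (4 * (τ₁ - τ₂))) := by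
  have h0 : τ₁ - τ₂ ≠ 0 := (sub_pos.2 hτ).ne'
  have e1 : 2 * Real.pi * (2 * τ₁ / s ^ 2 - 2 * τ₂ / s ^ 2)
      = (4 * Real.pi * (τ₁ - τ₂)) / s ^ 2 := by
    field_simp
    ring
  have e2 : -((u / s + s ^ 3) - (v / s + s ^ 3)) ^ 2 / (2 * (2 * τ₁ / s ^ 2 - 2 * τ₂ / s ^ 2))
      = -(u - v) ^ 2 / (4 * (τ₁ - τ₂)) := by
    have : 2 * (2 * τ₁ / s ^ 2 - 2 * τ₂ / s ^ 2) = 4 * (τ₁ - τ₂) / s ^ 2 := by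
      field_simp
      ring
    rw [this]
    field_simp
    ring
  rw [e1, e2, Real.sqrt_div' _ (sq_nonneg s), Real.sqrt_sq hs.le, ← mul_assoc]
  congr 1
  field_simp

/-- With s = a^{1/3}, substituting sz and sw gives λ = s⁴ in front of both z⁴/4 and the linear term
from the shift by a, while τ and u, v lose their scaling. Of the two Jacobian factors s, one cancels
against 1/(z-w) and the other against the prefactor. -/
theorem rescaledPearceyKernel_eq {a : ℝ} (ha : 0 < a) (τ₁ τ₂ u v : ℝ) :
    rescaledPearceyKernel a τ₁ τ₂ u v =
      1 / (2 * Real.pi * Complex.I) ^ 2 * kernelInt (a ^ (4 / 3 : ℝ)) τ₁ τ₂ u v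
      - (if τ₂ < τ₁ then
        ((1 / Real.sqrt (4 * Real.pi * (τ₁ - τ₂)) *
          Real.exp (-(u - v) ^ 2 / (4 * (τ₁ - τ₂))) : ℝ) : ℂ) else 0) := by
  set s : ℝ := a ^ (1 / 3 : ℝ) with hsd
  have hs : 0 < s := Real.rpow_pos_of_pos ha _
  have h2 : a ^ (2 / 3 : ℝ) = s ^ 2 := by
    rw [hsd, ← Real.rpow_natCast, ← Real.rpow_mul ha.le]
    norm_num
  have h3 : a = s ^ 3 := by
    rw [hsd, ← Real.rpow_natCast, ← Real.rpow_mul ha.le]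
    norm_num
  have h4 : a ^ (4 / 3 : ℝ) = s ^ 4 := by
    rw [hsd, ← Real.rpow_natCast, ← Real.rpow_mul ha.le]
    norm_num
  have hs' : (s : ℂ) ≠ 0 := by exact_mod_cast hs.ne'
  rw [rescaledPearceyKernel, h2, h4, ← hsd, h3, pearceyKernel, mul_sub]
  congr 1
  · rw [imaginaryAxisIntegral_scale hs]
    have e : ∀ z : ℂ, pearceyContourIntegral (fun ω =>
        Complex.exp (-(s * z) ^ 4 / 4 - (2 * τ₂ / s ^ 2 : ℝ) * (s * z) ^ 2 / 2
          - (v / s + s ^ 3 : ℝ) * (s * z) + ω ^ 4 / 4 + (2 * τ₁ / s ^ 2 : ℝ) * ω ^ 2 / 2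
          + (u / s + s ^ 3 : ℝ) * ω) / (s * z - ω))
        = pearceyContourIntegral fun w =>
          zInt (s ^ 4) (baseZ τ₂ v) z * wInt (s ^ 4) (baseW τ₁ u) w * (1 / (z - w)) := by
      intro z
      rw [pearceyContourIntegral_scale hs, ← pearceyContourIntegral_const_mul]
      congr 1
      ext w
      rw [zInt, wInt, baseZ, baseW, ← Complex.exp_add, ← Complex.exp_add, ← Complex.exp_add,
        ← mul_sub, phase, phase, mul_one_div, ← mul_div_assoc, mul_div_mul_left _ _ hs']
      congr 2
      push_cast
      field_simp
      ring
    simp only [e, kernelInt]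
    push_cast
    field_simp
  · have hiff : 2 * τ₂ / s ^ 2 < 2 * τ₁ / s ^ 2 ↔ τ₂ < τ₁ := by
      rw [div_lt_div_iff_of_pos_right (by positivity)]
      exact mul_lt_mul_iff_right₀ two_pos
    by_cases h : τ₂ < τ₁
    · rw [if_pos h, if_pos (hiff.2 h), ← Complex.ofReal_mul, rescaled_gaussian hs h]
    · rw [if_neg h, if_neg (fun h' => h (hiff.1 h')), mul_zero]

/-! ### The double integral as a real part -/

theorem rayIntegral_neg (θ : ℝ) (h : ℂ → ℂ) :
    rayIntegral (-θ) h = (starRingEnd ℂ) (rayIntegral θ fun w =>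
      (starRingEnd ℂ) (h ((starRingEnd ℂ) w))) := by
  rw [rayIntegral, rayIntegral, ← integral_conj]
  refine integral_congr_ae (Eventually.of_forall fun r => ?_)
  have e : (starRingEnd ℂ) (Complex.exp (θ * Complex.I)) = Complex.exp ((-θ : ℝ) * Complex.I) := by
    rw [← Complex.exp_conj, map_mul, Complex.conj_ofReal, Complex.conj_I]
    push_cast
    ring_nf
  simp only [map_mul, Complex.conj_conj, Complex.conj_ofReal, e]

theorem neg_rayIntegral_pi_div_four (h : ℂ → ℂ) :
    -rayIntegral (Real.pi / 4) h = ∫ t : ℝ, h (rayNE t) * weightNE t := by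
  have := setIntegral_ray_eq h 0
  simp only [zero_sub, zero_add, ← neg_mul] at this
  rw [rayIntegral, exp_pi_div_four]
  simp only [rayNE]
  rw [this]

theorem rayIntegral_three_pi_div_four (h : ℂ → ℂ) :
    rayIntegral (3 * Real.pi / 4) h = ∫ t : ℝ, h (wPath t) * weightNW t := by
  rw [rayIntegral, exp_three_pi_div_four]
  have h1 : ∀ t : ℝ, h (wPath t) * weightNW t
      = (Set.indicator (Set.Ioi 0) (fun r : ℝ => h (r * dirNW) * dirNW)) (t - 1) := by
    intro t
    by_cases ht : 1 < t
    · rw [weightNW, if_pos ht, Set.indicator_of_mem (by rw [Set.mem_Ioi]; linarith), wPath,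
        if_neg (by linarith), if_neg (by linarith)]
      push_cast
      rfl
    · rw [weightNW, if_neg ht, Set.indicator_of_notMem (by rw [Set.mem_Ioi]; linarith), mul_zero]
  rw [integral_congr_ae (Eventually.of_forall h1),
    integral_sub_right_eq_self (Set.indicator (Set.Ioi 0) fun r : ℝ => h (r * dirNW) * dirNW),
    integral_indicator measurableSet_Ioi]

/-- The two lower rays are the conjugates of the two upper ones with reversed orientation. -/
theorem pearceyContourIntegral_eq {F : ℂ → ℂ → ℂ}
    (hF : ∀ z w, F z ((starRingEnd ℂ) w) = (starRingEnd ℂ) (F ((starRingEnd ℂ) z) w)) (z : ℂ) :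
    pearceyContourIntegral (F z) =
      ((∫ t : ℝ, F z (rayNE t) * weightNE t) + ∫ t : ℝ, F z (wPath t) * weightNW t)
      - (starRingEnd ℂ) ((∫ t : ℝ, F ((starRingEnd ℂ) z) (rayNE t) * weightNE t)
        + ∫ t : ℝ, F ((starRingEnd ℂ) z) (wPath t) * weightNW t) := by
  rw [pearceyContourIntegral, rayIntegral_neg, rayIntegral_neg]
  simp only [hF, Complex.conj_conj]
  rw [← neg_rayIntegral_pi_div_four, ← neg_rayIntegral_pi_div_four,
    ← rayIntegral_three_pi_div_four, ← rayIntegral_three_pi_div_four, map_add, map_neg]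
  ring

theorem gaussianGrowth_exp {K : ℝ} {α β : ℝ} (hα : |α| + |β| ≤ K) :
    GaussianGrowth K fun z => Complex.exp (α * z + β * z ^ 2) where
  differentiable := by fun_prop
  norm_le z := by
    rw [Complex.norm_exp, Real.exp_le_exp]
    have h1 : (α * z + β * z ^ 2 : ℂ).re ≤ |α| * ‖z‖ + |β| * ‖z‖ ^ 2 := by
      refine (Complex.re_le_norm _).trans ((norm_add_le _ _).trans ?_)
      rw [norm_mul, norm_mul, norm_pow, Complex.norm_real, Complex.norm_real, Real.norm_eq_abs,
        Real.norm_eq_abs]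
    have h2 : |α| * ‖z‖ ≤ |α| * (1 + ‖z‖ ^ 2) :=
      mul_le_mul_of_nonneg_left (by nlinarith [sq_nonneg (‖z‖ - 1)]) (abs_nonneg _)
    have h3 : |β| * ‖z‖ ^ 2 ≤ |β| * (1 + ‖z‖ ^ 2) :=
      mul_le_mul_of_nonneg_left (by linarith) (abs_nonneg _)
    have h4 := mul_le_mul_of_nonneg_right hα (by positivity : 0 ≤ 1 + ‖z‖ ^ 2)
    linarith

theorem gaussianGrowth_baseZ {K τ v : ℝ} (h : |v| + |τ| ≤ K) : GaussianGrowth K (baseZ τ v) := by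
  have := gaussianGrowth_exp (K := K) (α := -v) (β := -τ) (by rwa [abs_neg, abs_neg])
  convert this using 2 with z
  rw [baseZ]
  push_cast
  ring_nf

theorem gaussianGrowth_baseW {K τ u : ℝ} (h : |u| + |τ| ≤ K) : GaussianGrowth K (baseW τ u) :=
  gaussianGrowth_exp h

theorem baseZ_conj (τ v : ℝ) (z : ℂ) :
    baseZ τ v ((starRingEnd ℂ) z) = (starRingEnd ℂ) (baseZ τ v z) := by
  rw [baseZ, baseZ, ← Complex.exp_conj]
  simp

theorem baseW_conj (τ u : ℝ) (z : ℂ) :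
    baseW τ u ((starRingEnd ℂ) z) = (starRingEnd ℂ) (baseW τ u z) := by
  rw [baseW, baseW, ← Complex.exp_conj]
  simp

theorem zInt_conj {lam : ℝ} {h : ℂ → ℂ}
    (hh : ∀ z, h ((starRingEnd ℂ) z) = (starRingEnd ℂ) (h z)) (z : ℂ) :
    zInt lam h ((starRingEnd ℂ) z) = (starRingEnd ℂ) (zInt lam h z) := by
  rw [zInt, zInt, hh, phase_conj, map_mul, ← Complex.exp_conj]
  simp

theorem wInt_conj {lam : ℝ} {h : ℂ → ℂ}
    (hh : ∀ z, h ((starRingEnd ℂ) z) = (starRingEnd ℂ) (h z)) (z : ℂ) :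
    wInt lam h ((starRingEnd ℂ) z) = (starRingEnd ℂ) (wInt lam h z) := by
  rw [wInt, wInt, hh, phase_conj, map_mul, ← Complex.exp_conj]
  simp

/-- The lower rays at iy contribute the negative conjugate of the upper rays at -iy. The factor i in
dζ turns this minus into a plus, and integrating over all y leaves twice a real part. -/
theorem kernelInt_eq {lam : ℝ} (hl : 0 < lam) (τ₁ τ₂ u v : ℝ) :
    kernelInt lam τ₁ τ₂ u v = (2 * (poleInt lam (baseZ τ₂ v) (baseW τ₁ u) 0 rayNE weightNE
      + poleInt lam (baseZ τ₂ v) (baseW τ₁ u) 0 wPath weightNW).re : ℝ) := by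
  set K := max (|v| + |τ₂|) (|u| + |τ₁|)
  have gz : GaussianGrowth K (baseZ τ₂ v) := gaussianGrowth_baseZ (le_max_left _ _)
  have gw : GaussianGrowth K (baseW τ₁ u) := gaussianGrowth_baseW (le_max_right _ _)
  set F : ℂ → ℂ → ℂ := fun z w =>
    zInt lam (baseZ τ₂ v) z * wInt lam (baseW τ₁ u) w * (1 / (z - w)) with hF
  have hconj : ∀ z w, F z ((starRingEnd ℂ) w) = (starRingEnd ℂ) (F ((starRingEnd ℂ) z) w) := by
    intro z w
    simp only [hF]
    rw [zInt_conj (baseZ_conj τ₂ v), wInt_conj (baseW_conj τ₁ u)]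
    simp
  have i1 := cornerSeparated_rayNE.integrable hl gz gw
  have i2 := (cornerSeparated_wPath_zero measurable_weightNW norm_weightNW_le).integrable hl gz gw
  set Y : ℝ → ℂ := fun y => ((∫ t : ℝ, F (y * Complex.I) (rayNE t) * weightNE t)
    + ∫ t : ℝ, F (y * Complex.I) (wPath t) * weightNW t) * Complex.I with hY
  have e : ∀ (γ c : ℝ → ℂ) (y : ℝ), (∫ t : ℝ, (zInt lam (baseZ τ₂ v) (vLine 0 y) * Complex.I) *
      (wInt lam (baseW τ₁ u) (γ t) * c t) * (1 / (vLine 0 y - γ t)))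
      = (∫ t : ℝ, F (y * Complex.I) (γ t) * c t) * Complex.I := by
    intro γ c y
    rw [← integral_mul_const]
    refine integral_congr_ae (Eventually.of_forall fun t => ?_)
    have : vLine 0 y = y * Complex.I := by simp [vLine]
    simp only [hF, this]
    ring
  have hX : poleInt lam (baseZ τ₂ v) (baseW τ₁ u) 0 rayNE weightNE
      + poleInt lam (baseZ τ₂ v) (baseW τ₁ u) 0 wPath weightNW = ∫ y, Y y := by
    rw [poleInt, poleInt, integral_prod _ i1, integral_prod _ i2,
      ← integral_add i1.integral_prod_left i2.integral_prod_left]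
    refine integral_congr_ae (Eventually.of_forall fun y => ?_)
    simp only [e, hY]
    ring
  have hYi : Integrable Y := by
    refine (i1.integral_prod_left.add i2.integral_prod_left).congr (Eventually.of_forall fun y => ?_)
    simp only [Pi.add_apply, e, hY]
    ring
  have hk : kernelInt lam τ₁ τ₂ u v = ∫ y, (Y y + (starRingEnd ℂ) (Y (-y))) := by
    rw [kernelInt, imaginaryAxisIntegral]
    refine integral_congr_ae (Eventually.of_forall fun y => ?_)
    have h1 := pearceyContourIntegral_eq hconj (y * Complex.I)
    have h2 : (starRingEnd ℂ) ((y : ℂ) * Complex.I) = ((-y : ℝ) : ℂ) * Complex.I := by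
      simp
    rw [h2] at h1
    simp only [hF] at h1 ⊢
    rw [h1]
    simp only [hY, map_mul, Complex.conj_I, hF]
    ring
  have hc : Integrable fun y => (starRingEnd ℂ) (Y (-y)) :=
    (Complex.conjCLE.integrable_comp_iff.2 hYi.comp_neg)
  rw [hk, integral_add hYi hc, integral_conj, integral_neg_eq_self Y, hX, Complex.add_conj]

/-- The main term of the sine kernel comes from the residues on the segment. -/
theorem segmentIntegral_conj_saddlePt {h : ℂ → ℂ} (hd : Differentiable ℂ h)
    (hconj : ∀ z, h ((starRingEnd ℂ) z) = (starRingEnd ℂ) (h z)) :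
    segmentIntegral ((starRingEnd ℂ) saddlePt) saddlePt h =
      (∫ t in (0 : ℝ)..1, h (t * saddlePt) * saddlePt)
        - (starRingEnd ℂ) (∫ t in (0 : ℝ)..1, h (t * saddlePt) * saddlePt) := by
  obtain ⟨E, hE'⟩ := hd.isExactOn_univ
  have hE : ∀ z, HasDerivAt E (h z) z := fun z => hE' z trivial
  have hc := hd.continuous
  have h1 := integral_segment_eq_sub hE hc ((starRingEnd ℂ) saddlePt)
    (saddlePt - (starRingEnd ℂ) saddlePt) 0 1
  have h2 := integral_segment_eq_sub hE hc 0 saddlePt 0 1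
  have h3 := integral_segment_eq_sub hE hc 0 ((starRingEnd ℂ) saddlePt) 0 1
  simp only [zero_add, Complex.ofReal_one, one_mul, Complex.ofReal_zero, zero_mul, add_zero,
    add_sub_cancel] at h1 h2 h3
  have h4 : (starRingEnd ℂ) (∫ t in (0 : ℝ)..1, h (t * saddlePt) * saddlePt)
      = ∫ t in (0 : ℝ)..1, h (t * (starRingEnd ℂ) saddlePt) * (starRingEnd ℂ) saddlePt := by
    rw [intervalIntegral.integral_of_le zero_le_one, intervalIntegral.integral_of_le zero_le_one,
      ← integral_conj]
    refine integral_congr_ae (Eventually.of_forall fun t => ?_)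
    simp only [map_mul, ← hconj, Complex.conj_ofReal]
  rw [h4, h2, h3, segmentIntegral, h1]
  ring

/-- The rescaled Pearcey kernel, the sine kernel and the double integral through the saddle
points. -/
theorem rescaledPearceyKernel_sub_sineKernelS2 {a : ℝ} (ha : 0 < a) (τ₁ τ₂ u v : ℝ) :
    rescaledPearceyKernel a τ₁ τ₂ u v - sineKernelS2 τ₁ τ₂ u v =
      1 / (2 * Real.pi * Complex.I) ^ 2 * (2 * (poleInt (a ^ (4 / 3 : ℝ)) (baseZ τ₂ v) (baseW τ₁ u)
        (1 / 2) wPath wWeight).re : ℝ) := by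
  set K := max (|v| + |τ₂|) (|u| + |τ₁|)
  have gz : GaussianGrowth K (baseZ τ₂ v) := gaussianGrowth_baseZ (le_max_left _ _)
  have gw : GaussianGrowth K (baseW τ₁ u) := gaussianGrowth_baseW (le_max_right _ _)
  have hl : 0 < a ^ (4 / 3 : ℝ) := Real.rpow_pos_of_pos ha _
  set X₁ := poleInt (a ^ (4 / 3 : ℝ)) (baseZ τ₂ v) (baseW τ₁ u) (1 / 2) wPath wWeight
  set Q := ∫ t in (0 : ℝ)..1, baseZ τ₂ v (t * saddlePt) * baseW τ₁ u (t * saddlePt) * saddlePt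
    with hQ
  have h1 := poleInt_rayNE_add hl gz gw
  have h2 := poleInt_seg_sub hl gz gw
  have h3 : segmentIntegral (Complex.exp (-(Real.pi / 3) * Complex.I))
        (Complex.exp (Real.pi / 3 * Complex.I))
        (fun ω => Complex.exp ((τ₁ - τ₂) * ω ^ 2 + (u - v) * ω)) = Q - (starRingEnd ℂ) Q := by
    have e1 : Complex.exp (-(Real.pi / 3) * Complex.I) = (starRingEnd ℂ) saddlePt := by
      rw [saddlePt, ← Complex.exp_conj]
      simp [map_ofNat]
    have e2 : (fun ω : ℂ => Complex.exp ((τ₁ - τ₂) * ω ^ 2 + (u - v) * ω))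
        = fun w => baseZ τ₂ v w * baseW τ₁ u w := by
      ext w
      rw [baseZ, baseW, ← Complex.exp_add]
      congr 1
      ring
    rw [e1, e2, hQ]
    refine segmentIntegral_conj_saddlePt (gz.differentiable.mul gw.differentiable) fun z => ?_
    rw [baseZ_conj, baseW_conj, map_mul]
  have h4 : poleInt (a ^ (4 / 3 : ℝ)) (baseZ τ₂ v) (baseW τ₁ u) 0 rayNE weightNE
      + poleInt (a ^ (4 / 3 : ℝ)) (baseZ τ₂ v) (baseW τ₁ u) 0 wPath weightNW
      = X₁ + 2 * Real.pi * Complex.I * Q := by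
    linear_combination h1 - h2
  -- Twice the real part of 2πiQ is 2πi(Q - Q̄), which is 2πi times the integral from p̄ to p. This
  -- produces the sine kernel, while the Gaussian corrections of the two kernels coincide.
  have h5 : ((2 * (X₁ + 2 * Real.pi * Complex.I * Q).re : ℝ) : ℂ)
      = (2 * X₁.re : ℝ) + 2 * Real.pi * Complex.I * (Q - (starRingEnd ℂ) Q) := by
    rw [← Complex.add_conj, ← Complex.add_conj]
    simp only [map_add, map_mul, Complex.conj_ofReal, Complex.conj_I, map_ofNat]
    ring
  have hpi : (2 * Real.pi * Complex.I : ℂ) ≠ 0 := Complex.two_pi_I_ne_zero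
  rw [rescaledPearceyKernel_eq ha, sineKernelS2, kernelInt_eq hl, h4, h5, h3]
  field_simp
  ring

/-! ### The double integral through the saddle points as an integral over the parameter -/

theorem norm_pow_le_sq {z : ℂ} {n : ℕ} (hn : n ≤ 3) : ‖z‖ ^ n ≤ (1 + ‖z‖ ^ 2) ^ 2 := by
  have h0 := norm_nonneg z
  have h4 : ‖z‖ ^ n ≤ 1 + ‖z‖ ^ 4 := by
    rcases le_total ‖z‖ 1 with h | h
    · have := pow_le_one₀ (n := n) h0 h
      have := pow_nonneg h0 4
      linarith
    · have := pow_le_pow_right₀ h (show n ≤ 4 by omega)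
      linarith
  nlinarith [sq_nonneg ‖z‖]

/-- The polynomial factors from `phase_sub_phase` cost only 2 in the growth constant, by (1+x)² ≤
e^{2x} with x = 1 + ‖z‖². -/
theorem GaussianGrowth.mul_of_norm_le {K : ℝ} {h q : ℂ → ℂ} (hh : GaussianGrowth K h)
    (hq : Differentiable ℂ q) (hb : ∀ z, ‖q z‖ ≤ (1 + (1 + ‖z‖ ^ 2)) ^ 2) :
    GaussianGrowth (2 + K) (fun z => q z * h z) where
  differentiable := hq.mul hh.differentiable
  norm_le z := by
    rw [norm_mul, add_mul, Real.exp_add]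
    refine mul_le_mul ((hb z).trans ?_) (hh.norm_le z) (norm_nonneg _) (Real.exp_pos _).le
    have h1 := Real.add_one_le_exp (1 + ‖z‖ ^ 2)
    have h2 : Real.exp (2 * (1 + ‖z‖ ^ 2)) = Real.exp (1 + ‖z‖ ^ 2) ^ 2 := by
      rw [← Real.exp_nat_mul]
      norm_num
    rw [h2]
    exact pow_le_pow_left₀ (by positivity) (by linarith) 2

theorem differentiable_phaseCoeff (j : Fin 4) : Differentiable ℂ (phaseCoeff j) := by
  unfold phaseCoeff
  fin_cases j <;> simp

theorem norm_phaseCoeff_le (j : Fin 4) (z : ℂ) : ‖phaseCoeff j z‖ ≤ (1 + (1 + ‖z‖ ^ 2)) ^ 2 := by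
  have hp : ∀ n ≤ 3, ‖z ^ n / 4‖ ≤ (1 + ‖z‖ ^ 2) ^ 2 := by
    intro n hn
    have h1 := norm_pow_le_sq (z := z) hn
    rw [norm_div, norm_pow]
    norm_num
    have : 0 ≤ ‖z‖ ^ n := by positivity
    linarith
  have h2 : (1 + ‖z‖ ^ 2) ^ 2 + 1 ≤ (1 + (1 + ‖z‖ ^ 2)) ^ 2 := by nlinarith [sq_nonneg ‖z‖]
  fin_cases j <;> simp only [phaseCoeff, Fin.zero_eta, Fin.mk_one, Fin.reduceFinMk,
    Matrix.cons_val]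
  · have := norm_add_le 1 (z ^ 3 / 4)
    rw [norm_one] at this
    linarith [hp 3 le_rfl]
  · linarith [hp 2 (by norm_num)]
  · have := hp 1 (by norm_num)
    rw [pow_one] at this
    linarith
  · have := hp 0 (by norm_num)
    rw [pow_zero] at this
    linarith

theorem gaussianGrowth_ampZ {K τ v : ℝ} (h : |v| + |τ| ≤ K) (j : Fin 4) :
    GaussianGrowth (2 + K) (ampZ τ v j) :=
  (gaussianGrowth_baseZ h).mul_of_norm_le (differentiable_phaseCoeff j) (norm_phaseCoeff_le j)

theorem gaussianGrowth_ampW {K τ u : ℝ} (h : |u| + |τ| ≤ K) (j : Fin 4) :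
    GaussianGrowth (2 + K) (ampW τ u j) := by
  refine (gaussianGrowth_baseW h).mul_of_norm_le (by fun_prop) fun z => ?_
  rw [norm_pow]
  have := norm_pow_le_sq (z := z) (n := j) (by omega)
  nlinarith [sq_nonneg ‖z‖]

theorem ampZ_conj (τ v : ℝ) (j : Fin 4) (z : ℂ) :
    ampZ τ v j ((starRingEnd ℂ) z) = (starRingEnd ℂ) (ampZ τ v j z) := by
  have h1 : phaseCoeff j ((starRingEnd ℂ) z) = (starRingEnd ℂ) (phaseCoeff j z) := by
    fin_cases j <;> simp [phaseCoeff, map_ofNat]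
  have h2 := baseZ_conj τ v z
  rw [baseZ, baseZ] at h2
  rw [ampZ, ampZ, h1, h2, map_mul]

/-- The upper half of the `ζ`-integral with amplitude `ampZ τ v j`. -/
noncomputable def zSaddleInt (τ v : ℝ) (j : Fin 4) (m : ℝ) : ℂ :=
  ∫ t, zInt m (ampZ τ v j) (zPath t) * zWeight t

/-- The `ω`-integral with amplitude `ampW τ u j`. -/
noncomputable def wSaddleInt (τ u : ℝ) (j : Fin 4) (m : ℝ) : ℂ :=
  ∫ t, wInt m (ampW τ u j) (wPath t) * wWeight t

theorem cornerSeparated_wWeight : CornerSeparated (1 / 2) wPath wWeight :=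
  cornerSeparated_wPath_half measurable_wWeight fun t => (norm_wWeight t).le

theorem phase_wPath_re_lt {t : ℝ} (ht : t ≠ 0) : (phase (wPath t)).re < 3 / 8 := by
  have h1 := phase_wPath_gap t
  rw [phase_saddlePt_re] at h1
  have : 0 < min (3 / 16 * t ^ 2) (3 / 8) := lt_min (by positivity) (by norm_num)
  linarith

theorem phase_vLine_half_re (y : ℝ) : 3 / 8 ≤ (phase (vLine (1 / 2) y)).re := by
  have h1 := phase_zPath_re (y - Real.sqrt 3 / 2)
  have e : zPath (y - Real.sqrt 3 / 2) = vLine (1 / 2) y := by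
    rw [zPath, vLine, saddlePt_eq]
    push_cast
    ring
  rw [e] at h1
  rw [h1]
  have := sq_nonneg ((y - Real.sqrt 3 / 2) * (y - Real.sqrt 3 / 2 + Real.sqrt 3))
  linarith

/-- On the line Re f ≥ 3/8, and on the path Re f < 3/8 except at p, so `integral_pairing` applies
with the phases f(z) and f(w), and `phase_sub_phase` supplies the four products. The integral over
the full line is that over its upper half minus the conjugate. -/
theorem integral_saddleInt {lam : ℝ} (hl : 0 < lam) (τ₁ τ₂ u v : ℝ) :
    (∀ Lam : ℝ, lam ≤ Lam → IntervalIntegrable (fun m : ℝ => ∑ j : Fin 4,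
      (zSaddleInt τ₂ v j m - (starRingEnd ℂ) (zSaddleInt τ₂ v j m)) * wSaddleInt τ₁ u j m)
        volume lam Lam) ∧
    Tendsto (fun Lam : ℝ => ∫ m in lam..Lam, ∑ j : Fin 4,
      (zSaddleInt τ₂ v j m - (starRingEnd ℂ) (zSaddleInt τ₂ v j m)) * wSaddleInt τ₁ u j m) atTop
      (𝓝 (poleInt lam (baseZ τ₂ v) (baseW τ₁ u) (1 / 2) wPath wWeight)) := by
  set K := max (|v| + |τ₂|) (|u| + |τ₁|)
  have gz : GaussianGrowth K (baseZ τ₂ v) := gaussianGrowth_baseZ (le_max_left _ _)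
  have gw : GaussianGrowth K (baseW τ₁ u) := gaussianGrowth_baseW (le_max_right _ _)
  have gaz : ∀ j, GaussianGrowth (2 + K) (ampZ τ₂ v j) := gaussianGrowth_ampZ (le_max_left _ _)
  have gaw : ∀ j, GaussianGrowth (2 + K) (ampW τ₁ u j) := gaussianGrowth_ampW (le_max_right _ _)
  have hb1 : |(1 / 2 : ℝ)| ≤ 1 := by norm_num [abs_of_pos]
  have hm := (continuous_vLine (1 / 2)).measurable
  have hm' := measurable_wPath
  have hm2 := measurable_wWeight
  have hz' := gz.differentiable.continuous.measurable
  have hw' := gw.differentiable.continuous.measurable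
  have hp := measurable_phase
  have hpc := fun j => (differentiable_phaseCoeff j).continuous.measurable
  have ez : ∀ (m : ℝ) (j : Fin 4) (y : ℝ), baseZ τ₂ v (vLine (1 / 2) y) * Complex.I *
      phaseCoeff j (vLine (1 / 2) y) * Complex.exp (-m * phase (vLine (1 / 2) y))
      = zInt m (ampZ τ₂ v j) (vLine (1 / 2) y) * Complex.I := by
    intro m j y
    rw [zInt, ampZ, baseZ]
    ring
  have ew : ∀ (m : ℝ) (j : Fin 4) (t : ℝ), baseW τ₁ u (wPath t) * wWeight t *
      wPath t ^ (j : ℕ) * Complex.exp (m * phase (wPath t))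
      = wInt m (ampW τ₁ u j) (wPath t) * wWeight t := by
    intro m j t
    rw [wInt, ampW, baseW]
    ring
  have eF : ∀ x : ℝ × ℝ, (zInt lam (baseZ τ₂ v) (vLine (1 / 2) x.1) * Complex.I) *
      (wInt lam (baseW τ₁ u) (wPath x.2) * wWeight x.2) * (1 / (vLine (1 / 2) x.1 - wPath x.2))
      = baseZ τ₂ v (vLine (1 / 2) x.1) * Complex.I * (baseW τ₁ u (wPath x.2) * wWeight x.2) *
        (1 / (vLine (1 / 2) x.1 - wPath x.2)) *
        Complex.exp (-lam * (phase (vLine (1 / 2) x.1) - phase (wPath x.2))) := by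
    intro x
    have : Complex.exp (-lam * (phase (vLine (1 / 2) x.1) - phase (wPath x.2)))
        = Complex.exp (-lam * phase (vLine (1 / 2) x.1)) *
          Complex.exp (lam * phase (wPath x.2)) := by
      rw [← Complex.exp_add]
      congr 1
      ring
    rw [this, zInt, wInt]
    ring
  have hint := cornerSeparated_wWeight.integrable hl gz gw
  simp only [eF] at hint
  have key := integral_pairing (μ := volume) (ν := volume) Finset.univ (lam := lam)
    (A := fun y => baseZ τ₂ v (vLine (1 / 2) y) * Complex.I)
    (p := fun y => phase (vLine (1 / 2) y))
    (B := fun t => baseW τ₁ u (wPath t) * wWeight t) (q := fun t => phase (wPath t))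
    (κ := fun x => 1 / (vLine (1 / 2) x.1 - wPath x.2))
    (a := fun (j : Fin 4) y => phaseCoeff j (vLine (1 / 2) y))
    (b := fun j t => wPath t ^ (j : ℕ))
    (by fun_prop) (by fun_prop) (by fun_prop) (by fun_prop) (by fun_prop)
    (fun j => (hpc j).comp hm) (by fun_prop) hint ?_ ?_ ?_
  · simp only [ez, ew] at key
    simp only [← eF] at key
    have e : ∀ Lam, lam ≤ Lam → ∀ m ∈ Set.uIcc lam Lam, ∑ j,
        (∫ y, zInt m (ampZ τ₂ v j) (vLine (1 / 2) y) * Complex.I) *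
          (∫ t, wInt m (ampW τ₁ u j) (wPath t) * wWeight t) = ∑ j,
        (zSaddleInt τ₂ v j m - (starRingEnd ℂ) (zSaddleInt τ₂ v j m)) * wSaddleInt τ₁ u j m := by
      intro Lam hL m hm
      rw [Set.uIcc_of_le hL] at hm
      refine Finset.sum_congr rfl fun j _ => ?_
      rw [zSaddleInt, ← integral_zInt_eq_sub_conj (hl.trans_le hm.1) (gaz j) (ampZ_conj τ₂ v j),
        wSaddleInt]
      rfl
    refine ⟨fun Lam hL => (key.1 Lam hL).congr fun m hm => e Lam hL m (Set.uIoc_subset_uIcc hm),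
      key.2.congr' ?_⟩
    filter_upwards [eventually_ge_atTop lam] with Lam hL
    exact intervalIntegral.integral_congr (e Lam hL)
  · have h0 : ∀ᵐ t : ℝ, t ≠ 0 := Measure.ae_ne volume 0
    filter_upwards [Measure.quasiMeasurePreserving_snd.ae h0] with x hx _
    have h1 := phase_wPath_re_lt hx
    have h2 := phase_vLine_half_re x.1
    have h3 : 0 < (phase (vLine (1 / 2) x.1) - phase (wPath x.2)).re := by
      rw [Complex.sub_re]
      linarith
    refine ⟨h3, ?_⟩
    have h4 : vLine (1 / 2) x.1 - wPath x.2 ≠ 0 := by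
      intro h
      rw [sub_eq_zero.1 h, sub_self] at h3
      simp at h3
    rw [phase_sub_phase]
    field_simp
  · intro m hlm j _
    simp only [ez]
    exact integrable_zInt_vLine (hl.trans_le hlm) hb1 (gaz j)
  · intro m hlm j _
    simp only [ew]
    exact cornerSeparated_wWeight.decay.integrable (hl.trans_le hlm) (gaw j)

/-! ### The integrals `B_{k,l}` -/

theorem integrable_pow_mul_exp_neg_sq (k : ℕ) {m : ℝ} (hm : 0 < m) :
    Integrable fun x : ℝ => (x : ℂ) ^ k * Complex.exp (-m * (x : ℂ) ^ 2) := by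
  have := (integrable_exp_neg_mul_sq_mul_pow hm k).ofReal (𝕜 := ℂ)
  refine this.congr (Eventually.of_forall fun x => ?_)
  simp only [Complex.coe_algebraMap]
  push_cast
  ring

theorem exists_pow_mul_exp_neg_sq_le (k : ℕ) :
    ∃ M : ℝ, ∀ x : ℝ, ‖(x : ℂ) ^ k * Complex.exp (-1 * (x : ℂ) ^ 2)‖ ≤ M := by
  refine ⟨1 + k.factorial, fun x => ?_⟩
  have h0 : -1 * (x : ℂ) ^ 2 = ((-x ^ 2 : ℝ) : ℂ) := by
    push_cast
    ring
  rw [h0, norm_mul, norm_pow, Complex.norm_real, Complex.norm_exp_ofReal, Real.norm_eq_abs,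
    Real.exp_neg, ← div_eq_mul_inv, div_le_iff₀ (Real.exp_pos _)]
  have h1 : |x| ^ k ≤ 1 + (x ^ 2) ^ k := by
    rw [← sq_abs, ← pow_mul]
    rcases le_total |x| 1 with h | h
    · have := pow_le_one₀ (n := k) (abs_nonneg x) h
      have : 0 ≤ |x| ^ (2 * k) := by positivity
      linarith
    · have := pow_le_pow_right₀ h (show k ≤ 2 * k by omega)
      linarith
  have h2 := Real.pow_div_factorial_le_exp _ (sq_nonneg x) k
  rw [div_le_iff₀ (by positivity)] at h2
  have h3 := Real.one_le_exp (sq_nonneg x)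
  linarith

theorem integral_pow_mul_exp_neg_sq_even {m : ℝ} (hm : 0 < m) (n : ℕ) :
    ∫ x : ℝ, (x : ℂ) ^ (2 * n) * Complex.exp (-m * (x : ℂ) ^ 2)
      = ((Real.Gamma (n + 1 / 2) * m ^ (-((n : ℝ) + 1 / 2)) : ℝ) : ℂ) := by
  rw [← integral_exp_neg_mul_sq_mul_pow_even hm n, ← integral_complex_ofReal]
  refine integral_congr_ae (Eventually.of_forall fun x => ?_)
  push_cast
  ring

theorem integral_pow_mul_exp_neg_sq_odd (m : ℝ) (n : ℕ) :
    ∫ x : ℝ, (x : ℂ) ^ (2 * n + 1) * Complex.exp (-m * (x : ℂ) ^ 2) = 0 := by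
  rw [← Complex.ofReal_zero, ← integral_exp_neg_mul_sq_mul_pow_odd m n, ← integral_complex_ofReal]
  refine integral_congr_ae (Eventually.of_forall fun x => ?_)
  push_cast
  ring

/-- The same device for the model integral: (x² + y²)/(x - iy) = x + iy is a sum of two products,
and the Gaussian weight corresponds to the parameter value 1. -/
theorem tendsto_BCoeff (k l : ℕ) :
    Tendsto (fun Lam : ℝ => ∫ m in (1 : ℝ)..Lam,
      ((∫ x : ℝ, (x : ℂ) ^ (k + 1) * Complex.exp (-m * (x : ℂ) ^ 2)) *
        (∫ y : ℝ, (y : ℂ) ^ l * Complex.exp (-m * (y : ℂ) ^ 2)) +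
      Complex.I * (∫ x : ℝ, (x : ℂ) ^ k * Complex.exp (-m * (x : ℂ) ^ 2)) *
        (∫ y : ℝ, (y : ℂ) ^ (l + 1) * Complex.exp (-m * (y : ℂ) ^ 2)))) atTop
      (𝓝 (BCoeff k l)) := by
  obtain ⟨M, hM⟩ := exists_pow_mul_exp_neg_sq_le k
  obtain ⟨M', hM'⟩ := exists_pow_mul_exp_neg_sq_le l
  have i1 := fun k => integrable_pow_mul_exp_neg_sq k one_pos
  push_cast at i1
  have hint := integrable_mul_kernel (i1 k) hM (i1 l) hM'
    (κ := fun x => 1 / ((x.1 : ℂ) - Complex.I * x.2)) (by fun_prop) (C := 1) (y₀ := 0) (t₀ := 0)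
    (fun y t _ _ => ?_)
  swap
  · have h1 : ‖(y : ℂ) - Complex.I * t‖ ^ 2 = y ^ 2 + t ^ 2 := by
      rw [Complex.sq_norm, Complex.normSq_apply]
      simp
      ring
    rw [norm_div, norm_one, div_pow, one_pow, mul_one_div, h1, sub_zero, sub_zero]
    refine div_le_of_le_mul₀ (by positivity) zero_le_one ?_
    have := sq_nonneg (|y| - |t|)
    rw [sub_sq, sq_abs, sq_abs] at this
    nlinarith [mul_nonneg (abs_nonneg y) (abs_nonneg t)]
  have e1 : ∀ x : ℝ × ℝ, (x.1 : ℂ) ^ k * Complex.exp (-1 * (x.1 : ℂ) ^ 2) *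
      ((x.2 : ℂ) ^ l * Complex.exp (-1 * (x.2 : ℂ) ^ 2)) * (1 / ((x.1 : ℂ) - Complex.I * x.2)) =
      (x.1 : ℂ) ^ k * (x.2 : ℂ) ^ l * (1 / ((x.1 : ℂ) - Complex.I * x.2)) *
        Complex.exp (-1 * ((x.1 : ℂ) ^ 2 - -(x.2 : ℂ) ^ 2)) := by
    intro x
    have : Complex.exp (-1 * ((x.1 : ℂ) ^ 2 - -(x.2 : ℂ) ^ 2))
        = Complex.exp (-1 * (x.1 : ℂ) ^ 2) * Complex.exp (-1 * (x.2 : ℂ) ^ 2) := by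
      rw [← Complex.exp_add]
      congr 1
      ring
    rw [this]
    ring
  have hB : BCoeff k l = ∫ x : ℝ × ℝ, (x.1 : ℂ) ^ k * (x.2 : ℂ) ^ l *
      (1 / ((x.1 : ℂ) - Complex.I * x.2)) *
        Complex.exp (-1 * ((x.1 : ℂ) ^ 2 - -(x.2 : ℂ) ^ 2)) ∂volume.prod volume := by
    simp only [e1] at hint
    rw [integral_prod _ hint, BCoeff]
    refine integral_congr_ae (Eventually.of_forall fun x => ?_)
    refine integral_congr_ae (Eventually.of_forall fun y => ?_)
    simp only
    rw [mul_one_div, show -((x : ℂ) ^ 2 + (y : ℂ) ^ 2) = -1 * ((x : ℂ) ^ 2 - -(y : ℂ) ^ 2) by ring]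
    ring
  have key := (integral_pairing (μ := volume) (ν := volume) (Finset.univ : Finset (Fin 2))
    (lam := 1) (A := fun x : ℝ => (x : ℂ) ^ k) (p := fun x => (x : ℂ) ^ 2)
    (B := fun y : ℝ => (y : ℂ) ^ l) (q := fun y => -(y : ℂ) ^ 2)
    (κ := fun x => 1 / ((x.1 : ℂ) - Complex.I * x.2))
    (a := ![fun x => (x : ℂ), fun _ => 1]) (b := ![fun _ => 1, fun y => Complex.I * y])
    (by fun_prop) (by fun_prop) (by fun_prop) (by fun_prop) (by fun_prop)
    (fun j => by fin_cases j <;> simp <;> fun_prop) (fun j => by fin_cases j <;> simp <;> fun_prop)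
    (by simpa only [e1, Complex.ofReal_one] using hint) ?_ ?_ ?_).2
  · rw [Complex.ofReal_one, ← hB] at key
    refine key.congr fun Lam => intervalIntegral.integral_congr fun m _ => ?_
    rw [Fin.sum_univ_two]
    simp only [Matrix.cons_val_zero, Matrix.cons_val_one, mul_one, mul_neg, neg_mul]
    simp only [pow_succ _ k, pow_succ _ l]
    have e : ∀ y : ℝ, (y : ℂ) ^ l * (Complex.I * y) * Complex.exp (-(m * (y : ℂ) ^ 2))
        = Complex.I * ((y : ℂ) ^ l * y * Complex.exp (-(m * (y : ℂ) ^ 2))) := fun y => by ring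
    simp only [e, integral_const_mul]
    ring
  · have h0 : ∀ᵐ t : ℝ, t ≠ 0 := Measure.ae_ne volume 0
    filter_upwards [Measure.quasiMeasurePreserving_snd.ae h0] with x hx _
    have h3 : ((x.1 : ℂ) ^ 2 - -(x.2 : ℂ) ^ 2).re = x.1 ^ 2 + x.2 ^ 2 := by
      rw [sub_neg_eq_add, ← Complex.ofReal_pow, ← Complex.ofReal_pow, ← Complex.ofReal_add,
        Complex.ofReal_re]
    refine ⟨by rw [h3]; positivity, ?_⟩
    have h4 : (x.1 : ℂ) - Complex.I * x.2 ≠ 0 := by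
      intro h
      have := congrArg Complex.im h
      simp at this
      exact hx this
    rw [Fin.sum_univ_two]
    simp only [Matrix.cons_val_zero, Matrix.cons_val_one, mul_one, one_mul]
    rw [mul_one_div, div_eq_iff h4]
    linear_combination (x.2 : ℂ) ^ 2 * Complex.I_sq
  · intro m hm j _
    have hm0 : 0 < m := by linarith
    fin_cases j
    · refine (integrable_pow_mul_exp_neg_sq (k + 1) hm0).congr (Eventually.of_forall fun x => ?_)
      simp [pow_succ]
    · refine (integrable_pow_mul_exp_neg_sq k hm0).congr (Eventually.of_forall fun x => ?_)
      simp
  · intro m hm j _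
    have hm0 : 0 < m := by linarith
    fin_cases j
    · refine (integrable_pow_mul_exp_neg_sq l hm0).congr (Eventually.of_forall fun x => ?_)
      simp
    · refine ((integrable_pow_mul_exp_neg_sq (l + 1) hm0).const_mul Complex.I).congr
        (Eventually.of_forall fun x => ?_)
      simp [pow_succ]
      ring

theorem tendsto_integral_rpow_neg (n : ℕ) :
    Tendsto (fun Lam : ℝ => ∫ m in (1 : ℝ)..Lam, m ^ (-((n : ℝ) + 2))) atTop
      (𝓝 (1 / ((n : ℝ) + 1))) := by
  have h0 : (n : ℝ) + 1 ≠ 0 := by positivity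
  have h1 := intervalIntegral_tendsto_integral_Ioi 1
    (integrableOn_Ioi_rpow_of_lt (a := -((n : ℝ) + 2)) (by linarith [n.cast_nonneg (α := ℝ)])
      one_pos) tendsto_id
  rw [integral_Ioi_rpow_of_lt (by linarith [n.cast_nonneg (α := ℝ)]) one_pos, Real.one_rpow] at h1
  rwa [show -((n : ℝ) + 2) + 1 = -((n : ℝ) + 1) by ring, neg_div_neg_eq] at h1

/-- By parity only the product carrying the factor x survives. Its Gaussian moments scale like
m^{-(n+r+2)}, whose integral over [1, ∞) is 1/(n+r+1). -/
theorem BCoeff_odd_even (n r : ℕ) : BCoeff (2 * n + 1) (2 * r) =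
    ((Real.Gamma ((n + 1 : ℕ) + 1 / 2) * Real.Gamma (r + 1 / 2) / ((n + r : ℕ) + 1) : ℝ) : ℂ) := by
  have h1 := tendsto_BCoeff (2 * n + 1) (2 * r)
  have h2 := (Complex.continuous_ofReal.tendsto _).comp ((tendsto_integral_rpow_neg (n + r)).const_mul
    (Real.Gamma ((n + 1 : ℕ) + 1 / 2) * Real.Gamma (r + 1 / 2)))
  rw [mul_one_div] at h2
  refine tendsto_nhds_unique h1 (h2.congr' ?_)
  filter_upwards [eventually_ge_atTop 1] with Lam hL
  rw [Function.comp_apply, ← intervalIntegral.integral_const_mul, ← intervalIntegral.integral_ofReal]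
  refine intervalIntegral.integral_congr fun m hm => ?_
  rw [Set.uIcc_of_le hL] at hm
  have hm0 : 0 < m := by linarith [hm.1]
  rw [show 2 * n + 1 + 1 = 2 * (n + 1) by ring, integral_pow_mul_exp_neg_sq_even hm0,
    integral_pow_mul_exp_neg_sq_even hm0, integral_pow_mul_exp_neg_sq_odd, mul_zero, zero_mul,
    add_zero, ← Complex.ofReal_mul]
  have : m ^ (-(((n + r : ℕ) : ℝ) + 2)) = m ^ (-(((n + 1 : ℕ) : ℝ) + 1 / 2)) *
      m ^ (-((r : ℝ) + 1 / 2)) := by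
    rw [← Real.rpow_add hm0]
    congr 1
    push_cast
    ring
  rw [this]
  congr 1
  ring

theorem BCoeff_even_odd (n r : ℕ) : BCoeff (2 * n) (2 * r + 1) = Complex.I *
    ((Real.Gamma (n + 1 / 2) * Real.Gamma ((r + 1 : ℕ) + 1 / 2) / ((n + r : ℕ) + 1) : ℝ) : ℂ) := by
  have h1 := tendsto_BCoeff (2 * n) (2 * r + 1)
  have h2 := ((Complex.continuous_ofReal.tendsto _).comp
    ((tendsto_integral_rpow_neg (n + r)).const_mul
    (Real.Gamma (n + 1 / 2) * Real.Gamma ((r + 1 : ℕ) + 1 / 2)))).const_mul Complex.I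
  rw [mul_one_div] at h2
  refine tendsto_nhds_unique h1 (h2.congr' ?_)
  filter_upwards [eventually_ge_atTop 1] with Lam hL
  rw [Function.comp_apply, ← intervalIntegral.integral_const_mul,
    ← intervalIntegral.integral_ofReal, ← intervalIntegral.integral_const_mul]
  refine intervalIntegral.integral_congr fun m hm => ?_
  rw [Set.uIcc_of_le hL] at hm
  have hm0 : 0 < m := by linarith [hm.1]
  rw [show 2 * r + 1 + 1 = 2 * (r + 1) by ring, integral_pow_mul_exp_neg_sq_even hm0,
    integral_pow_mul_exp_neg_sq_even hm0, integral_pow_mul_exp_neg_sq_odd, zero_mul,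
    zero_add, mul_assoc Complex.I, ← Complex.ofReal_mul]
  have : m ^ (-(((n + r : ℕ) : ℝ) + 2)) = m ^ (-((n : ℝ) + 1 / 2)) *
      m ^ (-(((r + 1 : ℕ) : ℝ) + 1 / 2)) := by
    rw [← Real.rpow_add hm0]
    congr 1
    push_cast
    ring
  rw [this]
  congr 2
  ring

/-! ### Recursions for the coefficient sums -/

/-- `∑_{n+r=ν} f(2n,2r) Γ(n+1/2) Γ(r+1/2)`. -/
noncomputable def gammaSum (f : ℕ → ℕ → ℂ) (ν : ℕ) : ℂ :=
  ∑ x ∈ Finset.HasAntidiagonal.antidiagonal ν, f (2 * x.1) (2 * x.2) *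
    ((Real.Gamma (x.1 + 1 / 2) * Real.Gamma (x.2 + 1 / 2) : ℝ) : ℂ)

theorem sum_antidiagonal_odd (f : ℕ → ℕ → ℂ) (ν : ℕ) :
    ∑ x ∈ Finset.HasAntidiagonal.antidiagonal (2 * ν + 1), f x.1 x.2
      = ∑ x ∈ Finset.HasAntidiagonal.antidiagonal ν,
        (f (2 * x.1 + 1) (2 * x.2) + f (2 * x.1) (2 * x.2 + 1)) := by
  rw [Finset.Nat.sum_antidiagonal_eq_sum_range_succ f,
    Finset.Nat.sum_antidiagonal_eq_sum_range_succ
      fun a b => f (2 * a + 1) (2 * b) + f (2 * a) (2 * b + 1),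
    show (2 * ν + 1).succ = 2 * (ν + 1) by omega, sum_range_two_mul]
  refine Finset.sum_congr rfl fun i hi => ?_
  have : i ≤ ν := Nat.lt_succ_iff.1 (Finset.mem_range.1 hi)
  rw [show 2 * ν + 1 - 2 * i = 2 * (ν - i) + 1 by omega,
    show 2 * ν + 1 - (2 * i + 1) = 2 * (ν - i) by omega, add_comm]

theorem gammaSum_succ_fst {f g : ℕ → ℕ → ℂ} (h0 : ∀ l, f 0 l = 0)
    (h1 : ∀ k l, f (2 * (k + 1)) (2 * l) = g k l) (ν : ℕ) :
    gammaSum f (ν + 1) = ∑ x ∈ Finset.HasAntidiagonal.antidiagonal ν, g x.1 x.2 *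
      ((Real.Gamma ((x.1 + 1 : ℕ) + 1 / 2) * Real.Gamma (x.2 + 1 / 2) : ℝ) : ℂ) := by
  rw [gammaSum, Finset.Nat.sum_antidiagonal_succ]
  simp only [h0, mul_zero, zero_mul, zero_add, h1]

theorem gammaSum_succ_snd {f g : ℕ → ℕ → ℂ} (h0 : ∀ k, f k 0 = 0)
    (h1 : ∀ k l, f (2 * k) (2 * (l + 1)) = g k l) (ν : ℕ) :
    gammaSum f (ν + 1) = ∑ x ∈ Finset.HasAntidiagonal.antidiagonal ν, g x.1 x.2 *
      ((Real.Gamma (x.1 + 1 / 2) * Real.Gamma ((x.2 + 1 : ℕ) + 1 / 2) : ℝ) : ℂ) := by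
  rw [gammaSum, Finset.Nat.sum_antidiagonal_succ']
  simp only [h0, mul_zero, zero_mul, zero_add, h1]

theorem gammaSum_add (f g : ℕ → ℕ → ℂ) (ν : ℕ) :
    gammaSum (fun k l => f k l + g k l) ν = gammaSum f ν + gammaSum g ν := by
  simp only [gammaSum, add_mul, Finset.sum_add_distrib]

theorem gammaSum_const_mul (c : ℂ) (f : ℕ → ℕ → ℂ) (ν : ℕ) :
    gammaSum (fun k l => c * f k l) ν = c * gammaSum f ν := by
  simp only [gammaSum, mul_assoc, Finset.mul_sum]

theorem gammaSum_shift_zero (b : ℕ → ℕ → ℂ) :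
    gammaSum (fun k l => shiftFst b k l + Complex.I * shiftSnd b k l) 0 = 0 := by
  simp [gammaSum, shiftFst, shiftSnd]

/-- The shift by x or y pairs each b_{k,l} with the Gamma values in B_{k,l}; the denominators of all
B_{k,l} with k + l = 2ν + 1 equal ν + 1, which is the factor in front. -/
theorem gammaSum_shift_succ (b : ℕ → ℕ → ℂ) (ν : ℕ) :
    gammaSum (fun k l => shiftFst b k l + Complex.I * shiftSnd b k l) (ν + 1) =
      ((ν : ℂ) + 1) * ∑ x ∈ Finset.HasAntidiagonal.antidiagonal (2 * ν + 1), b x.1 x.2 * BCoeff x.1 x.2 := by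
  rw [gammaSum_add, gammaSum_const_mul, sum_antidiagonal_odd fun k l => b k l * BCoeff k l,
    gammaSum_succ_fst (g := fun k l => b (2 * k + 1) (2 * l)) (fun l => by simp [shiftFst])
      (fun k l => by simp [shiftFst, show 2 * (k + 1) - 1 = 2 * k + 1 by omega]),
    gammaSum_succ_snd (g := fun k l => b (2 * k) (2 * l + 1)) (fun l => by simp [shiftSnd])
      (fun k l => by simp [shiftSnd, show 2 * (l + 1) - 1 = 2 * l + 1 by omega]),
    Finset.mul_sum, Finset.mul_sum, ← Finset.sum_add_distrib]
  refine Finset.sum_congr rfl fun x hx => ?_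
  rw [BCoeff_odd_even, BCoeff_even_odd, Finset.HasAntidiagonal.mem_antidiagonal.1 hx]
  have : (ν : ℂ) + 1 ≠ 0 := by exact_mod_cast Nat.succ_ne_zero ν
  push_cast
  field_simp

theorem gammaSum_shift_shift_zero (c : ℕ → ℕ → ℂ) :
    gammaSum (fun k l => shiftFst (shiftFst c) k l + shiftSnd (shiftSnd c) k l) 0 = 0 := by
  simp [gammaSum, shiftFst, shiftSnd]

/-- Shifting by x² or y² raises one Gamma argument by 1, giving the factors n + 1/2 and r + 1/2,
whose sum is ν + 1. -/
theorem gammaSum_shift_shift_succ (c : ℕ → ℕ → ℂ) (ν : ℕ) :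
    gammaSum (fun k l => shiftFst (shiftFst c) k l + shiftSnd (shiftSnd c) k l) (ν + 1) =
      ((ν : ℂ) + 1) * gammaSum c ν := by
  rw [gammaSum_add,
    gammaSum_succ_fst (g := fun k l => c (2 * k) (2 * l)) (fun l => by simp [shiftFst])
      (fun k l => by
        simp only [shiftFst, if_neg (show 2 * (k + 1) ≠ 0 by omega),
          if_neg (show 2 * (k + 1) - 1 ≠ 0 by omega), show 2 * (k + 1) - 1 - 1 = 2 * k by omega]),
    gammaSum_succ_snd (g := fun k l => c (2 * k) (2 * l)) (fun l => by simp [shiftSnd])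
      (fun k l => by
        simp only [shiftSnd, if_neg (show 2 * (l + 1) ≠ 0 by omega),
          if_neg (show 2 * (l + 1) - 1 ≠ 0 by omega), show 2 * (l + 1) - 1 - 1 = 2 * l by omega]),
    gammaSum, Finset.mul_sum, ← Finset.sum_add_distrib]
  refine Finset.sum_congr rfl fun x hx => ?_
  have hG : ∀ n : ℕ, Real.Gamma ((n + 1 : ℕ) + 1 / 2) = (n + 1 / 2) * Real.Gamma (n + 1 / 2) := by
    intro n
    rw [← Real.Gamma_add_one (by positivity)]
    congr 1
    push_cast
    ring
  have hs : (ν : ℂ) = x.1 + x.2 := by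
    rw [← Finset.HasAntidiagonal.mem_antidiagonal.1 hx]
    push_cast
    rfl
  rw [hG, hG, hs]
  push_cast
  ring

/-! ### Products and integrals of expansions -/

theorem sum_range_antidiagonal (f : ℕ → ℕ → ℂ) (N : ℕ) :
    ∑ ν ∈ Finset.range N, ∑ x ∈ Finset.HasAntidiagonal.antidiagonal ν, f x.1 x.2 =
      ∑ x ∈ Finset.range N ×ˢ Finset.range N, if x.1 + x.2 < N then f x.1 x.2 else 0 := by
  rw [← Finset.sum_filter, ← Finset.sum_fiberwise_of_maps_to
    (g := fun x : ℕ × ℕ => x.1 + x.2) (t := Finset.range N)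
    (fun x hx => Finset.mem_range.2 (Finset.mem_filter.1 hx).2)]
  refine Finset.sum_congr rfl fun ν hν => Finset.sum_congr ?_ fun _ _ => rfl
  ext x
  simp only [Finset.HasAntidiagonal.mem_antidiagonal, Finset.mem_filter, Finset.mem_product,
    Finset.mem_range] at hν ⊢
  omega

/-- The product of two expansions in powers of `t`. -/
theorem norm_mul_sub_antidiagonal_le {X Y : ℂ} {a b : ℕ → ℂ} {t C : ℝ} {N : ℕ} (ht0 : 0 ≤ t)
    (ht1 : t ≤ 1) (hC : 0 ≤ C) (ha : ∀ n, n < N → ‖a n‖ ≤ C) (hb : ∀ n, n < N → ‖b n‖ ≤ C)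
    (hX : ‖X - ∑ n ∈ Finset.range N, a n * (t : ℂ) ^ n‖ ≤ C * t ^ N)
    (hY : ‖Y - ∑ n ∈ Finset.range N, b n * (t : ℂ) ^ n‖ ≤ C * t ^ N) :
    ‖X * Y - ∑ ν ∈ Finset.range N,
      (∑ x ∈ Finset.HasAntidiagonal.antidiagonal ν, a x.1 * b x.2) * (t : ℂ) ^ ν‖
      ≤ (N + 1) ^ 2 * C ^ 2 * t ^ N := by
  set a' := ∑ n ∈ Finset.range N, a n * (t : ℂ) ^ n with ha'
  set b' := ∑ n ∈ Finset.range N, b n * (t : ℂ) ^ n with hb'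
  have htp : ∀ n : ℕ, ‖(t : ℂ) ^ n‖ ≤ 1 := fun n => by
    rw [norm_pow, Complex.norm_real, Real.norm_eq_abs, abs_of_nonneg ht0]
    exact pow_le_one₀ ht0 ht1
  have hsum : ∀ c : ℕ → ℂ, (∀ n, n < N → ‖c n‖ ≤ C) →
      ‖∑ n ∈ Finset.range N, c n * (t : ℂ) ^ n‖ ≤ N * C := by
    intro c hc
    refine (norm_sum_le_of_le _ (f := fun n => c n * (t : ℂ) ^ n) (fun n hn => ?_)).trans
      (b := ∑ _n ∈ Finset.range N, C) (by simp)
    rw [norm_mul]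
    exact (mul_le_of_le_one_right (norm_nonneg _) (htp n)).trans (hc n (Finset.mem_range.1 hn))
  have htN : t ^ N ≤ 1 := pow_le_one₀ ht0 ht1
  have htN0 : 0 ≤ t ^ N := pow_nonneg ht0 N
  have hYn : ‖Y‖ ≤ N * C + C := by
    have h1 := norm_add_le (Y - b') b'
    rw [sub_add_cancel] at h1
    have := hsum b hb
    have := mul_le_of_le_one_right hC htN
    linarith
  have h1 : ‖(X - a') * Y‖ ≤ C * t ^ N * (N * C + C) := by
    rw [norm_mul]
    exact mul_le_mul hX hYn (norm_nonneg _) (by positivity)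
  have h2 : ‖a' * (Y - b')‖ ≤ N * C * (C * t ^ N) := by
    rw [norm_mul]
    exact mul_le_mul (hsum a ha) hY (norm_nonneg _) (by positivity)
  -- The product of the truncations differs from the truncated product by the pairs of total degree
  -- at least N, at most N² of them, each bounded by C² t^N.
  have h3 : ‖a' * b' - ∑ ν ∈ Finset.range N,
      (∑ x ∈ Finset.HasAntidiagonal.antidiagonal ν, a x.1 * b x.2) * (t : ℂ) ^ ν‖
      ≤ N ^ 2 * (C ^ 2 * t ^ N) := by
    have e : ∑ ν ∈ Finset.range N,
        (∑ x ∈ Finset.HasAntidiagonal.antidiagonal ν, a x.1 * b x.2) * (t : ℂ) ^ ν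
        = ∑ ν ∈ Finset.range N, ∑ x ∈ Finset.HasAntidiagonal.antidiagonal ν,
          a x.1 * b x.2 * (t : ℂ) ^ (x.1 + x.2) := by
      refine Finset.sum_congr rfl fun ν _ => ?_
      rw [Finset.sum_mul]
      refine Finset.sum_congr rfl fun x hx => ?_
      rw [Finset.HasAntidiagonal.mem_antidiagonal.1 hx]
    rw [e, sum_range_antidiagonal fun n l => a n * b l * (t : ℂ) ^ (n + l), ha', hb',
      Finset.sum_mul_sum, ← Finset.sum_product', ← Finset.sum_sub_distrib]
    have hterm : ∀ x ∈ Finset.range N ×ˢ Finset.range N,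
        ‖a x.1 * (t : ℂ) ^ x.1 * (b x.2 * (t : ℂ) ^ x.2) -
          (if x.1 + x.2 < N then a x.1 * b x.2 * (t : ℂ) ^ (x.1 + x.2) else 0)‖
          ≤ C ^ 2 * t ^ N := by
      intro x hx
      obtain ⟨hx1, hx2⟩ := Finset.mem_product.1 hx
      have e2 : a x.1 * (t : ℂ) ^ x.1 * (b x.2 * (t : ℂ) ^ x.2)
          = a x.1 * b x.2 * (t : ℂ) ^ (x.1 + x.2) := by
        rw [pow_add]
        ring
      rw [e2]
      split_ifs with h
      · rw [sub_self, norm_zero]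
        positivity
      · rw [sub_zero, norm_mul, norm_mul, norm_pow, Complex.norm_real, Real.norm_eq_abs,
          abs_of_nonneg ht0, sq]
        exact mul_le_mul (mul_le_mul (ha _ (Finset.mem_range.1 hx1)) (hb _ (Finset.mem_range.1 hx2))
          (norm_nonneg _) hC) (pow_le_pow_of_le_one ht0 ht1 (not_lt.1 h)) (by positivity)
          (by positivity)
    refine (norm_sum_le_of_le _ hterm).trans (le_of_eq ?_)
    rw [Finset.sum_const, Finset.card_product, Finset.card_range, nsmul_eq_mul]
    push_cast
    ring
  have e : X * Y - ∑ ν ∈ Finset.range N,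
      (∑ x ∈ Finset.HasAntidiagonal.antidiagonal ν, a x.1 * b x.2) * (t : ℂ) ^ ν
      = (X - a') * Y + a' * (Y - b') + (a' * b' - ∑ ν ∈ Finset.range N,
      (∑ x ∈ Finset.HasAntidiagonal.antidiagonal ν, a x.1 * b x.2) * (t : ℂ) ^ ν) := by ring
  rw [e]
  refine (norm_add₃_le.trans (add_le_add (add_le_add h1 h2) h3)).trans (le_of_eq ?_)
  ring

/-- The partial sums `∑ λ^{-(ν+1)} (D_ν + e^{-iωλ} C_ν)`. -/
noncomputable def oscSum (ω : ℝ) (D C : ℕ → ℂ) (M : ℕ) (lam : ℝ) : ℂ :=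
  ∑ ν ∈ Finset.range M,
    ((lam : ℂ)⁻¹) ^ (ν + 1) * (D ν + Complex.exp (-(Complex.I * ω * lam)) * C ν)

theorem hasDerivAt_oscSum (ω : ℝ) (D C : ℕ → ℂ) (M : ℕ) {lam : ℝ} (hl : 0 < lam) :
    HasDerivAt (oscSum ω D C M) (-∑ ν ∈ Finset.range M,
      ((ν + 1) * ((lam : ℂ)⁻¹) ^ (ν + 2) * (D ν + Complex.exp (-(Complex.I * ω * lam)) * C ν) +
        ((lam : ℂ)⁻¹) ^ (ν + 1) * (Complex.I * ω * Complex.exp (-(Complex.I * ω * lam)) * C ν)))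
      lam := by
  rw [← Finset.sum_neg_distrib]
  refine HasDerivAt.fun_sum fun ν _ => ?_
  have hl' : (lam : ℂ) ≠ 0 := by exact_mod_cast hl.ne'
  have h1 : HasDerivAt (fun x : ℝ => ((x : ℂ)⁻¹) ^ (ν + 1))
      (((ν + 1 : ℕ) : ℂ) * ((lam : ℂ)⁻¹) ^ ν * (-1 / (lam : ℂ) ^ 2)) lam :=
    ((hasDerivAt_id lam).ofReal_comp.fun_inv hl').fun_pow (ν + 1)
  rw [show -1 / (lam : ℂ) ^ 2 = -((lam : ℂ)⁻¹) ^ 2 by rw [inv_pow, neg_div, one_div]] at h1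
  have h2 : HasDerivAt (fun x : ℝ => -(Complex.I * ω * x)) (-(Complex.I * ω * 1)) lam :=
    ((hasDerivAt_id lam).ofReal_comp.const_mul (Complex.I * ω)).neg
  refine (h1.mul ((h2.cexp.mul_const (C ν)).const_add (D ν))).congr_deriv ?_
  push_cast
  ring

theorem tendsto_oscSum (ω : ℝ) (D C : ℕ → ℂ) (M : ℕ) :
    Tendsto (oscSum ω D C M) atTop (𝓝 0) := by
  unfold oscSum
  rw [← Finset.sum_const_zero (s := Finset.range M)]
  refine tendsto_finsetSum _ fun ν _ => ?_
  have h1 : Tendsto (fun x : ℝ => ((x⁻¹) ^ (ν + 1)) * (‖D ν‖ + ‖C ν‖)) atTop (𝓝 0) := by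
    have := (tendsto_inv_atTop_zero (𝕜 := ℝ)).pow (ν + 1)
    rw [zero_pow (Nat.succ_ne_zero ν)] at this
    simpa using this.mul_const (‖D ν‖ + ‖C ν‖)
  refine squeeze_zero_norm' ?_ h1
  filter_upwards [eventually_gt_atTop 0] with x hx
  rw [norm_mul, norm_pow, norm_inv, Complex.norm_real, Real.norm_eq_abs, abs_of_pos hx]
  refine mul_le_mul_of_nonneg_left ((norm_add_le _ _).trans ?_) (by positivity)
  have : ‖Complex.exp (-(Complex.I * ω * x))‖ = 1 := by
    rw [show -(Complex.I * ω * x) = ((-(ω * x) : ℝ) : ℂ) * Complex.I by push_cast; ring,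
      Complex.norm_exp_ofReal_mul_I]
  rw [norm_mul, this, one_mul]

/-- Integrating an expansion of the negative derivative. -/
theorem abs_re_sub_oscSum_le {H : ℝ → ℂ} {X : ℂ} {ω : ℝ} {D C : ℕ → ℂ} {M : ℕ} (hM : M ≠ 0)
    {B lam : ℝ} (hl : 1 ≤ lam)
    (hi : ∀ Lam, lam ≤ Lam → IntervalIntegrable H volume lam Lam)
    (hX : Tendsto (fun Lam => ∫ m in lam..Lam, H m) atTop (𝓝 X))
    (hB : ∀ m : ℝ, 1 ≤ m → |(H m - ∑ ν ∈ Finset.range M,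
      ((ν + 1) * ((m : ℂ)⁻¹) ^ (ν + 2) * (D ν + Complex.exp (-(Complex.I * ω * m)) * C ν) +
        ((m : ℂ)⁻¹) ^ (ν + 1) * (Complex.I * ω * Complex.exp (-(Complex.I * ω * m)) * C ν))).re|
        ≤ B * (m⁻¹) ^ (M + 1)) :
    |X.re - (oscSum ω D C M lam).re| ≤ B * (lam⁻¹) ^ M := by
  have hl0 : 0 < lam := by linarith
  set T := oscSum ω D C M with hT
  set T' : ℝ → ℂ := fun m => -∑ ν ∈ Finset.range M,
      ((ν + 1) * ((m : ℂ)⁻¹) ^ (ν + 2) * (D ν + Complex.exp (-(Complex.I * ω * m)) * C ν) +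
        ((m : ℂ)⁻¹) ^ (ν + 1) * (Complex.I * ω * Complex.exp (-(Complex.I * ω * m)) * C ν))
    with hT'
  have hB0 : 0 ≤ B := by
    have := (abs_nonneg _).trans (hB 1 le_rfl)
    simpa using this
  -- Up to a finite Λ the error integrates to at most (B/M)(λ^{-M} - Λ^{-M}); afterwards Λ → ∞,
  -- where the partial sum tends to 0.
  have hfin : ∀ Lam, lam ≤ Lam →
      |((∫ m in lam..Lam, H m) + (T Lam - T lam)).re| ≤ B * (lam⁻¹) ^ M := by
    intro Lam hL
    have hpos : ∀ m ∈ Set.uIcc lam Lam, 0 < m := fun m hm => by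
      rw [Set.uIcc_of_le hL] at hm
      linarith [hm.1]
    have hT'i : IntervalIntegrable T' volume lam Lam := by
      refine ContinuousOn.intervalIntegrable fun m hm => ContinuousAt.continuousWithinAt ?_
      have hm0 : (m : ℂ) ≠ 0 := by exact_mod_cast (hpos m hm).ne'
      simp only [hT']
      fun_prop (disch := assumption)
    have e1 : T Lam - T lam = ∫ m in lam..Lam, T' m :=
      (intervalIntegral.integral_eq_sub_of_hasDerivAt
        (fun m hm => hasDerivAt_oscSum ω D C M (hpos m hm)) hT'i).symm
    have e2 : ((∫ m in lam..Lam, H m) + (T Lam - T lam)).re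
        = ∫ m in lam..Lam, (H m + T' m).re := by
      rw [e1, ← intervalIntegral.integral_add (hi Lam hL) hT'i]
      exact (Complex.reCLM.intervalIntegral_comp_comm ((hi Lam hL).add hT'i)).symm
    have hM0 : (M : ℝ) ≠ 0 := by exact_mod_cast hM
    have hder : ∀ m ∈ Set.uIcc lam Lam, HasDerivAt (fun x : ℝ => -(B / M) * (x⁻¹) ^ M)
        (B * (m⁻¹) ^ (M + 1)) m := by
      intro m hm
      have hm0 := (hpos m hm).ne'
      refine (((hasDerivAt_inv hm0).fun_pow M).const_mul (-(B / M))).congr_deriv ?_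
      obtain ⟨k, rfl⟩ := Nat.exists_eq_succ_of_ne_zero hM
      have h1 : B / (k.succ : ℝ) * k.succ = B := div_mul_cancel₀ _ hM0
      simp only [Nat.succ_eq_add_one, Nat.add_sub_cancel] at h1 ⊢
      rw [← inv_pow]
      linear_combination (m⁻¹) ^ (k + 2) * h1
    have hci : IntervalIntegrable (fun m : ℝ => B * (m⁻¹) ^ (M + 1)) volume lam Lam := by
      refine ContinuousOn.intervalIntegrable fun m hm => ContinuousAt.continuousWithinAt ?_
      have hm0 := (hpos m hm).ne'
      fun_prop (disch := assumption)
    rw [e2, ← Real.norm_eq_abs]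
    refine (intervalIntegral.norm_integral_le_of_norm_le hL (Eventually.of_forall fun m hm => ?_)
      hci).trans ?_
    · rw [Real.norm_eq_abs, hT', ← sub_eq_add_neg]
      exact hB m (by linarith [hm.1])
    · rw [intervalIntegral.integral_eq_sub_of_hasDerivAt hder hci]
      have h1 : 0 ≤ B / M * (Lam⁻¹) ^ M := by
        have : 0 ≤ Lam := by linarith
        positivity
      have h2 : B / M * (lam⁻¹) ^ M ≤ B * (lam⁻¹) ^ M := by
        refine mul_le_mul_of_nonneg_right (div_le_self hB0 ?_) (by positivity)
        exact_mod_cast Nat.one_le_iff_ne_zero.2 hM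
      linarith
  have hlim : Tendsto (fun Lam => |((∫ m in lam..Lam, H m) + (T Lam - T lam)).re|) atTop
      (𝓝 |(X + (0 - T lam)).re|) :=
    (Complex.continuous_re.tendsto _ |>.comp
      (hX.add ((tendsto_oscSum ω D C M).sub_const _))).abs
  have := le_of_tendsto hlim (eventually_atTop.2 ⟨lam, hfin⟩)
  rwa [zero_sub, ← sub_eq_add_neg, Complex.sub_re] at this

/-! ### The expansion of the double integral through the saddle points -/

/-- The coefficients in the expansion of the `ζ`-integrals. -/
noncomputable def zCoeff (τ v : ℝ) (j : Fin 4) (n : ℕ) : ℂ :=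
  taylorCoeff (localAmp (ampZ τ v j) saddleBranch) (2 * n) * (Real.Gamma (n + 1 / 2) : ℝ)

/-- The coefficients in the expansion of the `ω`-integrals. -/
noncomputable def wCoeff (τ u : ℝ) (j : Fin 4) (n : ℕ) : ℂ :=
  taylorCoeff (localAmp (ampW τ u j) branchW) (2 * n) * (Real.Gamma (n + 1 / 2) : ℝ)

/-- The coefficients of the non-oscillating part of the derivative. -/
noncomputable def diagDerivCoeff (τ₁ τ₂ u v : ℝ) (ν : ℕ) : ℂ :=
  ∑ j, ∑ x ∈ Finset.HasAntidiagonal.antidiagonal ν, zCoeff τ₂ v j x.1 * wCoeff τ₁ u j x.2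

/-- The coefficients of the oscillating part of the derivative. -/
noncomputable def oscDerivCoeff (τ₁ τ₂ u v : ℝ) (ν : ℕ) : ℂ :=
  -∑ j, ∑ x ∈ Finset.HasAntidiagonal.antidiagonal ν,
    zCoeff τ₂ v j x.1 * (starRingEnd ℂ) (wCoeff τ₁ u j x.2)

/-- `∑_{k+l=2ν+1} b_{k,l} B_{k,l}`. -/
noncomputable def diagCoeff (τ₁ τ₂ u v : ℝ) (ν : ℕ) : ℂ :=
  ∑ x ∈ Finset.HasAntidiagonal.antidiagonal (2 * ν + 1),
    bCoeff τ₁ τ₂ u v x.1 x.2 * BCoeff x.1 x.2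

/-- The frequency of the oscillations. -/
noncomputable def oscFreq : ℝ := 3 * Real.sqrt 3 / 4

theorem gammaSum_eq {f : ℕ → ℕ → ℂ} {a b : Fin 4 → ℕ → ℂ} {ν : ℕ}
    (h : ∀ k l, f (2 * k) (2 * l) = ∑ j, a j (2 * k) * b j (2 * l)) :
    gammaSum f ν = ∑ j, ∑ x ∈ Finset.HasAntidiagonal.antidiagonal ν,
      (a j (2 * x.1) * (Real.Gamma (x.1 + 1 / 2) : ℝ)) *
        (b j (2 * x.2) * (Real.Gamma (x.2 + 1 / 2) : ℝ)) := by
  rw [Finset.sum_comm, gammaSum]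
  refine Finset.sum_congr rfl fun x _ => ?_
  rw [h, Finset.sum_mul]
  refine Finset.sum_congr rfl fun j _ => ?_
  push_cast
  ring

theorem diagDerivCoeff_eq (τ₁ τ₂ u v : ℝ) (ν : ℕ) : diagDerivCoeff τ₁ τ₂ u v ν =
    gammaSum (fun k l => shiftFst (bCoeff τ₁ τ₂ u v) k l
      + Complex.I * shiftSnd (bCoeff τ₁ τ₂ u v) k l) ν :=
  (gammaSum_eq fun k l => shift_bCoeff τ₁ τ₂ u v (2 * k) (2 * l)).symm

/-- There is no non-oscillating term of order 1/m, which would not be integrable at infinity. -/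
theorem diagDerivCoeff_zero (τ₁ τ₂ u v : ℝ) : diagDerivCoeff τ₁ τ₂ u v 0 = 0 := by
  rw [diagDerivCoeff_eq, gammaSum_shift_zero]

/-- This matches the negative derivative of λ^{-(ν+1)} times `diagCoeff` of index ν. -/
theorem diagDerivCoeff_succ (τ₁ τ₂ u v : ℝ) (ν : ℕ) :
    diagDerivCoeff τ₁ τ₂ u v (ν + 1) = (ν + 1) * diagCoeff τ₁ τ₂ u v ν := by
  rw [diagDerivCoeff_eq, gammaSum_shift_succ, diagCoeff]

theorem phase_sub_conj :
    3 / 4 * saddlePt - 3 / 4 * (starRingEnd ℂ) saddlePt = Complex.I * oscFreq := by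
  rw [oscFreq, saddlePt_eq]
  simp only [map_add, map_mul, Complex.conj_ofReal, Complex.conj_I, map_div₀, map_one, map_ofNat]
  push_cast
  ring

/-- The minus sign in front of the conjugate part of the ζ-integral is the one that relates the
coefficients of `branchWConj` to those of `branchW`. -/
theorem oscDerivCoeff_eq (τ₁ τ₂ u v : ℝ) (ν : ℕ) : oscDerivCoeff τ₁ τ₂ u v ν =
    Complex.I * oscFreq * gammaSum (cCoeff τ₁ τ₂ u v) ν +
    gammaSum (fun k l => shiftFst (shiftFst (cCoeff τ₁ τ₂ u v)) k l
      + shiftSnd (shiftSnd (cCoeff τ₁ τ₂ u v)) k l) ν := by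
  rw [← gammaSum_const_mul, ← gammaSum_add, gammaSum_eq
    (a := fun j k => taylorCoeff (localAmp (ampZ τ₂ v j) saddleBranch) k)
    (b := fun j l => taylorCoeff (localAmp (ampW τ₁ u j) branchWConj) l), oscDerivCoeff,
    ← Finset.sum_neg_distrib]
  · refine Finset.sum_congr rfl fun j _ => ?_
    rw [← Finset.sum_neg_distrib]
    refine Finset.sum_congr rfl fun x _ => ?_
    rw [taylorCoeff_branchWConj, zCoeff, wCoeff, map_mul, Complex.conj_ofReal]
    ring
  · intro k l
    rw [← shift_cCoeff, phase_sub_conj]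
    ring

theorem oscDerivCoeff_zero (τ₁ τ₂ u v : ℝ) : oscDerivCoeff τ₁ τ₂ u v 0 =
    Complex.I * oscFreq * gammaSum (cCoeff τ₁ τ₂ u v) 0 := by
  rw [oscDerivCoeff_eq, gammaSum_shift_shift_zero, add_zero]

/-- The negative derivative of λ^{-(ν+1)} e^{-iωλ} has one term of the same order with factor iω and
one of the next order with factor ν + 1; the order λ^{-(ν+2)} collects contributions from two
consecutive indices. -/
theorem oscDerivCoeff_succ (τ₁ τ₂ u v : ℝ) (ν : ℕ) : oscDerivCoeff τ₁ τ₂ u v (ν + 1) =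
    Complex.I * oscFreq * gammaSum (cCoeff τ₁ τ₂ u v) (ν + 1)
      + (ν + 1) * gammaSum (cCoeff τ₁ τ₂ u v) ν := by
  rw [oscDerivCoeff_eq, gammaSum_shift_shift_succ]

/-- The expansions of the single integrals, uniformly in the parameters. -/
theorem exists_saddleInt_expansion (K : ℝ) (N : ℕ) : ∃ C : ℝ, 0 ≤ C ∧
    (∀ τ v : ℝ, |v| + |τ| ≤ K → ∀ j, (∀ n < N, ‖zCoeff τ v j n‖ ≤ C) ∧ ∀ m : ℝ, 1 ≤ m →
      ‖(m ^ (1 / 2 : ℝ) : ℝ) * (Complex.exp (m * phase saddlePt) * zSaddleInt τ v j m) -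
        ∑ n ∈ Finset.range N, zCoeff τ v j n * ((m⁻¹ : ℝ) : ℂ) ^ n‖ ≤ C * (m⁻¹) ^ N) ∧
    (∀ τ u : ℝ, |u| + |τ| ≤ K → ∀ j, (∀ n < N, ‖wCoeff τ u j n‖ ≤ C) ∧ ∀ m : ℝ, 1 ≤ m →
      ‖(m ^ (1 / 2 : ℝ) : ℝ) * (Complex.exp (-m * phase saddlePt) * wSaddleInt τ u j m) -
        ∑ n ∈ Finset.range N, wCoeff τ u j n * ((m⁻¹ : ℝ) : ℂ) ^ n‖ ≤ C * (m⁻¹) ^ N) := by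
  have hgamma : ∀ n : ℕ, ‖((Real.Gamma (n + 1 / 2) : ℝ) : ℂ)‖ = Real.Gamma (n + 1 / 2) := by
    intro n
    rw [Complex.norm_real, Real.norm_eq_abs, abs_of_pos (Real.Gamma_pos_of_pos (by positivity))]
  have hpow : ∀ m : ℝ, 1 ≤ m → ∀ n : ℕ,
      m ^ (1 / 2 : ℝ) * m ^ (-((n : ℝ) + 1 / 2)) = (m⁻¹) ^ n := by
    intro m hm n
    have h0 : 0 < m := by linarith
    rw [← Real.rpow_add h0, inv_pow, ← Real.rpow_natCast, ← Real.rpow_neg h0.le]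
    congr 1
    ring
  -- Both families are covered at once, with F = f for the ζ-integrals and F = -f for the
  -- ω-integrals. The factor m^{1/2} turns the powers m^{-(n+1/2)} into m^{-n}.
  have main : ∀ (F G : ℂ → ℂ) (γ c : ℝ → ℂ), SaddleCoord F G saddlePt →
      SaddlePath F saddlePt (deriv G 0) γ c → ∃ C : ℝ, 0 ≤ C ∧ ∀ h : ℂ → ℂ,
        GaussianGrowth (2 + K) h →
        (∀ n < N, ‖taylorCoeff (localAmp h G) (2 * n) * (Real.Gamma (n + 1 / 2) : ℝ)‖ ≤ C) ∧
        ∀ m : ℝ, 1 ≤ m → ‖(m ^ (1 / 2 : ℝ) : ℝ) * (Complex.exp (m * F saddlePt) *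
          ∫ t, Complex.exp (-m * F (γ t)) * h (γ t) * c t) - ∑ n ∈ Finset.range N,
            taylorCoeff (localAmp h G) (2 * n) * (Real.Gamma (n + 1 / 2) : ℝ) *
              ((m⁻¹ : ℝ) : ℂ) ^ n‖ ≤ C * (m⁻¹) ^ N := by
    intro F G γ c hS hP
    obtain ⟨C, hC⟩ := hP.exists_expansion hS (2 + K) N
    choose C' hC' using fun k => hS.exists_taylorCoeff_le (2 + K) k
    set C'' := |C| + ∑ n ∈ Finset.range N, |C' (2 * n)| * Real.Gamma (n + 1 / 2) with hC''
    have hnn : ∀ n : ℕ, 0 ≤ |C' (2 * n)| * Real.Gamma (n + 1 / 2) := fun n =>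
      mul_nonneg (abs_nonneg _) (Real.Gamma_pos_of_pos (by positivity)).le
    have hsum0 := Finset.sum_nonneg fun n (_ : n ∈ Finset.range N) => hnn n
    refine ⟨C'', by positivity, fun h hh => ⟨fun n hn => ?_, fun m hm => ?_⟩⟩
    · rw [norm_mul, hgamma]
      have h1 := mul_le_mul_of_nonneg_right ((hC' (2 * n) h hh.differentiable hh.norm_le).trans
        (le_abs_self _)) (Real.Gamma_pos_of_pos (show (0 : ℝ) < n + 1 / 2 by positivity)).le
      have h2 := Finset.single_le_sum (f := fun n : ℕ => |C' (2 * n)| * Real.Gamma (n + 1 / 2))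
        (fun n _ => hnn n) (Finset.mem_range.2 hn)
      have := abs_nonneg C
      linarith
    · have hm0 : 0 < m := by linarith
      have h1 := hC h hh.differentiable hh.norm_le m hm
      have h2 : 0 ≤ m ^ (1 / 2 : ℝ) := Real.rpow_nonneg hm0.le _
      have h3 := mul_le_mul_of_nonneg_left h1 h2
      rw [mul_left_comm, hpow m hm N] at h3
      refine le_trans (le_of_eq ?_) (h3.trans (mul_le_mul_of_nonneg_right
        ((le_abs_self C).trans (by linarith)) (by positivity)))
      have e : ‖((m ^ (1 / 2 : ℝ) : ℝ) : ℂ)‖ = m ^ (1 / 2 : ℝ) := by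
        rw [Complex.norm_real, Real.norm_eq_abs, abs_of_nonneg h2]
      conv_rhs => rw [← e, ← norm_mul, mul_sub, Finset.mul_sum]
      congr 2
      refine Finset.sum_congr rfl fun n _ => ?_
      rw [← Complex.ofReal_pow, ← hpow m hm n]
      push_cast
      ring
  obtain ⟨C₁, hC₁0, hC₁⟩ := main _ _ _ _ saddleCoord_phase saddlePath_z
  obtain ⟨C₂, hC₂0, hC₂⟩ := main _ _ _ _ saddleCoord_neg_phase saddlePath_w
  refine ⟨max C₁ C₂, le_max_of_le_left hC₁0, fun τ v h j => ?_, fun τ u h j => ?_⟩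
  · obtain ⟨h1, h2⟩ := hC₁ _ (gaussianGrowth_ampZ h j)
    refine ⟨fun n hn => (h1 n hn).trans (le_max_left _ _), fun m hm => ?_⟩
    have hm0 : 0 ≤ m⁻¹ := by positivity
    refine le_trans ?_ ((h2 m hm).trans
      (mul_le_mul_of_nonneg_right (le_max_left _ _) (pow_nonneg hm0 N)))
    rfl
  · obtain ⟨h1, h2⟩ := hC₂ _ (gaussianGrowth_ampW h j)
    refine ⟨fun n hn => (h1 n hn).trans (le_max_right _ _), fun m hm => ?_⟩
    have hm0 : 0 ≤ m⁻¹ := by positivity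
    refine le_trans ?_ ((h2 m hm).trans
      (mul_le_mul_of_nonneg_right (le_max_right _ _) (pow_nonneg hm0 N)))
    simp only [mul_neg, neg_mul, neg_neg]
    rfl

theorem norm_sum_antidiagonal_le {a b : ℕ → ℂ} {C : ℝ} (hC : 0 ≤ C) {ν : ℕ}
    (ha : ∀ n, n < ν + 1 → ‖a n‖ ≤ C) (hb : ∀ n, n < ν + 1 → ‖b n‖ ≤ C) :
    ‖∑ x ∈ Finset.HasAntidiagonal.antidiagonal ν, a x.1 * b x.2‖ ≤ (ν + 1) * C ^ 2 := by
  refine (norm_sum_le_of_le _ (f := fun x : ℕ × ℕ => a x.1 * b x.2) (n := fun _ => C ^ 2)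
    fun x hx => ?_).trans ?_
  · have := Finset.HasAntidiagonal.mem_antidiagonal.1 hx
    rw [norm_mul, sq]
    exact mul_le_mul (ha _ (by omega)) (hb _ (by omega)) (norm_nonneg _) hC
  · rw [Finset.sum_const, Finset.Nat.card_antidiagonal, nsmul_eq_mul]
    push_cast
    exact le_rfl

theorem norm_sum_fin_four_le {f : Fin 4 → ℂ} {B : ℝ} (h : ∀ j, ‖f j‖ ≤ B) :
    ‖∑ j, f j‖ ≤ 4 * B := by
  refine (norm_sum_le_of_le _ fun j _ => h j).trans ?_
  rw [Finset.sum_const, Finset.card_univ, Fintype.card_fin, nsmul_eq_mul]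
  norm_num

theorem exists_derivCoeff_le (K : ℝ) (ν : ℕ) : ∃ B : ℝ, 0 ≤ B ∧ ∀ τ₁ τ₂ u v : ℝ,
    |v| + |τ₂| ≤ K → |u| + |τ₁| ≤ K →
      ‖diagDerivCoeff τ₁ τ₂ u v ν‖ ≤ B ∧ ‖oscDerivCoeff τ₁ τ₂ u v ν‖ ≤ B := by
  obtain ⟨C, hC, hz, hw⟩ := exists_saddleInt_expansion K (ν + 1)
  refine ⟨4 * ((ν + 1) * C ^ 2), by positivity, fun τ₁ τ₂ u v h2 h1 => ⟨?_, ?_⟩⟩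
  · exact norm_sum_fin_four_le fun j =>
      norm_sum_antidiagonal_le hC (hz τ₂ v h2 j).1 (hw τ₁ u h1 j).1
  · rw [oscDerivCoeff, norm_neg]
    refine norm_sum_fin_four_le fun j => norm_sum_antidiagonal_le
      (b := fun n => (starRingEnd ℂ) (wCoeff τ₁ u j n)) hC (hz τ₂ v h2 j).1 fun n hn => ?_
    rw [RCLike.norm_conj]
    exact (hw τ₁ u h1 j).1 n hn

theorem oscFreq_pos : 0 < oscFreq := by
  rw [oscFreq]
  positivity

theorem exists_diagCoeff_le (K : ℝ) (ν : ℕ) : ∃ B : ℝ, 0 ≤ B ∧ ∀ τ₁ τ₂ u v : ℝ,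
    |v| + |τ₂| ≤ K → |u| + |τ₁| ≤ K → ‖diagCoeff τ₁ τ₂ u v ν‖ ≤ B := by
  obtain ⟨B, hB, h⟩ := exists_derivCoeff_le K (ν + 1)
  refine ⟨B, hB, fun τ₁ τ₂ u v h2 h1 => le_trans ?_ (h τ₁ τ₂ u v h2 h1).1⟩
  rw [diagDerivCoeff_succ, norm_mul]
  refine le_mul_of_one_le_left (norm_nonneg _) ?_
  rw [← Nat.cast_succ, Complex.norm_natCast]
  exact_mod_cast Nat.succ_le_succ (Nat.zero_le _)

/-- Since ω ≠ 0, the recursion for the oscillating coefficients can be solved for the sums over c.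
Uniform bounds then follow inductively from those for the single integrals. -/
theorem exists_gammaSum_le (K : ℝ) (ν : ℕ) : ∃ B : ℝ, 0 ≤ B ∧ ∀ τ₁ τ₂ u v : ℝ,
    |v| + |τ₂| ≤ K → |u| + |τ₁| ≤ K → ‖gammaSum (cCoeff τ₁ τ₂ u v) ν‖ ≤ B := by
  have key : ∀ z : ℂ, ‖z‖ = ‖Complex.I * oscFreq * z‖ / oscFreq := fun z => by
    rw [norm_mul, norm_mul, Complex.norm_I, Complex.norm_real, Real.norm_eq_abs,
      abs_of_pos oscFreq_pos, one_mul, mul_div_cancel_left₀ _ oscFreq_pos.ne']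
  have h0 := oscFreq_pos.le
  induction ν with
  | zero =>
    obtain ⟨B, hB, h⟩ := exists_derivCoeff_le K 0
    refine ⟨B / oscFreq, by positivity, fun τ₁ τ₂ u v h2 h1 => ?_⟩
    rw [key, ← oscDerivCoeff_zero]
    exact div_le_div_of_nonneg_right (h τ₁ τ₂ u v h2 h1).2 h0
  | succ ν ih =>
    obtain ⟨B, hB, h⟩ := exists_derivCoeff_le K (ν + 1)
    obtain ⟨B', hB', h'⟩ := ih
    refine ⟨(B + (ν + 1) * B') / oscFreq, by positivity, fun τ₁ τ₂ u v h2 h1 => ?_⟩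
    rw [key, eq_sub_of_add_eq (oscDerivCoeff_succ τ₁ τ₂ u v ν).symm]
    refine div_le_div_of_nonneg_right ((norm_sub_le _ _).trans
      (add_le_add (h τ₁ τ₂ u v h2 h1).2 ?_)) h0
    rw [norm_mul, ← Nat.cast_succ, Complex.norm_natCast]
    push_cast
    exact mul_le_mul_of_nonneg_left (h' τ₁ τ₂ u v h2 h1) (by positivity)

/-- The recursions between the coefficients, summed up. -/
theorem sum_derivCoeff_eq (τ₁ τ₂ u v : ℝ) (t e : ℂ) (M : ℕ) :
    t * ∑ ν ∈ Finset.range (M + 1),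
      (diagDerivCoeff τ₁ τ₂ u v ν + e * oscDerivCoeff τ₁ τ₂ u v ν) * t ^ ν =
    ∑ ν ∈ Finset.range M, ((ν + 1) * t ^ (ν + 2) *
        (diagCoeff τ₁ τ₂ u v ν + e * gammaSum (cCoeff τ₁ τ₂ u v) ν) +
      t ^ (ν + 1) * (Complex.I * oscFreq * e * gammaSum (cCoeff τ₁ τ₂ u v) ν)) +
    t ^ (M + 1) * (Complex.I * oscFreq * e * gammaSum (cCoeff τ₁ τ₂ u v) M) := by
  induction M with
  | zero =>
    rw [Finset.sum_range_one, diagDerivCoeff_zero, oscDerivCoeff_zero, Finset.sum_range_zero]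
    ring
  | succ M ih =>
    rw [Finset.sum_range_succ, mul_add, ih, Finset.sum_range_succ _ M, diagDerivCoeff_succ,
      oscDerivCoeff_succ]
    ring

/-- Under the real part the conjugate may be moved from the ζ-integral to the ω-integral. The
normalizing factors e^{±mf(p)} cancel in the plain product, and in the conjugated one they leave
e^{-iωm}, because f(p) minus its conjugate is iω. -/
theorem re_sum_saddleInt_eq {m : ℝ} (hm : 0 < m) (τ₁ τ₂ u v : ℝ) :
    (∑ j, (zSaddleInt τ₂ v j m - (starRingEnd ℂ) (zSaddleInt τ₂ v j m)) *
      wSaddleInt τ₁ u j m).re =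
    (((m⁻¹ : ℝ) : ℂ) * ∑ j,
      (((m ^ (1 / 2 : ℝ) : ℝ) * (Complex.exp (m * phase saddlePt) * zSaddleInt τ₂ v j m)) *
        ((m ^ (1 / 2 : ℝ) : ℝ) * (Complex.exp (-m * phase saddlePt) * wSaddleInt τ₁ u j m)) -
      Complex.exp (-(Complex.I * oscFreq * m)) *
        (((m ^ (1 / 2 : ℝ) : ℝ) * (Complex.exp (m * phase saddlePt) * zSaddleInt τ₂ v j m)) *
        (starRingEnd ℂ) ((m ^ (1 / 2 : ℝ) : ℝ) *
          (Complex.exp (-m * phase saddlePt) * wSaddleInt τ₁ u j m))))).re := by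
  rw [Finset.mul_sum, Complex.re_sum, Complex.re_sum]
  refine Finset.sum_congr rfl fun j _ => ?_
  generalize zSaddleInt τ₂ v j m = A
  generalize wSaddleInt τ₁ u j m = W
  have hr : ((m ^ (1 / 2 : ℝ) : ℝ) : ℂ) * ((m ^ (1 / 2 : ℝ) : ℝ) : ℂ) = m := by
    rw [← Complex.ofReal_mul, ← Real.rpow_add hm]
    norm_num
  have hi : ((m⁻¹ : ℝ) : ℂ) * m = 1 := by
    rw [← Complex.ofReal_mul, inv_mul_cancel₀ hm.ne', Complex.ofReal_one]
  have hPQ : Complex.exp (m * phase saddlePt) * Complex.exp (-m * phase saddlePt) = 1 := by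
    rw [← Complex.exp_add]
    simp
  have hPC : Complex.exp (-(Complex.I * oscFreq * m)) * Complex.exp (m * phase saddlePt) *
      (starRingEnd ℂ) (Complex.exp (-m * phase saddlePt)) = 1 := by
    rw [← Complex.exp_conj, ← Complex.exp_add, ← Complex.exp_add, ← Complex.exp_zero]
    congr 1
    rw [phase_saddlePt, ← phase_sub_conj]
    simp only [map_mul, map_neg, Complex.conj_ofReal, map_div₀, map_ofNat]
    ring
  have e1 : ∀ x : ℂ, ((starRingEnd ℂ) A * W).re = (A * (starRingEnd ℂ) W).re := fun _ => by
    rw [← Complex.conj_re, map_mul, Complex.conj_conj]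
  rw [sub_mul, Complex.sub_re, e1 0, ← Complex.sub_re]
  congr 1
  simp only [map_mul, Complex.conj_ofReal]
  set r := ((m ^ (1 / 2 : ℝ) : ℝ) : ℂ)
  set i := ((m⁻¹ : ℝ) : ℂ)
  set P := Complex.exp (m * phase saddlePt)
  set Q := Complex.exp (-m * phase saddlePt)
  set e := Complex.exp (-(Complex.I * oscFreq * m))
  linear_combination (-(A * W) * (P * Q) * i + i * e * P * (starRingEnd ℂ) Q * A *
      (starRingEnd ℂ) W) * hr - (A * W * P * Q - e * P * (starRingEnd ℂ) Q * A *
      (starRingEnd ℂ) W) * hi - A * W * hPQ + A * (starRingEnd ℂ) W * hPC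

/-- The expansion of the double integral, uniformly in the parameters. -/
theorem exists_poleInt_expansion (K : ℝ) (N : ℕ) : ∃ C : ℝ, 0 ≤ C ∧ ∀ τ₁ τ₂ u v : ℝ,
    |v| + |τ₂| ≤ K → |u| + |τ₁| ≤ K → ∀ lam : ℝ, 1 ≤ lam →
      |(poleInt lam (baseZ τ₂ v) (baseW τ₁ u) (1 / 2) wPath wWeight).re -
        (oscSum oscFreq (diagCoeff τ₁ τ₂ u v) (gammaSum (cCoeff τ₁ τ₂ u v)) N lam).re|
        ≤ C * (lam⁻¹) ^ (N + 1) := by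
  -- An error O(m^{-(N+2)}) in the integrand is needed to obtain O(λ^{-(N+1)}) after integration.
  -- The incomplete last oscillating term in `sum_derivCoeff_eq` with M = N + 1 is of that same
  -- order.
  obtain ⟨C, hC, hz, hw⟩ := exists_saddleInt_expansion K (N + 2)
  obtain ⟨B₁, hB₁, hd⟩ := exists_diagCoeff_le K N
  obtain ⟨B₂, hB₂, hg⟩ := exists_gammaSum_le K N
  obtain ⟨B₃, hB₃, hg'⟩ := exists_gammaSum_le K (N + 1)
  have hω := oscFreq_pos
  set E := 4 * (2 * ((((N + 2 : ℕ) : ℝ) + 1) ^ 2 * C ^ 2)) + oscFreq * B₃ with hE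
  refine ⟨E + (B₁ + B₂), by positivity, fun τ₁ τ₂ u v h2 h1 lam hl => ?_⟩
  obtain ⟨hi, hX⟩ := integral_saddleInt (by linarith : 0 < lam) τ₁ τ₂ u v
  have hexp : ∀ m : ℝ, ‖Complex.exp (-(Complex.I * oscFreq * m))‖ = 1 := fun m => by
    rw [show -(Complex.I * oscFreq * m) = ((-(oscFreq * m) : ℝ) : ℂ) * Complex.I by
      push_cast; ring]
    exact Complex.norm_exp_ofReal_mul_I _
  have main := abs_re_sub_oscSum_le (ω := oscFreq) (D := diagCoeff τ₁ τ₂ u v)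
    (C := gammaSum (cCoeff τ₁ τ₂ u v)) (M := N + 1) (B := E) (Nat.succ_ne_zero N) hl hi hX ?_
  · have hsplit : oscSum oscFreq (diagCoeff τ₁ τ₂ u v) (gammaSum (cCoeff τ₁ τ₂ u v)) (N + 1) lam
        = oscSum oscFreq (diagCoeff τ₁ τ₂ u v) (gammaSum (cCoeff τ₁ τ₂ u v)) N lam +
        ((lam : ℂ)⁻¹) ^ (N + 1) * (diagCoeff τ₁ τ₂ u v N +
          Complex.exp (-(Complex.I * oscFreq * lam)) * gammaSum (cCoeff τ₁ τ₂ u v) N) :=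
      Finset.sum_range_succ _ _
    rw [hsplit, Complex.add_re] at main
    have hlast : ‖((lam : ℂ)⁻¹) ^ (N + 1) * (diagCoeff τ₁ τ₂ u v N +
          Complex.exp (-(Complex.I * oscFreq * lam)) * gammaSum (cCoeff τ₁ τ₂ u v) N)‖
        ≤ (B₁ + B₂) * (lam⁻¹) ^ (N + 1) := by
      rw [norm_mul, mul_comm, norm_pow, norm_inv, Complex.norm_real, Real.norm_eq_abs,
        abs_of_nonneg (by linarith : 0 ≤ lam)]
      refine mul_le_mul_of_nonneg_right ((norm_add_le _ _).trans (add_le_add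
        (hd τ₁ τ₂ u v h2 h1) ?_)) (by positivity)
      rw [norm_mul, hexp, one_mul]
      exact hg τ₁ τ₂ u v h2 h1
    have h3 := (Complex.abs_re_le_norm _).trans hlast
    rw [abs_le] at main h3 ⊢
    constructor <;> linarith [main.1, main.2, h3.1, h3.2]
  · intro m hm
    have hm0 : 0 < m := by linarith
    have ht0 : 0 ≤ m⁻¹ := by positivity
    have ht1 : m⁻¹ ≤ 1 := inv_le_one_of_one_le₀ hm
    rw [Complex.sub_re, re_sum_saddleInt_eq hm0, ← Complex.sub_re]
    refine (Complex.abs_re_le_norm _).trans ?_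
    set e := Complex.exp (-(Complex.I * oscFreq * m)) with he
    rw [← Complex.ofReal_inv]
    set t := m⁻¹ with ht
    rw [eq_sub_of_add_eq (sum_derivCoeff_eq τ₁ τ₂ u v t e (N + 1)).symm]
    set X : Fin 4 → ℂ := fun j => (m ^ (1 / 2 : ℝ) : ℝ) *
      (Complex.exp (m * phase saddlePt) * zSaddleInt τ₂ v j m) with hXd
    set Y : Fin 4 → ℂ := fun j => (m ^ (1 / 2 : ℝ) : ℝ) *
      (Complex.exp (-m * phase saddlePt) * wSaddleInt τ₁ u j m) with hYd
    set S : Fin 4 → ℂ := fun j => ∑ ν ∈ Finset.range (N + 2),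
      (∑ x ∈ Finset.HasAntidiagonal.antidiagonal ν,
        zCoeff τ₂ v j x.1 * wCoeff τ₁ u j x.2) * (t : ℂ) ^ ν with hS
    set S' : Fin 4 → ℂ := fun j => ∑ ν ∈ Finset.range (N + 2),
      (∑ x ∈ Finset.HasAntidiagonal.antidiagonal ν,
        zCoeff τ₂ v j x.1 * (starRingEnd ℂ) (wCoeff τ₁ u j x.2)) * (t : ℂ) ^ ν with hS'
    have hsumS : ∑ ν ∈ Finset.range (N + 1 + 1),
        (diagDerivCoeff τ₁ τ₂ u v ν + e * oscDerivCoeff τ₁ τ₂ u v ν) * (t : ℂ) ^ ν =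
        ∑ j, (S j - e * S' j) := by
      simp only [hS, hS', Finset.mul_sum, ← Finset.sum_sub_distrib]
      rw [Finset.sum_comm]
      refine Finset.sum_congr rfl fun ν _ => ?_
      rw [Finset.sum_sub_distrib, diagDerivCoeff, oscDerivCoeff, ← Finset.mul_sum,
        ← Finset.sum_mul, ← Finset.sum_mul]
      ring
    have hb1 : ∀ j, ‖X j * Y j - S j‖ ≤ (((N + 2 : ℕ) : ℝ) + 1) ^ 2 * C ^ 2 * t ^ (N + 2) :=
      fun j => norm_mul_sub_antidiagonal_le ht0 ht1 hC (hz τ₂ v h2 j).1 (hw τ₁ u h1 j).1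
        ((hz τ₂ v h2 j).2 m hm) ((hw τ₁ u h1 j).2 m hm)
    have hb2 : ∀ j, ‖X j * (starRingEnd ℂ) (Y j) - S' j‖ ≤
        (((N + 2 : ℕ) : ℝ) + 1) ^ 2 * C ^ 2 * t ^ (N + 2) := fun j => by
      refine norm_mul_sub_antidiagonal_le (b := fun n => (starRingEnd ℂ) (wCoeff τ₁ u j n))
        ht0 ht1 hC (hz τ₂ v h2 j).1 (fun n hn => ?_) ((hz τ₂ v h2 j).2 m hm) ?_
      · rw [RCLike.norm_conj]
        exact (hw τ₁ u h1 j).1 n hn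
      · refine le_trans (le_of_eq ?_) ((hw τ₁ u h1 j).2 m hm)
        rw [← RCLike.norm_conj, map_sub, map_sum, Complex.conj_conj]
        simp only [map_mul, map_pow, Complex.conj_conj, Complex.conj_ofReal]
        rfl
    have hb : ‖∑ j, (X j * Y j - e * (X j * (starRingEnd ℂ) (Y j))) - ∑ j, (S j - e * S' j)‖
        ≤ 4 * (2 * ((((N + 2 : ℕ) : ℝ) + 1) ^ 2 * C ^ 2 * t ^ (N + 2))) := by
      rw [← Finset.sum_sub_distrib]
      refine norm_sum_fin_four_le fun j => ?_
      rw [show X j * Y j - e * (X j * (starRingEnd ℂ) (Y j)) - (S j - e * S' j) =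
        (X j * Y j - S j) - e * (X j * (starRingEnd ℂ) (Y j) - S' j) by ring]
      refine (norm_sub_le _ _).trans ?_
      rw [norm_mul, he, hexp, one_mul, two_mul]
      exact add_le_add (hb1 j) (hb2 j)
    have hlast : ‖(t : ℂ) ^ (N + 1 + 1) *
        (Complex.I * oscFreq * e * gammaSum (cCoeff τ₁ τ₂ u v) (N + 1))‖ ≤
        oscFreq * B₃ * t ^ (N + 2) := by
      rw [norm_mul, mul_comm, norm_pow, Complex.norm_real, Real.norm_eq_abs, abs_of_nonneg ht0]
      refine mul_le_mul_of_nonneg_right ?_ (by positivity)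
      rw [norm_mul, norm_mul, norm_mul, he, hexp, Complex.norm_I, Complex.norm_real,
        Real.norm_eq_abs, abs_of_pos hω, one_mul, mul_one]
      exact mul_le_mul_of_nonneg_left (hg' τ₁ τ₂ u v h2 h1) hω.le
    rw [hsumS, sub_sub_eq_add_sub, add_sub_right_comm, ← mul_sub]
    refine (norm_add_le _ _).trans ((add_le_add
      (b := 4 * (2 * ((((N + 2 : ℕ) : ℝ) + 1) ^ 2 * C ^ 2 * t ^ (N + 2)))) ?_ hlast).trans
      (le_of_eq ?_))
    · rw [norm_mul, Complex.norm_real, Real.norm_eq_abs, abs_of_nonneg ht0]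
      exact (mul_le_of_le_one_left (norm_nonneg _) ht1).trans hb
    · rw [hE]
      ring

/-! ### The complete asymptotic expansion -/

theorem sum_Icc_one_eq_sum_range (f : ℕ → ℂ) (N : ℕ) :
    ∑ ν ∈ Finset.Icc 1 N, f ν = ∑ ν ∈ Finset.range N, f (ν + 1) := by
  induction N with
  | zero => simp
  | succ N ih => rw [Finset.sum_Icc_succ_top (by omega), ih, Finset.sum_range_succ]

theorem rpow_four_thirds_mul {a : ℝ} (ha : 0 < a) (n : ℕ) :
    a ^ (4 / 3 * n : ℝ) = (a ^ (4 / 3 : ℝ)) ^ n := by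
  rw [Real.rpow_mul ha.le, Real.rpow_natCast]

theorem diagTerm_add_oscTerm {a : ℝ} (ha : 0 < a) (τ₁ τ₂ u v : ℝ) (ν : ℕ) :
    diagTerm τ₁ τ₂ u v a (ν + 1) + oscTerm τ₁ τ₂ u v a (ν + 1) =
    1 / (2 * Real.pi * Complex.I) ^ 2 * (2 * ((((a ^ (4 / 3 : ℝ) : ℝ) : ℂ)⁻¹) ^ (ν + 1) *
      (diagCoeff τ₁ τ₂ u v ν + Complex.exp (-(Complex.I * oscFreq * (a ^ (4 / 3 : ℝ) : ℝ))) *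
        gammaSum (cCoeff τ₁ τ₂ u v) ν)).re : ℝ) := by
  have h1 : ((((a ^ (4 / 3 : ℝ) : ℝ) : ℂ)⁻¹) ^ (ν + 1) : ℂ) =
      ((((a ^ (4 / 3 : ℝ)) ^ (ν + 1))⁻¹ : ℝ) : ℂ) := by
    push_cast
    rw [inv_pow]
  have h2 : (diagCoeff τ₁ τ₂ u v ν).re = ∑ p ∈ Finset.HasAntidiagonal.antidiagonal
      (2 * (ν + 1) - 1), (bCoeff τ₁ τ₂ u v p.1 p.2 * BCoeff p.1 p.2).re := by
    rw [diagCoeff, Complex.re_sum]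
    rfl
  have h3 : (Complex.exp (-(Complex.I * oscFreq * (a ^ (4 / 3 : ℝ) : ℝ))) *
      gammaSum (cCoeff τ₁ τ₂ u v) ν).re = ∑ p ∈ Finset.HasAntidiagonal.antidiagonal (ν + 1 - 1),
      (cCoeff τ₁ τ₂ u v (2 * p.1) (2 * p.2) *
        Complex.exp (-Complex.I * ((3 * Real.sqrt 3 / 4 * a ^ (4 / 3 : ℝ) : ℝ) : ℂ))).re
      * Real.Gamma (p.1 + 1 / 2) * Real.Gamma (p.2 + 1 / 2) := by
    rw [gammaSum, Finset.mul_sum, Complex.re_sum, Nat.add_sub_cancel]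
    refine Finset.sum_congr rfl fun p _ => ?_
    rw [show -Complex.I * ((3 * Real.sqrt 3 / 4 * a ^ (4 / 3 : ℝ) : ℝ) : ℂ) =
      -(Complex.I * oscFreq * (a ^ (4 / 3 : ℝ) : ℝ)) by rw [oscFreq]; push_cast; ring,
      ← mul_assoc, mul_comm, Complex.re_ofReal_mul, mul_comm (cCoeff _ _ _ _ _ _)]
    ring
  rw [h1, Complex.re_ofReal_mul, Complex.add_re, h2, h3, diagTerm, oscTerm,
    rpow_four_thirds_mul ha]
  push_cast
  ring

/-- A function is `O(a^{-4(N+1)/3})` if it is, up to a factor, the error of the expansion of the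
double integral. -/
theorem uniformBigOOnCompacts_of_eq {R : ℝ → ℝ → ℝ → ℝ → ℝ → ℂ} (N : ℕ)
    (h : ∀ a, 0 < a → ∀ τ₁ τ₂ u v, R a τ₁ τ₂ u v = 1 / (2 * Real.pi * Complex.I) ^ 2 *
      (2 * ((poleInt (a ^ (4 / 3 : ℝ)) (baseZ τ₂ v) (baseW τ₁ u) (1 / 2) wPath wWeight).re -
        (oscSum oscFreq (diagCoeff τ₁ τ₂ u v) (gammaSum (cCoeff τ₁ τ₂ u v)) N
          (a ^ (4 / 3 : ℝ))).re) : ℝ)) :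
    UniformBigOOnCompacts R (4 / 3 * ((N : ℝ) + 1)) := by
  intro T₁ T₂ U V hT₁ hT₂ hU hV
  obtain ⟨k₁, hk₁⟩ := hT₁.isBounded.exists_norm_le
  obtain ⟨k₂, hk₂⟩ := hT₂.isBounded.exists_norm_le
  obtain ⟨k₃, hk₃⟩ := hU.isBounded.exists_norm_le
  obtain ⟨k₄, hk₄⟩ := hV.isBounded.exists_norm_le
  obtain ⟨C, hC, hX⟩ := exists_poleInt_expansion (max (k₄ + k₂) (k₃ + k₁)) N
  refine ⟨‖1 / (2 * Real.pi * Complex.I) ^ 2‖ * (2 * C), ?_⟩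
  filter_upwards [eventually_ge_atTop 1] with a ha τ₁ h₁ τ₂ h₂ u h₃ v h₄
  have ha0 : 0 < a := by linarith
  have hb := hX τ₁ τ₂ u v ((add_le_add (hk₄ v h₄) (hk₂ τ₂ h₂)).trans (le_max_left _ _))
    ((add_le_add (hk₃ u h₃) (hk₁ τ₁ h₁)).trans (le_max_right _ _)) (a ^ (4 / 3 : ℝ))
    (Real.one_le_rpow ha (by norm_num))
  have hp : (a ^ (4 / 3 : ℝ))⁻¹ ^ (N + 1) = a ^ (-(4 / 3 * ((N : ℝ) + 1))) := by
    rw [Real.rpow_neg ha0.le, inv_pow, ← rpow_four_thirds_mul ha0]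
    push_cast
    rfl
  rw [hp] at hb
  rw [h a ha0, norm_mul, Complex.norm_real, norm_mul, Real.norm_eq_abs, Real.norm_eq_abs,
    abs_two]
  have := mul_le_mul_of_nonneg_left (mul_le_mul_of_nonneg_left hb zero_le_two)
    (norm_nonneg (1 / (2 * Real.pi * Complex.I) ^ 2))
  linarith

theorem uniformBigOOnCompacts_expansion (N : ℕ) : UniformBigOOnCompacts
    (fun a τ₁ τ₂ u v =>
      rescaledPearceyKernel a τ₁ τ₂ u v - sineKernelS2 τ₁ τ₂ u v
        - ∑ ν ∈ Finset.Icc 1 N, diagTerm τ₁ τ₂ u v a ν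
        - ∑ ν ∈ Finset.Icc 1 N, oscTerm τ₁ τ₂ u v a ν)
    (4 / 3 * ((N : ℝ) + 1)) := by
  refine uniformBigOOnCompacts_of_eq N fun a ha τ₁ τ₂ u v => ?_
  rw [sub_sub, ← Finset.sum_add_distrib, sum_Icc_one_eq_sum_range,
    Finset.sum_congr rfl fun ν _ => diagTerm_add_oscTerm ha τ₁ τ₂ u v ν, ← Finset.mul_sum,
    rescaledPearceyKernel_sub_sineKernelS2 ha, ← Complex.ofReal_sum, ← Finset.mul_sum,
    ← Complex.re_sum, ← mul_sub, ← Complex.ofReal_sub, ← mul_sub]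
  rfl

/-! ### The first coefficients -/

theorem BCoeff_one_zero : BCoeff 1 0 = (Real.pi / 2 : ℝ) := by
  have := BCoeff_odd_even 0 0
  norm_num at this
  rw [this, Real.Gamma_one_half_eq, show (3 / 2 : ℝ) = 1 / 2 + 1 by norm_num,
    Real.Gamma_add_one (by norm_num), Real.Gamma_one_half_eq]
  have h := Complex.ofReal_mul (Real.sqrt Real.pi) (Real.sqrt Real.pi)
  rw [Real.mul_self_sqrt Real.pi_pos.le] at h
  push_cast
  rw [h]
  ring

theorem BCoeff_zero_one : BCoeff 0 1 = Complex.I * (Real.pi / 2 : ℝ) := by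
  have := BCoeff_even_odd 0 0
  norm_num at this
  rw [this, Real.Gamma_one_half_eq, show (3 / 2 : ℝ) = 1 / 2 + 1 by norm_num,
    Real.Gamma_add_one (by norm_num), Real.Gamma_one_half_eq]
  have h := Complex.ofReal_mul (Real.sqrt Real.pi) (Real.sqrt Real.pi)
  rw [Real.mul_self_sqrt Real.pi_pos.le] at h
  push_cast
  rw [h]
  ring

/-- Since B_{0,1} = i B_{1,0}, only this combination enters the first-order term. The divided
difference is symmetric, so one function s appears as s(x) in φ(x,0) and as s(iy) in φ(0,y); its
derivative cancels because i·i = -1, and g''(0) is not needed. -/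
theorem bCoeff_one_zero_add (τ₁ τ₂ u v : ℝ) :
    bCoeff τ₁ τ₂ u v 1 0 + Complex.I * bCoeff τ₁ τ₂ u v 0 1 =
      2 / 3 * Complex.I * saddlePt * (u + v + 2 * (τ₁ + τ₂) * saddlePt) *
        Complex.exp ((u - v) * saddlePt + (τ₁ - τ₂) * saddlePt ^ 2) := by
  have hA := saddleBranch_spec.analyticAt
  have h0 := saddleBranch_spec.map_zero
  have h1 := deriv_saddleBranch_zero
  obtain ⟨R, hR, -, -, -, -, hD⟩ := exists_saddleBranch_radius
  have hd0 : dslope saddleBranch 0 0 = saddleDir := by rw [dslope_same, h1]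
  set s : ℂ → ℂ := fun x => (dslope saddleBranch 0 x)⁻¹ * deriv saddleBranch x with hs
  have hsd : DifferentiableAt ℂ s 0 := by
    have := (hD 0 0 (by simpa) (by simpa)).1.differentiableAt.comp (0 : ℂ)
      (f := fun x : ℂ => ((x, 0) : ℂ × ℂ)) (by fun_prop)
    exact (this.inv (by simpa [h1] using saddleDir_ne_zero)).mul
      hA.deriv.differentiableAt
  have hs0 : s 0 = 1 := by
    simp only [hs]
    rw [hd0, h1, inv_mul_cancel₀ saddleDir_ne_zero]
  set σ := deriv s 0
  have hs' : HasDerivAt s σ 0 := hsd.hasDerivAt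
  have hg : HasDerivAt saddleBranch saddleDir 0 := h1 ▸ hA.differentiableAt.hasDerivAt
  have hI : HasDerivAt (fun y : ℂ => Complex.I * y) Complex.I 0 := by
    simpa using (hasDerivAt_id (0 : ℂ)).const_mul Complex.I
  have hsI : HasDerivAt (fun y : ℂ => s (Complex.I * y)) (σ * Complex.I) 0 :=
    HasDerivAt.comp (0 : ℂ) (h₂ := s) (h := fun y : ℂ => Complex.I * y)
      (by rwa [mul_zero]) hI
  have hgI : HasDerivAt (fun y : ℂ => saddleBranch (Complex.I * y)) (saddleDir * Complex.I) 0 :=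
    HasDerivAt.comp (0 : ℂ) (h₂ := saddleBranch) (h := fun y : ℂ => Complex.I * y)
      (by rwa [mul_zero]) hI
  have hsym : ∀ a b : ℂ, dslope saddleBranch a b = dslope saddleBranch b a := by
    intro a b
    rcases eq_or_ne a b with rfl | hab
    · rfl
    · rw [dslope_of_ne _ hab, dslope_of_ne _ hab.symm, slope_comm]
  have b10 : bCoeff τ₁ τ₂ u v 1 0 = deriv (fun x => s x * Complex.exp (-v * saddleBranch x
      - τ₂ * saddleBranch x ^ 2 + u * saddlePt + τ₁ * saddlePt ^ 2) *
        (Complex.I * saddleDir)) 0 := by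
    rw [bCoeff, taylorCoeff₂, iteratedDeriv_one]
    simp only [iteratedDeriv_zero, Nat.factorial_one, Nat.factorial_zero, Nat.cast_one, mul_one,
      div_one]
    congr 1
    funext x
    rw [phiFun, deriv_comp_I_mul, mul_zero, h0, h1]
    ring
  have b01 : bCoeff τ₁ τ₂ u v 0 1 = deriv (fun y => s (Complex.I * y) * Complex.exp
      (-v * saddlePt - τ₂ * saddlePt ^ 2 + u * saddleBranch (Complex.I * y)
        + τ₁ * saddleBranch (Complex.I * y) ^ 2) * (Complex.I * saddleDir)) 0 := by
    rw [bCoeff, taylorCoeff₂, iteratedDeriv_zero, iteratedDeriv_one]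
    simp only [Nat.factorial_one, Nat.factorial_zero, Nat.cast_one, mul_one, div_one]
    congr 1
    funext y
    rw [phiFun, deriv_comp_I_mul, h0, h1, hsym]
    ring
  have d10 := ((hs'.mul ((((hg.const_mul (-v : ℂ)).sub ((hg.pow 2).const_mul (τ₂ : ℂ))).add_const
    (u * saddlePt)).add_const (τ₁ * saddlePt ^ 2)).cexp).mul_const (Complex.I * saddleDir)).deriv
  have d01 := ((hsI.mul (((hgI.const_mul (u : ℂ)).const_add
    (-v * saddlePt - τ₂ * saddlePt ^ 2)).add ((hgI.pow 2).const_mul (τ₁ : ℂ))).cexp).mul_const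
      (Complex.I * saddleDir)).deriv
  have e10 := b10.trans d10
  have e01 := b01.trans d01
  simp only [Pi.pow_apply, Pi.sub_apply, Pi.add_apply, mul_zero, h0, hs0] at e10 e01
  rw [e10, e01]
  rw [show -v * saddlePt - τ₂ * saddlePt ^ 2 + u * saddlePt + τ₁ * saddlePt ^ 2 =
    (u - v) * saddlePt + (τ₁ - τ₂) * saddlePt ^ 2 by ring]
  push_cast
  set E := Complex.exp ((u - v) * saddlePt + (τ₁ - τ₂) * saddlePt ^ 2)
  linear_combination Complex.I * saddleDir * E * (σ + (u + 2 * τ₁ * saddlePt) * saddleDir) *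
    Complex.I_sq - Complex.I * E * (u + v + 2 * (τ₁ + τ₂) * saddlePt) * saddleDir_sq

theorem saddleDir_mul_conj : saddleDir * (starRingEnd ℂ) saddleDir = 2 / 3 := by
  have h : saddlePt * (starRingEnd ℂ) saddlePt = 1 := by
    rw [saddlePt, ← Complex.exp_conj, ← Complex.exp_add, ← Complex.exp_zero]
    congr 1
    simp only [map_mul, map_div₀, Complex.conj_ofReal, Complex.conj_I, map_ofNat]
    ring
  have h2 : ((Real.sqrt (2 / 3) : ℝ) : ℂ) ^ 2 = 2 / 3 := by
    rw [← Complex.ofReal_pow, Real.sq_sqrt (by norm_num)]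
    push_cast
    rfl
  rw [saddleDir, map_mul, map_pow, Complex.conj_ofReal]
  linear_combination h2 * (saddlePt * (starRingEnd ℂ) saddlePt) ^ 2 +
    2 / 3 * (saddlePt * (starRingEnd ℂ) saddlePt + 1) * h

theorem cCoeff_zero_zero (τ₁ τ₂ u v : ℝ) : cCoeff τ₁ τ₂ u v 0 0 =
    ((2 / 3 / Real.sqrt 3 : ℝ) : ℂ) * Complex.exp (-v * saddlePt - τ₂ * saddlePt ^ 2 +
      u * (starRingEnd ℂ) saddlePt + τ₁ * (starRingEnd ℂ) saddlePt ^ 2) := by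
  have hd : deriv saddleBranchConj 0 = (starRingEnd ℂ) saddleDir := by
    rw [saddleBranchConj_eq, deriv_conj_conj, Function.comp_apply, Function.comp_apply, map_zero,
      deriv_saddleBranch_zero]
  have hp : saddlePt - (starRingEnd ℂ) saddlePt = Complex.I * (Real.sqrt 3 : ℝ) := by
    rw [saddlePt_eq]
    simp only [map_add, map_mul, Complex.conj_ofReal, Complex.conj_I, map_div₀, map_one, map_ofNat]
    push_cast
    ring
  have h3 : ((Real.sqrt 3 : ℝ) : ℂ) ≠ 0 := by
    exact_mod_cast (Real.sqrt_pos.2 (by norm_num : (0 : ℝ) < 3)).ne'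
  rw [cCoeff, taylorCoeff₂, iteratedDeriv_zero, iteratedDeriv_zero, capPhiFun, deriv_comp_I_mul,
    mul_zero, saddleBranch_spec.map_zero, saddleBranchConj_zero, deriv_saddleBranch_zero, hd, hp]
  have hI := Complex.I_ne_zero
  push_cast
  simp only [Nat.factorial_zero, Nat.cast_one, mul_one, div_one]
  field_simp
  linear_combination 3 * saddleDir_mul_conj

/-- The real parts of the coefficients in the first order term. -/
theorem diagCoeff_zero_re (τ₁ τ₂ u v : ℝ) : (diagCoeff τ₁ τ₂ u v 0).re =
    -(Real.pi / 3) * Real.exp ((u - v) / 2 - (τ₁ - τ₂) / 2) * flucCoeffS2 τ₁ τ₂ u v := by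
  have h : diagCoeff τ₁ τ₂ u v 0 = ((Real.pi / 2 : ℝ) : ℂ) *
      (bCoeff τ₁ τ₂ u v 1 0 + Complex.I * bCoeff τ₁ τ₂ u v 0 1) := by
    have := sum_antidiagonal_odd (fun k l => bCoeff τ₁ τ₂ u v k l * BCoeff k l) 0
    simp only [Finset.Nat.antidiagonal_zero, Finset.sum_singleton, mul_zero, zero_add] at this
    rw [diagCoeff, mul_zero, zero_add, this, BCoeff_one_zero, BCoeff_zero_one]
    ring
  have he : Complex.exp ((u - v) * saddlePt + (τ₁ - τ₂) * saddlePt ^ 2) =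
      (Real.exp ((u - v) / 2 - (τ₁ - τ₂) / 2) : ℝ) *
        ((Real.cos (Real.sqrt 3 / 2 * (u - v + τ₁ - τ₂)) : ℝ) +
          (Real.sin (Real.sqrt 3 / 2 * (u - v + τ₁ - τ₂)) : ℝ) * Complex.I) := by
    rw [Complex.ofReal_exp, Complex.ofReal_cos, Complex.ofReal_sin, ← Complex.exp_mul_I,
      ← Complex.exp_add, saddlePt_sq, saddlePt_eq]
    congr 1
    push_cast
    ring
  rw [h, bCoeff_one_zero_add, he, Complex.re_ofReal_mul, flucCoeffS2,
    show 2 / 3 * Complex.I * saddlePt * (u + v + 2 * (τ₁ + τ₂) * saddlePt) =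
      2 / 3 * Complex.I * ((u + v) * saddlePt + 2 * (τ₁ + τ₂) * saddlePt ^ 2) by ring,
    saddlePt_sq, saddlePt_eq]
  generalize Real.exp ((u - v) / 2 - (τ₁ - τ₂) / 2) = E
  generalize Real.cos (Real.sqrt 3 / 2 * (u - v + τ₁ - τ₂)) = c
  generalize Real.sin (Real.sqrt 3 / 2 * (u - v + τ₁ - τ₂)) = s
  generalize Real.sqrt 3 = r
  rw [show 2 / 3 * Complex.I * (((u : ℂ) + v) * (1 / 2 + ((r / 2 : ℝ) : ℂ) * Complex.I) +
      2 * (τ₁ + τ₂) * (-1 / 2 + ((r / 2 : ℝ) : ℂ) * Complex.I)) * (E * (c + s * Complex.I)) =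
      ((-(2 / 3) * E * (((u + v) / 2 - (τ₁ + τ₂)) * s + r * ((u + v) / 2 + (τ₁ + τ₂)) * c) : ℝ) : ℂ)
      + ((2 / 3 * E * (((u + v) / 2 - (τ₁ + τ₂)) * c - r * ((u + v) / 2 + (τ₁ + τ₂)) * s) : ℝ) : ℂ)
        * Complex.I by
    push_cast
    linear_combination ((2 / 3 : ℂ) * E * (((u + v) / 2 - (τ₁ + τ₂)) * s +
      r * ((u + v) / 2 + (τ₁ + τ₂)) * c) + (2 / 3 : ℂ) * E * r * ((u + v) / 2 + (τ₁ + τ₂)) * s *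
        Complex.I) * Complex.I_sq]
  rw [Complex.add_re, Complex.ofReal_re, Complex.re_ofReal_mul, Complex.I_re]
  ring

theorem exp_mul_gammaSum_zero_re (τ₁ τ₂ u v lam : ℝ) :
    (Complex.exp (-(Complex.I * oscFreq * lam)) * gammaSum (cCoeff τ₁ τ₂ u v) 0).re =
    2 / 3 / Real.sqrt 3 * Real.pi * Real.exp ((u - v) / 2 - (τ₁ - τ₂) / 2) *
      Real.cos (3 * Real.sqrt 3 / 4 * lam + Real.sqrt 3 / 2 * (u + v + τ₁ + τ₂)) := by
  have h : gammaSum (cCoeff τ₁ τ₂ u v) 0 = cCoeff τ₁ τ₂ u v 0 0 * (Real.pi : ℝ) := by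
    rw [gammaSum, Finset.Nat.antidiagonal_zero, Finset.sum_singleton]
    norm_num [Real.Gamma_one_half_eq]
    rw [← Complex.ofReal_mul, Real.mul_self_sqrt Real.pi_pos.le]
    simp
  have he : Complex.exp (-(Complex.I * oscFreq * lam)) * Complex.exp (-v * saddlePt -
      τ₂ * saddlePt ^ 2 + u * (starRingEnd ℂ) saddlePt + τ₁ * (starRingEnd ℂ) saddlePt ^ 2) =
      (Real.exp ((u - v) / 2 - (τ₁ - τ₂) / 2) : ℝ) * Complex.exp (((-(3 * Real.sqrt 3 / 4 * lam
        + Real.sqrt 3 / 2 * (u + v + τ₁ + τ₂)) : ℝ) : ℂ) * Complex.I) := by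
    rw [← map_pow, Complex.ofReal_exp, ← Complex.exp_add, ← Complex.exp_add, saddlePt_sq,
      saddlePt_eq, oscFreq]
    simp only [map_add, map_mul, map_neg, Complex.conj_ofReal, Complex.conj_I, map_div₀, map_one,
      map_ofNat]
    congr 1
    push_cast
    ring
  rw [h, cCoeff_zero_zero, ← mul_assoc, mul_left_comm, he, mul_comm, ← mul_assoc, ← mul_assoc,
    ← Complex.ofReal_mul, ← Complex.ofReal_mul, Complex.re_ofReal_mul,
    Complex.exp_ofReal_mul_I_re, Real.cos_neg]
  ring

/-- The explicit fluctuation is exactly the first term of the two series, so the first-order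
statement is the expansion with N = 1. -/
theorem flucS2_eq (τ₁ τ₂ u v a : ℝ) : flucS2 u v τ₁ τ₂ a =
    1 / (2 * Real.pi * Complex.I) ^ 2 * (2 * (oscSum oscFreq (diagCoeff τ₁ τ₂ u v)
      (gammaSum (cCoeff τ₁ τ₂ u v)) 1 (a ^ (4 / 3 : ℝ))).re : ℝ) := by
  rw [oscSum, Finset.sum_range_one, zero_add, pow_one, ← Complex.ofReal_inv,
    Complex.re_ofReal_mul, Complex.add_re, diagCoeff_zero_re, exp_mul_gammaSum_zero_re, flucS2]
  push_cast
  ring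

theorem uniformBigOOnCompacts_flucS2 : UniformBigOOnCompacts
    (fun a τ₁ τ₂ u v =>
      rescaledPearceyKernel a τ₁ τ₂ u v - sineKernelS2 τ₁ τ₂ u v - flucS2 u v τ₁ τ₂ a)
    (8 / 3) := by
  rw [show (8 / 3 : ℝ) = 4 / 3 * (((1 : ℕ) : ℝ) + 1) by norm_num]
  refine uniformBigOOnCompacts_of_eq 1 fun a ha τ₁ τ₂ u v => ?_
  rw [flucS2_eq, rescaledPearceyKernel_sub_sineKernelS2 ha, ← mul_sub, ← Complex.ofReal_sub,
    ← mul_sub]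

theorem theorem2 :
    -- first-order fluctuations
    UniformBigOOnCompacts
      (fun a τ₁ τ₂ u v =>
        rescaledPearceyKernel a τ₁ τ₂ u v - sineKernelS2 τ₁ τ₂ u v - flucS2 u v τ₁ τ₂ a)
      (8 / 3) ∧
    -- complete asymptotic expansion
    (∀ N : ℕ, UniformBigOOnCompacts
      (fun a τ₁ τ₂ u v =>
        rescaledPearceyKernel a τ₁ τ₂ u v - sineKernelS2 τ₁ τ₂ u v
          - ∑ ν ∈ Finset.Icc 1 N, diagTerm τ₁ τ₂ u v a ν
          - ∑ ν ∈ Finset.Icc 1 N, oscTerm τ₁ τ₂ u v a ν)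
      (4 / 3 * ((N : ℝ) + 1))) ∧
    -- the coefficients are those of convergent power series expansions near the origin
    (∃ ε : ℝ, 0 < ε ∧ ∀ (τ₁ τ₂ u v : ℝ) (x y : ℂ), ‖x‖ < ε → ‖y‖ < ε →
      HasSum (fun p : ℕ × ℕ => bCoeff τ₁ τ₂ u v p.1 p.2 * x ^ p.1 * y ^ p.2)
        (phiFun τ₁ τ₂ u v x y) ∧
      HasSum (fun p : ℕ × ℕ => cCoeff τ₁ τ₂ u v p.1 p.2 * x ^ p.1 * y ^ p.2)
        (capPhiFun τ₁ τ₂ u v x y)) := by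
  exact ⟨uniformBigOOnCompacts_flucS2, uniformBigOOnCompacts_expansion,
    exists_hasSum_phiFun_capPhiFun⟩
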